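/- Let $(K,|\cdot|)$ be a field of characteristic $0$, complete for a non-trivial ultrametric absolute value with $|p|<1$ for a prime number $p$, and let $\Omega/K$ be a complete ultrametric extension with $|\Omega|=\mathbb{R}_{\ge 0}$ whose residue field is not algebraic over that of $K$. **Base rings.** For $0<\varepsilon<1$ let $\mathcal{A}_K(I_\varepsilon)$ be the ring of analytic functions $\sum_{i\in\mathbb{Z}}a_iT^i$ on the annulus $|T|\in I_\varepsilon$. Let $B=\bigcup_\varepsilon\mathcal{A}_K(I_\varepsilon)$, where either $I_\varepsilon=\,]1-\varepsilon,1[$, so that $B=\mathcal{R}_K$ is the Robba ring, or $I_\varepsilon=\,]1-\varepsilon,1+\varepsilon[$, so that $B=\mathcal{H}^\dagger_K$. Let $|\cdot|_\rho$ be the Gauss norm, and let $\sigma_q(f)(T)=f(qT)$ for $q\in K$, $|q|=1$. Put $d_q=\frac{\sigma_q-1}{(q-1)T}$ and $\delta_1=T\frac{d}{dT}$. For $\rho\in I_\varepsilon$, a generic point $t_\rho\in\Omega$ is a point with $|t_\rho|=\rho$ and $|P(t_\rho)|=|P|_\rho$ for all $P\in K[T]$. Let $D^-(1,r)=\{q\in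 K:|q-1|<r\}$. For $S\subseteq\{|q|=1\}$ let $\langle S\rangle$ be the group generated by $S$, let $S_\tau=S\cap D^-(1,\tau)$, and let $S^\circ$ be the set of $q\in S$ that are not roots of unity. **Modules.** A $\sigma$-module over $S$ is a finite free $B$-module $M$ with a semi-linear action $q\mapsto\sigma_q^M$ of $\langle S\rangle$ (that is, $\sigma_q^M(fm)=\sigma_q(f)\sigma_q^M(m)$). In a basis it gives the equations $\sigma_q(Y)=A(q,T)Y$. A $(\sigma,\delta)$-module has in addition a connection $\delta_1^M$ (with $\delta_1^M(fm)=\delta_1(f)m+f\delta_1^M(m)$), which gives the equation $\delta_1(Y)=G(1,T)Y$. Morphisms are the $B$-linear maps that commute with the $\sigma_q^M$ (and with $\delta_1^M$). **Taylor solutions and radii.** Let $q$ not be a root of unity and write $A=A(q,T)$. Put $H_0=1$, $H_1=\frac{A-1}{(q-1)T}$, $H_{m+1}=d_q(H_m)+\sigma_q(H_m)H_1$, and $Y_A(x,y)=\sum_m H_m(y)\frac{(x-y)(x-qy)\cdots(x-q^{m-1}y)}{[m]_q^!}$, where $[m]_q^!=\prod_{i=1}^m(1+q+\dots+q^{i-1})$.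 Put $Ray(\rho)=\min\bigl(\liminf_m(|H_m|_\rho/|[m]^!_q|)^{-1/m},\rho\bigr)$. For $G=G(1,T)$ put $G_{[0]}=1$, $G_{[1]}=T^{-1}G$, $G_{[m+1]}=\frac{d}{dT}G_{[m]}+G_{[m]}G_{[1]}$, $Y_G(x,y)=\sum_m G_{[m]}(y)\frac{(x-y)^m}{m!}$ and $Ray(\rho)=\min\bigl(\liminf_m(|G_{[m]}|_\rho/|m!|)^{-1/m},\rho\bigr)$. Let $0<r\le1$. The *radius condition* for $q$ is: over $\mathcal{H}^\dagger_K$, $|q-1|<r\le Ray(1)$; over $\mathcal{R}_K$, $|q-1|\le r\le\lim_{\rho\to1^-}Ray(\rho)$, and $Ray(\rho)>|q-1|$ for all $\rho<1$ close to $1$. **The categories.** $\sigma\text{-Mod}(B)^{[r]}_S$ is the full subcategory of the $\sigma$-modules $M$ over $S$ such that 1. the radius condition for $q$ holds for the equation $\sigma_q(Y)=A(q,T)Y$, for every $q\in S^\circ$; 2. for every $0<\tau<r$ there are $\varepsilon\in\,]0,1[$ and a basis of $M$ in which all $A(q,T)$, $q\in\langle S_\tau\rangle$, have entries in $\mathcal{A}_K(I_\varepsilon)$,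 and such that at all generic points $t_\rho$, $\rho\in I_\varepsilon$, the equations for the $q\in S_\tau$ have the same Taylor solution: there are $0<R\le\rho$ and an analytic matrix $Y$ on the disk $|x-t_\rho|<R$ of $\Omega$ with $Y(t_\rho)=1$ such that, for all $q\in S_\tau$, $|q-1|\rho<R$ and $Y(qx)=A(q,x)Y(x)$, and $Y(x)=Y_{A(q,T)}(x,t_\rho)$ if $q$ is not a root of unity. $(\sigma,\delta)\text{-Mod}(B)^{[r]}_S$ is defined in the same way, but in 1. the radius condition is required for every $q\in S$ with $Ray$ the radius of $\delta_1(Y)=G(1,T)Y$, and in 2. moreover $G(1,T)$ has entries in $\mathcal{A}_K(I_\varepsilon)$ and $Y(x)=Y_{G(1,T)}(x,t_\rho)$. **Analytically constant modules.** Write $\mathcal{A}_L(c,R)$ for the ring of analytic functions on the open disk $D^-(c,R)$ over $L$. A $\sigma$-module over $D^-(1,r)$ is *analytically $C$-constant* over $D^-(1,r)$ if for every $0<\tau<r$ there are $\varepsilon$ and a basis such that * all $A(q,T)$, $q\in D^-(1,\tau)$, have entries in $\mathcal{A}_K(I_\varepsilon)$, and $A$ is locally on $D^-(1,\tau)$ an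 analytic function of $(q,T)$, $|T|\in I_\varepsilon$; * for every complete ultrametric extension $L/K$ and every $c\in L$ with $|c|\in I_\varepsilon$, all equations $Y(qT)=A(q,T)Y(T)$, $q\in D^-(1,\tau)$, have a common solution $Y\in GL_n(C)$, $C=\mathcal{A}_L(c,\tau|c|)$; and if moreover, for $B=\mathcal{H}^\dagger_K$, there is a basis in which for all $L$ and all $c\in L$ with $|c|=1$ the equations for all $q\in D^-(1,r)$ have a common solution in $GL_n(\mathcal{A}_L(c,r))$. For $(\sigma,\delta)$-modules one requires in addition that $G(1,T)$ has entries in $\mathcal{A}_K(I_\varepsilon)$, that $G(1,T)=\lim_{q\to1}\frac{A(q,T)-1}{q-1}$ for all norms $|\cdot|_\rho$, $\rho\in I_\varepsilon$, and that $\delta_1(Y)=G(1,T)Y$. **Proposition.** Let $B=\mathcal{H}^\dagger_K$ or $B=\mathcal{R}_K$, let $0<r\le1$ and let $S\subseteq D^-(1,r)$. (a) If $S^\circ\neq\emptyset$, then the restriction functor $$\sigma\text{-Mod}(B)^{[r]}_{D^-(1,r)}\longrightarrow\sigma\text{-Mod}(B)^{[r]}_S$$ is an equivalence of categories, and every $M\in\sigma\text{-Mod}(B)^{[r]}_S$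 is (isomorphic to) the restriction to $S$ of an object of $\sigma\text{-Mod}(B)^{[r]}_{D^-(1,r)}$ that is analytically $C$-constant over $D^-(1,r)$. (b) If $S\neq\emptyset$ (without supposing that $S^\circ\ne\emptyset$), then the restriction functor $$(\sigma,\delta)\text{-Mod}(B)^{[r]}_{D^-(1,r)}\longrightarrow(\sigma,\delta)\text{-Mod}(B)^{[r]}_S$$ is an equivalence of categories, and every $M\in(\sigma,\delta)\text{-Mod}(B)^{[r]}_S$ is (isomorphic to) the restriction to $S$ of an object of $(\sigma,\delta)\text{-Mod}(B)^{[r]}_{D^-(1,r)}$ that is analytically $C$-constant over $D^-(1,r)$. In particular (case $r=1$) solvable modules extend to the whole disk $D^-(1,1)$. -/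

import Mathlib

open Filter Topology CategoryTheory
open scoped ENNReal

universe u v w

noncomputable section

set_option linter.unusedSectionVars false

namespace QDiff

/-! ## The base rings -/

/-- The two base rings: the Robba ring `R_K`, and the ring `H^†_K` of overconvergent analytic
elements on the circle `|T| = 1`. -/
inductive BaseKind : Type
  | robba : BaseKind
  | hdagger : BaseKind

/-- The interval `I_ε`: it is `]1-ε, 1[` for the Robba ring and `]1-ε, 1+ε[` for `H^†_K`. -/
def annulus : BaseKind → ℝ → Set ℝ
  | BaseKind.robba, ε => Set.Ioo (1 - ε) 1
  | BaseKind.hdagger, ε => Set.Ioo (1 - ε) (1 + ε)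

/-- The formal Laurent series `∑ a_i T^i` is an analytic function on the annulus `|T| ∈ I`, i.e.
`|a_i| ρ^i → 0` as `i → ±∞`, for every `ρ ∈ I`. -/
def ConvergesOn {K : Type u} [NormedField K] (I : Set ℝ) (a : ℤ → K) : Prop :=
  ∀ ρ ∈ I, Tendsto (fun i : ℤ => ‖a i‖ * ρ ^ i) cofinite (𝓝 0)

/-- The ring `B`: the union over `0 < ε < 1` of the rings of analytic functions on the annuli
`|T| ∈ I_ε`. It is the Robba ring `R_K` for `κ = robba` and `H^†_K` for `κ = hdagger`. -/
@[ext]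
structure BaseRing (K : Type u) [NormedField K] (κ : BaseKind) : Type u where
  /-- The coefficient of `T^i`. -/
  coeff : ℤ → K
  conv : ∃ ε : ℝ, 0 < ε ∧ ε < 1 ∧ ConvergesOn (annulus κ ε) coeff

theorem annulus_mono (κ : BaseKind) {ε ε' : ℝ} (h : ε ≤ ε') : annulus κ ε ⊆ annulus κ ε' := by
  cases κ <;> intro ρ hρ <;> simp only [annulus, Set.mem_Ioo] at * <;> constructor <;> linarith

theorem annulus_pos (κ : BaseKind) {ε : ℝ} (h : ε < 1) {ρ : ℝ} (hρ : ρ ∈ annulus κ ε) : 0 < ρ := by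
  cases κ <;> simp only [annulus, Set.mem_Ioo] at * <;> linarith

section Sequences

variable {K : Type u} [NormedField K]

theorem ConvergesOn.mono {I J : Set ℝ} {a : ℤ → K} (h : ConvergesOn J a) (hIJ : I ⊆ J) :
    ConvergesOn I a := fun ρ hρ => h ρ (hIJ hρ)

theorem exists_common {κ : BaseKind} {a b : ℤ → K}
    (ha : ∃ ε : ℝ, 0 < ε ∧ ε < 1 ∧ ConvergesOn (annulus κ ε) a)
    (hb : ∃ ε : ℝ, 0 < ε ∧ ε < 1 ∧ ConvergesOn (annulus κ ε) b) :
    ∃ ε : ℝ, 0 < ε ∧ ε < 1 ∧ ConvergesOn (annulus κ ε) a ∧ ConvergesOn (annulus κ ε) b := by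
  obtain ⟨ε, h0, h1, h⟩ := ha
  obtain ⟨ε', h0', h1', h'⟩ := hb
  exact ⟨min ε ε', lt_min h0 h0', min_lt_of_left_lt h1,
    h.mono (annulus_mono κ (min_le_left _ _)), h'.mono (annulus_mono κ (min_le_right _ _))⟩

theorem null_of_le {a b : ℤ → K} {ρ : ℝ} (hρ : 0 < ρ) (h : ∀ i, ‖b i‖ ≤ ‖a i‖)
    (ha : Tendsto (fun i : ℤ => ‖a i‖ * ρ ^ i) cofinite (𝓝 0)) :
    Tendsto (fun i : ℤ => ‖b i‖ * ρ ^ i) cofinite (𝓝 0) :=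
  squeeze_zero (fun i => by positivity)
    (fun i => mul_le_mul_of_nonneg_right (h i) (zpow_nonneg hρ.le i)) ha

theorem null_add {a b : ℤ → K} {ρ : ℝ} (hρ : 0 < ρ)
    (ha : Tendsto (fun i : ℤ => ‖a i‖ * ρ ^ i) cofinite (𝓝 0))
    (hb : Tendsto (fun i : ℤ => ‖b i‖ * ρ ^ i) cofinite (𝓝 0)) :
    Tendsto (fun i : ℤ => ‖a i + b i‖ * ρ ^ i) cofinite (𝓝 0) := by
  refine squeeze_zero (fun i => by positivity) (fun i => ?_) (by simpa using ha.add hb)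
  rw [← add_mul]
  exact mul_le_mul_of_nonneg_right (norm_add_le _ _) (zpow_nonneg hρ.le i)

theorem null_single (m : ℤ) (c : K) (ρ : ℝ) :
    Tendsto (fun i : ℤ => ‖(Pi.single m c : ℤ → K) i‖ * ρ ^ i) cofinite (𝓝 0) := by
  refine tendsto_nhds_of_eventually_eq ?_
  filter_upwards [(Set.finite_singleton m).compl_mem_cofinite] with i hi
  have : i ≠ m := by simpa using hi
  simp [Pi.single_eq_of_ne this]

theorem null_shift {a : ℤ → K} {ρ : ℝ} (hρ : 0 < ρ) (m : ℤ)
    (ha : Tendsto (fun i : ℤ => ‖a i‖ * ρ ^ i) cofinite (𝓝 0)) :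
    Tendsto (fun i : ℤ => ‖a (i + m)‖ * ρ ^ i) cofinite (𝓝 0) := by
  have h1 := (ha.comp (add_left_injective m).tendsto_cofinite).const_mul (ρ ^ (-m))
  rw [mul_zero] at h1
  refine h1.congr fun i => ?_
  simp only [Function.comp_apply]
  rw [zpow_add₀ hρ.ne', zpow_neg]
  field_simp

/-- Weighted norms of the products of two null families. -/
theorem null_mul_pairs {a b : ℤ → K} {ρ : ℝ}
    (ha : Tendsto (fun i : ℤ => ‖a i‖ * ρ ^ i) cofinite (𝓝 0))
    (hb : Tendsto (fun i : ℤ => ‖b i‖ * ρ ^ i) cofinite (𝓝 0)) :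
    Tendsto (fun p : ℤ × ℤ => (‖a p.1‖ * ρ ^ p.1) * (‖b p.2‖ * ρ ^ p.2)) cofinite (𝓝 0) :=
  tendsto_mul_cofinite_nhds_zero ha hb

variable [IsUltrametricDist K] [CompleteSpace K]

theorem summable_conv {a b : ℤ → K} {ρ : ℝ} (hρ : 0 < ρ)
    (ha : Tendsto (fun i : ℤ => ‖a i‖ * ρ ^ i) cofinite (𝓝 0))
    (hb : Tendsto (fun i : ℤ => ‖b i‖ * ρ ^ i) cofinite (𝓝 0)) (n : ℤ) :
    Summable fun i : ℤ => a i * b (n - i) := by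
  refine NonarchimedeanAddGroup.summable_of_tendsto_cofinite_zero ?_
  rw [tendsto_zero_iff_norm_tendsto_zero]
  have hinj : Function.Injective fun i : ℤ => (i, n - i) := fun i j h => (Prod.ext_iff.1 h).1
  have h1 := ((null_mul_pairs ha hb).comp hinj.tendsto_cofinite).const_mul (ρ ^ (-n))
  rw [mul_zero] at h1
  refine h1.congr fun i => ?_
  simp only [Function.comp_apply]
  rw [norm_mul, zpow_neg, zpow_sub₀ hρ.ne']
  have := zpow_pos hρ i
  have := zpow_pos hρ n
  field_simp

theorem null_conv {a b : ℤ → K} {ρ : ℝ} (hρ : 0 < ρ)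
    (ha : Tendsto (fun i : ℤ => ‖a i‖ * ρ ^ i) cofinite (𝓝 0))
    (hb : Tendsto (fun i : ℤ => ‖b i‖ * ρ ^ i) cofinite (𝓝 0)) :
    Tendsto (fun n : ℤ => ‖∑' i : ℤ, a i * b (n - i)‖ * ρ ^ n) cofinite (𝓝 0) := by
  rw [Metric.tendsto_nhds]
  intro e he
  have hfin : {p : ℤ × ℤ | ¬ dist ((‖a p.1‖ * ρ ^ p.1) * (‖b p.2‖ * ρ ^ p.2)) 0 < e / 2}.Finite :=
    (Metric.tendsto_nhds.1 (null_mul_pairs ha hb) (e / 2) (half_pos he))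
  have hfin2 := hfin.image fun p : ℤ × ℤ => p.1 + p.2
  filter_upwards [hfin2.compl_mem_cofinite] with n hn
  have hb2 : ∀ i : ℤ, ‖a i * b (n - i)‖ ≤ (e / 2) * ρ ^ (-n) := by
    intro i
    by_contra hcon
    apply hn
    refine ⟨(i, n - i), ?_, by simp⟩
    simp only [Set.mem_ofPred_eq]
    intro hlt
    apply hcon
    have h0 : 0 ≤ (‖a i‖ * ρ ^ i) * (‖b (n - i)‖ * ρ ^ (n - i)) := by positivity
    rw [Real.dist_eq, sub_zero, abs_of_nonneg h0] at hlt
    have hn0 := zpow_pos hρ n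
    have hi0 := zpow_pos hρ i
    have heq : ‖a i * b (n - i)‖ =
        ((‖a i‖ * ρ ^ i) * (‖b (n - i)‖ * ρ ^ (n - i))) * ρ ^ (-n) := by
      rw [norm_mul, zpow_neg, zpow_sub₀ hρ.ne']
      field_simp
    rw [heq]
    exact mul_le_mul_of_nonneg_right hlt.le (zpow_nonneg hρ.le _)
  have hle := IsUltrametricDist.norm_tsum_le_of_forall_le hb2
  have h0 : 0 ≤ ‖∑' i : ℤ, a i * b (n - i)‖ * ρ ^ n := by positivity
  rw [Real.dist_eq, sub_zero, abs_of_nonneg h0]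
  calc ‖∑' i : ℤ, a i * b (n - i)‖ * ρ ^ n ≤ ((e / 2) * ρ ^ (-n)) * ρ ^ n :=
        mul_le_mul_of_nonneg_right hle (zpow_nonneg hρ.le _)
    _ = e / 2 := by
        rw [mul_assoc, ← zpow_add₀ hρ.ne']
        simp
    _ < e := half_lt_self he

theorem conv_assoc {a b c : ℤ → K} {ρ : ℝ} (hρ : 0 < ρ)
    (ha : Tendsto (fun i : ℤ => ‖a i‖ * ρ ^ i) cofinite (𝓝 0))
    (hb : Tendsto (fun i : ℤ => ‖b i‖ * ρ ^ i) cofinite (𝓝 0))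
    (hc : Tendsto (fun i : ℤ => ‖c i‖ * ρ ^ i) cofinite (𝓝 0)) (n : ℤ) :
    ∑' i : ℤ, (∑' j : ℤ, a j * b (i - j)) * c (n - i) =
      ∑' j : ℤ, a j * ∑' k : ℤ, b k * c (n - j - k) := by
  have hsum : Summable (Function.uncurry fun i j : ℤ => a j * b (i - j) * c (n - i)) := by
    refine NonarchimedeanAddGroup.summable_of_tendsto_cofinite_zero ?_
    rw [tendsto_zero_iff_norm_tendsto_zero]
    have hinj : Function.Injective fun p : ℤ × ℤ => ((p.2, p.1 - p.2), n - p.1) := by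
      rintro ⟨i, j⟩ ⟨i', j'⟩ h
      simp only [Prod.mk.injEq] at h
      ext <;> simp only <;> omega
    have h3 := tendsto_mul_cofinite_nhds_zero (null_mul_pairs ha hb) hc
    have h1 := (h3.comp hinj.tendsto_cofinite).const_mul (ρ ^ (-n))
    rw [mul_zero] at h1
    refine h1.congr fun p => ?_
    simp only [Function.comp_apply, Function.uncurry]
    rw [norm_mul, norm_mul, zpow_neg, zpow_sub₀ hρ.ne', zpow_sub₀ hρ.ne']
    have := zpow_pos hρ p.1
    have := zpow_pos hρ p.2
    have := zpow_pos hρ n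
    field_simp
  calc ∑' i : ℤ, (∑' j : ℤ, a j * b (i - j)) * c (n - i)
      = ∑' i : ℤ, ∑' j : ℤ, a j * b (i - j) * c (n - i) := by
        simp_rw [tsum_mul_right]
    _ = ∑' j : ℤ, ∑' i : ℤ, a j * b (i - j) * c (n - i) := hsum.tsum_comm.symm
    _ = ∑' j : ℤ, a j * ∑' k : ℤ, b k * c (n - j - k) := by
        refine tsum_congr fun j => ?_
        rw [← tsum_mul_left, ← (Equiv.addRight j).tsum_eq]
        refine tsum_congr fun k => ?_
        simp only [Equiv.coe_addRight, add_sub_cancel_right, mul_assoc]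
        congr 3
        omega

end Sequences

namespace BaseRing

variable {K : Type u} [NormedField K] {κ : BaseKind}

instance : Zero (BaseRing K κ) :=
  ⟨⟨0, 1 / 2, by norm_num, by norm_num, fun ρ _ => by simp⟩⟩

instance : Add (BaseRing K κ) :=
  ⟨fun f g => ⟨fun i => f.coeff i + g.coeff i, by
    obtain ⟨ε, h0, h1, h, h'⟩ := exists_common f.conv g.conv
    exact ⟨ε, h0, h1, fun ρ hρ => null_add (annulus_pos κ h1 hρ) (h ρ hρ) (h' ρ hρ)⟩⟩⟩

instance : Neg (BaseRing K κ) :=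
  ⟨fun f => ⟨fun i => -f.coeff i, by
    obtain ⟨ε, h0, h1, h⟩ := f.conv
    exact ⟨ε, h0, h1, fun ρ hρ => by simpa using h ρ hρ⟩⟩⟩

/-- The monomial `c T^m`. -/
def monomial (m : ℤ) (c : K) : BaseRing K κ :=
  ⟨Pi.single m c, 1 / 2, by norm_num, by norm_num, fun ρ _ => null_single m c ρ⟩

instance : One (BaseRing K κ) := ⟨monomial 0 1⟩

variable [IsUltrametricDist K] [CompleteSpace K]

/-- The product of Laurent series: the coefficient of `T^n` in `f g` is the convergent sum
`∑ f_i g_{n-i}` over `i ∈ ℤ`. -/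
instance : Mul (BaseRing K κ) :=
  ⟨fun f g => ⟨fun n => ∑' i : ℤ, f.coeff i * g.coeff (n - i), by
    obtain ⟨ε, h0, h1, h, h'⟩ := exists_common f.conv g.conv
    exact ⟨ε, h0, h1, fun ρ hρ => null_conv (annulus_pos κ h1 hρ) (h ρ hρ) (h' ρ hρ)⟩⟩⟩

theorem coeff_mul (f g : BaseRing K κ) (n : ℤ) :
    (f * g).coeff n = ∑' i : ℤ, f.coeff i * g.coeff (n - i) := rfl

theorem coeff_add (f g : BaseRing K κ) (n : ℤ) : (f + g).coeff n = f.coeff n + g.coeff n := rfl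

theorem exists_null₃ (f g k : BaseRing K κ) : ∃ ρ : ℝ, 0 < ρ ∧
    Tendsto (fun i : ℤ => ‖f.coeff i‖ * ρ ^ i) cofinite (𝓝 0) ∧
    Tendsto (fun i : ℤ => ‖g.coeff i‖ * ρ ^ i) cofinite (𝓝 0) ∧
    Tendsto (fun i : ℤ => ‖k.coeff i‖ * ρ ^ i) cofinite (𝓝 0) := by
  obtain ⟨ε, h0, h1, h, h'⟩ := exists_common f.conv g.conv
  obtain ⟨ε', h0', h1', h''⟩ := k.conv
  have hm0 := lt_min h0 h0'
  have hm1 : min ε ε' < 1 := min_lt_of_left_lt h1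
  have hρ : (1 - (min ε ε') / 2) ∈ annulus κ (min ε ε') := by
    cases κ <;> simp only [annulus, Set.mem_Ioo] <;> constructor <;> linarith
  have m1 := annulus_mono κ (min_le_left ε ε') hρ
  have m2 := annulus_mono κ (min_le_right ε ε') hρ
  exact ⟨_, annulus_pos κ h1 m1, h _ m1, h' _ m1, h'' _ m2⟩

protected theorem mul_comm' (f g : BaseRing K κ) : f * g = g * f := by
  ext n
  rw [coeff_mul, coeff_mul, ← (Equiv.subLeft n).tsum_eq]
  refine tsum_congr fun i => ?_
  simp only [Equiv.subLeft_apply, sub_sub_cancel]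
  exact mul_comm _ _

protected theorem one_mul' (f : BaseRing K κ) : 1 * f = f := by
  ext n
  rw [coeff_mul, tsum_eq_single 0]
  · change (Pi.single (0 : ℤ) (1 : K) : ℤ → K) 0 * _ = _
    simp
  · intro i hi
    change (Pi.single (0 : ℤ) (1 : K) : ℤ → K) i * _ = _
    simp [Pi.single_eq_of_ne hi]

protected theorem mul_add' (f g k : BaseRing K κ) : f * (g + k) = f * g + f * k := by
  ext n
  obtain ⟨ρ, hρ, hf, hg, hk⟩ := exists_null₃ f g k
  rw [coeff_add, coeff_mul, coeff_mul, coeff_mul,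
    ← (summable_conv hρ hf hg n).tsum_add (summable_conv hρ hf hk n)]
  refine tsum_congr fun i => ?_
  rw [coeff_add, mul_add]

protected theorem mul_assoc' (f g k : BaseRing K κ) : f * g * k = f * (g * k) := by
  ext n
  obtain ⟨ρ, hρ, hf, hg, hk⟩ := exists_null₃ f g k
  exact conv_assoc hρ hf hg hk n

instance : CommRing (BaseRing K κ) where
  add_assoc f g k := by ext n; exact add_assoc _ _ _
  zero_add f := by ext n; exact zero_add _
  add_zero f := by ext n; exact add_zero _
  add_comm f g := by ext n; exact add_comm _ _
  neg_add_cancel f := by ext n; exact neg_add_cancel _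
  mul_assoc := BaseRing.mul_assoc'
  mul_comm := BaseRing.mul_comm'
  one_mul := BaseRing.one_mul'
  mul_one f := by rw [BaseRing.mul_comm', BaseRing.one_mul']
  zero_mul f := by
    ext n
    rw [coeff_mul]
    change ∑' i : ℤ, (0 : K) * _ = 0
    simp
  mul_zero f := by
    ext n
    rw [coeff_mul]
    change ∑' i : ℤ, _ * (0 : K) = 0
    simp
  left_distrib := BaseRing.mul_add'
  right_distrib f g k := by
    rw [BaseRing.mul_comm', BaseRing.mul_add', BaseRing.mul_comm' k f, BaseRing.mul_comm' k g]
  nsmul := nsmulRec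
  zsmul := zsmulRec

end BaseRing

/-! ## The operators `σ_q`, `d_q`, `T d/dT`, Gauss norms, values at points -/

/-- The group `{q ∈ K : |q| = 1}` of all `q` for which `σ_q : f(T) ↦ f(qT)` is an automorphism
of the base ring. -/
abbrev UnitGroup (K : Type u) [NormedField K] : Type u := Metric.sphere (0 : K) 1

/-- The open disk `D⁻(1,r)` (used for `r ≤ 1`, where all its points have absolute value `1`). -/
def disk (K : Type u) [NormedField K] (r : ℝ) : Set (UnitGroup K) := {q | ‖(q : K) - 1‖ < r}

namespace BaseRing

variable {K : Type u} [NormedField K] [IsUltrametricDist K] [CompleteSpace K] {κ : BaseKind}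

theorem norm_coe_zpow (q : UnitGroup K) (i : ℤ) : ‖(q : K) ^ i‖ = 1 := by
  have h : ‖(q : K)‖ = 1 := by simpa using q.2
  rw [norm_zpow, h, one_zpow]

theorem coe_ne_zero (q : UnitGroup K) : (q : K) ≠ 0 := by
  have h : ‖(q : K)‖ = 1 := by simpa using q.2
  intro h0
  simp [h0] at h

/-- The ring endomorphism `σ_q : f(T) ↦ f(qT)`, for `|q| = 1`. -/
def sigma (q : UnitGroup K) : BaseRing K κ →+* BaseRing K κ where
  toFun f := ⟨fun i => (q : K) ^ i * f.coeff i, by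
    obtain ⟨ε, h0, h1, h⟩ := f.conv
    refine ⟨ε, h0, h1, fun ρ hρ => ?_⟩
    simpa only [norm_mul, norm_coe_zpow, one_mul] using h ρ hρ⟩
  map_one' := by
    ext i
    change (q : K) ^ i * (Pi.single (0 : ℤ) (1 : K) : ℤ → K) i = (Pi.single (0 : ℤ) (1 : K) : ℤ → K) i
    by_cases hi : i = 0
    · subst hi
      simp
    · simp [Pi.single_eq_of_ne hi]
  map_mul' f g := by
    ext n
    change (q : K) ^ n * (∑' i : ℤ, f.coeff i * g.coeff (n - i)) =
      ∑' i : ℤ, ((q : K) ^ i * f.coeff i) * ((q : K) ^ (n - i) * g.coeff (n - i))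
    rw [← tsum_mul_left]
    refine tsum_congr fun i => ?_
    have hq := zpow_ne_zero i (coe_ne_zero q)
    rw [zpow_sub₀ (coe_ne_zero q)]
    field_simp
  map_zero' := by
    ext i
    exact mul_zero _
  map_add' f g := by
    ext i
    exact mul_add _ _ _

/-- The derivation `δ₁ = T d/dT`. -/
def theta (f : BaseRing K κ) : BaseRing K κ :=
  ⟨fun i => (i : K) * f.coeff i, by
    obtain ⟨ε, h0, h1, h⟩ := f.conv
    refine ⟨ε, h0, h1, fun ρ hρ => null_of_le (annulus_pos κ h1 hρ) (fun i => ?_) (h ρ hρ)⟩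
    rw [norm_mul]
    exact mul_le_of_le_one_left (norm_nonneg _) (IsUltrametricDist.norm_intCast_le_one K i)⟩

/-- The derivation `d/dT`. -/
def ddT (f : BaseRing K κ) : BaseRing K κ := monomial (-1) 1 * theta f

/-- The `q`-derivation `d_q = (σ_q - 1) / ((q - 1) T)` (for `q ≠ 1`). -/
def dq (q : UnitGroup K) (f : BaseRing K κ) : BaseRing K κ :=
  monomial (-1) ((q : K) - 1)⁻¹ * (sigma q f - f)

/-- The Gauss norm `|f|_ρ = sup_i |a_i| ρ^i`, with values in `[0, ∞]`. -/
def gaussNorm (ρ : ℝ) (f : BaseRing K κ) : ℝ≥0∞ := ⨆ i : ℤ, ‖f.coeff i‖ₑ * ENNReal.ofReal ρ ^ i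

/-- The value `f(x)` at a point `x` of an extension `L` of `K`, where `|x|` lies in an interval on
which `f` converges. -/
def eval {L : Type w} [NontriviallyNormedField L] [NormedAlgebra K L] (x : L)
    (f : BaseRing K κ) : L :=
  ∑' i : ℤ, algebraMap K L (f.coeff i) * x ^ i

end BaseRing

open BaseRing

section Taylor

variable {K : Type u} [NormedField K] [IsUltrametricDist K] [CompleteSpace K] {κ : BaseKind}
  {n : ℕ}

/-- The Gauss norm of a matrix: the maximum of the Gauss norms of its entries. -/
def matNorm (ρ : ℝ) (A : Matrix (Fin n) (Fin n) (BaseRing K κ)) : ℝ≥0∞ :=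
  ⨆ i, ⨆ j, gaussNorm ρ (A i j)

/-- The value of a matrix of functions at a point `x`. -/
def matEval {L : Type w} [NontriviallyNormedField L] [NormedAlgebra K L] (x : L)
    (A : Matrix (Fin n) (Fin n) (BaseRing K κ)) : Matrix (Fin n) (Fin n) L :=
  A.map (eval x)

/-- All entries of the matrix are analytic functions on the annulus `|T| ∈ I`. -/
def MatConvergesOn (I : Set ℝ) (A : Matrix (Fin n) (Fin n) (BaseRing K κ)) : Prop :=
  ∀ i j, ConvergesOn I (A i j).coeff

/-- The matrices `H_m` with `d_q^m (Y) = H_m Y` for the solutions `Y` of `σ_q(Y) = A Y`: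
`H_0 = 1` and `H_{m+1} = d_q(H_m) + σ_q(H_m) H_1`, where `H_1 = (A - 1) / ((q-1) T)`. -/
def qIter (q : UnitGroup K) (A : Matrix (Fin n) (Fin n) (BaseRing K κ)) :
    ℕ → Matrix (Fin n) (Fin n) (BaseRing K κ)
  | 0 => 1
  | m + 1 => (qIter q A m).map (dq q) +
      (qIter q A m).map (sigma q) * (A - 1).map fun f => monomial (-1) ((q : K) - 1)⁻¹ * f

/-- The matrices `G_[m]` with `(d/dT)^m (Y) = G_[m] Y` for the solutions `Y` of `δ₁(Y) = G Y`:
`G_[0] = 1` and `G_[m+1] = G_[m]' + G_[m] G_[1]`, where `G_[1] = T⁻¹ G`. -/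
def dIter (G : Matrix (Fin n) (Fin n) (BaseRing K κ)) :
    ℕ → Matrix (Fin n) (Fin n) (BaseRing K κ)
  | 0 => 1
  | m + 1 => (dIter G m).map ddT + dIter G m * G.map fun f => monomial (-1) 1 * f

/-- The `q`-factorial `[m]_q^! = ∏_{i=1}^{m} (1 + q + ⋯ + q^{i-1})`. -/
def qFactorial (q : K) (m : ℕ) : K := ∏ i ∈ Finset.range m, ∑ j ∈ Finset.range (i + 1), q ^ j

/-- The `m`-th term `H_m(c) (x-c)_{q,m} / [m]_q^!` of the `q`-Taylor solution `Y_A(x,c)`, where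
`(x-c)_{q,m} = (x-c)(x-qc)⋯(x-q^{m-1}c)`. -/
def qTaylorTerm {L : Type w} [NontriviallyNormedField L] [NormedAlgebra K L] (q : UnitGroup K)
    (A : Matrix (Fin n) (Fin n) (BaseRing K κ)) (c x : L) (m : ℕ) : Matrix (Fin n) (Fin n) L :=
  ((∏ i ∈ Finset.range m, (x - algebraMap K L (q : K) ^ i * c)) /
    algebraMap K L (qFactorial (q : K) m)) • matEval c (qIter q A m)

/-- The `m`-th term `G_[m](c) (x-c)^m / m!` of the Taylor solution `Y_G(x,c)`. -/
def dTaylorTerm {L : Type w} [NontriviallyNormedField L] [NormedAlgebra K L]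
    (G : Matrix (Fin n) (Fin n) (BaseRing K κ)) (c x : L) (m : ℕ) : Matrix (Fin n) (Fin n) L :=
  ((x - c) ^ m / (m.factorial : L)) • matEval c (dIter G m)

/-- The generic radius of convergence at `ρ` of the `q`-difference equation `σ_q(Y) = A Y`, for `q`
not a root of unity: `min (liminf_m (|H_m|_ρ / |[m]_q^!|)^{-1/m}, ρ)`. -/
def qRay (q : UnitGroup K) (A : Matrix (Fin n) (Fin n) (BaseRing K κ)) (ρ : ℝ) : ℝ≥0∞ :=
  min (liminf (fun m : ℕ => (matNorm ρ (qIter q A m) / ‖qFactorial (q : K) m‖ₑ) ^ (-(1 / (m : ℝ))))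
    atTop) (ENNReal.ofReal ρ)

/-- The generic radius of convergence at `ρ` of the differential equation `δ₁(Y) = G Y`:
`min (liminf_m (|G_[m]|_ρ / |m!|)^{-1/m}, ρ)`. -/
def dRay (G : Matrix (Fin n) (Fin n) (BaseRing K κ)) (ρ : ℝ) : ℝ≥0∞ :=
  min (liminf (fun m : ℕ => (matNorm ρ (dIter G m) / ‖(m.factorial : K)‖ₑ) ^ (-(1 / (m : ℝ))))
    atTop) (ENNReal.ofReal ρ)

/-- The condition `[r]` on the function `ρ ↦ Ray(ρ)` for the parameter `q`. Over `H^†_K` it is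
`|q - 1| < r` and `Ray(1) ≥ r`. Over the Robba ring it is `|q - 1| ≤ r`, `lim Ray(ρ) ≥ r` as
`ρ → 1⁻`, and `Ray(ρ) > |q - 1|` for all `ρ < 1` close to `1`. (A generic radius is a log-concave
function of `ρ`, so its limit exists and is the `liminf` below.) -/
def RadiusCondition (κ : BaseKind) (r : ℝ) (q : UnitGroup K) (ray : ℝ → ℝ≥0∞) : Prop :=
  match κ with
  | BaseKind.hdagger => ‖(q : K) - 1‖ < r ∧ ENNReal.ofReal r ≤ ray 1
  | BaseKind.robba => ‖(q : K) - 1‖ ≤ r ∧ ENNReal.ofReal r ≤ liminf ray (𝓝[<] (1 : ℝ)) ∧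
      ∀ᶠ ρ in 𝓝[<] (1 : ℝ), ENNReal.ofReal ‖(q : K) - 1‖ < ray ρ

end Taylor

/-- `t` is a generic point `t_ρ` of the disk `|T| ≤ ρ`: `|t| = ρ` and the value of every polynomial
over `K` at `t` has the absolute value `|P|_ρ` (the inequality `≤` being automatic). Equivalently
`|t| = ρ` and no point algebraic over `K` lies in the open disk of radius `ρ` around `t`. -/
def IsGenericPoint (K : Type u) [NormedField K] {Ω : Type w} [NontriviallyNormedField Ω]
    [NormedAlgebra K Ω] (ρ : ℝ) (t : Ω) : Prop :=
  ‖t‖ = ρ ∧ ∀ (P : Polynomial K) (i : ℕ), ‖P.coeff i‖ * ρ ^ i ≤ ‖Polynomial.aeval t P‖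

/-- The entries of `Y` belong to the ring `A_L(c,R)` of analytic functions on the open disk
`D⁻(c,R)`: they are power series in `x - c` with radius of convergence at least `R`. -/
def IsAnalyticOnDisk {L : Type w} [NontriviallyNormedField L] {n : ℕ} (c : L) (R : ℝ)
    (Y : L → Matrix (Fin n) (Fin n) L) : Prop :=
  ∀ i j, ∃ a : ℕ → L, (∀ s : ℝ, 0 ≤ s → s < R → Tendsto (fun m => ‖a m‖ * s ^ m) atTop (𝓝 0)) ∧
    ∀ x : L, ‖x - c‖ < R → HasSum (fun m => a m * (x - c) ^ m) (Y x i j)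

/-! ## Discrete `σ`-modules and `(σ,δ)`-modules -/

section Modules

variable (K : Type u) [NormedField K] [IsUltrametricDist K] [CompleteSpace K] (κ : BaseKind)

/-- A discrete `σ`-module over `S`: a finite free `B`-module with a semi-linear action of the
group `⟨S⟩` generated by `S`. (Additivity, semi-linearity and the group law make each `σ_q` a
`K`-linear automorphism; it is continuous because `σ_q` is continuous on `B`.) -/
structure SigmaModule (S : Set (UnitGroup K)) : Type (max u (v + 1)) where
  carrier : Type v
  [addCommGroup : AddCommGroup carrier]
  [module : Module (BaseRing K κ) carrier]
  [free : Module.Free (BaseRing K κ) carrier]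
  [finite : Module.Finite (BaseRing K κ) carrier]
  /-- The action `q ↦ σ_q^M` of `⟨S⟩`. -/
  σ : Subgroup.closure S →* AddMonoid.End carrier
  semilinear : ∀ (q : Subgroup.closure S) (f : BaseRing K κ) (m : carrier),
    σ q (f • m) = sigma (q : UnitGroup K) f • σ q m

attribute [instance] SigmaModule.addCommGroup SigmaModule.module SigmaModule.free
  SigmaModule.finite

/-- A discrete `(σ,δ)`-module over `S`: a discrete `σ`-module with a connection `δ₁^M`. -/
structure SigmaDeltaModule (S : Set (UnitGroup K)) extends SigmaModule.{u, v} K κ S where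
  /-- The connection `δ₁^M`. -/
  δ : carrier →+ carrier
  leibniz : ∀ (f : BaseRing K κ) (m : carrier), δ (f • m) = theta f • m + f • δ m

variable {K κ}
variable {S S' : Set (UnitGroup K)}

/-- Morphisms of discrete `σ`-modules: `B`-linear maps that commute with all `σ_q`. -/
@[ext]
structure SigmaModule.Hom (M N : SigmaModule.{u, v} K κ S) where
  toLin : M.carrier →ₗ[BaseRing K κ] N.carrier
  comm : ∀ (q : Subgroup.closure S) (m : M.carrier), toLin (M.σ q m) = N.σ q (toLin m)

instance : Category (SigmaModule.{u, v} K κ S) where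
  Hom M N := SigmaModule.Hom M N
  id M := ⟨LinearMap.id, fun _ _ => rfl⟩
  comp f g := ⟨g.toLin.comp f.toLin, fun q m => by
    simp only [LinearMap.comp_apply, f.comm, g.comm]⟩

/-- Morphisms of discrete `(σ,δ)`-modules: `B`-linear maps that commute with all `σ_q` and with the
connections. -/
@[ext]
structure SigmaDeltaModule.Hom (M N : SigmaDeltaModule.{u, v} K κ S) extends
    SigmaModule.Hom M.toSigmaModule N.toSigmaModule where
  comm_δ : ∀ m : M.carrier, toLin (M.δ m) = N.δ (toLin m)

instance : Category (SigmaDeltaModule.{u, v} K κ S) where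
  Hom M N := SigmaDeltaModule.Hom M N
  id M := ⟨⟨LinearMap.id, fun _ _ => rfl⟩, fun _ => rfl⟩
  comp f g := ⟨⟨g.toLin.comp f.toLin, fun q m => by
    simp only [LinearMap.comp_apply, f.comm, g.comm]⟩, fun m => by
    simp only [LinearMap.comp_apply, f.comm_δ, g.comm_δ]⟩

/-- Restriction of the action from `⟨S⟩` to `⟨S'⟩`, for `S' ⊆ S`. -/
def SigmaModule.restrict (h : S' ⊆ S) (M : SigmaModule.{u, v} K κ S) :
    SigmaModule.{u, v} K κ S' where
  carrier := M.carrier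
  σ := M.σ.comp (Subgroup.inclusion (Subgroup.closure_mono h))
  semilinear q f m := M.semilinear (Subgroup.inclusion (Subgroup.closure_mono h) q) f m

/-- Restriction of the action from `⟨S⟩` to `⟨S'⟩`, for `S' ⊆ S`. -/
def SigmaDeltaModule.restrict (h : S' ⊆ S) (M : SigmaDeltaModule.{u, v} K κ S) :
    SigmaDeltaModule.{u, v} K κ S' where
  toSigmaModule := M.toSigmaModule.restrict h
  δ := M.δ
  leibniz := M.leibniz

/-- The restriction functor `Res^S_{S'}` on discrete `σ`-modules. -/
def SigmaModule.res (h : S' ⊆ S) : SigmaModule.{u, v} K κ S ⥤ SigmaModule.{u, v} K κ S' where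
  obj M := M.restrict h
  map f := ⟨f.toLin, fun q m => f.comm (Subgroup.inclusion (Subgroup.closure_mono h) q) m⟩

/-- The restriction functor `Res^S_{S'}` on discrete `(σ,δ)`-modules. -/
def SigmaDeltaModule.res (h : S' ⊆ S) :
    SigmaDeltaModule.{u, v} K κ S ⥤ SigmaDeltaModule.{u, v} K κ S' where
  obj M := M.restrict h
  map f := ⟨⟨f.toLin, fun q m => f.comm (Subgroup.inclusion (Subgroup.closure_mono h) q) m⟩,
    f.comm_δ⟩

/-- The matrix `A(q,T)` of `σ_q^M` in a basis: `σ_q^M (e_i) = ∑_j A_{ij} e_j`. -/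
def SigmaModule.mat (M : SigmaModule.{u, v} K κ S) {n : ℕ}
    (e : Module.Basis (Fin n) (BaseRing K κ) M.carrier) (q : Subgroup.closure S) :
    Matrix (Fin n) (Fin n) (BaseRing K κ) :=
  Matrix.of fun i j => e.repr (M.σ q (e i)) j

/-- The matrix `G(1,T)` of `δ₁^M` in a basis: `δ₁^M (e_i) = ∑_j G_{ij} e_j`. -/
def SigmaDeltaModule.dmat (M : SigmaDeltaModule.{u, v} K κ S) {n : ℕ}
    (e : Module.Basis (Fin n) (BaseRing K κ) M.carrier) : Matrix (Fin n) (Fin n) (BaseRing K κ) :=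
  Matrix.of fun i j => e.repr (M.δ (e i)) j

/-- The restriction of `M` to `⟨V⟩` comes by scalar extension from the discrete `σ`-module over `V`
on the annulus `|T| ∈ I` which is spanned by the basis `e`: the matrices of the `σ_q`, `q ∈ ⟨V⟩`,
have their entries in the ring of analytic functions on the annulus. (Since `⟨V⟩` is a group, they
are then invertible over that ring.) -/
def SigmaModule.IsDefinedOn (M : SigmaModule.{u, v} K κ S) {n : ℕ}
    (e : Module.Basis (Fin n) (BaseRing K κ) M.carrier) (I : Set ℝ) (V : Set (UnitGroup K)) :
    Prop :=
  ∀ q : Subgroup.closure S, (q : UnitGroup K) ∈ Subgroup.closure V → MatConvergesOn I (M.mat e q)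

/-! ## The categories of modules of generic radius at least `r` -/

variable (Ω : Type w) [NontriviallyNormedField Ω] [NormedAlgebra K Ω] (r : ℝ)

/-- The object property that defines `σ-Mod(B)^{[r]}_S`.
The first condition says that the restriction of `M` to every `q ∈ S` that is not a root of unity
belongs to `σ_q-Mod(B)^{[r]}`.
The second one says that for every `0 < τ < r`, with `S_τ = S ∩ D⁻(1,τ)`, the restriction of `M` to
`⟨S_τ⟩` is defined on some annulus `|T| ∈ I_ε`, and that at all generic points `t_ρ`, `ρ ∈ I_ε`, all
equations `σ_q(Y) = A(q,T) Y`, `q ∈ S_τ`, have one and the same Taylor solution `Y(T,t_ρ)`: if `q` is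
not a root of unity, `Y` is the (convergent) `q`-Taylor solution `Y_{A(q,T)}(T,t_ρ)`; and `Y` is a
solution of the equation also if `q` is a root of unity, where `Y_{A(q,T)}` is not defined. -/
def sigmaProp (S : Set (UnitGroup K)) : ObjectProperty (SigmaModule.{u, v} K κ S) := fun M =>
  (∀ q : Subgroup.closure S, (q : UnitGroup K) ∈ S → ¬ IsOfFinOrder (q : UnitGroup K) →
    ∃ (n : ℕ) (e : Module.Basis (Fin n) (BaseRing K κ) M.carrier),
      RadiusCondition κ r (q : UnitGroup K) (qRay (q : UnitGroup K) (M.mat e q))) ∧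
  ∀ τ : ℝ, 0 < τ → τ < r → ∃ ε : ℝ, 0 < ε ∧ ε < 1 ∧
    ∃ (n : ℕ) (e : Module.Basis (Fin n) (BaseRing K κ) M.carrier),
      M.IsDefinedOn e (annulus κ ε) (S ∩ disk K τ) ∧
      ∀ ρ ∈ annulus κ ε, ∀ t : Ω, IsGenericPoint K ρ t →
        ∃ R : ℝ, 0 < R ∧ R ≤ ρ ∧ ∃ Y : Ω → Matrix (Fin n) (Fin n) Ω,
          IsAnalyticOnDisk t R Y ∧ Y t = 1 ∧
          ∀ q : Subgroup.closure S, (q : UnitGroup K) ∈ S ∩ disk K τ →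
            ‖((q : UnitGroup K) : K) - 1‖ * ρ < R ∧
            (¬ IsOfFinOrder (q : UnitGroup K) → ∀ x : Ω, ‖x - t‖ < R →
              HasSum (qTaylorTerm (q : UnitGroup K) (M.mat e q) t x) (Y x)) ∧
            ∀ x : Ω, ‖x - t‖ < R →
              Y (algebraMap K Ω ((q : UnitGroup K) : K) * x) = matEval x (M.mat e q) * Y x

/-- The object property that defines `(σ,δ)-Mod(B)^{[r]}_S`: as for `σ`-modules, but now with the
generic radius of the differential equation of `δ₁^M` (for all `q ∈ S`), and with the Taylor solution
`Y_{G(1,T)}(T,t_ρ)` of that equation as the common solution. -/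
def sigmaDeltaProp (S : Set (UnitGroup K)) : ObjectProperty (SigmaDeltaModule.{u, v} K κ S) :=
  fun M =>
  (∀ q : Subgroup.closure S, (q : UnitGroup K) ∈ S →
    ∃ (n : ℕ) (e : Module.Basis (Fin n) (BaseRing K κ) M.carrier),
      RadiusCondition κ r (q : UnitGroup K) (dRay (M.dmat e))) ∧
  ∀ τ : ℝ, 0 < τ → τ < r → ∃ ε : ℝ, 0 < ε ∧ ε < 1 ∧
    ∃ (n : ℕ) (e : Module.Basis (Fin n) (BaseRing K κ) M.carrier),
      M.IsDefinedOn e (annulus κ ε) (S ∩ disk K τ) ∧ MatConvergesOn (annulus κ ε) (M.dmat e) ∧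
      ∀ ρ ∈ annulus κ ε, ∀ t : Ω, IsGenericPoint K ρ t →
        ∃ R : ℝ, 0 < R ∧ R ≤ ρ ∧ ∃ Y : Ω → Matrix (Fin n) (Fin n) Ω,
          IsAnalyticOnDisk t R Y ∧ Y t = 1 ∧
          (∀ x : Ω, ‖x - t‖ < R → HasSum (dTaylorTerm (M.dmat e) t x) (Y x)) ∧
          ∀ q : Subgroup.closure S, (q : UnitGroup K) ∈ S ∩ disk K τ →
            ‖((q : UnitGroup K) : K) - 1‖ * ρ < R ∧
            (¬ IsOfFinOrder (q : UnitGroup K) → ∀ x : Ω, ‖x - t‖ < R →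
              HasSum (qTaylorTerm (q : UnitGroup K) (M.mat e q) t x) (Y x)) ∧
            ∀ x : Ω, ‖x - t‖ < R →
              Y (algebraMap K Ω ((q : UnitGroup K) : K) * x) = matEval x (M.mat e q) * Y x

theorem sigmaProp_restrict (h : S' ⊆ S) (M : SigmaModule.{u, v} K κ S)
    (hM : sigmaProp Ω r S M) : sigmaProp Ω r S' (M.restrict h) := by
  refine ⟨fun q hq hq' => hM.1 ⟨q, Subgroup.closure_mono h q.2⟩ (h hq) hq', fun τ h0 h1 => ?_⟩
  obtain ⟨ε, he0, he1, n, e, hd, hY⟩ := hM.2 τ h0 h1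
  refine ⟨ε, he0, he1, n, e, fun q hq => hd ⟨q, Subgroup.closure_mono h q.2⟩
    (Subgroup.closure_mono (Set.inter_subset_inter_left _ h) hq), fun ρ hρ t ht => ?_⟩
  obtain ⟨R, hR0, hR, Y, hYan, hYt, hYq⟩ := hY ρ hρ t ht
  exact ⟨R, hR0, hR, Y, hYan, hYt, fun q hq =>
    hYq ⟨q, Subgroup.closure_mono h q.2⟩ ⟨h hq.1, hq.2⟩⟩

theorem sigmaDeltaProp_restrict (h : S' ⊆ S) (M : SigmaDeltaModule.{u, v} K κ S)
    (hM : sigmaDeltaProp Ω r S M) : sigmaDeltaProp Ω r S' (M.restrict h) := by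
  refine ⟨fun q hq => hM.1 ⟨q, Subgroup.closure_mono h q.2⟩ (h hq), fun τ h0 h1 => ?_⟩
  obtain ⟨ε, he0, he1, n, e, hd, hG, hY⟩ := hM.2 τ h0 h1
  refine ⟨ε, he0, he1, n, e, fun q hq => hd ⟨q, Subgroup.closure_mono h q.2⟩
    (Subgroup.closure_mono (Set.inter_subset_inter_left _ h) hq), hG, fun ρ hρ t ht => ?_⟩
  obtain ⟨R, hR0, hR, Y, hYan, hYt, hYG, hYq⟩ := hY ρ hρ t ht
  exact ⟨R, hR0, hR, Y, hYan, hYt, hYG, fun q hq =>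
    hYq ⟨q, Subgroup.closure_mono h q.2⟩ ⟨h hq.1, hq.2⟩⟩

variable (K κ)

/-- The category `σ-Mod(B)^{[r]}_S`. -/
abbrev SigmaCat (S : Set (UnitGroup K)) : Type (max u (v + 1)) :=
  (sigmaProp.{u, v, w} (κ := κ) Ω r S).FullSubcategory

/-- The category `(σ,δ)-Mod(B)^{[r]}_S`. -/
abbrev SigmaDeltaCat (S : Set (UnitGroup K)) : Type (max u (v + 1)) :=
  (sigmaDeltaProp.{u, v, w} (κ := κ) Ω r S).FullSubcategory

/-- The restriction functor `σ-Mod(B)^{[r]}_S ⥤ σ-Mod(B)^{[r]}_{S'}`. -/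
def sigmaRes (h : S' ⊆ S) : SigmaCat.{u, v, w} K κ Ω r S ⥤ SigmaCat.{u, v, w} K κ Ω r S' :=
  ObjectProperty.lift _ (ObjectProperty.ι _ ⋙ SigmaModule.res h)
    fun M => sigmaProp_restrict Ω r h M.obj M.property

/-- The restriction functor `(σ,δ)-Mod(B)^{[r]}_S ⥤ (σ,δ)-Mod(B)^{[r]}_{S'}`. -/
def sigmaDeltaRes (h : S' ⊆ S) :
    SigmaDeltaCat.{u, v, w} K κ Ω r S ⥤ SigmaDeltaCat.{u, v, w} K κ Ω r S' :=
  ObjectProperty.lift _ (ObjectProperty.ι _ ⋙ SigmaDeltaModule.res h)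
    fun M => sigmaDeltaProp_restrict Ω r h M.obj M.property

end Modules

/-! ## Analytic modules and constant modules -/

section Analytic

variable {K : Type u} [NormedField K] [IsUltrametricDist K] [CompleteSpace K] {κ : BaseKind}
  {S : Set (UnitGroup K)} {n : ℕ}

/-- Analyticity on `U` over the annulus `|T| ∈ I`: locally around every `q ∈ U`, on some disk
`D⁻(q,η)`, the matrix `A(Q,T)` of `σ_Q^M` is an analytic function
`∑_{k ≥ 0, m ∈ ℤ} a_{k,m} (Q-q)^k T^m` on `D⁻(q,η) × {|T| ∈ I}`. -/
def SigmaModule.IsAnalyticOn (M : SigmaModule.{u, v} K κ S)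
    (e : Module.Basis (Fin n) (BaseRing K κ) M.carrier) (I : Set ℝ) (U : Set (UnitGroup K)) :
    Prop :=
  ∀ q : Subgroup.closure S, (q : UnitGroup K) ∈ U → ∃ η : ℝ, 0 < η ∧ ∀ i j : Fin n,
    ∃ a : ℕ → ℤ → K,
      (∀ ρ ∈ I, ∀ s : ℝ, 0 ≤ s → s < η →
        Tendsto (fun p : ℕ × ℤ => ‖a p.1 p.2‖ * s ^ p.1 * ρ ^ p.2) cofinite (𝓝 0)) ∧
      ∀ q' : Subgroup.closure S,
        ‖((q' : UnitGroup K) : K) - ((q : UnitGroup K) : K)‖ < η → ∀ m : ℤ,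
          HasSum (fun k : ℕ => a k m * (((q' : UnitGroup K) : K) - ((q : UnitGroup K) : K)) ^ k)
            ((M.mat e q' i j).coeff m)

/-- `M` is trivialized on `U` by the algebra `C = A_L(c,R)` of analytic functions on the disk
`D⁻(c,R)` over `L`: there is a matrix `Y ∈ GL_n(C)` (with inverse `Z`) which is a simultaneous
solution of all the equations `Y(qT) = A(q,T) Y(T)`, `q ∈ U`. -/
def SigmaModule.IsTrivializedBy (M : SigmaModule.{u, v} K κ S)
    (e : Module.Basis (Fin n) (BaseRing K κ) M.carrier) (U : Set (UnitGroup K))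
    {L : Type w} [NontriviallyNormedField L] [NormedAlgebra K L] (c : L) (R : ℝ) : Prop :=
  ∃ Y Z : L → Matrix (Fin n) (Fin n) L, IsAnalyticOnDisk c R Y ∧ IsAnalyticOnDisk c R Z ∧
    (∀ x : L, ‖x - c‖ < R → Y x * Z x = 1) ∧
    ∀ q : Subgroup.closure S, (q : UnitGroup K) ∈ U → ∀ x : L, ‖x - c‖ < R →
      Y (algebraMap K L ((q : UnitGroup K) : K) * x) = matEval x (M.mat e q) * Y x

/-- The analogue for `(σ,δ)`-modules: in addition `T dY/dT = G(1,T) Y`. -/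
def SigmaDeltaModule.IsTrivializedBy (M : SigmaDeltaModule.{u, v} K κ S)
    (e : Module.Basis (Fin n) (BaseRing K κ) M.carrier) (U : Set (UnitGroup K))
    {L : Type w} [NontriviallyNormedField L] [NormedAlgebra K L] (c : L) (R : ℝ) : Prop :=
  ∃ Y Z : L → Matrix (Fin n) (Fin n) L, IsAnalyticOnDisk c R Y ∧ IsAnalyticOnDisk c R Z ∧
    (∀ x : L, ‖x - c‖ < R → Y x * Z x = 1) ∧
    (∀ q : Subgroup.closure S, (q : UnitGroup K) ∈ U → ∀ x : L, ‖x - c‖ < R →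
      Y (algebraMap K L ((q : UnitGroup K) : K) * x) = matEval x (M.mat e q) * Y x) ∧
    ∀ x : L, ‖x - c‖ < R → ∀ i j : Fin n, ∃ y' : L,
      HasDerivAt (fun z => Y z i j) y' x ∧ x * y' = (matEval x (M.dmat e) * Y x) i j

/-- Analyticity of a `(σ,δ)`-module: the `σ`-module is analytic, and the connection is the one which
is derived from it, `δ₁^M = lim (σ_q^M - 1) / (q - 1)` as `q → 1`, i.e.
`G(1,T) = lim (A(q,T) - A(1,T)) / (q - 1)` for all norms `|·|_ρ`, `ρ ∈ I`. -/
def SigmaDeltaModule.IsAnalyticOn (M : SigmaDeltaModule.{u, v} K κ S)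
    (e : Module.Basis (Fin n) (BaseRing K κ) M.carrier) (I : Set ℝ) (U : Set (UnitGroup K)) :
    Prop :=
  M.toSigmaModule.IsAnalyticOn e I U ∧ MatConvergesOn I (M.dmat e) ∧
    ∀ ρ ∈ I, Tendsto (fun q : Subgroup.closure S =>
      matNorm ρ ((M.mat e q - M.mat e 1).map
        (fun f => monomial 0 (((q : UnitGroup K) : K) - 1)⁻¹ * f) - M.dmat e))
      (𝓝[≠] 1) (𝓝 0)

/-- A `σ`-module over the whole disk `D⁻(1,r)` is analytically `C`-constant.
For every `τ < r` its restriction to `D⁻(1,τ)` is defined on some annulus `|T| ∈ I_ε`, is analytic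
there, and is trivialized by the algebras `C = A_L(c, τ|c|)` around all points `c` of the annulus,
rational over `K` or over any complete ultrametric extension `L` of `K` (after extension of the
scalars to `L`).
Over `H^†_K`, where the circle `|T| = 1` is contained in all annuli, the module is moreover
trivialized on the whole disk `D⁻(1,r)` by `C = A_L(c,r)` for all points `c` with `|c| = 1`. -/
def SigmaModule.IsAnalyticallyConstant (r : ℝ) (M : SigmaModule.{u, v} K κ (disk K r)) : Prop :=
  (∀ τ : ℝ, 0 < τ → τ < r → ∃ ε : ℝ, 0 < ε ∧ ε < 1 ∧
    ∃ (n : ℕ) (e : Module.Basis (Fin n) (BaseRing K κ) M.carrier),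
      M.IsDefinedOn e (annulus κ ε) (disk K τ) ∧
      M.IsAnalyticOn e (annulus κ ε) (disk K τ) ∧
      ∀ (L : Type u) [NontriviallyNormedField L] [IsUltrametricDist L] [CompleteSpace L]
        [NormedAlgebra K L] (c : L), ‖c‖ ∈ annulus κ ε →
          M.IsTrivializedBy e (disk K τ) c (τ * ‖c‖)) ∧
  (κ = BaseKind.hdagger →
    ∃ (n : ℕ) (e : Module.Basis (Fin n) (BaseRing K κ) M.carrier),
      ∀ (L : Type u) [NontriviallyNormedField L] [IsUltrametricDist L] [CompleteSpace L]
        [NormedAlgebra K L] (c : L), ‖c‖ = 1 → M.IsTrivializedBy e (disk K r) c r)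

/-- The analogue for `(σ,δ)`-modules. -/
def SigmaDeltaModule.IsAnalyticallyConstant (r : ℝ)
    (M : SigmaDeltaModule.{u, v} K κ (disk K r)) : Prop :=
  (∀ τ : ℝ, 0 < τ → τ < r → ∃ ε : ℝ, 0 < ε ∧ ε < 1 ∧
    ∃ (n : ℕ) (e : Module.Basis (Fin n) (BaseRing K κ) M.carrier),
      M.IsDefinedOn e (annulus κ ε) (disk K τ) ∧
      M.IsAnalyticOn e (annulus κ ε) (disk K τ) ∧
      ∀ (L : Type u) [NontriviallyNormedField L] [IsUltrametricDist L] [CompleteSpace L]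
        [NormedAlgebra K L] (c : L), ‖c‖ ∈ annulus κ ε →
          M.IsTrivializedBy e (disk K τ) c (τ * ‖c‖)) ∧
  (κ = BaseKind.hdagger →
    ∃ (n : ℕ) (e : Module.Basis (Fin n) (BaseRing K κ) M.carrier),
      ∀ (L : Type u) [NontriviallyNormedField L] [IsUltrametricDist L] [CompleteSpace L]
        [NormedAlgebra K L] (c : L), ‖c‖ = 1 → M.IsTrivializedBy e (disk K r) c r)

end Analytic

end QDiff

end

noncomputable section

set_option linter.unusedSectionVars false

namespace QDiff

namespace BaseRing

/-! ### Coefficient calculus in the base ring, and convergence and Gauss bounds on a single circle.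
-/

section Basic

variable {K : Type u} [NormedField K] {κ : BaseKind}

/-! A σ-module of radius `r` is a differential module in disguise. For a connection with matrix `G`
let `N_k = T^k G_[k] / k!` (`binomMat`), the matrix of `binom(δ₁, k)`. In the relative coordinate `x
= (1 + u) c` the Taylor solution at `c` is `∑ N_k(c) u^k`, and taking `x = qc` gives the operator
`A(q,T) = ∑ (q-1)^k N_k` (`IsTaylorMat`). If for every `τ < r` the Gauss norms of `N_k` are
`O(τ^{-k})` on some annulus (`Rad`), these series converge for every `q` in `D⁻(1,r)`. The cocycle
identity `Y(y,c) = Y(y,x) Y(x,c)` (`solAt_cocycle`) makes them an action of the whole disk, and the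
Taylor solutions are the common solutions demanded by analytic constancy. It remains to see that
every object over `S` comes in this way from a connection.

For `(σ,δ)`-modules the connection is given. For σ-modules it is built from one `q ∈ S` that is not
a root of unity. With `P_m = T^m H_m / [m]_q^!` (`qMat`) the `q`-Taylor solution is the Newton
series `∑ P_m(c) ∏_{i<m} (u - (q^i - 1))`. For `|q-1| < s` the nodes lie in the disk of radius `s`,
so passing between Newton series and power series preserves bounds `O(s^{-k})`. The matrix `G` is
the coefficient of `u`. The differential equation holds at the nodes by a discrete cocycle identity
(`qNode_add`); the nodes accumulate at `0` because `q^{p^k} → 1`, so it holds everywhere by the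
identity principle. This is `exists_isTaylorMat`.

The identity principle also gives fullness in the σ-case: a matrix that intertwines one `σ_q`, `q`
not a root of unity, intertwines the Taylor solutions and hence all operators
(`sigma_intertwine_of_sigma`). For the other elements of `S`, roots of unity included, the common
Taylor solution at a generic point `t` forces `A(q,t)` to be the value of the Taylor matrix, and a
function is determined by its value at a generic point (`IsGenericPoint.eq_zero`).

The radius condition yields bounds on an annulus directly over the Robba ring. Over `H^†_K` it
concerns only the circle `|T| = 1`; there a three circles inequality is combined with crude bounds
`D^m` on two neighbouring circles (`exists_seqBound_near_one`). -/

theorem coeff_zero (m : ℤ) : (0 : BaseRing K κ).coeff m = 0 := rfl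

theorem coeff_neg (f : BaseRing K κ) (m : ℤ) : (-f).coeff m = -f.coeff m := rfl

theorem coeff_monomial (a : ℤ) (c : K) (m : ℤ) :
    (monomial a c : BaseRing K κ).coeff m = if m = a then c else 0 := by
  change (Pi.single a c : ℤ → K) m = _
  simp [Pi.single_apply]

theorem coeff_one (m : ℤ) : (1 : BaseRing K κ).coeff m = if m = 0 then 1 else 0 :=
  coeff_monomial 0 1 m

instance : SMul K (BaseRing K κ) :=
  ⟨fun c f => ⟨fun i => c * f.coeff i, by
    obtain ⟨ε, h0, h1, h⟩ := f.conv
    refine ⟨ε, h0, h1, fun ρ hρ => ?_⟩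
    have := (h ρ hρ).const_mul ‖c‖
    rw [mul_zero] at this
    refine this.congr fun i => ?_
    rw [norm_mul, mul_assoc]⟩⟩

theorem coeff_smul (c : K) (f : BaseRing K κ) (m : ℤ) : (c • f).coeff m = c * f.coeff m := rfl

variable [IsUltrametricDist K] [CompleteSpace K]

theorem coeff_sub (f g : BaseRing K κ) (m : ℤ) : (f - g).coeff m = f.coeff m - g.coeff m := by
  rw [sub_eq_add_neg, coeff_add, coeff_neg, sub_eq_add_neg]

theorem coeff_monomial_mul (a : ℤ) (c : K) (f : BaseRing K κ) (m : ℤ) :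
    (monomial a c * f).coeff m = c * f.coeff (m - a) := by
  rw [coeff_mul, tsum_eq_single a]
  · simp [coeff_monomial]
  · intro i hi
    simp [coeff_monomial, hi]

instance : Module K (BaseRing K κ) where
  one_smul f := by ext m; simp [coeff_smul]
  mul_smul a b f := by ext m; simp [coeff_smul, mul_assoc]
  smul_zero a := by ext m; simp [coeff_smul, coeff_zero]
  smul_add a f g := by ext m; simp [coeff_smul, coeff_add, mul_add]
  add_smul a b f := by ext m; simp [coeff_smul, coeff_add, add_mul]
  zero_smul f := by ext m; simp [coeff_smul, coeff_zero]

instance : Algebra K (BaseRing K κ) :=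
  Algebra.ofModule
    (fun c f g => by
      ext m
      simp only [coeff_smul, coeff_mul, mul_assoc, tsum_mul_left])
    (fun c f g => by
      ext m
      simp only [coeff_smul, coeff_mul, mul_left_comm _ c, tsum_mul_left])

theorem monomial_mul_eq_smul (a : ℤ) (c : K) (f : BaseRing K κ) :
    monomial a c * f = c • (monomial a 1 * f) := by
  ext m
  simp [coeff_monomial_mul, coeff_smul]

theorem monomial_zero_mul (c : K) (f : BaseRing K κ) : monomial 0 c * f = c • f := by
  ext m
  simp [coeff_monomial_mul, coeff_smul]

theorem monomial_mul_monomial (a b : ℤ) (c d : K) :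
    (monomial a c * monomial b d : BaseRing K κ) = monomial (a + b) (c * d) := by
  ext m
  simp only [coeff_monomial_mul, coeff_monomial]
  by_cases h : m = a + b
  · simp [h]
  · rw [if_neg h, if_neg (by omega), mul_zero]

theorem coeff_sigma (q : UnitGroup K) (f : BaseRing K κ) (m : ℤ) :
    (sigma q f).coeff m = (q : K) ^ m * f.coeff m := rfl

theorem sigma_smul (q : UnitGroup K) (c : K) (f : BaseRing K κ) :
    sigma q (c • f) = c • sigma q f := by
  ext m
  simp only [coeff_sigma, coeff_smul]
  ring

theorem sigma_monomial (q : UnitGroup K) (a : ℤ) (c : K) :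
    sigma q (monomial a c : BaseRing K κ) = monomial a ((q : K) ^ a * c) := by
  ext m
  simp only [coeff_sigma, coeff_monomial]
  split_ifs with h
  · rw [h]
  · simp

theorem sigma_sigma (q q' : UnitGroup K) (f : BaseRing K κ) :
    sigma q (sigma q' f) = sigma (q * q') f := by
  ext m
  simp only [coeff_sigma, Metric.unitSphere.coe_mul, mul_zpow]
  ring

theorem sigma_one (f : BaseRing K κ) : sigma (1 : UnitGroup K) f = f := by
  ext m
  simp [coeff_sigma]

theorem coeff_theta (f : BaseRing K κ) (m : ℤ) : (theta f).coeff m = m * f.coeff m := rfl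

theorem theta_add (f g : BaseRing K κ) : theta (f + g) = theta f + theta g := by
  ext m
  simp [coeff_theta, coeff_add, mul_add]

theorem theta_smul (c : K) (f : BaseRing K κ) : theta (c • f) = c • theta f := by
  ext m
  simp only [coeff_theta, coeff_smul]
  ring

/-- `δ₁ = T d/dT` as a linear map. -/
def thetaHom : BaseRing K κ →ₗ[K] BaseRing K κ where
  toFun := theta
  map_add' := theta_add
  map_smul' := theta_smul

theorem theta_sum {ι : Type*} (s : Finset ι) (f : ι → BaseRing K κ) :
    theta (∑ i ∈ s, f i) = ∑ i ∈ s, theta (f i) := map_sum thetaHom f s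

theorem theta_zero : theta (0 : BaseRing K κ) = 0 := map_zero thetaHom

theorem theta_nsmul (n : ℕ) (f : BaseRing K κ) : theta (n • f) = n • theta f :=
  map_nsmul thetaHom n f

theorem theta_one : theta (1 : BaseRing K κ) = 0 := by
  ext m
  simp only [coeff_theta, coeff_one, coeff_zero]
  split_ifs with h <;> simp [h]

/-- Coefficientwise this is `n = i + (n - i)`; the auxiliary radii serve only to sum the two
resulting series separately. -/
theorem theta_mul (f g : BaseRing K κ) : theta (f * g) = theta f * g + f * theta g := by
  ext n
  obtain ⟨ρ, hρ, hf, hg, -⟩ := exists_null₃ f g 0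
  obtain ⟨ρ', hρ', hf', hg', -⟩ := exists_null₃ (theta f) g 0
  obtain ⟨ρ₂, hρ₂, hf₂, hg₂, -⟩ := exists_null₃ f (theta g) 0
  rw [coeff_theta, coeff_add, coeff_mul, coeff_mul, coeff_mul, ← tsum_mul_left,
    ← (summable_conv hρ' hf' hg' n).tsum_add (summable_conv hρ₂ hf₂ hg₂ n)]
  refine tsum_congr fun i => ?_
  rw [coeff_theta, coeff_theta]
  push_cast
  ring

/-! ### Convergence and Gauss bounds at a radius -/

/-- The Laurent series `f` converges on the circle of radius `ρ`. -/
def ConvAt (ρ : ℝ) (f : BaseRing K κ) : Prop :=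
  Tendsto (fun i : ℤ => ‖f.coeff i‖ * ρ ^ i) cofinite (𝓝 0)

/-- The Gauss norm of `f` at `ρ` is at most `C`. -/
def GaussLE (ρ C : ℝ) (f : BaseRing K κ) : Prop := ∀ m : ℤ, ‖f.coeff m‖ * ρ ^ m ≤ C

variable {ρ : ℝ} {f g : BaseRing K κ}

theorem ConvAt.exists_gaussLE (h : ConvAt ρ f) : ∃ C, 0 ≤ C ∧ GaussLE ρ C f := by
  have hfin : {i : ℤ | ¬ ‖f.coeff i‖ * ρ ^ i < 1}.Finite :=
    h.eventually_lt_const one_pos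
  obtain ⟨C, hC⟩ := (hfin.image fun i => ‖f.coeff i‖ * ρ ^ i).bddAbove
  refine ⟨max C 1, by positivity, fun m => ?_⟩
  by_cases hm : ‖f.coeff m‖ * ρ ^ m < 1
  · exact hm.le.trans (le_max_right _ _)
  · exact (hC ⟨m, hm, rfl⟩).trans (le_max_left _ _)

theorem GaussLE.mono {C D : ℝ} (h : GaussLE ρ C f) (hCD : C ≤ D) : GaussLE ρ D f :=
  fun m => (h m).trans hCD

theorem GaussLE.nonneg {C : ℝ} (h : GaussLE ρ C f) : 0 ≤ C := by
  have := h 0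
  simp only [zpow_zero, mul_one] at this
  exact (norm_nonneg _).trans this

theorem convAt_zero : ConvAt ρ (0 : BaseRing K κ) := by
  simp only [ConvAt, coeff_zero, norm_zero, zero_mul]
  exact tendsto_const_nhds

theorem convAt_monomial (a : ℤ) (c : K) : ConvAt ρ (monomial a c : BaseRing K κ) :=
  null_single a c ρ

theorem convAt_one : ConvAt ρ (1 : BaseRing K κ) := convAt_monomial 0 1

theorem ConvAt.add (hρ : 0 < ρ) (hf : ConvAt ρ f) (hg : ConvAt ρ g) : ConvAt ρ (f + g) :=
  null_add hρ hf hg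

theorem ConvAt.smul (c : K) (hf : ConvAt ρ f) : ConvAt ρ (c • f) := by
  have := Tendsto.const_mul ‖c‖ hf
  rw [mul_zero] at this
  refine this.congr fun i => ?_
  rw [coeff_smul, norm_mul, mul_assoc]

theorem ConvAt.nsmul (n : ℕ) (hf : ConvAt ρ f) : ConvAt ρ (n • f) := by
  rw [← Nat.cast_smul_eq_nsmul K]
  exact hf.smul _

theorem ConvAt.neg (hf : ConvAt ρ f) : ConvAt ρ (-f) := by
  simpa using hf.smul (-1)

theorem ConvAt.sub (hρ : 0 < ρ) (hf : ConvAt ρ f) (hg : ConvAt ρ g) : ConvAt ρ (f - g) := by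
  rw [sub_eq_add_neg]
  exact hf.add hρ hg.neg

theorem ConvAt.mul (hρ : 0 < ρ) (hf : ConvAt ρ f) (hg : ConvAt ρ g) : ConvAt ρ (f * g) :=
  null_conv hρ hf hg

theorem ConvAt.sum {ι : Type*} {s : Finset ι} {F : ι → BaseRing K κ} (hρ : 0 < ρ)
    (h : ∀ i ∈ s, ConvAt ρ (F i)) : ConvAt ρ (∑ i ∈ s, F i) :=
  Finset.sum_induction F (ConvAt ρ) (fun _ _ ha hb => ha.add hρ hb) convAt_zero h

theorem ConvAt.theta (hρ : 0 < ρ) (hf : ConvAt ρ f) : ConvAt ρ (theta f) :=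
  null_of_le hρ (fun i => by
    rw [coeff_theta, norm_mul]
    exact mul_le_of_le_one_left (norm_nonneg _) (IsUltrametricDist.norm_intCast_le_one K i)) hf

theorem ConvAt.sigma (q : UnitGroup K) (hf : ConvAt ρ f) : ConvAt ρ (sigma q f) := by
  refine Tendsto.congr (fun i => ?_) hf
  rw [coeff_sigma, norm_mul, norm_coe_zpow, one_mul]

theorem GaussLE.add {C : ℝ} (hρ : 0 < ρ) (hf : GaussLE ρ C f) (hg : GaussLE ρ C g) :
    GaussLE ρ C (f + g) := by
  intro m
  have h0 := zpow_pos hρ m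
  rw [← le_div_iff₀ h0]
  rw [coeff_add]
  exact (IsUltrametricDist.norm_add_le_max _ _).trans
    (max_le ((le_div_iff₀ h0).2 (hf m)) ((le_div_iff₀ h0).2 (hg m)))

theorem GaussLE.smul {C : ℝ} (c : K) (hf : GaussLE ρ C f) : GaussLE ρ (‖c‖ * C) (c • f) := by
  intro m
  rw [coeff_smul, norm_mul, mul_assoc]
  exact mul_le_mul_of_nonneg_left (hf m) (norm_nonneg _)

theorem GaussLE.neg {C : ℝ} (hf : GaussLE ρ C f) : GaussLE ρ C (-f) := by
  intro m
  rw [coeff_neg, norm_neg]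
  exact hf m

theorem GaussLE.sub {C : ℝ} (hρ : 0 < ρ) (hf : GaussLE ρ C f) (hg : GaussLE ρ C g) :
    GaussLE ρ C (f - g) := by
  rw [sub_eq_add_neg]
  exact hf.add hρ hg.neg

theorem GaussLE.mul {C D : ℝ} (hρ : 0 < ρ) (hf : GaussLE ρ C f) (hg : GaussLE ρ D g) :
    GaussLE ρ (C * D) (f * g) := by
  intro m
  have h0 := zpow_pos hρ m
  rw [← le_div_iff₀ h0, coeff_mul]
  refine IsUltrametricDist.norm_tsum_le_of_forall_le fun i => ?_
  rw [le_div_iff₀ h0, norm_mul]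
  calc ‖f.coeff i‖ * ‖g.coeff (m - i)‖ * ρ ^ m
      = (‖f.coeff i‖ * ρ ^ i) * (‖g.coeff (m - i)‖ * ρ ^ (m - i)) := by
        rw [zpow_sub₀ hρ.ne']
        have := zpow_pos hρ i
        field_simp
    _ ≤ C * D := mul_le_mul (hf i) (hg _) (by positivity) hf.nonneg

theorem gaussLE_zero {C : ℝ} (hC : 0 ≤ C) : GaussLE ρ C (0 : BaseRing K κ) := by
  intro m
  simpa [coeff_zero] using hC

theorem GaussLE.sum {ι : Type*} {s : Finset ι} {F : ι → BaseRing K κ} {C : ℝ} (hρ : 0 < ρ)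
    (hC : 0 ≤ C) (h : ∀ i ∈ s, GaussLE ρ C (F i)) : GaussLE ρ C (∑ i ∈ s, F i) :=
  Finset.sum_induction F (GaussLE ρ C) (fun _ _ ha hb => ha.add hρ hb) (gaussLE_zero hC) h

theorem gaussLE_monomial (hρ : 0 < ρ) (a : ℤ) (c : K) :
    GaussLE ρ (‖c‖ * ρ ^ a) (monomial a c : BaseRing K κ) := by
  intro m
  rw [coeff_monomial]
  split_ifs with h
  · rw [h]
  · simp only [norm_zero, zero_mul]
    positivity

theorem gaussLE_monomial_mul {C : ℝ} (hρ : 0 < ρ) (a : ℤ) (hf : GaussLE ρ C f) :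
    GaussLE ρ (ρ ^ a * C) (monomial a 1 * f) := by
  simpa using (gaussLE_monomial (κ := κ) hρ a (1 : K)).mul hρ hf

theorem GaussLE.theta {C : ℝ} (hρ : 0 < ρ) (hf : GaussLE ρ C f) : GaussLE ρ C (theta f) := by
  intro m
  refine le_trans ?_ (hf m)
  refine mul_le_mul_of_nonneg_right ?_ (zpow_nonneg hρ.le m)
  rw [coeff_theta, norm_mul]
  exact mul_le_of_le_one_left (norm_nonneg _) (IsUltrametricDist.norm_intCast_le_one K m)

theorem GaussLE.sigma {C : ℝ} (q : UnitGroup K) (hf : GaussLE ρ C f) :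
    GaussLE ρ C (sigma q f) := by
  intro m
  rw [coeff_sigma, norm_mul, norm_coe_zpow, one_mul]
  exact hf m

theorem gaussLE_one (hρ : 0 < ρ) : GaussLE ρ 1 (1 : BaseRing K κ) := by
  have h := gaussLE_monomial (κ := κ) hρ 0 (1 : K)
  rw [norm_one, zpow_zero, one_mul] at h
  exact h

/-- Any finite family of elements of the base ring converges on a common annulus. -/
theorem exists_convAt_finite {ι : Type*} [Finite ι] (F : ι → BaseRing K κ) :
    ∃ ε : ℝ, 0 < ε ∧ ε < 1 ∧ ∀ ρ ∈ annulus κ ε, ∀ i, ConvAt ρ (F i) := by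
  choose e h0 h1 h using fun i => (F i).conv
  cases nonempty_fintype ι
  rcases isEmpty_or_nonempty ι with hι | hι
  · exact ⟨1 / 2, by norm_num, by norm_num, fun ρ _ i => hι.elim i⟩
  · obtain ⟨i₀, hi₀⟩ := Finite.exists_min e
    exact ⟨e i₀, h0 _, h1 _, fun ρ hρ i => h i ρ (annulus_mono κ (hi₀ i) hρ)⟩

end Basic

end BaseRing

/-! ## Ultrametric double series and bounded power series -/

section DoubleSeries

variable {L : Type*} [NormedField L] {α β : Type*}

/-- Only finitely many rows have `c a ≥ e`, and in each of them only finitely many entries reach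
`e`. Supplies the hypothesis of `hasSum_swap`. -/
theorem tendsto_norm_uncurry {F : α → β → L} {c : α → ℝ} (hc : Tendsto c cofinite (𝓝 0))
    (h1 : ∀ a, Tendsto (fun b => ‖F a b‖) cofinite (𝓝 0)) (h2 : ∀ a b, ‖F a b‖ ≤ c a) :
    Tendsto (fun p : α × β => ‖F p.1 p.2‖) cofinite (𝓝 0) := by
  rw [Metric.tendsto_nhds]
  intro e he
  have hfa : {a | ¬ c a < e}.Finite := hc.eventually_lt_const he
  have hfb : ∀ a, {b | ¬ ‖F a b‖ < e}.Finite := fun a => (h1 a).eventually_lt_const he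
  have hfin : (⋃ a ∈ {a | ¬ c a < e}, (fun b => (a, b)) '' {b | ¬ ‖F a b‖ < e}).Finite :=
    hfa.biUnion fun a _ => (hfb a).image _
  refine hfin.subset ?_
  rintro ⟨a, b⟩ hab
  have hab' : ¬ ‖F a b‖ < e := by
    intro hlt
    apply hab
    simpa using hlt
  simp only [Set.mem_iUnion]
  exact ⟨a, fun h => hab' ((h2 a b).trans_lt h), b, hab', rfl⟩

variable [IsUltrametricDist L] [CompleteSpace L]

theorem summable_of_norm_null {F : α → L} (h : Tendsto (fun a => ‖F a‖) cofinite (𝓝 0)) :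
    Summable F :=
  NonarchimedeanAddGroup.summable_of_tendsto_cofinite_zero
    (tendsto_zero_iff_norm_tendsto_zero.2 h)

theorem norm_le_of_hasSum {F : α → L} {s : L} {C : ℝ} (hC : 0 ≤ C) (h : HasSum F s)
    (hF : ∀ a, ‖F a‖ ≤ C) : ‖s‖ ≤ C := by
  rw [← h.tsum_eq]
  exact IsUltrametricDist.norm_tsum_le_of_forall_le_of_nonneg hC hF

/-- In a complete ultrametric field a family is summable as soon as it is null, so a null double
series may be summed in either order. All interchanges of re-expansions and Newton series below go
through this lemma. -/
theorem hasSum_swap {F : α → β → L} (hF : Tendsto (fun p : α × β => ‖F p.1 p.2‖) cofinite (𝓝 0))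
    {g : α → L} {h : β → L} {s : L} (hg : ∀ a, HasSum (F a) (g a)) (hs : HasSum g s)
    (hh : ∀ b, HasSum (fun a => F a b) (h b)) : HasSum h s := by
  have hsum : Summable fun p : α × β => F p.1 p.2 := summable_of_norm_null hF
  have h1 := hsum.hasSum.prod_fiberwise hg
  have h2 : HasSum (fun p : β × α => F p.2 p.1) (∑' p : α × β, F p.1 p.2) :=
    (Equiv.prodComm β α).hasSum_iff.2 hsum.hasSum
  rw [hs.unique h1]
  exact h2.prod_fiberwise hh

end DoubleSeries

/-! ### Power series with geometrically bounded coefficients and their values on an open disk. -/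

section PowerSeries

open PowerSeries

variable {L : Type*} [NormedField L]

/-- The coefficients of `f` satisfy `|a_k| s^k ≤ C` for some constant `C`. -/
def PB (s : ℝ) (f : L⟦X⟧) : Prop := ∃ C : ℝ, ∀ k, ‖coeff k f‖ * s ^ k ≤ C

/-- The value of a power series at `u`. -/
def ev (u : L) (f : L⟦X⟧) : L := ∑' k, coeff k f * u ^ k

variable {s : ℝ} {f g : L⟦X⟧} {u : L}

theorem PB.exists_nonneg (h : PB s f) : ∃ C : ℝ, 0 ≤ C ∧ ∀ k, ‖coeff k f‖ * s ^ k ≤ C := by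
  obtain ⟨C, hC⟩ := h
  exact ⟨C, (by simpa using (mul_nonneg (norm_nonneg _) (by simp)).trans (hC 0)), hC⟩

theorem PB.mono {s' : ℝ} (h : PB s f) (h0 : 0 ≤ s') (hs : s' ≤ s) : PB s' f := by
  obtain ⟨C, hC⟩ := h
  exact ⟨C, fun k => (mul_le_mul_of_nonneg_left (pow_le_pow_left₀ h0 hs k) (norm_nonneg _)).trans
    (hC k)⟩

/-- A bound at `s` gives convergence only strictly inside; this is why many proofs below insert an
intermediate radius. -/
theorem PB.null (h : PB s f) {x : ℝ} (h0 : 0 ≤ x) (hx : x < s) :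
    Tendsto (fun k => ‖coeff k f‖ * x ^ k) atTop (𝓝 0) := by
  obtain ⟨C, hC0, hC⟩ := h.exists_nonneg
  have hs : 0 < s := h0.trans_lt hx
  have h1 := (tendsto_pow_atTop_nhds_zero_of_lt_one (div_nonneg h0 hs.le)
    ((div_lt_one hs).2 hx)).const_mul C
  rw [mul_zero] at h1
  refine squeeze_zero (fun k => by positivity) (fun k => ?_) h1
  have : ‖coeff k f‖ * x ^ k = (‖coeff k f‖ * s ^ k) * (x / s) ^ k := by
    rw [div_pow]
    field_simp
  rw [this]
  exact mul_le_mul_of_nonneg_right (hC k) (by positivity)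

theorem PB.null_term (h : PB s f) (hu : ‖u‖ < s) :
    Tendsto (fun k => ‖coeff k f * u ^ k‖) cofinite (𝓝 0) := by
  rw [Nat.cofinite_eq_atTop]
  refine (h.null (norm_nonneg u) hu).congr fun k => ?_
  rw [norm_mul, norm_pow]

variable [IsUltrametricDist L]

theorem PB.add (hf : PB s f) (hg : PB s g) (hs : 0 < s) : PB s (f + g) := by
  obtain ⟨C, hC⟩ := hf
  obtain ⟨D, hD⟩ := hg
  refine ⟨max C D, fun k => ?_⟩
  have h0 := pow_pos hs k
  rw [← le_div_iff₀ h0, map_add]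
  exact (IsUltrametricDist.norm_add_le_max _ _).trans
    (max_le ((le_div_iff₀ h0).2 ((hC k).trans (le_max_left _ _)))
      ((le_div_iff₀ h0).2 ((hD k).trans (le_max_right _ _))))

theorem PB.mul (hf : PB s f) (hg : PB s g) (hs : 0 < s) : PB s (f * g) := by
  obtain ⟨C, hC0, hC⟩ := hf.exists_nonneg
  obtain ⟨D, hD0, hD⟩ := hg.exists_nonneg
  refine ⟨C * D, fun k => ?_⟩
  have h0 := pow_pos hs k
  rw [← le_div_iff₀ h0, coeff_mul]
  refine IsUltrametricDist.norm_sum_le_of_forall_le_of_nonneg (by positivity) fun p hp => ?_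
  rw [le_div_iff₀ h0, norm_mul, ← Finset.HasAntidiagonal.mem_antidiagonal.1 hp, pow_add]
  calc ‖coeff p.1 f‖ * ‖coeff p.2 g‖ * (s ^ p.1 * s ^ p.2)
      = (‖coeff p.1 f‖ * s ^ p.1) * (‖coeff p.2 g‖ * s ^ p.2) := by ring
    _ ≤ C * D := mul_le_mul (hC _) (hD _) (by positivity) hC0

theorem PB_zero : PB s (0 : L⟦X⟧) := ⟨0, fun k => by simp⟩

theorem PB_C (a : L) : PB s (C a : L⟦X⟧) := by
  refine ⟨‖a‖, fun k => ?_⟩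
  rw [coeff_C]
  split_ifs with h
  · simp [h]
  · simp

theorem PB_X : PB s (X : L⟦X⟧) := by
  refine ⟨max s 0, fun k => ?_⟩
  rw [coeff_X]
  split_ifs with h
  · simp [h]
  · simp

theorem PB_one : PB s (1 : L⟦X⟧) := by
  simpa using PB_C (s := s) (1 : L)

theorem PB.sum {ι : Type*} {t : Finset ι} {F : ι → L⟦X⟧} (hs : 0 < s) (h : ∀ i ∈ t, PB s (F i)) :
    PB s (∑ i ∈ t, F i) :=
  Finset.sum_induction F (PB s) (fun _ _ ha hb => ha.add hb hs) PB_zero h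

theorem PB.neg (hf : PB s f) : PB s (-f) := by
  obtain ⟨C, hC⟩ := hf
  exact ⟨C, fun k => by simpa using hC k⟩

theorem PB.sub (hf : PB s f) (hg : PB s g) (hs : 0 < s) : PB s (f - g) := by
  rw [sub_eq_add_neg]
  exact hf.add hg.neg hs

theorem PB.derivative (hf : PB s f) (hs : 0 < s) : PB s (d⁄dX L f) := by
  obtain ⟨C, hC⟩ := hf
  refine ⟨C / s, fun k => ?_⟩
  rw [coeff_derivative, le_div_iff₀ hs]
  refine le_trans ?_ (hC (k + 1))
  rw [norm_mul, pow_succ, mul_assoc, mul_assoc]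
  refine mul_le_mul_of_nonneg_left ?_ (norm_nonneg _)
  refine mul_le_of_le_one_left (by positivity) ?_
  exact_mod_cast IsUltrametricDist.norm_natCast_le_one L (k + 1)

variable [CompleteSpace L]

theorem PB.hasSum (h : PB s f) (hu : ‖u‖ < s) : HasSum (fun k => coeff k f * u ^ k) (ev u f) :=
  (summable_of_norm_null (h.null_term hu)).hasSum

theorem ev_eq_of_hasSum {a : L} (h : HasSum (fun k => coeff k f * u ^ k) a) : ev u f = a :=
  h.tsum_eq

theorem ev_add (hf : PB s f) (hg : PB s g) (hu : ‖u‖ < s) : ev u (f + g) = ev u f + ev u g := by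
  refine ev_eq_of_hasSum (((hf.hasSum hu).add (hg.hasSum hu)).congr_fun fun k => ?_)
  rw [map_add, add_mul]

theorem ev_neg (f : L⟦X⟧) : ev u (-f) = -ev u f := by
  simp only [ev, map_neg, neg_mul, tsum_neg]

theorem ev_sub (hf : PB s f) (hg : PB s g) (hu : ‖u‖ < s) : ev u (f - g) = ev u f - ev u g := by
  rw [sub_eq_add_neg, ev_add hf hg.neg hu, ev_neg, sub_eq_add_neg]

theorem ev_C (a : L) : ev u (C a : L⟦X⟧) = a := by
  rw [ev, tsum_eq_single 0]
  · simp
  · intro k hk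
    simp [coeff_C, hk]

theorem ev_one : ev u (1 : L⟦X⟧) = 1 := by
  simpa using ev_C (u := u) (1 : L)

theorem ev_zero : ev u (0 : L⟦X⟧) = 0 := by simp [ev]

theorem ev_X : ev u (X : L⟦X⟧) = u := by
  rw [ev, tsum_eq_single 1]
  · simp
  · intro k hk
    simp [coeff_X, hk]

theorem ev_at_zero (f : L⟦X⟧) : ev 0 f = coeff 0 f := by
  rw [ev, tsum_eq_single 0]
  · simp
  · intro k hk
    simp [hk]

theorem ev_mul (hf : PB s f) (hg : PB s g) (hu : ‖u‖ < s) : ev u (f * g) = ev u f * ev u g := by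
  have h2 : Tendsto (fun p : ℕ × ℕ => ‖(coeff p.1 f * u ^ p.1) * (coeff p.2 g * u ^ p.2)‖)
      cofinite (𝓝 0) := by
    simp only [norm_mul _ (coeff _ g * _)]
    exact tendsto_mul_cofinite_nhds_zero (hf.null_term hu) (hg.null_term hu)
  have h3 := Summable.tsum_mul_tsum_eq_tsum_sum_antidiagonal (hf.hasSum hu).summable
    (hg.hasSum hu).summable (summable_of_norm_null h2)
  rw [ev, ev, ev, h3]
  refine tsum_congr fun k => ?_
  rw [coeff_mul, Finset.sum_mul]
  refine Finset.sum_congr rfl fun p hp => ?_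
  rw [← Finset.HasAntidiagonal.mem_antidiagonal.1 hp, pow_add]
  ring

theorem ev_sum {ι : Type*} {t : Finset ι} {F : ι → L⟦X⟧} (hs : 0 < s) (h : ∀ i ∈ t, PB s (F i))
    (hu : ‖u‖ < s) : ev u (∑ i ∈ t, F i) = ∑ i ∈ t, ev u (F i) := by
  classical
  induction t using Finset.induction_on with
  | empty => simp [ev_zero]
  | insert a t ha ih =>
    rw [Finset.sum_insert ha, Finset.sum_insert ha, ev_add (h a (by simp))
      (PB.sum hs fun i hi => h i (by simp [hi])) hu, ih fun i hi => h i (by simp [hi])]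

/-- Re-expansion of a bounded power series along `v ↦ u + l v`. -/
theorem PB.reexpand (hf : PB s f) (hu : ‖u‖ < s) {l : L} (hl : ‖l‖ ≤ 1) :
    ∃ g : L⟦X⟧, PB s g ∧
      (∀ j, HasSum (fun k => coeff k f * ((k.choose j : L) * u ^ (k - j) * l ^ j)) (coeff j g)) ∧
      ∀ v : L, ‖v‖ < s → ev v g = ev (u + l * v) f := by
  have hs : 0 < s := (norm_nonneg u).trans_lt hu
  obtain ⟨C, hC0, hC⟩ := hf.exists_nonneg
  -- Binomial coefficients have norm at most `1`. The estimate is used with `x = s` to bound the new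
  -- series and with `x < s` to sum it. For `k < j` the binomial coefficient vanishes, so the
  -- truncated subtraction `k - j` is harmless.
  have key : ∀ (x : ℝ), ‖u‖ ≤ x → ∀ k j : ℕ,
      ‖coeff k f * ((k.choose j : L) * u ^ (k - j) * l ^ j)‖ * x ^ j ≤ ‖coeff k f‖ * x ^ k := by
    intro x hx k j
    have hx0 : 0 ≤ x := (norm_nonneg u).trans hx
    rcases lt_or_ge k j with hkj | hkj
    · rw [Nat.choose_eq_zero_of_lt hkj]
      simp only [Nat.cast_zero, zero_mul, mul_zero, norm_zero]
      positivity
    · rw [norm_mul, mul_assoc]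
      refine mul_le_mul_of_nonneg_left ?_ (norm_nonneg _)
      rw [norm_mul, norm_mul, norm_pow, norm_pow]
      calc ‖(k.choose j : L)‖ * ‖u‖ ^ (k - j) * ‖l‖ ^ j * x ^ j
          ≤ 1 * x ^ (k - j) * 1 * x ^ j := by
            gcongr
            · exact IsUltrametricDist.norm_natCast_le_one L _
            · exact pow_le_one₀ (norm_nonneg _) hl
        _ = x ^ k := by
            rw [one_mul, mul_one, ← pow_add, Nat.sub_add_cancel hkj]
  have hsum : ∀ j, Summable fun k => coeff k f * ((k.choose j : L) * u ^ (k - j) * l ^ j) := by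
    intro j
    obtain ⟨x, hx1, hx2⟩ := exists_between hu
    have hx0 : 0 < x := (norm_nonneg u).trans_lt hx1
    refine summable_of_norm_null ?_
    rw [Nat.cofinite_eq_atTop]
    have h1 := (hf.null hx0.le hx2).mul_const (x ^ j)⁻¹
    rw [zero_mul] at h1
    refine squeeze_zero (fun k => norm_nonneg _) (fun k => ?_) h1
    rw [← div_eq_mul_inv, le_div_iff₀ (by positivity)]
    exact key x hx1.le k j
  refine ⟨PowerSeries.mk fun j => ∑' k, coeff k f * ((k.choose j : L) * u ^ (k - j) * l ^ j),
    ⟨C, fun j => ?_⟩, fun j => by rw [coeff_mk]; exact (hsum j).hasSum, fun v hv => ?_⟩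
  · rw [coeff_mk, ← le_div_iff₀ (by positivity)]
    refine norm_le_of_hasSum (by positivity) (hsum j).hasSum fun k => ?_
    rw [le_div_iff₀ (by positivity)]
    exact (key s hu.le k j).trans (hC k)
  · have hlv : ‖u + l * v‖ < s := by
      refine (IsUltrametricDist.norm_add_le_max _ _).trans_lt (max_lt hu ?_)
      rw [norm_mul]
      exact (mul_le_of_le_one_left (norm_nonneg _) hl).trans_lt hv
    refine ev_eq_of_hasSum (hasSum_swap (L := L)
      (F := fun k j => coeff k f * ((k.choose j : L) * u ^ (k - j) * l ^ j) * v ^ j)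
      ?_ (fun k => ?_) (hf.hasSum hlv) fun j => ?_)
    · obtain ⟨x, hx1, hx2⟩ := exists_between (max_lt hu hv)
      have hx0 : 0 < x := (norm_nonneg u).trans_lt ((le_max_left _ _).trans_lt hx1)
      refine tendsto_norm_uncurry (L := L)
        (F := fun k j => coeff k f * ((k.choose j : L) * u ^ (k - j) * l ^ j) * v ^ j)
        (c := fun k => ‖coeff k f‖ * x ^ k) ?_ (fun k => ?_)
        fun k j => ?_
      · rw [Nat.cofinite_eq_atTop]
        exact hf.null hx0.le hx2
      · refine tendsto_nhds_of_eventually_eq ?_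
        rw [Nat.cofinite_eq_atTop]
        filter_upwards [eventually_gt_atTop k] with j hj
        simp [Nat.choose_eq_zero_of_lt hj]
      · refine le_trans ?_ (key x ((le_max_left _ _).trans hx1.le) k j)
        rw [norm_mul, norm_pow]
        gcongr
        exact (le_max_right _ _).trans hx1.le
    · rw [add_comm u, add_pow, Finset.mul_sum]
      have : ∀ j ∈ Finset.range (k + 1), coeff k f * ((l * v) ^ j * u ^ (k - j) * (k.choose j : L))
          = coeff k f * ((k.choose j : L) * u ^ (k - j) * l ^ j) * v ^ j := by
        intro j _
        rw [mul_pow]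
        ring
      rw [Finset.sum_congr rfl this]
      refine hasSum_sum_of_ne_finset_zero fun j hj => ?_
      have : k < j := by simpa using hj
      simp [Nat.choose_eq_zero_of_lt this]
    · rw [coeff_mk]
      exact (hsum j).hasSum.mul_right _

end PowerSeries

/-! ### Differentiation of bounded power series and the identity principle. -/

section Derivative

open PowerSeries

variable {L : Type*} [NontriviallyNormedField L] [IsUltrametricDist L] [CompleteSpace L]
  {s : ℝ} {f g : L⟦X⟧} {u : L}

/-- After recentring at `u`, the linear coefficient is the value of the formal derivative, and the
terms of order at least `2` are bounded by `(C / s^2) |v|^2`. -/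
theorem PB.hasDerivAt (hf : PB s f) (hu : ‖u‖ < s) :
    HasDerivAt (fun z => ev z f) (ev u (d⁄dX L f)) u := by
  have hs : 0 < s := (norm_nonneg u).trans_lt hu
  obtain ⟨g, ⟨C, hC⟩, hg, hev⟩ := hf.reexpand hu (l := 1) (by simp)
  have h1 : coeff 1 g = ev u (d⁄dX L f) := by
    refine (ev_eq_of_hasSum ?_).symm
    have h2 := hg 1
    rw [← hasSum_nat_add_iff' 1] at h2
    simp only [Finset.range_one, Finset.sum_singleton, Nat.choose_one_right, Nat.cast_zero,
      zero_mul, mul_zero, sub_zero, one_pow, mul_one, Nat.add_sub_cancel] at h2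
    refine h2.congr_fun fun k => ?_
    rw [coeff_derivative]
    push_cast
    ring
  have h0 : coeff 0 g = ev u f := by
    have := hev 0 (by simpa using hs)
    rwa [ev_at_zero, mul_zero, add_zero] at this
  rw [hasDerivAt_iff_isLittleO_nhds_zero]
  refine Asymptotics.IsBigO.trans_isLittleO (g := fun h : L => h ^ 2) ?_
    (Asymptotics.isLittleO_pow_id one_lt_two)
  refine Asymptotics.IsBigO.of_bound (C / s ^ 2) ?_
  filter_upwards [Metric.ball_mem_nhds (0 : L) hs] with v hv
  have hv' : ‖v‖ < s := by simpa using hv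
  have hC0 : 0 ≤ C := (mul_nonneg (norm_nonneg _) (by simp)).trans (hC 0)
  have h2 : HasSum (fun k => coeff k g * v ^ k) (ev v g) := PB.hasSum ⟨C, hC⟩ hv'
  rw [← hasSum_nat_add_iff' 2] at h2
  have h3 : ev v g - ∑ i ∈ Finset.range 2, coeff i g * v ^ i =
      ev (u + v) f - ev u f - v • ev u (d⁄dX L f) := by
    rw [hev v hv', Finset.sum_range_succ, Finset.sum_range_one, h0, h1, smul_eq_mul]
    ring_nf
  rw [h3] at h2
  refine norm_le_of_hasSum (by positivity) h2 fun k => ?_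
  rw [norm_mul, norm_pow, norm_pow, pow_add, ← mul_assoc]
  refine mul_le_mul_of_nonneg_right ?_ (by positivity)
  rw [le_div_iff₀ (by positivity)]
  refine le_trans ?_ (hC (k + 2))
  rw [pow_add s, ← mul_assoc]
  gcongr

theorem PB.continuousAt (hf : PB s f) (hu : ‖u‖ < s) : ContinuousAt (fun z => ev z f) u :=
  (hf.hasDerivAt hu).continuousAt

theorem eventually_norm_lt (hs : 0 < s) : ∀ᶠ z in 𝓝[≠] (0 : L), ‖z‖ < s := by
  refine Filter.Eventually.filter_mono nhdsWithin_le_nhds ?_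
  filter_upwards [Metric.ball_mem_nhds (0 : L) hs] with z hz
  simpa using hz

/-- Identity principle: a bounded power series with zeros accumulating at `0` vanishes. -/
theorem PB.eq_zero (hf : PB s f) (hs : 0 < s) (h : ∃ᶠ z in 𝓝[≠] (0 : L), ev z f = 0) : f = 0 := by
  by_contra hne
  have hex : ∃ n, coeff n f ≠ 0 := by
    by_contra! hcon
    exact hne (PowerSeries.ext fun n => by simp [hcon n])
  classical
  obtain ⟨n, hn, hmin⟩ : ∃ n, coeff n f ≠ 0 ∧ ∀ m < n, coeff m f = 0 :=
    ⟨Nat.find hex, Nat.find_spec hex, fun m hm => by simpa using Nat.find_min hex hm⟩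
  -- Write `f = X^n g` with `g(0) ≠ 0`. By continuity `g` has no zero near `0`, so `f` has none near
  -- `0` except `0` itself.
  obtain ⟨g, hg⟩ := X_pow_dvd_iff.2 hmin
  have hcoeff : ∀ k, coeff k g = coeff (k + n) f := fun k => by rw [hg, coeff_X_pow_mul]
  have hgb : PB s g := by
    obtain ⟨C, hC⟩ := hf
    refine ⟨C / s ^ n, fun k => ?_⟩
    rw [le_div_iff₀ (by positivity), hcoeff, mul_assoc, ← pow_add]
    exact hC _
  have hXn : PB s ((X : L⟦X⟧) ^ n) := by
    induction n with
    | zero => simpa using PB_one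
    | succ n _ =>
      refine ⟨s ^ (n + 1), fun k => ?_⟩
      rw [coeff_X_pow]
      split_ifs with hk
      · simp [hk]
      · simp; positivity
  have hev : ∀ z : L, ‖z‖ < s → ev z f = z ^ n * ev z g := by
    intro z hz
    rw [hg, ev_mul hXn hgb hz]
    congr 1
    rw [ev, tsum_eq_single n]
    · simp
    · intro k hk
      simp [coeff_X_pow, hk]
  have hcont := hgb.continuousAt (u := 0) (by simpa using hs)
  have hne0 : ev (0 : L) g ≠ 0 := by
    rw [ev_at_zero, hcoeff, zero_add]
    exact hn
  have h1 : ∀ᶠ z in 𝓝[≠] (0 : L), ev z g ≠ 0 :=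
    (hcont.eventually_ne hne0).filter_mono nhdsWithin_le_nhds
  have h2 := eventually_norm_lt (L := L) hs
  obtain ⟨z, hz, hz1, hz2, hz3⟩ :=
    (h.and_eventually (h1.and (h2.and self_mem_nhdsWithin))).exists
  rw [hev z hz2] at hz
  exact (mul_ne_zero (pow_ne_zero n hz3) hz1) hz

theorem PB.ext_of_frequently (hf : PB s f) (hg : PB s g) (hs : 0 < s)
    (h : ∃ᶠ z in 𝓝[≠] (0 : L), ev z f = ev z g) : f = g := by
  refine sub_eq_zero.1 ((hf.sub hg hs).eq_zero hs ?_)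
  have h2 := eventually_norm_lt (L := L) hs
  refine (h.and_eventually h2).mono fun z hz => ?_
  rw [ev_sub hf hg hz.2, hz.1, sub_self]

end Derivative

namespace BaseRing

/-! ### Values of Laurent series at points of an extension field. -/

section Eval

variable {K : Type u} [NormedField K] [IsUltrametricDist K] [CompleteSpace K] {κ : BaseKind}
  {L : Type w} [NontriviallyNormedField L] [IsUltrametricDist L] [CompleteSpace L]
  [NormedAlgebra K L] {x : L} {f g : BaseRing K κ}

theorem norm_eval_term (f : BaseRing K κ) (x : L) (i : ℤ) :
    ‖algebraMap K L (f.coeff i) * x ^ i‖ = ‖f.coeff i‖ * ‖x‖ ^ i := by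
  rw [norm_mul, norm_algebraMap', norm_zpow]

theorem ConvAt.null_eval_term (hf : ConvAt ‖x‖ f) :
    Tendsto (fun i : ℤ => ‖algebraMap K L (f.coeff i) * x ^ i‖) cofinite (𝓝 0) := by
  simp only [norm_eval_term]
  exact hf

theorem ConvAt.hasSum_eval (hf : ConvAt ‖x‖ f) :
    HasSum (fun i : ℤ => algebraMap K L (f.coeff i) * x ^ i) (eval x f) :=
  (summable_of_norm_null hf.null_eval_term).hasSum

theorem eval_eq_of_hasSum {a : L} (h : HasSum (fun i : ℤ => algebraMap K L (f.coeff i) * x ^ i) a) :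
    eval x f = a := h.tsum_eq

theorem eval_zero : eval x (0 : BaseRing K κ) = 0 := by
  simp [eval, coeff_zero]

theorem eval_monomial (a : ℤ) (c : K) :
    eval x (monomial a c : BaseRing K κ) = algebraMap K L c * x ^ a := by
  rw [eval, tsum_eq_single a]
  · simp [coeff_monomial]
  · intro i hi
    simp [coeff_monomial, hi]

theorem eval_one : eval x (1 : BaseRing K κ) = 1 := by
  have := eval_monomial (κ := κ) (x := x) 0 (1 : K)
  rw [map_one, zpow_zero, one_mul] at this
  exact this

theorem eval_smul (c : K) (f : BaseRing K κ) : eval x (c • f) = algebraMap K L c * eval x f := by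
  simp only [eval, coeff_smul, map_mul, mul_assoc, tsum_mul_left]

theorem eval_neg (f : BaseRing K κ) : eval x (-f) = -eval x f := by
  simp only [eval, coeff_neg, map_neg, neg_mul, tsum_neg]

theorem eval_add (hf : ConvAt ‖x‖ f) (hg : ConvAt ‖x‖ g) :
    eval x (f + g) = eval x f + eval x g := by
  refine eval_eq_of_hasSum ((hf.hasSum_eval.add hg.hasSum_eval).congr_fun fun i => ?_)
  rw [coeff_add, map_add, add_mul]

theorem eval_sub (hf : ConvAt ‖x‖ f) (hg : ConvAt ‖x‖ g) :
    eval x (f - g) = eval x f - eval x g := by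
  rw [sub_eq_add_neg, eval_add hf hg.neg, eval_neg, sub_eq_add_neg]

theorem eval_sum (hx : 0 < ‖x‖) {ι : Type*} {s : Finset ι} {F : ι → BaseRing K κ}
    (h : ∀ i ∈ s, ConvAt ‖x‖ (F i)) : eval x (∑ i ∈ s, F i) = ∑ i ∈ s, eval x (F i) := by
  classical
  induction s using Finset.induction_on with
  | empty => simp [eval_zero]
  | insert a t ha ih =>
    rw [Finset.sum_insert ha, Finset.sum_insert ha, eval_add (h a (by simp))
      (ConvAt.sum hx fun i hi => h i (by simp [hi])), ih fun i hi => h i (by simp [hi])]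

theorem eval_mul (hx : 0 < ‖x‖) (hf : ConvAt ‖x‖ f) (hg : ConvAt ‖x‖ g) :
    eval x (f * g) = eval x f * eval x g := by
  have hx0 : x ≠ 0 := norm_pos_iff.1 hx
  have h2 : Tendsto (fun p : ℤ × ℤ => ‖(algebraMap K L (f.coeff p.1) * x ^ p.1) *
      (algebraMap K L (g.coeff p.2) * x ^ p.2)‖) cofinite (𝓝 0) := by
    simp only [norm_mul (algebraMap K L (f.coeff _) * _)]
    exact tendsto_mul_cofinite_nhds_zero hf.null_eval_term hg.null_eval_term
  have h3 := hf.hasSum_eval.mul hg.hasSum_eval (summable_of_norm_null h2)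
  -- The pair `(n, i)` corresponds to the pair of exponents `(i, n - i)`, so that summing over `i`
  -- first produces the coefficients of the product.
  let E : ℤ × ℤ ≃ ℤ × ℤ :=
    { toFun := fun p => (p.2, p.1 - p.2)
      invFun := fun p => (p.1 + p.2, p.1)
      left_inv := fun p => by simp
      right_inv := fun p => by simp }
  have h4 := E.hasSum_iff.2 h3
  refine eval_eq_of_hasSum (h4.prod_fiberwise fun n => ?_)
  have h5 := (summable_conv hx hf hg n).hasSum.map (algebraMap K L)
    (algebraMapCLM K L).continuous
  have h6 := h5.mul_right (x ^ n)
  refine h6.congr_fun fun i => ?_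
  simp only [E, Equiv.coe_fn_mk, Function.comp_apply, map_mul]
  rw [zpow_sub₀ hx0]
  field_simp

theorem GaussLE.norm_eval_le {C : ℝ} (hf : ConvAt ‖x‖ f) (h : GaussLE ‖x‖ C f) :
    ‖eval x f‖ ≤ C := by
  refine norm_le_of_hasSum h.nonneg hf.hasSum_eval fun i => ?_
  rw [norm_eval_term]
  exact h i

theorem eval_sigma (q : UnitGroup K) (f : BaseRing K κ) :
    eval x (sigma q f) = eval (algebraMap K L (q : K) * x) f := by
  refine tsum_congr fun i => ?_
  rw [coeff_sigma, map_mul, mul_zpow, map_zpow₀]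
  ring

theorem norm_algebraMap_mul (q : UnitGroup K) (x : L) :
    ‖algebraMap K L (q : K) * x‖ = ‖x‖ := by
  rw [norm_mul, norm_algebraMap']
  have h : ‖(q : K)‖ = 1 := by simp
  rw [h, one_mul]

end Eval

/-! ### Infinite sums of coefficients -/

section CoeffSum

variable {K : Type u} [NormedField K] [IsUltrametricDist K] [CompleteSpace K] {κ : BaseKind}

/-- `g` is the coefficientwise sum of the sequence `f`. -/
def IsCoeffSum (f : ℕ → BaseRing K κ) (g : BaseRing K κ) : Prop :=
  ∀ m : ℤ, HasSum (fun k => (f k).coeff m) (g.coeff m)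

/-- A sequence of Laurent series converging at `ρ` whose Gauss norms at `ρ` tend to `0`. -/
def NullFamily (ρ : ℝ) (f : ℕ → BaseRing K κ) : Prop :=
  (∀ k, ConvAt ρ (f k)) ∧ ∃ c : ℕ → ℝ, Tendsto c atTop (𝓝 0) ∧ ∀ k, GaussLE ρ (c k) (f k)

variable {ρ : ℝ} {f : ℕ → BaseRing K κ} {g : BaseRing K κ}

theorem IsCoeffSum.unique {g' : BaseRing K κ} (h : IsCoeffSum f g) (h' : IsCoeffSum f g') :
    g = g' := by
  ext m
  exact (h m).unique (h' m)

theorem NullFamily.summable_coeff (hρ : 0 < ρ) (h : NullFamily ρ f) (m : ℤ) :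
    Summable fun k => (f k).coeff m := by
  obtain ⟨-, c, hc, hG⟩ := h
  refine summable_of_norm_null ?_
  rw [Nat.cofinite_eq_atTop]
  have h1 := hc.div_const (ρ ^ m)
  rw [zero_div] at h1
  exact squeeze_zero (fun k => norm_nonneg _)
    (fun k => (le_div_iff₀ (zpow_pos hρ m)).2 (hG k m)) h1

theorem IsCoeffSum.gaussLE {C : ℝ} (hρ : 0 < ρ) (h : IsCoeffSum f g)
    (hf : ∀ k, GaussLE ρ C (f k)) : GaussLE ρ C g := by
  intro m
  have h0 := zpow_pos hρ m
  rw [← le_div_iff₀ h0]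
  exact norm_le_of_hasSum (div_nonneg (hf 0).nonneg h0.le) (h m)
    fun k => (le_div_iff₀ h0).2 (hf k m)

theorem NullFamily.tendsto_coeff (h : NullFamily ρ f) (hρ : 0 < ρ) :
    Tendsto (fun p : ℕ × ℤ => ‖(f p.1).coeff p.2‖ * ρ ^ p.2) cofinite (𝓝 0) := by
  obtain ⟨hcv, c, hc, hG⟩ := h
  rw [Metric.tendsto_nhds]
  intro e he
  have hfa : {a | ¬ c a < e}.Finite := by
    have := hc.eventually_lt_const he
    rwa [← Nat.cofinite_eq_atTop] at this
  have hfb : ∀ a, {b | ¬ ‖(f a).coeff b‖ * ρ ^ b < e}.Finite :=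
    fun a => Tendsto.eventually_lt_const he (hcv a)
  refine (hfa.biUnion fun a _ => (hfb a).image fun b => (a, b)).subset ?_
  rintro ⟨a, b⟩ hab
  have hab' : ¬ ‖(f a).coeff b‖ * ρ ^ b < e := by
    intro hlt
    apply hab
    have h0 : 0 ≤ ‖(f a).coeff b‖ * ρ ^ b := by positivity
    change dist (‖(f a).coeff b‖ * ρ ^ b) 0 < e
    rwa [Real.dist_eq, sub_zero, abs_of_nonneg h0]
  simp only [Set.mem_iUnion]
  exact ⟨a, fun h => hab' ((hG a b).trans_lt h), b, hab', rfl⟩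

/-- Only finitely many pairs `(k, m)` carry a large weighted coefficient; outside their projection
to `m` every summand is small, and so is the sum, by the ultrametric inequality. -/
theorem NullFamily.null_of_hasSum (h : NullFamily ρ f) (hρ : 0 < ρ) {a : ℤ → K}
    (ha : ∀ m, HasSum (fun k => (f k).coeff m) (a m)) :
    Tendsto (fun m => ‖a m‖ * ρ ^ m) cofinite (𝓝 0) := by
  have h1 := h.tendsto_coeff hρ
  rw [Metric.tendsto_nhds]
  intro e he
  have hfin : {p : ℕ × ℤ | ¬ ‖(f p.1).coeff p.2‖ * ρ ^ p.2 < e / 2}.Finite :=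
    h1.eventually_lt_const (half_pos he)
  filter_upwards [(hfin.image Prod.snd).compl_mem_cofinite] with m hm
  have h0 := zpow_pos hρ m
  have hle : ‖a m‖ ≤ (e / 2) / ρ ^ m := by
    refine norm_le_of_hasSum (by positivity) (ha m) fun k => ?_
    rw [le_div_iff₀ h0]
    by_contra hcon
    exact hm ⟨(k, m), fun h => hcon (le_of_lt h), rfl⟩
  rw [le_div_iff₀ h0] at hle
  rw [Real.dist_eq, sub_zero, abs_of_nonneg (by positivity)]
  linarith

theorem NullFamily.convAt (h : NullFamily ρ f) (hρ : 0 < ρ) (hg : IsCoeffSum f g) :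
    ConvAt ρ g := h.null_of_hasSum hρ hg

theorem exists_mem_annulus (κ : BaseKind) {ε : ℝ} (h0 : 0 < ε) : ∃ ρ, ρ ∈ annulus κ ε := by
  refine ⟨1 - ε / 2, ?_⟩
  cases κ <;> simp only [annulus, Set.mem_Ioo] <;> constructor <;> linarith

/-- A sequence that is null on an annulus has a coefficientwise sum in the base ring. -/
theorem exists_isCoeffSum {ε : ℝ} (h0 : 0 < ε) (h1 : ε < 1)
    (h : ∀ ρ ∈ annulus κ ε, NullFamily ρ f) : ∃ g, IsCoeffSum f g := by
  obtain ⟨ρ₀, hρ₀⟩ := exists_mem_annulus κ h0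
  have hs := fun m => ((h _ hρ₀).summable_coeff (annulus_pos κ h1 hρ₀) m).hasSum
  exact ⟨⟨fun m => ∑' k, (f k).coeff m, ε, h0, h1, fun ρ hρ =>
    (h ρ hρ).null_of_hasSum (annulus_pos κ h1 hρ) hs⟩, hs⟩

theorem NullFamily.hasSum_eval {L : Type w} [NontriviallyNormedField L] [IsUltrametricDist L]
    [CompleteSpace L] [NormedAlgebra K L] {x : L} (h : NullFamily ‖x‖ f) (hx : 0 < ‖x‖)
    (hg : IsCoeffSum f g) : HasSum (fun k => eval x (f k)) (eval x g) := by
  have hswap : Tendsto (fun p : ℤ × ℕ => ‖algebraMap K L ((f p.2).coeff p.1) * x ^ p.1‖)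
      cofinite (𝓝 0) := by
    refine ((h.tendsto_coeff hx).comp (Prod.swap_injective.tendsto_cofinite)).congr fun p => ?_
    rw [norm_eval_term]
    rfl
  refine hasSum_swap (L := L) (F := fun (m : ℤ) (k : ℕ) => algebraMap K L ((f k).coeff m) * x ^ m)
    hswap (fun m => ?_) (h.convAt hx hg).hasSum_eval fun k => (h.1 k).hasSum_eval
  exact ((hg m).map (algebraMap K L) (algebraMapCLM K L).continuous).mul_right _

end CoeffSum

/-! ### Taylor expansion at a point -/

section Taylor

open PowerSeries

variable {K : Type u} [NormedField K] [IsUltrametricDist K] [CompleteSpace K] {κ : BaseKind}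

/-- `binom(δ₁, i)`, the coefficient of `u^i` in `f((1+u)T)`. -/
def binomTheta (i : ℕ) (f : BaseRing K κ) : BaseRing K κ :=
  ⟨fun m => (Ring.choose m i : ℤ) * f.coeff m, by
    obtain ⟨ε, h0, h1, h⟩ := f.conv
    refine ⟨ε, h0, h1, fun ρ hρ => null_of_le (annulus_pos κ h1 hρ) (fun i => ?_) (h ρ hρ)⟩
    rw [norm_mul]
    exact mul_le_of_le_one_left (norm_nonneg _) (IsUltrametricDist.norm_intCast_le_one K _)⟩

theorem coeff_binomTheta (i : ℕ) (f : BaseRing K κ) (m : ℤ) :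
    (binomTheta i f).coeff m = (Ring.choose m i : ℤ) * f.coeff m := rfl

variable {ρ : ℝ} {f g : BaseRing K κ}

theorem ConvAt.binomTheta (hρ : 0 < ρ) (i : ℕ) (hf : ConvAt ρ f) : ConvAt ρ (binomTheta i f) :=
  null_of_le hρ (fun m => by
    rw [coeff_binomTheta, norm_mul]
    exact mul_le_of_le_one_left (norm_nonneg _) (IsUltrametricDist.norm_intCast_le_one K _)) hf

theorem GaussLE.binomTheta {C : ℝ} (hρ : 0 < ρ) (i : ℕ) (hf : GaussLE ρ C f) :
    GaussLE ρ C (binomTheta i f) := by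
  intro m
  refine le_trans ?_ (hf m)
  refine mul_le_mul_of_nonneg_right ?_ (zpow_nonneg hρ.le m)
  rw [coeff_binomTheta, norm_mul]
  exact mul_le_of_le_one_left (norm_nonneg _) (IsUltrametricDist.norm_intCast_le_one K _)

theorem binomTheta_zero (f : BaseRing K κ) : binomTheta 0 f = f := by
  ext m
  simp [coeff_binomTheta]

/-- This is `(i+1) binom(m, i+1) = (m - i) binom(m, i)`. It is exactly what makes `shiftDer` kill
`tay f`. -/
theorem binomTheta_succ (i : ℕ) (f : BaseRing K κ) :
    (i + 1) • binomTheta (i + 1) f = theta (binomTheta i f) - i • binomTheta i f := by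
  have key : ∀ m : ℤ, ((i + 1 : ℕ) : ℤ) * Ring.choose m (i + 1) = (m - i) * Ring.choose m i := by
    intro m
    have h1 := Ring.choose_smul_choose m (n := i + 1) (k := i) (Nat.le_succ i)
    rw [Nat.choose_succ_self_right, show i + 1 - i = 1 by omega, Ring.choose_one_right] at h1
    rw [← nsmul_eq_mul, h1]
    ring
  ext m
  rw [coeff_sub, coeff_theta, ← Nat.cast_smul_eq_nsmul K, ← Nat.cast_smul_eq_nsmul K, coeff_smul,
    coeff_smul, coeff_binomTheta, coeff_binomTheta, ← mul_assoc]
  have := congrArg (Int.cast : ℤ → K) (key m)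
  push_cast at this ⊢
  rw [this]
  ring

/-- The Taylor series `f((1+X)T) = ∑ binom(δ₁, i)(f) X^i`. -/
def tay (f : BaseRing K κ) : (BaseRing K κ)⟦X⟧ := PowerSeries.mk fun i => binomTheta i f

variable {L : Type w} [NontriviallyNormedField L] [IsUltrametricDist L] [CompleteSpace L]
  [NormedAlgebra K L] {x : L}

/-- The coefficientwise value at `x` of a power series over the base ring. -/
def evalPS (x : L) (F : (BaseRing K κ)⟦X⟧) : L⟦X⟧ := PowerSeries.mk fun k => eval x (PowerSeries.coeff k F)

theorem coeff_evalPS (x : L) (F : (BaseRing K κ)⟦X⟧) (k : ℕ) :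
    PowerSeries.coeff k (evalPS x F) = eval x (PowerSeries.coeff k F) := coeff_mk _ _

theorem PB_evalPS_tay (hx : 0 < ‖x‖) (hf : ConvAt ‖x‖ f) : PB 1 (evalPS x (tay f)) := by
  obtain ⟨C, -, hC⟩ := hf.exists_gaussLE
  refine ⟨C, fun k => ?_⟩
  rw [one_pow, mul_one, coeff_evalPS, tay, coeff_mk]
  exact GaussLE.norm_eval_le (hf.binomTheta hx k) (hC.binomTheta hx k)

/-- Integer binomial coefficients have norm at most `1`, so the binomial series converges on the
open unit disk. Additivity in the exponent gives natural exponents by induction and negative ones by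
inversion. -/
theorem hasSum_choose_int {u : L} (hu : ‖u‖ < 1) (m : ℤ) :
    HasSum (fun i => ((Ring.choose m i : ℤ) : L) * u ^ i) ((1 + u) ^ m) := by
  have hB : ∀ m : ℤ, PB 1 (binomialSeries L m) := fun m => ⟨1, fun k => by
    rw [binomialSeries_coeff, one_pow, mul_one, zsmul_eq_mul, mul_one]
    exact IsUltrametricDist.norm_intCast_le_one L _⟩
  have hnat : ∀ n : ℕ, ev u (binomialSeries L (n : ℤ)) = (1 + u) ^ n := by
    intro n
    induction n with
    | zero => simp [ev_one]
    | succ n ih =>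
      rw [Nat.cast_succ, binomialSeries_add, ev_mul (hB _) (hB _) hu, ih, pow_succ]
      congr 1
      have := binomialSeries_nat (R := ℤ) (A := L) 1
      rw [Nat.cast_one] at this
      rw [this, pow_one, ev_add PB_one PB_X hu, ev_one, ev_X]
  have h1u : (1 + u) ≠ 0 := by
    intro h0
    have : u = -1 := by linear_combination h0
    simp [this] at hu
  have hint : ev u (binomialSeries L m) = (1 + u) ^ m := by
    obtain ⟨n, rfl | rfl⟩ := m.eq_nat_or_neg
    · rw [hnat, zpow_natCast]
    · have h2 : ev u (binomialSeries L (-(n : ℤ))) * ev u (binomialSeries L (n : ℤ)) = 1 := by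
        rw [← ev_mul (hB _) (hB _) hu, ← binomialSeries_add, neg_add_cancel, binomialSeries_zero,
          ev_one]
      rw [hnat] at h2
      rw [zpow_neg, zpow_natCast]
      exact eq_inv_of_mul_eq_one_left h2
  rw [← hint]
  refine ((hB m).hasSum hu).congr_fun fun i => ?_
  rw [binomialSeries_coeff, zsmul_eq_mul, mul_one]

/-- Expand each `((1+u) x)^m` by the binomial series and exchange the sum over `m` with that over
the powers of `u`. Since `|1 + u| = 1`, the point `(1+u) x` stays on the circle of `x`. -/
theorem ev_evalPS_tay (hx : 0 < ‖x‖) (hf : ConvAt ‖x‖ f) {u : L} (hu : ‖u‖ < 1) :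
    ev u (evalPS x (tay f)) = eval ((1 + u) * x) f := by
  have h1u : ‖1 + u‖ = 1 := by
    have := IsUltrametricDist.norm_add_eq_max_of_norm_ne_norm (x := (1 : L)) (y := u)
      (by rw [norm_one]; exact hu.ne')
    rw [this, norm_one, max_eq_left hu.le]
  have hnorm : ‖(1 + u) * x‖ = ‖x‖ := by rw [norm_mul, h1u, one_mul]
  refine ev_eq_of_hasSum (hasSum_swap (L := L)
    (F := fun (m : ℤ) (i : ℕ) => algebraMap K L (f.coeff m) * x ^ m *
      (((Ring.choose m i : ℤ) : L) * u ^ i)) ?_ (fun m => ?_)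
      (ConvAt.hasSum_eval (hnorm ▸ hf)) fun i => ?_)
  · refine tendsto_norm_uncurry (L := L) (F := fun (m : ℤ) (i : ℕ) => algebraMap K L (f.coeff m) *
      x ^ m * (((Ring.choose m i : ℤ) : L) * u ^ i)) hf.null_eval_term (fun m => ?_) fun m i => ?_
    · have h2 := (hasSum_choose_int hu m).summable.tendsto_cofinite_zero.norm.const_mul
        ‖algebraMap K L (f.coeff m) * x ^ m‖
      rw [norm_zero, mul_zero] at h2
      exact h2.congr fun i => (norm_mul _ _).symm
    · rw [norm_mul _ (_ * u ^ i)]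
      refine mul_le_of_le_one_right (norm_nonneg _) ?_
      rw [norm_mul, norm_pow]
      exact mul_le_one₀ (IsUltrametricDist.norm_intCast_le_one L _) (by positivity)
        (pow_le_one₀ (norm_nonneg _) hu.le)
  · rw [mul_zpow, mul_left_comm, mul_comm ((1 + u) ^ m)]
    exact (hasSum_choose_int hu m).mul_left _
  · rw [coeff_evalPS, tay, coeff_mk]
    refine ((hf.binomTheta hx i).hasSum_eval.mul_right (u ^ i)).congr_fun fun m => ?_
    rw [coeff_binomTheta, map_mul, map_intCast]
    ring

end Taylor

end BaseRing

open BaseRing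

open PowerSeries (C X mk derivative)

/-! ## The formal differential system -/

section Formal

variable {K : Type u} [NormedField K] [IsUltrametricDist K] [CompleteSpace K] {κ : BaseKind}

/-- Stated for bare functions with a Leibniz rule, because `shiftDer` and `eulerPS` are not packaged
as derivations. -/
theorem matrix_map_mul_of_leibniz {R : Type*} [CommRing R] {E : R → R} (hadd : ∀ a b, E (a + b) = E a + E b)
    (hmul : ∀ a b, E (a * b) = E a * b + a * E b) {a b c : Type*} [Fintype b]
    (A : Matrix a b R) (D : Matrix b c R) : (A * D).map E = A.map E * D + A * D.map E := by
  have h0 : E 0 = 0 := by simpa using hadd 0 0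
  have hsum : ∀ (s : Finset b) (f : b → R), E (∑ i ∈ s, f i) = ∑ i ∈ s, E (f i) := by
    classical
    intro s f
    induction s using Finset.induction_on with
    | empty => simpa using h0
    | insert i s hi ih => rw [Finset.sum_insert hi, Finset.sum_insert hi, hadd, ih]
  ext i j
  simp only [Matrix.map_apply, Matrix.mul_apply, Matrix.add_apply, hsum, hmul,
    Finset.sum_add_distrib]

/-- `δ₁` applied to the coefficients of a power series. -/
def thetaPS (f : PowerSeries (BaseRing K κ)) : PowerSeries (BaseRing K κ) :=
  mk fun k => theta (PowerSeries.coeff k f)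

theorem coeff_thetaPS (f : PowerSeries (BaseRing K κ)) (k : ℕ) :
    PowerSeries.coeff k (thetaPS f) = theta (PowerSeries.coeff k f) := PowerSeries.coeff_mk _ _

theorem thetaPS_add (f g : PowerSeries (BaseRing K κ)) :
    thetaPS (f + g) = thetaPS f + thetaPS g := by
  ext1 k
  simp [coeff_thetaPS, theta_add]

theorem thetaPS_mul (f g : PowerSeries (BaseRing K κ)) :
    thetaPS (f * g) = thetaPS f * g + f * thetaPS g := by
  ext1 k
  simp only [coeff_thetaPS, PowerSeries.coeff_mul, map_add, theta_sum, theta_mul,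
    Finset.sum_add_distrib]

/-- The Euler operator `(1 + X) d/dX` of the variable `1 + X`. -/
def eulerPS {R : Type*} [CommRing R] (f : PowerSeries R) : PowerSeries R :=
  (1 + X) * derivative R f

theorem eulerPS_add {R : Type*} [CommRing R] (f g : PowerSeries R) :
    eulerPS (f + g) = eulerPS f + eulerPS g := by
  simp [eulerPS, mul_add]

theorem eulerPS_mul {R : Type*} [CommRing R] (f g : PowerSeries R) :
    eulerPS (f * g) = eulerPS f * g + f * eulerPS g := by
  simp only [eulerPS, Derivation.leibniz, smul_eq_mul]
  ring

theorem eulerPS_C {R : Type*} [CommRing R] (a : R) : eulerPS (C a : PowerSeries R) = 0 := by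
  rw [eulerPS, PowerSeries.derivative_C, mul_zero]

theorem coeff_eulerPS {R : Type*} [CommRing R] (f : PowerSeries R) (k : ℕ) :
    PowerSeries.coeff k (eulerPS f) =
      (k + 1) * PowerSeries.coeff (k + 1) f + k * PowerSeries.coeff k f := by
  rw [eulerPS, add_mul, one_mul, map_add, PowerSeries.coeff_derivative]
  cases k with
  | zero => simp
  | succ k =>
    rw [PowerSeries.coeff_succ_X_mul, PowerSeries.coeff_derivative]
    push_cast
    ring

theorem eulerPS_thetaPS (f : PowerSeries (BaseRing K κ)) :
    eulerPS (thetaPS f) = thetaPS (eulerPS f) := by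
  ext1 k
  simp only [coeff_eulerPS, coeff_thetaPS, theta_add, ← nsmul_eq_mul, theta_nsmul,
    ← Nat.cast_succ]

/-- The derivation `(1 + X) d/dX - δ₁`, which kills the Taylor series `f((1+X)T)`. -/
def shiftDer (f : PowerSeries (BaseRing K κ)) : PowerSeries (BaseRing K κ) :=
  eulerPS f - thetaPS f

theorem shiftDer_add (f g : PowerSeries (BaseRing K κ)) :
    shiftDer (f + g) = shiftDer f + shiftDer g := by
  simp only [shiftDer, eulerPS_add, thetaPS_add]
  ring

theorem shiftDer_mul (f g : PowerSeries (BaseRing K κ)) :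
    shiftDer (f * g) = shiftDer f * g + f * shiftDer g := by
  simp only [shiftDer, eulerPS_mul, thetaPS_mul]
  ring

theorem shiftDer_tay (f : BaseRing K κ) : shiftDer (tay f) = 0 := by
  ext1 k
  rw [shiftDer, map_sub, coeff_eulerPS, coeff_thetaPS, tay, PowerSeries.coeff_mk,
    PowerSeries.coeff_mk, ← Nat.cast_succ, ← nsmul_eq_mul, ← nsmul_eq_mul, binomTheta_succ]
  simp

theorem shiftDer_C (f : BaseRing K κ) : shiftDer (C f : PowerSeries (BaseRing K κ)) = -C (theta f) := by
  rw [shiftDer, eulerPS_C, zero_sub]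
  congr 1
  ext1 k
  rw [coeff_thetaPS, PowerSeries.coeff_C, PowerSeries.coeff_C]
  split_ifs
  · rfl
  · exact theta_zero

variable {a n : ℕ}

variable [CharZero K]

theorem baseRing_nsmul_cancel {k : ℕ} {f g : BaseRing K κ} (h : (k + 1) • f = (k + 1) • g) :
    f = g := by
  ext m
  have h1 := congrArg (fun f => f.coeff m) h
  simp only [← Nat.cast_smul_eq_nsmul K, coeff_smul] at h1
  exact mul_left_cancel₀ (by exact_mod_cast Nat.succ_ne_zero k) h1

/-- Formal uniqueness for `(1 + X) dZ/dX - δ₁ Z = Z G`. -/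
theorem formal_ext {G : Matrix (Fin n) (Fin n) (BaseRing K κ)}
    {Z Z' : Matrix (Fin a) (Fin n) (PowerSeries (BaseRing K κ))}
    (hZ : Z.map shiftDer = Z * G.map C) (hZ' : Z'.map shiftDer = Z' * G.map C)
    (h0 : Z.map (PowerSeries.coeff 0) = Z'.map (PowerSeries.coeff 0)) : Z = Z' := by
  have key : ∀ {Z : Matrix (Fin a) (Fin n) (PowerSeries (BaseRing K κ))},
      Z.map shiftDer = Z * G.map C → ∀ k i j, (k + 1) • PowerSeries.coeff (k + 1) (Z i j) =
        theta (PowerSeries.coeff k (Z i j)) - k • PowerSeries.coeff k (Z i j) +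
          ∑ l, PowerSeries.coeff k (Z i l) * G l j := by
    intro Z hZ k i j
    have h1 := congrArg (PowerSeries.coeff k) (congrFun (congrFun hZ i) j)
    rw [Matrix.map_apply, shiftDer, map_sub, coeff_eulerPS, coeff_thetaPS, Matrix.mul_apply,
      map_sum] at h1
    simp only [Matrix.map_apply, PowerSeries.coeff_mul_C] at h1
    rw [← h1, nsmul_eq_mul, nsmul_eq_mul]
    push_cast
    ring
  have hk : ∀ k i j, PowerSeries.coeff k (Z i j) = PowerSeries.coeff k (Z' i j) := by
    intro k
    induction k with
    | zero => exact fun i j => congrFun (congrFun h0 i) j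
    | succ k ih =>
      intro i j
      -- The equation determines `(k+1)` times the coefficient of `X^(k+1)` from the coefficients of
      -- `X^k`; characteristic `0` allows the cancellation.
      refine baseRing_nsmul_cancel (k := k) ?_
      rw [key hZ, key hZ', ih]
      simp only [ih]
  ext i j : 1
  exact PowerSeries.ext fun k => hk k i j

/-- The matrices `N_k` of the operators `binom(δ₁^M, k)`, i.e. `T^k G_[k] / k!`. -/
def binomMat (G : Matrix (Fin n) (Fin n) (BaseRing K κ)) :
    ℕ → Matrix (Fin n) (Fin n) (BaseRing K κ)
  | 0 => 1
  | k + 1 => ((k + 1 : K)⁻¹) • ((binomMat G k).map theta + binomMat G k * G - k • binomMat G k)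

/-- The generating series `∑ N_k X^k`, the formal Taylor solution at the point `T` in the
coordinate `x = (1 + X) T`. -/
def genSol (G : Matrix (Fin n) (Fin n) (BaseRing K κ)) :
    Matrix (Fin n) (Fin n) (PowerSeries (BaseRing K κ)) :=
  Matrix.of fun i j => mk fun k => binomMat G k i j

theorem coeff_genSol (G : Matrix (Fin n) (Fin n) (BaseRing K κ)) (i j : Fin n) (k : ℕ) :
    PowerSeries.coeff k (genSol G i j) = binomMat G k i j := by
  rw [genSol, Matrix.of_apply, PowerSeries.coeff_mk]

theorem binomMat_one (G : Matrix (Fin n) (Fin n) (BaseRing K κ)) : binomMat G 1 = G := by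
  simp only [binomMat]
  have : (1 : Matrix (Fin n) (Fin n) (BaseRing K κ)).map theta = 0 := by
    ext i j : 1
    rw [Matrix.map_apply, Matrix.one_apply]
    split_ifs
    · exact theta_one
    · exact theta_zero
  rw [this]
  simp

/-- At fixed `x = (1+X) T`, `shiftDer` is minus the derivative `T d/dT` in the base point. The
equation describes how the Taylor solution depends on its base point; coefficientwise it is the
recursion defining `binomMat`. -/
theorem shiftDer_genSol (G : Matrix (Fin n) (Fin n) (BaseRing K κ)) :
    (genSol G).map shiftDer = genSol G * G.map C := by
  ext i j : 1
  refine PowerSeries.ext fun k => ?_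
  rw [Matrix.map_apply, shiftDer, map_sub, coeff_eulerPS, coeff_thetaPS, Matrix.mul_apply, map_sum]
  simp only [Matrix.map_apply, PowerSeries.coeff_mul_C, coeff_genSol]
  have hk : (k + 1 : K) ≠ 0 := by exact_mod_cast Nat.succ_ne_zero k
  have h1 : ((k : BaseRing K κ) + 1) * binomMat G (k + 1) i j =
      theta (binomMat G k i j) + (binomMat G k * G) i j - k • binomMat G k i j := by
    rw [binomMat, ← Nat.cast_succ, ← nsmul_eq_mul, ← Nat.cast_smul_eq_nsmul K, Matrix.smul_apply,
      smul_smul]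
    push_cast
    rw [mul_inv_cancel₀ hk, one_smul]
    rfl
  rw [h1, Matrix.mul_apply, nsmul_eq_mul]
  ring

theorem genSol_coeff_zero (G : Matrix (Fin n) (Fin n) (BaseRing K κ)) :
    (genSol G).map (PowerSeries.coeff 0) = 1 := by
  ext i j : 1
  rw [Matrix.map_apply, coeff_genSol, binomMat]

/-- If `F` intertwines the connections `G` and `G'`, then `N F = F((1+X)T) N'`. -/
theorem genSol_intertwine {m : ℕ} {G : Matrix (Fin n) (Fin n) (BaseRing K κ)}
    {G' : Matrix (Fin m) (Fin m) (BaseRing K κ)} {F : Matrix (Fin n) (Fin m) (BaseRing K κ)}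
    (h : G * F = F.map theta + F * G') :
    genSol G * F.map C = F.map tay * genSol G' := by
  -- Both sides satisfy the base point equation for `G'`: the left one by the intertwining relation,
  -- the right one because `shiftDer` kills the Taylor series of `F`. Their constant coefficients
  -- are both `F`.
  refine formal_ext (G := G') ?_ ?_ ?_
  · rw [matrix_map_mul_of_leibniz shiftDer_add shiftDer_mul, shiftDer_genSol, Matrix.mul_assoc,
      Matrix.mul_assoc, ← Matrix.map_mul, ← Matrix.map_mul, ← Matrix.mul_add, h]
    congr 1
    ext i j : 1
    simp [shiftDer_C]
  · rw [matrix_map_mul_of_leibniz shiftDer_add shiftDer_mul, shiftDer_genSol, Matrix.mul_assoc]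
    convert zero_add _
    convert Matrix.zero_mul _
    ext i j : 1
    simp [shiftDer_tay]
  · have hc : ∀ {b c d : ℕ} (A : Matrix (Fin b) (Fin c) (PowerSeries (BaseRing K κ)))
        (D : Matrix (Fin c) (Fin d) (PowerSeries (BaseRing K κ))),
        (A * D).map (PowerSeries.coeff 0) =
          A.map (PowerSeries.coeff 0) * D.map (PowerSeries.coeff 0) := by
      intro b c d A D
      ext i j : 1
      simp [Matrix.mul_apply]
    rw [hc, hc, genSol_coeff_zero, genSol_coeff_zero, Matrix.one_mul, Matrix.mul_one]
    ext i j : 1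
    simp [tay, binomTheta_zero]

/-- The Taylor solution satisfies `(1 + X) dN/dX = G((1+X)T) N`. -/
theorem eulerPS_genSol (G : Matrix (Fin n) (Fin n) (BaseRing K κ)) :
    (genSol G).map eulerPS = G.map tay * genSol G := by
  have hE : (genSol G).map eulerPS = (genSol G).map thetaPS + genSol G * G.map C := by
    rw [← shiftDer_genSol]
    ext i j : 1
    simp [shiftDer]
  -- Again both sides satisfy the base point equation: `eulerPS` commutes with `shiftDer` and kills
  -- constants, and `shiftDer` kills `tay`. At `X = 0` both are `G`.
  refine formal_ext (G := G) ?_ ?_ ?_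
  · have h1 : ((genSol G).map eulerPS).map shiftDer = ((genSol G).map shiftDer).map eulerPS := by
      ext i j : 1
      simp only [Matrix.map_apply, shiftDer]
      have hs : ∀ f g : PowerSeries (BaseRing K κ), eulerPS (f - g) = eulerPS f - eulerPS g := by
        intro f g
        simp [eulerPS, mul_sub]
      rw [hs, eulerPS_thetaPS]
    rw [h1, shiftDer_genSol, matrix_map_mul_of_leibniz eulerPS_add eulerPS_mul]
    convert add_zero _
    convert Matrix.mul_zero _
    ext i j : 1
    simp [eulerPS_C]
  · rw [matrix_map_mul_of_leibniz shiftDer_add shiftDer_mul, shiftDer_genSol, Matrix.mul_assoc]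
    convert zero_add _
    convert Matrix.zero_mul _
    ext i j : 1
    simp [shiftDer_tay]
  · ext i j : 1
    rw [hE]
    simp only [Matrix.map_apply, Matrix.add_apply, map_add, Matrix.mul_apply, map_sum,
      PowerSeries.coeff_zero_eq_constantCoeff, map_mul, PowerSeries.constantCoeff_C]
    have hth : ∀ f : PowerSeries (BaseRing K κ), PowerSeries.constantCoeff (thetaPS f) =
        theta (PowerSeries.constantCoeff f) := by
      intro f
      rw [← PowerSeries.coeff_zero_eq_constantCoeff_apply, coeff_thetaPS,
        PowerSeries.coeff_zero_eq_constantCoeff_apply]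
    have hN : ∀ i j, PowerSeries.constantCoeff (genSol G i j) = (1 : Matrix _ _ _) i j := by
      intro i j
      rw [← PowerSeries.coeff_zero_eq_constantCoeff_apply, coeff_genSol, binomMat]
    have hT : ∀ f : BaseRing K κ, PowerSeries.constantCoeff (tay f) = f := by
      intro f
      rw [← PowerSeries.coeff_zero_eq_constantCoeff_apply, tay, PowerSeries.coeff_mk,
        binomTheta_zero]
    simp only [hth, hN, hT, ← Matrix.mul_apply, Matrix.one_mul, Matrix.mul_one]
    rw [Matrix.one_apply]
    split_ifs
    · rw [theta_one, zero_add]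
    · rw [theta_zero, zero_add]

/-- `N_k = T^k G_[k] / k!`. -/
theorem binomMat_eq_dIter (G : Matrix (Fin n) (Fin n) (BaseRing K κ)) (k : ℕ) :
    binomMat G k = ((k.factorial : K)⁻¹) •
      (dIter G k).map (fun f => monomial (k : ℤ) 1 * f) := by
  induction k with
  | zero =>
    ext i j : 1
    simp only [binomMat, dIter, Matrix.smul_apply, Matrix.map_apply, monomial_zero_mul,
      Nat.factorial_zero, Nat.cast_zero, Nat.cast_one, inv_one, one_smul]
  | succ k ih =>
    have hk : (k + 1 : K) ≠ 0 := by exact_mod_cast Nat.succ_ne_zero k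
    ext i j : 1
    have hth : ∀ f : BaseRing K κ, theta (monomial (k : ℤ) 1 * f) =
        k • (monomial (k : ℤ) 1 * f) + monomial (k : ℤ) 1 * theta f := by
      intro f
      rw [theta_mul]
      congr 1
      ext m
      rw [← Nat.cast_smul_eq_nsmul K, ← smul_mul_assoc]
      congr 2
      ext m'
      simp only [coeff_theta, coeff_monomial, coeff_smul]
      split_ifs with h
      · rw [h]; simp
      · simp
    have hmul : ∀ f : BaseRing K κ, monomial ((k + 1 : ℕ) : ℤ) 1 * (monomial (-1) 1 * f) =
        monomial (k : ℤ) 1 * f := by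
      intro f
      rw [← mul_assoc, monomial_mul_monomial]
      congr 2
      · push_cast; ring
      · ring
    rw [binomMat, ih]
    simp only [dIter, Matrix.smul_apply, Matrix.map_apply, Matrix.add_apply, Matrix.sub_apply,
      Matrix.mul_apply, theta_smul, hth, ddT, mul_add, hmul, Finset.mul_sum]
    have hsum : ∀ l, monomial ((k + 1 : ℕ) : ℤ) 1 * (dIter G k i l * (monomial (-1) 1 * G l j)) =
        (monomial (k : ℤ) 1 * dIter G k i l) * G l j := by
      intro l
      rw [mul_left_comm, hmul]
      ring
    simp only [hsum, smul_mul_assoc, ← Finset.smul_sum]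
    rw [Nat.factorial_succ]
    push_cast
    rw [mul_inv, mul_smul]
    congr 1
    rw [smul_comm k, ← smul_add, ← smul_sub]
    congr 1
    abel

theorem ConvAt.binomMat {ρ : ℝ} (hρ : 0 < ρ) {G : Matrix (Fin n) (Fin n) (BaseRing K κ)}
    (hG : ∀ i j, ConvAt ρ (G i j)) (k : ℕ) (i j : Fin n) : ConvAt ρ (binomMat G k i j) := by
  induction k generalizing i j with
  | zero =>
    rw [QDiff.binomMat, Matrix.one_apply]
    split_ifs
    · exact convAt_one
    · exact convAt_zero
  | succ k ih =>
    rw [QDiff.binomMat]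
    refine ConvAt.smul _ (ConvAt.sub hρ (ConvAt.add hρ ((ih i j).theta hρ) ?_) ((ih i j).nsmul k))
    exact ConvAt.sum hρ fun l _ => (ih i l).mul hρ (hG l j)

end Formal

/-! ## Matrices of bounded power series -/

section MatrixSeries

variable {L : Type*} [NontriviallyNormedField L] [IsUltrametricDist L] [CompleteSpace L]
  {a b c : ℕ}

/-- All entries are bounded power series for the radius `s`. -/
def PBM (s : ℝ) (F : Matrix (Fin a) (Fin b) (PowerSeries L)) : Prop := ∀ i j, PB s (F i j)

/-- The value at `u` of a matrix of power series. -/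
def evM (u : L) (F : Matrix (Fin a) (Fin b) (PowerSeries L)) : Matrix (Fin a) (Fin b) L :=
  F.map (ev u)

variable {s : ℝ} {u : L}

theorem PBM.mul {F : Matrix (Fin a) (Fin b) (PowerSeries L)}
    {H : Matrix (Fin b) (Fin c) (PowerSeries L)} (hF : PBM s F) (hH : PBM s H) (hs : 0 < s) :
    PBM s (F * H) := fun i j => by
  rw [Matrix.mul_apply]
  exact PB.sum hs fun l _ => (hF i l).mul (hH l j) hs

theorem evM_mul {F : Matrix (Fin a) (Fin b) (PowerSeries L)}
    {H : Matrix (Fin b) (Fin c) (PowerSeries L)} (hF : PBM s F) (hH : PBM s H) (hu : ‖u‖ < s) :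
    evM u (F * H) = evM u F * evM u H := by
  have hs : 0 < s := (norm_nonneg u).trans_lt hu
  ext i j : 1
  rw [evM, Matrix.map_apply, Matrix.mul_apply, Matrix.mul_apply,
    ev_sum hs (fun l _ => (hF i l).mul (hH l j) hs) hu]
  exact Finset.sum_congr rfl fun l _ => ev_mul (hF i l) (hH l j) hu

theorem PBM_C (A : Matrix (Fin a) (Fin b) L) : PBM s (A.map (C : L →+* PowerSeries L)) :=
  fun _ _ => PB_C _

theorem evM_C (A : Matrix (Fin a) (Fin b) L) : evM u (A.map (C : L →+* PowerSeries L)) = A := by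
  ext i j : 1
  exact ev_C _

theorem PB.euler {f : PowerSeries L} (hf : PB s f) (hs : 0 < s) : PB s (eulerPS f) :=
  (PB_one.add PB_X hs).mul (hf.derivative hs) hs

theorem ev_euler {f : PowerSeries L} (hf : PB s f) (hu : ‖u‖ < s) :
    ev u (eulerPS f) = (1 + u) * ev u (derivative L f) := by
  have hs : 0 < s := (norm_nonneg u).trans_lt hu
  rw [eulerPS, ev_mul (PB_one.add PB_X hs) (hf.derivative hs) hu, ev_add PB_one PB_X hu, ev_one,
    ev_X]

theorem matrixPS_ext_of_frequently {F H : Matrix (Fin a) (Fin b) (PowerSeries L)} (hF : PBM s F)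
    (hH : PBM s H) (hs : 0 < s) (h : ∃ᶠ z in 𝓝[≠] (0 : L), evM z F = evM z H) : F = H := by
  ext i j : 1
  exact (hF i j).ext_of_frequently (hH i j) hs (h.mono fun z hz => congrFun (congrFun hz i) j)

/-- Formal uniqueness for `(1 + X) dZ/dX = A Z` in characteristic `0`. -/
theorem euler_ext [CharZero L] {A : Matrix (Fin a) (Fin a) (PowerSeries L)}
    {Z Z' : Matrix (Fin a) (Fin b) (PowerSeries L)} (hZ : Z.map eulerPS = A * Z)
    (hZ' : Z'.map eulerPS = A * Z')
    (h0 : Z.map (PowerSeries.coeff 0) = Z'.map (PowerSeries.coeff 0)) : Z = Z' := by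
  have hk : ∀ k i j, PowerSeries.coeff k (Z i j) = PowerSeries.coeff k (Z' i j) := by
    intro k
    induction k using Nat.strong_induction_on with
    | _ k ih =>
      intro i j
      cases k with
      | zero => exact congrFun (congrFun h0 i) j
      | succ k =>
        have key : ∀ {Z : Matrix (Fin a) (Fin b) (PowerSeries L)}, Z.map eulerPS = A * Z →
            (k + 1 : L) * PowerSeries.coeff (k + 1) (Z i j) =
            (∑ l, ∑ p ∈ Finset.HasAntidiagonal.antidiagonal k, PowerSeries.coeff p.1 (A i l) *
              PowerSeries.coeff p.2 (Z l j)) - k * PowerSeries.coeff k (Z i j) := by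
          intro Z hZ
          have h1 := congrArg (PowerSeries.coeff k) (congrFun (congrFun hZ i) j)
          rw [Matrix.map_apply, coeff_eulerPS, Matrix.mul_apply, map_sum] at h1
          simp only [PowerSeries.coeff_mul] at h1
          rw [← h1]
          ring
        have hk : (k + 1 : L) ≠ 0 := by exact_mod_cast Nat.succ_ne_zero k
        refine mul_left_cancel₀ hk ?_
        rw [key hZ, key hZ', ih k (Nat.lt_succ_self k)]
        congr 1
        refine Finset.sum_congr rfl fun l _ => Finset.sum_congr rfl fun p hp => ?_
        rw [ih p.2]
        have := Finset.HasAntidiagonal.mem_antidiagonal.1 hp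
        omega
  ext i j : 1
  exact PowerSeries.ext fun k => hk k i j

end MatrixSeries

/-! ### Values of the formal Taylor solution at points, and the cocycle identity. -/

section Solutions

variable {K : Type u} [NormedField K] [IsUltrametricDist K] [CompleteSpace K] [CharZero K]
  {κ : BaseKind}
  {L : Type w} [NontriviallyNormedField L] [IsUltrametricDist L] [CompleteSpace L]
  [NormedAlgebra K L] {n : ℕ} {c x : L}

theorem matEval_one (x : L) : matEval x (1 : Matrix (Fin n) (Fin n) (BaseRing K κ)) = 1 := by
  ext i j : 1
  rw [matEval, Matrix.map_apply, Matrix.one_apply, Matrix.one_apply]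
  split_ifs
  · exact eval_one
  · exact eval_zero

theorem matEval_mul (hx : 0 < ‖x‖) {a b d : ℕ} {A : Matrix (Fin a) (Fin b) (BaseRing K κ)}
    {D : Matrix (Fin b) (Fin d) (BaseRing K κ)} (hA : ∀ i j, ConvAt ‖x‖ (A i j))
    (hD : ∀ i j, ConvAt ‖x‖ (D i j)) :
    (A * D).map (eval x) = A.map (eval x) * D.map (eval x) := by
  ext i j : 1
  rw [Matrix.map_apply, Matrix.mul_apply, Matrix.mul_apply,
    eval_sum hx fun l _ => (hA i l).mul hx (hD l j)]
  exact Finset.sum_congr rfl fun l _ => eval_mul hx (hA i l) (hD l j)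

theorem evalPS_mul (hx : 0 < ‖x‖) {f g : PowerSeries (BaseRing K κ)}
    (hf : ∀ k, ConvAt ‖x‖ (PowerSeries.coeff k f)) (hg : ∀ k, ConvAt ‖x‖ (PowerSeries.coeff k g)) :
    evalPS x (f * g) = evalPS x f * evalPS x g := by
  ext1 k
  rw [coeff_evalPS, PowerSeries.coeff_mul, PowerSeries.coeff_mul,
    eval_sum hx fun p _ => (hf _).mul hx (hg _)]
  refine Finset.sum_congr rfl fun p _ => ?_
  rw [eval_mul hx (hf _) (hg _), coeff_evalPS, coeff_evalPS]

theorem map_evalPS_mul (hx : 0 < ‖x‖) {a b d : ℕ}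
    {A : Matrix (Fin a) (Fin b) (PowerSeries (BaseRing K κ))}
    {D : Matrix (Fin b) (Fin d) (PowerSeries (BaseRing K κ))}
    (hA : ∀ i j k, ConvAt ‖x‖ (PowerSeries.coeff k (A i j)))
    (hD : ∀ i j k, ConvAt ‖x‖ (PowerSeries.coeff k (D i j))) :
    (A * D).map (evalPS x) = A.map (evalPS x) * D.map (evalPS x) := by
  ext i j : 1
  rw [Matrix.map_apply, Matrix.mul_apply, Matrix.mul_apply]
  have hconv : ∀ l k, ConvAt ‖x‖ (PowerSeries.coeff k (A i l * D l j)) := fun l k => by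
    rw [PowerSeries.coeff_mul]
    exact ConvAt.sum hx fun p _ => (hA _ _ _).mul hx (hD _ _ _)
  ext1 k
  rw [coeff_evalPS, map_sum, map_sum, eval_sum hx fun l _ => hconv l k]
  refine Finset.sum_congr rfl fun l _ => ?_
  rw [Matrix.map_apply, Matrix.map_apply, ← evalPS_mul hx (hA i l) (hD l j), coeff_evalPS]

theorem convAt_coeff_tay {ρ : ℝ} (hρ : 0 < ρ) {f : BaseRing K κ} (hf : ConvAt ρ f) (k : ℕ) :
    ConvAt ρ (PowerSeries.coeff k (tay f)) := by
  rw [tay, PowerSeries.coeff_mk]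
  exact hf.binomTheta hρ k

theorem convAt_coeff_genSol {ρ : ℝ} (hρ : 0 < ρ) {G : Matrix (Fin n) (Fin n) (BaseRing K κ)}
    (hG : ∀ i j, ConvAt ρ (G i j)) (i j : Fin n) (k : ℕ) :
    ConvAt ρ (PowerSeries.coeff k (genSol G i j)) := by
  rw [coeff_genSol]
  exact ConvAt.binomMat hρ hG k i j

/-- The Taylor solution at the point `c` in the coordinate `u`, `x = (1 + u) c`. -/
def solAt (c : L) (G : Matrix (Fin n) (Fin n) (BaseRing K κ)) :
    Matrix (Fin n) (Fin n) (PowerSeries L) :=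
  (genSol G).map (evalPS c)

theorem coeff_solAt (c : L) (G : Matrix (Fin n) (Fin n) (BaseRing K κ)) (i j : Fin n) (k : ℕ) :
    PowerSeries.coeff k (solAt c G i j) = eval c (binomMat G k i j) := by
  rw [solAt, Matrix.map_apply, coeff_evalPS, coeff_genSol]

/-- The Gauss norms of the matrices `X_k` at `ρ` are `O(s^{-k})`. -/
def SeqBound {a b : ℕ} (ρ s : ℝ) (X : ℕ → Matrix (Fin a) (Fin b) (BaseRing K κ)) : Prop :=
  ∃ C : ℝ, ∀ k i j, GaussLE ρ (C / s ^ k) (X k i j)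

theorem SeqBound.exists_nonneg {a b : ℕ} {ρ s : ℝ} (hs : 0 < s)
    {X : ℕ → Matrix (Fin a) (Fin b) (BaseRing K κ)} (h : SeqBound ρ s X) :
    ∃ C : ℝ, 0 ≤ C ∧ ∀ k i j, GaussLE ρ (C / s ^ k) (X k i j) := by
  obtain ⟨C, hC⟩ := h
  refine ⟨max C 0, le_max_right _ _, fun k i j => (hC k i j).mono ?_⟩
  gcongr
  exact le_max_left _ _

theorem SeqBound.mono {a b : ℕ} {ρ s s' : ℝ} (hs' : 0 < s') (hs : s' ≤ s)
    {X : ℕ → Matrix (Fin a) (Fin b) (BaseRing K κ)} (h : SeqBound ρ s X) : SeqBound ρ s' X := by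
  obtain ⟨C, h0, hC⟩ := h.exists_nonneg (hs'.trans_le hs)
  exact ⟨C, fun k i j => (hC k i j).mono (by gcongr)⟩

variable {G : Matrix (Fin n) (Fin n) (BaseRing K κ)} {s : ℝ}

theorem PBM_solAt (hc : 0 < ‖c‖) (hs : 0 < s) (hG : ∀ i j, ConvAt ‖c‖ (G i j))
    (hB : SeqBound ‖c‖ s (binomMat G)) : PBM s (solAt c G) := by
  intro i j
  obtain ⟨C, hC⟩ := hB
  refine ⟨C, fun k => ?_⟩
  rw [coeff_solAt, ← le_div_iff₀ (pow_pos hs k)]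
  exact GaussLE.norm_eval_le (ConvAt.binomMat hc hG k i j) (hC k i j)

theorem solAt_coeff_zero (c : L) (G : Matrix (Fin n) (Fin n) (BaseRing K κ)) :
    (solAt c G).map (PowerSeries.coeff 0) = 1 := by
  ext i j : 1
  rw [Matrix.map_apply, coeff_solAt, binomMat, ← matEval_one (K := K) (κ := κ) c]
  rfl

theorem evM_zero {a b : ℕ} (F : Matrix (Fin a) (Fin b) (PowerSeries L)) :
    evM 0 F = F.map (PowerSeries.coeff 0) := by
  ext i j : 1
  exact ev_at_zero _

theorem evalPS_euler {f : PowerSeries (BaseRing K κ)}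
    (hf : ∀ k, ConvAt ‖c‖ (PowerSeries.coeff k f)) :
    evalPS c (eulerPS f) = eulerPS (evalPS c f) := by
  ext1 k
  have h1 : ∀ (m : ℕ) (b : BaseRing K κ), (m : BaseRing K κ) * b = (m : K) • b := fun m b => by
    rw [← nsmul_eq_mul, Nat.cast_smul_eq_nsmul]
  rw [coeff_evalPS, coeff_eulerPS, coeff_eulerPS, coeff_evalPS, coeff_evalPS, ← Nat.cast_succ, h1,
    h1, eval_add ((hf _).smul _) ((hf _).smul _), eval_smul, eval_smul]
  simp

theorem euler_solAt (hc : 0 < ‖c‖) (hG : ∀ i j, ConvAt ‖c‖ (G i j)) :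
    (solAt c G).map eulerPS = (G.map tay).map (evalPS c) * solAt c G := by
  rw [solAt, ← map_evalPS_mul hc (A := G.map tay) (fun i j k => convAt_coeff_tay hc (hG i j) k)
    (convAt_coeff_genSol hc hG), ← eulerPS_genSol]
  ext i j : 1
  exact (evalPS_euler (convAt_coeff_genSol hc hG i j)).symm

theorem PBM_tay (hc : 0 < ‖c‖) {a b : ℕ} {F : Matrix (Fin a) (Fin b) (BaseRing K κ)}
    (hF : ∀ i j, ConvAt ‖c‖ (F i j)) (hs : 0 ≤ s) (hs1 : s ≤ 1) :
    PBM s ((F.map tay).map (evalPS c)) :=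
  fun i j => (PB_evalPS_tay hc (hF i j)).mono hs hs1

theorem evM_tay (hc : 0 < ‖c‖) {a b : ℕ} {F : Matrix (Fin a) (Fin b) (BaseRing K κ)}
    (hF : ∀ i j, ConvAt ‖c‖ (F i j)) {u : L} (hu : ‖u‖ < 1) :
    evM u ((F.map tay).map (evalPS c)) = F.map (eval ((1 + u) * c)) := by
  ext i j : 1
  exact ev_evalPS_tay hc (hF i j) hu

theorem charZero_of_algebra (K L : Type*) [Field K] [CharZero K] [Field L] [Algebra K L] :
    CharZero L := charZero_of_injective_algebraMap (algebraMap K L).injective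

/-- Analytic uniqueness: a bounded solution of the differential system near `x` is the Taylor
solution multiplied by its initial value. -/
theorem eq_solAt_mul (hx : 0 < ‖x‖) (hs : 0 < s) (hs1 : s ≤ 1) (hG : ∀ i j, ConvAt ‖x‖ (G i j))
    {b : ℕ} {Z : Matrix (Fin n) (Fin b) (PowerSeries L)} (hZ : PBM s Z)
    (h : ∃ᶠ z in 𝓝[≠] (0 : L), evM z (Z.map eulerPS) = matEval ((1 + z) * x) G * evM z Z) :
    Z = solAt x G * (Z.map (PowerSeries.coeff 0)).map C := by
  have := charZero_of_algebra K L
  have hT := PBM_tay hx hG hs.le hs1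
  refine euler_ext (A := (G.map tay).map (evalPS x)) ?_ ?_ ?_
  -- The identity principle upgrades the equation from points accumulating at `0` to an identity of
  -- series. This weak hypothesis is what allows the lemma to be applied with only the nodes `q^l -
  -- 1`.
  · refine matrixPS_ext_of_frequently (fun i j => (hZ i j).euler hs) (hT.mul hZ hs) hs ?_
    refine (h.and_eventually (eventually_norm_lt hs)).mono fun z hz => ?_
    rw [hz.1, evM_mul hT hZ hz.2, evM_tay hx hG (hz.2.trans_le hs1)]
    rfl
  · rw [matrix_map_mul_of_leibniz eulerPS_add eulerPS_mul, euler_solAt hx hG, Matrix.mul_assoc]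
    convert add_zero _
    convert Matrix.mul_zero _
    ext i j : 1
    simp [eulerPS_C]
  · rw [← evM_zero, ← evM_zero (solAt x G * _)]
    ext i j : 1
    have h1 := congrFun (congrFun (solAt_coeff_zero x G) i)
    simp only [evM, Matrix.map_apply, ev_at_zero, Matrix.mul_apply, map_sum,
      PowerSeries.coeff_mul_C] at h1 ⊢
    simp only [h1, Matrix.one_apply]
    simp

/-- The cocycle property of the Taylor solutions. -/
theorem solAt_cocycle (hc : 0 < ‖c‖) (hs : 0 < s) (hs1 : s ≤ 1) (hG : ∀ i j, ConvAt ‖c‖ (G i j))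
    (hB : SeqBound ‖c‖ s (binomMat G)) {u v : L} (hu : ‖u‖ < s) (hv : ‖v‖ < s) :
    evM (u + (1 + u) * v) (solAt c G) = evM v (solAt ((1 + u) * c) G) * evM u (solAt c G) := by
  have hsol := PBM_solAt hc hs hG hB
  have h1u : ‖1 + u‖ = 1 := by
    have := IsUltrametricDist.norm_add_eq_max_of_norm_ne_norm (x := (1 : L)) (y := u)
      (by rw [norm_one]; exact (hu.trans_le hs1).ne')
    rw [this, norm_one, max_eq_left (hu.trans_le hs1).le]
  have hx : ‖(1 + u) * c‖ = ‖c‖ := by rw [norm_mul, h1u, one_mul]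
  -- Since `(1 + u + (1+u) v) c = (1+v) ((1+u) c)`, the series at `c` is recentred along `v ↦ u +
  -- (1+u) v`, which turns it into a series in the relative coordinate at `(1+u) c`.
  choose g hg hg0 hev using fun i j => (hsol i j).reexpand hu (l := 1 + u) h1u.le
  have hw : ∀ z : L, ‖z‖ < s → ‖u + (1 + u) * z‖ < s := fun z hz => by
    refine (IsUltrametricDist.norm_add_le_max _ _).trans_lt (max_lt hu ?_)
    rwa [norm_mul, h1u, one_mul]
  have hZ : PBM s (Matrix.of g) := hg
  have hevZ : ∀ z : L, ‖z‖ < s → evM z (Matrix.of g) = evM (u + (1 + u) * z) (solAt c G) :=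
    fun z hz => by
      ext i j : 1
      exact hev i j z hz
  have hder : ∀ z : L, ‖z‖ < s → ∀ i j, ev z (derivative L (g i j)) =
      (1 + u) * ev (u + (1 + u) * z) (derivative L (solAt c G i j)) := by
    intro z hz i j
    have d1 := (hg i j).hasDerivAt hz
    have d2 : HasDerivAt (fun z => u + (1 + u) * z) (1 + u) z := by
      simpa using ((hasDerivAt_id z).const_mul (1 + u)).const_add u
    have d3 := ((hsol i j).hasDerivAt (hw z hz)).comp z d2
    have d4 : (fun z => ev z (g i j)) =ᶠ[𝓝 z]
        ((fun w => ev w (solAt c G i j)) ∘ fun z => u + (1 + u) * z) := by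
      filter_upwards [(isOpen_lt continuous_norm continuous_const).mem_nhds hz] with y hy
      exact hev i j y hy
    rw [mul_comm]
    exact d1.unique (d3.congr_of_eventuallyEq d4)
  have hode : ∀ w : L, ‖w‖ < s →
      evM w ((solAt c G).map eulerPS) = matEval ((1 + w) * c) G * evM w (solAt c G) := by
    intro w hw
    rw [euler_solAt hc hG, evM_mul (PBM_tay hc hG hs.le hs1) hsol hw,
      evM_tay hc hG (hw.trans_le hs1)]
    rfl
  -- The recentred series solves the same differential equation at the new base point, so it is the
  -- Taylor solution there times its initial value `Y((1+u)c, c)`.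
  have key := eq_solAt_mul (x := (1 + u) * c) (by rwa [hx]) hs hs1 (by rwa [hx]) hZ (by
    refine Eventually.frequently ?_
    filter_upwards [eventually_norm_lt (L := L) hs] with z hz
    rw [hevZ z hz, ← mul_assoc, show (1 + z) * (1 + u) = 1 + (u + (1 + u) * z) by ring,
      ← hode _ (hw z hz)]
    ext i j : 1
    change ev z (eulerPS (g i j)) = ev _ (eulerPS (solAt c G i j))
    rw [ev_euler (hg i j) hz, ev_euler (hsol i j) (hw z hz), hder z hz]
    ring)
  rw [← hevZ v hv, key, evM_mul (PBM_solAt (by rwa [hx]) hs (by rwa [hx]) (by rwa [hx])) (PBM_C _)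
    hv, evM_C]
  congr 1
  rw [← evM_zero, hevZ 0 (by simpa using hs), mul_zero, add_zero]

end Solutions

/-! ## Taylor solutions as functions on disks -/

section SolFun

variable {K : Type u} [NormedField K] [IsUltrametricDist K] [CompleteSpace K] [CharZero K]
  {κ : BaseKind}
  {L : Type w} [NontriviallyNormedField L] [IsUltrametricDist L] [CompleteSpace L]
  [NormedAlgebra K L] {n : ℕ} {c x : L} {G : Matrix (Fin n) (Fin n) (BaseRing K κ)} {s τ : ℝ}

theorem SeqBound.nullFamily {ρ : ℝ} {a b : ℕ} {N : ℕ → Matrix (Fin a) (Fin b) (BaseRing K κ)}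
    (hN : ∀ k i j, ConvAt ρ (N k i j)) (hB : SeqBound ρ s N) {w : K} (hw : ‖w‖ < s)
    (i : Fin a) (j : Fin b) : NullFamily ρ fun k => w ^ k • N k i j := by
  have hs : 0 < s := (norm_nonneg w).trans_lt hw
  obtain ⟨B, hB0, hB⟩ := hB.exists_nonneg hs
  refine ⟨fun k => (hN k i j).smul _, fun k => B * (‖w‖ / s) ^ k, ?_, fun k => ?_⟩
  · have := (tendsto_pow_atTop_nhds_zero_of_lt_one (div_nonneg (norm_nonneg w) hs.le)
      ((div_lt_one hs).2 hw)).const_mul B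
    rwa [mul_zero] at this
  · refine ((hB k i j).smul (w ^ k)).mono (le_of_eq ?_)
    simp only [norm_pow, div_pow]
    ring

/-- The matrix of the action of `q` on the Taylor solutions: `A = ∑ (q - 1)^k N_k`. -/
def IsTaylorMat (q : K) (G A : Matrix (Fin n) (Fin n) (BaseRing K κ)) : Prop :=
  ∀ i j, IsCoeffSum (fun k => (q - 1) ^ k • binomMat G k i j) (A i j)

theorem IsTaylorMat.unique {q : K} {A A' : Matrix (Fin n) (Fin n) (BaseRing K κ)}
    (h : IsTaylorMat q G A) (h' : IsTaylorMat q G A') : A = A' := by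
  ext i j : 1
  exact (h i j).unique (h' i j)

theorem IsTaylorMat.convAt {ρ : ℝ} (hρ : 0 < ρ) {q : K}
    {A : Matrix (Fin n) (Fin n) (BaseRing K κ)} (h : IsTaylorMat q G A)
    (hG : ∀ i j, ConvAt ρ (G i j)) (hB : SeqBound ρ s (binomMat G)) (hq : ‖q - 1‖ < s)
    (i j : Fin n) : ConvAt ρ (A i j) :=
  (hB.nullFamily (ConvAt.binomMat hρ hG) hq i j).convAt hρ (h i j)

/-- The value `A(q,x)` is the Taylor solution based at `x`, evaluated at `qx`, whose relative
coordinate is `u = q - 1`. This links operators with solutions throughout. -/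
theorem IsTaylorMat.matEval_eq (hx : 0 < ‖x‖) {q : K}
    {A : Matrix (Fin n) (Fin n) (BaseRing K κ)} (h : IsTaylorMat q G A)
    (hG : ∀ i j, ConvAt ‖x‖ (G i j)) (hB : SeqBound ‖x‖ s (binomMat G)) (hq : ‖q - 1‖ < s) :
    matEval x A = evM (algebraMap K L (q - 1)) (solAt x G) := by
  ext i j : 1
  have h1 := (hB.nullFamily (ConvAt.binomMat hx hG) hq i j).hasSum_eval hx (h i j)
  refine (ev_eq_of_hasSum (h1.congr_fun fun k => ?_)).symm
  rw [eval_smul, coeff_solAt, map_pow, mul_comm]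

/-- The Taylor solution at `c`, as a function of the point. -/
def solFun (c : L) (G : Matrix (Fin n) (Fin n) (BaseRing K κ)) (x : L) : Matrix (Fin n) (Fin n) L :=
  evM (x / c - 1) (solAt c G)

theorem norm_div_sub_one (hc : 0 < ‖c‖) (x : L) : ‖x / c - 1‖ = ‖x - c‖ / ‖c‖ := by
  have hc0 : c ≠ 0 := norm_pos_iff.1 hc
  rw [← norm_div, sub_div, div_self hc0]

theorem norm_div_sub_one_lt (hc : 0 < ‖c‖) (h : ‖x - c‖ < s * ‖c‖) : ‖x / c - 1‖ < s := by
  rwa [norm_div_sub_one hc, div_lt_iff₀ hc]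

theorem one_add_mul_eq (hc : 0 < ‖c‖) (x : L) : (1 + (x / c - 1)) * c = x := by
  have hc0 : c ≠ 0 := norm_pos_iff.1 hc
  field_simp
  ring

theorem norm_eq_of_mem_disk (hc : 0 < ‖c‖) (hs : s ≤ 1) (h : ‖x - c‖ < s * ‖c‖) :
    ‖x‖ = ‖c‖ := by
  have h1 : ‖x - c‖ < ‖c‖ := h.trans_le (mul_le_of_le_one_left hc.le hs)
  have := IsUltrametricDist.norm_add_eq_max_of_norm_ne_norm (x := x - c) (y := c) h1.ne
  rw [sub_add_cancel] at this
  rw [this, max_eq_right h1.le]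

/-- The substitution `u = (x - c)/c` rescales radii by `|c|`: relative radius `τ` becomes radius `τ
|c|`. -/
theorem isAnalyticOnDisk_of_PBM (hc : 0 < ‖c‖) {F : Matrix (Fin n) (Fin n) (PowerSeries L)}
    (hF : ∀ s, 0 < s → s < τ → PBM s F) {Y : L → Matrix (Fin n) (Fin n) L}
    (hY : ∀ x, ‖x - c‖ < τ * ‖c‖ → Y x = evM (x / c - 1) F) :
    IsAnalyticOnDisk c (τ * ‖c‖) Y := by
  have hc0 : c ≠ 0 := norm_pos_iff.1 hc
  intro i j
  refine ⟨fun m => PowerSeries.coeff m (F i j) / c ^ m, fun s hs0 hs => ?_, fun x hx => ?_⟩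
  · have h1 : s / ‖c‖ < τ := (div_lt_iff₀ hc).2 hs
    obtain ⟨s', h2, h3⟩ := exists_between h1
    have h0 : 0 ≤ s / ‖c‖ := by positivity
    refine ((hF s' (h0.trans_lt h2) h3 i j).null h0 h2).congr fun m => ?_
    rw [norm_div, norm_pow, div_pow]
    ring
  · have h1 := norm_div_sub_one_lt hc hx
    obtain ⟨s', h2, h3⟩ := exists_between h1
    have h4 := (hF s' ((norm_nonneg _).trans_lt h2) h3 i j).hasSum h2
    rw [hY x hx]
    refine h4.congr_fun fun m => ?_
    have : x / c - 1 = (x - c) / c := by field_simp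
    rw [this, div_pow]
    ring

theorem solFun_self (hc : 0 < ‖c‖) : solFun c G c = 1 := by
  have hc0 : c ≠ 0 := norm_pos_iff.1 hc
  rw [solFun, div_self hc0, sub_self, evM_zero, solAt_coeff_zero]

theorem solFun_isAnalytic (hc : 0 < ‖c‖) (hG : ∀ i j, ConvAt ‖c‖ (G i j))
    (hB : ∀ s, 0 < s → s < τ → SeqBound ‖c‖ s (binomMat G)) :
    IsAnalyticOnDisk c (τ * ‖c‖) (solFun c G) :=
  isAnalyticOnDisk_of_PBM hc (fun s h0 h1 => PBM_solAt hc h0 hG (hB s h0 h1)) fun _ _ => rfl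

theorem matrix_hasSum {α : Type*} {F : α → Matrix (Fin n) (Fin n) L} {A : Matrix (Fin n) (Fin n) L} :
    HasSum F A ↔ ∀ i j, HasSum (fun a => F a i j) (A i j) :=
  ⟨fun h i j => h.map (Matrix.entryAddMonoidHom L i j) (continuous_id.matrix_elem i j),
    fun h => by
      have h1 : HasSum (fun a i => F a i) fun i => A i := Pi.hasSum.2 fun i => Pi.hasSum.2 (h i)
      exact h1⟩

theorem dTaylorTerm_eq (hc : 0 < ‖c‖) (hG : ∀ i j, ConvAt ‖c‖ (G i j)) (x : L) (m : ℕ)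
    (i j : Fin n) : dTaylorTerm G c x m i j =
      PowerSeries.coeff m (solAt c G i j) * (x / c - 1) ^ m := by
  have hc0 : c ≠ 0 := norm_pos_iff.1 hc
  have := charZero_of_algebra K L
  have hd : ∀ k i j, ConvAt ‖c‖ (dIter G k i j) := by
    intro k i j
    have h1 := binomMat_eq_dIter G k
    have h2 : dIter G k i j = (k.factorial : K) • (monomial (-(k : ℤ)) 1 * binomMat G k i j) := by
      rw [h1, Matrix.smul_apply, Matrix.map_apply, mul_smul_comm, smul_smul,
        mul_inv_cancel₀ (by exact_mod_cast k.factorial_ne_zero), one_smul, ← mul_assoc,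
        monomial_mul_monomial, neg_add_cancel, one_mul, monomial_zero_mul, one_smul]
    rw [h2]
    exact ((convAt_monomial _ _).mul hc (ConvAt.binomMat hc hG k i j)).smul _
  rw [dTaylorTerm, coeff_solAt, binomMat_eq_dIter, Matrix.smul_apply, Matrix.smul_apply,
    Matrix.map_apply, eval_smul, eval_mul hc (convAt_monomial _ _) (hd m i j), eval_monomial,
    show x / c - 1 = (x - c) / c by field_simp, div_pow, matEval, Matrix.map_apply, smul_eq_mul,
    map_inv₀, map_natCast, map_one, zpow_natCast]
  field_simp

theorem hasSum_dTaylorTerm (hc : 0 < ‖c‖) (hG : ∀ i j, ConvAt ‖c‖ (G i j))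
    (hB : ∀ s, 0 < s → s < τ → SeqBound ‖c‖ s (binomMat G)) (hx : ‖x - c‖ < τ * ‖c‖) :
    HasSum (dTaylorTerm G c x) (solFun c G x) := by
  rw [matrix_hasSum]
  intro i j
  obtain ⟨s', h2, h3⟩ := exists_between (norm_div_sub_one_lt hc hx)
  have h0 := (norm_nonneg _).trans_lt h2
  exact ((PBM_solAt hc h0 hG (hB s' h0 h3) i j).hasSum h2).congr_fun fun m =>
    dTaylorTerm_eq hc hG x m i j

/-- The cocycle identity `Y(y,c) = Y(y,x) Y(x,c)` in terms of points. Any point `x` of the disk is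
also a centre of it and satisfies `|x| = |c|`, so the same bounds hold at `x`. -/
theorem solFun_mul (hc : 0 < ‖c‖) (hτ : τ ≤ 1) (hG : ∀ i j, ConvAt ‖c‖ (G i j))
    (hB : ∀ s, 0 < s → s < τ → SeqBound ‖c‖ s (binomMat G)) (hx : ‖x - c‖ < τ * ‖c‖)
    {y : L} (hy : ‖y - c‖ < τ * ‖c‖) : solFun c G y = solFun x G y * solFun c G x := by
  have hc0 : c ≠ 0 := norm_pos_iff.1 hc
  have hxc := norm_eq_of_mem_disk hc hτ hx
  have hx0 : x ≠ 0 := norm_pos_iff.1 (hxc ▸ hc)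
  have hyx : ‖y - x‖ < τ * ‖x‖ := by
    rw [hxc, show y - x = (y - c) + (c - x) by ring]
    refine (IsUltrametricDist.norm_add_le_max _ _).trans_lt (max_lt hy ?_)
    rwa [norm_sub_rev]
  obtain ⟨s', h2, h3⟩ := exists_between (max_lt (norm_div_sub_one_lt hc hx)
    (norm_div_sub_one_lt (hxc ▸ hc) hyx))
  have h4 := (le_max_left _ _).trans_lt h2
  have h0 := (norm_nonneg _).trans_lt h4
  have key := solAt_cocycle hc h0 (h3.le.trans hτ) hG (hB s' h0 h3) h4
    ((le_max_right _ _).trans_lt h2)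
  rw [one_add_mul_eq hc] at key
  rw [solFun, solFun, solFun, ← key]
  congr 1
  field_simp
  ring

/-- The cocycle identity with `y = qx`: the factor `Y(qx,x)` is `A(q,x)`. -/
theorem solFun_q (hc : 0 < ‖c‖) (hτ : τ ≤ 1) (hG : ∀ i j, ConvAt ‖c‖ (G i j))
    (hB : ∀ s, 0 < s → s < τ → SeqBound ‖c‖ s (binomMat G)) (hx : ‖x - c‖ < τ * ‖c‖)
    {q : UnitGroup K} (hq : ‖(q : K) - 1‖ < τ) {A : Matrix (Fin n) (Fin n) (BaseRing K κ)}
    (hA : IsTaylorMat (q : K) G A) :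
    solFun c G (algebraMap K L (q : K) * x) = matEval x A * solFun c G x := by
  have hxc := norm_eq_of_mem_disk hc hτ hx
  have hx0 : x ≠ 0 := norm_pos_iff.1 (hxc ▸ hc)
  obtain ⟨s', h2, h3⟩ := exists_between hq
  have h0 := (norm_nonneg _).trans_lt h2
  have hqx : ‖algebraMap K L (q : K) * x - c‖ < τ * ‖c‖ := by
    rw [show algebraMap K L (q : K) * x - c = algebraMap K L ((q : K) - 1) * x + (x - c) by
      rw [map_sub, map_one]; ring]
    refine (IsUltrametricDist.norm_add_le_max _ _).trans_lt (max_lt ?_ hx)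
    rw [norm_mul, norm_algebraMap', hxc]
    exact mul_lt_mul_of_pos_right hq hc
  rw [solFun_mul hc hτ hG hB hx hqx, hA.matEval_eq (hxc ▸ hc) (hxc ▸ hG) (hxc ▸ hB s' h0 h3) h2,
    solFun]
  congr 2
  rw [mul_div_cancel_right₀ _ hx0, map_sub, map_one]

/-- The cocycle identity with `y = c`. -/
theorem solFun_inv_mul (hc : 0 < ‖c‖) (hτ : τ ≤ 1) (hG : ∀ i j, ConvAt ‖c‖ (G i j))
    (hB : ∀ s, 0 < s → s < τ → SeqBound ‖c‖ s (binomMat G)) (hx : ‖x - c‖ < τ * ‖c‖) :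
    solFun c G x * solFun x G c = 1 := by
  have h := solFun_mul hc hτ hG hB hx (y := c)
    (by rw [sub_self, norm_zero]; exact (norm_nonneg _).trans_lt hx)
  rw [solFun_self hc] at h
  exact mul_eq_one_comm.1 h.symm

/-- The inverse `Y(c,x) = ∑ N_k(x) (c/x - 1)^k` depends on `x` through its base point, so
analyticity is not visible from the series. Writing the `k`-th term as `x^{-k} N_k(x) (c - x)^k` and
Taylor expanding it at `c` gives a series of order at least `k` in `u = x/c - 1`; hence each
coefficient of the total is a finite sum. -/
theorem solFun_inv_isAnalytic (hc : 0 < ‖c‖) (hτ : τ ≤ 1) (hG : ∀ i j, ConvAt ‖c‖ (G i j))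
    (hB : ∀ s, 0 < s → s < τ → SeqBound ‖c‖ s (binomMat G)) :
    IsAnalyticOnDisk c (τ * ‖c‖) fun x => solFun x G c := by
  have hc0 : c ≠ 0 := norm_pos_iff.1 hc
  let f : ℕ → Fin n → Fin n → BaseRing K κ := fun k i j => monomial (-(k : ℤ)) 1 * binomMat G k i j
  have hf : ∀ k i j, ConvAt ‖c‖ (f k i j) := fun k i j =>
    (convAt_monomial _ _).mul hc (ConvAt.binomMat hc hG k i j)
  -- The expansion in `u` of `x^{-k} N_k(x) (c - x)^k`, using `c - x = -c u`.
  let ψ : ℕ → Fin n → Fin n → PowerSeries L := fun k i j =>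
    evalPS c (tay (f k i j)) * C ((-c) ^ k) * X ^ k
  have hψ : ∀ k i j l, l < k → PowerSeries.coeff l (ψ k i j) = 0 := fun k i j l hl => by
    simp only [ψ]
    rw [PowerSeries.coeff_mul_X_pow', if_neg (by omega)]
  have hψb : ∀ {s B : ℝ}, 0 < s → (∀ k i j, GaussLE ‖c‖ (B / s ^ k) (binomMat G k i j)) →
      ∀ k i j l, ‖PowerSeries.coeff l (ψ k i j)‖ ≤ B / s ^ k := by
    intro s B hs hBd k i j l
    have hB0 : 0 ≤ B / s ^ k := (hBd k i j).nonneg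
    rcases lt_or_ge l k with hl | hl
    · rwa [hψ k i j l hl, norm_zero]
    · simp only [ψ]
      rw [PowerSeries.coeff_mul_X_pow', if_pos hl, PowerSeries.coeff_mul_C, coeff_evalPS, tay,
        PowerSeries.coeff_mk, norm_mul, norm_pow, norm_neg]
      have h1 := gaussLE_monomial_mul hc (-(k : ℤ)) (hBd k i j)
      have h2 := GaussLE.norm_eval_le ((hf k i j).binomTheta hc (l - k))
        (h1.binomTheta hc (l - k))
      refine (mul_le_mul_of_nonneg_right h2 (by positivity)).trans (le_of_eq ?_)
      rw [zpow_neg, zpow_natCast]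
      have := pow_pos hc k
      field_simp
  -- The terms with `k > l` do not contribute to the coefficient of `u^l`.
  let F : Matrix (Fin n) (Fin n) (PowerSeries L) := Matrix.of fun i j =>
    mk fun l => ∑ k ∈ Finset.range (l + 1), PowerSeries.coeff l (ψ k i j)
  refine isAnalyticOnDisk_of_PBM hc (F := F) (fun s h0 h1 => ?_) fun x hx => ?_
  · intro i j
    obtain ⟨B, hB0, hBd⟩ := (hB s h0 h1).exists_nonneg h0
    refine ⟨B, fun l => ?_⟩
    rw [← le_div_iff₀ (by positivity)]
    simp only [F, Matrix.of_apply, PowerSeries.coeff_mk]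
    refine IsUltrametricDist.norm_sum_le_of_forall_le_of_nonneg (by positivity) fun k hk => ?_
    refine (hψb h0 hBd k i j l).trans ?_
    have hkl : k ≤ l := by simpa [Nat.lt_succ_iff] using hk
    -- The bound `B / s^k` with `k ≤ l` is at most `B / s^l` because `s ≤ 1`.
    exact div_le_div_of_nonneg_left hB0 (by positivity)
      (pow_le_pow_of_le_one h0.le (h1.le.trans hτ) hkl)
  · have hxc := norm_eq_of_mem_disk hc hτ hx
    have hx0 : x ≠ 0 := norm_pos_iff.1 (hxc ▸ hc)
    obtain ⟨s, h2, h3⟩ := exists_between (norm_div_sub_one_lt hc hx)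
    have h0 := (norm_nonneg _).trans_lt h2
    obtain ⟨B, hB0, hBd⟩ := (hB s h0 h3).exists_nonneg h0
    have hs1 : s ≤ 1 := h3.le.trans hτ
    set u := x / c - 1 with hu
    have hux : (1 + u) * c = x := one_add_mul_eq hc x
    have hcx : ‖c / x - 1‖ < s := by
      rw [norm_div_sub_one (hxc ▸ hc), norm_sub_rev, hxc, ← norm_div_sub_one hc]
      exact h2
    ext i j : 1
    have hsolx := (PBM_solAt (c := x) (hxc ▸ hc) h0 (hxc ▸ hG) (hxc ▸ hB s h0 h3) i j).hasSum hcx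
    rw [solFun]
    refine (ev_eq_of_hasSum (hasSum_swap (L := L)
      (F := fun k l => PowerSeries.coeff l (ψ k i j) * u ^ l) ?_ (fun k => ?_) hsolx
      fun l => ?_)).symm
    · refine tendsto_norm_uncurry (L := L) (F := fun k l => PowerSeries.coeff l (ψ k i j) * u ^ l)
        (c := fun k => B * (‖u‖ / s) ^ k) ?_ (fun k => ?_) fun k l => ?_
      · rw [Nat.cofinite_eq_atTop]
        have := (tendsto_pow_atTop_nhds_zero_of_lt_one (div_nonneg (norm_nonneg u) h0.le)
          ((div_lt_one h0).2 h2)).const_mul B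
        rwa [mul_zero] at this
      · refine PB.null_term (s := 1) ⟨B / s ^ k, fun l => ?_⟩ (h2.trans_le hs1)
        rw [one_pow, mul_one]
        exact hψb h0 hBd k i j l
      · rcases lt_or_ge l k with hl | hl
        · rw [hψ k i j l hl, zero_mul, norm_zero]
          positivity
        · rw [norm_mul, norm_pow, div_pow]
          calc ‖PowerSeries.coeff l (ψ k i j)‖ * ‖u‖ ^ l ≤ (B / s ^ k) * ‖u‖ ^ k :=
                mul_le_mul (hψb h0 hBd k i j l)
                  (pow_le_pow_of_le_one (norm_nonneg _) (h2.le.trans hs1) hl) (by positivity)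
                  (by positivity)
            _ = B * (‖u‖ ^ k / s ^ k) := by ring
    · have h4 : PB 1 (evalPS c (tay (f k i j))) := PB_evalPS_tay hc (hf k i j)
      have h5 : PB 1 ((X : PowerSeries L) ^ k) := ⟨1, fun l => by
        rw [PowerSeries.coeff_X_pow]
        split_ifs <;> simp⟩
      have h6 : ev u ((X : PowerSeries L) ^ k) = u ^ k := by
        rw [ev, tsum_eq_single k]
        · simp
        · intro l hl
          simp [PowerSeries.coeff_X_pow, hl]
      have hu1 : ‖u‖ < 1 := h2.trans_le hs1
      have h7 : ev u (ψ k i j) = PowerSeries.coeff k (solAt x G i j) * (c / x - 1) ^ k := by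
        simp only [ψ]
        rw [ev_mul (h4.mul (PB_C _) one_pos) h5 hu1, ev_mul h4 (PB_C _) hu1, ev_C, h6,
          ev_evalPS_tay hc (hf k i j) hu1, hux, coeff_solAt]
        simp only [f]
        rw [eval_mul (hxc ▸ hc) (convAt_monomial _ _)
          (ConvAt.binomMat (hxc ▸ hc) (hxc ▸ hG) k i j), eval_monomial, zpow_neg, zpow_natCast,
          map_one, one_mul]
        have h8 : (-c) * u = (c / x - 1) * x := by
          have e1 : (c / x - 1) * x = c - x := by field_simp
          rw [e1, hu]
          field_simp
          ring
        calc (x ^ k)⁻¹ * eval x (binomMat G k i j) * (-c) ^ k * u ^ k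
            = (x ^ k)⁻¹ * eval x (binomMat G k i j) * ((-c) * u) ^ k := by rw [mul_pow]; ring
          _ = eval x (binomMat G k i j) * (c / x - 1) ^ k := by
              rw [h8, mul_pow]
              field_simp
      rw [← h7]
      exact ((h4.mul (PB_C _) one_pos).mul h5 one_pos).hasSum hu1
    · simp only [F, Matrix.of_apply, PowerSeries.coeff_mk, Finset.sum_mul]
      refine hasSum_sum_of_ne_finset_zero fun k hk => ?_
      rw [hψ k i j l (by simpa [Nat.lt_succ_iff] using hk), zero_mul]

theorem solFun_hasDerivAt (hc : 0 < ‖c‖) (hτ : τ ≤ 1) (hG : ∀ i j, ConvAt ‖c‖ (G i j))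
    (hB : ∀ s, 0 < s → s < τ → SeqBound ‖c‖ s (binomMat G)) (hx : ‖x - c‖ < τ * ‖c‖)
    (i j : Fin n) : ∃ y' : L, HasDerivAt (fun z => solFun c G z i j) y' x ∧
      x * y' = (matEval x G * solFun c G x) i j := by
  have hc0 : c ≠ 0 := norm_pos_iff.1 hc
  obtain ⟨s, h2, h3⟩ := exists_between (norm_div_sub_one_lt hc hx)
  have h0 := (norm_nonneg _).trans_lt h2
  have hs1 := h3.le.trans hτ
  have hsol := PBM_solAt hc h0 hG (hB s h0 h3)
  have d1 := (hsol i j).hasDerivAt h2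
  have d2 : HasDerivAt (fun z => z / c - 1) (1 / c) x := by
    simpa using ((hasDerivAt_id x).div_const c).sub_const 1
  refine ⟨_, HasDerivAt.comp (h₂ := fun z => ev z (solAt c G i j)) x d1 d2, ?_⟩
  have hode := evM_mul (PBM_tay hc hG h0.le hs1) hsol h2
  rw [← euler_solAt hc hG, evM_tay hc hG (h2.trans_le hs1), one_add_mul_eq hc] at hode
  have h5 := congrFun (congrFun hode i) j
  rw [evM, Matrix.map_apply, Matrix.map_apply, ev_euler (hsol i j) h2] at h5
  refine Eq.trans ?_ h5
  field_simp
  ring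

end SolFun

/-! ## Generic points -/

section Generic

variable {K : Type u} [NormedField K] [IsUltrametricDist K] [CompleteSpace K] {κ : BaseKind}
  {Ω : Type w} [NontriviallyNormedField Ω] [IsUltrametricDist Ω] [CompleteSpace Ω]
  [NormedAlgebra K Ω] {ρ : ℝ} {t : Ω}

/-- A function which vanishes at a generic point is zero. -/
theorem IsGenericPoint.eq_zero (ht : IsGenericPoint K ρ t) (hρ : 0 < ρ) {f : BaseRing K κ}
    (hf : ConvAt ρ f) (h0 : eval t f = 0) : f = 0 := by
  classical
  obtain ⟨rfl, hP⟩ := ht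
  have ht0 : t ≠ 0 := norm_pos_iff.1 hρ
  by_contra hne
  obtain ⟨m, hm⟩ : ∃ m, f.coeff m ≠ 0 := by
    by_contra! hcon
    exact hne (BaseRing.ext (funext hcon))
  set d := ‖f.coeff m‖ * ‖t‖ ^ m with hd
  have hd0 : 0 < d := mul_pos (norm_pos_iff.2 hm) (zpow_pos hρ m)
  have hfin : {i : ℤ | ¬ ‖f.coeff i‖ * ‖t‖ ^ i < d / 2}.Finite :=
    Tendsto.eventually_lt_const (half_pos hd0) hf
  -- The finitely many indices whose terms have size at least half the nonzero term `d`. Since the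
  -- total is zero, the partial sum over `s` has norm at most `d/2`.
  set s := hfin.toFinset with hs
  have hmem : ∀ i, i ∈ s ↔ ¬ ‖f.coeff i‖ * ‖t‖ ^ i < d / 2 := fun i => by simp [hs]
  have hms : m ∈ s := by
    rw [hmem, not_lt]
    linarith
  set N : ℕ := s.sup Int.natAbs with hN
  have hNs : ∀ i ∈ s, 0 ≤ i + N := fun i hi => by
    have : i.natAbs ≤ N := Finset.le_sup (f := Int.natAbs) hi
    omega
  -- Multiplication by `T^N` clears the negative exponents. Genericity then bounds the value of the
  -- partial sum below by `d`, which exceeds `d/2`.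
  let P : Polynomial K := ∑ i ∈ s, Polynomial.monomial (i + N).toNat (f.coeff i)
  have hcoeff : P.coeff (m + N).toNat = f.coeff m := by
    simp only [P, Polynomial.finsetSum_coeff, Polynomial.coeff_monomial]
    rw [Finset.sum_eq_single m]
    · simp
    · intro i hi him
      rw [if_neg]
      have := hNs i hi
      have := hNs m hms
      omega
    · exact fun h => (h hms).elim
  have haeval : Polynomial.aeval t P =
      (∑ i ∈ s, algebraMap K Ω (f.coeff i) * t ^ i) * t ^ N := by
    simp only [P, map_sum, Polynomial.aeval_monomial, Finset.sum_mul]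
    refine Finset.sum_congr rfl fun i hi => ?_
    rw [mul_assoc, ← zpow_natCast t, ← zpow_natCast t N, ← zpow_add₀ ht0, Int.toNat_of_nonneg (hNs i hi)]
  have hrest : ‖∑ i ∈ s, algebraMap K Ω (f.coeff i) * t ^ i‖ ≤ d / 2 := by
    have h1 : HasSum (fun i : {i // i ∉ s} => algebraMap K Ω (f.coeff i) * t ^ (i : ℤ))
        (eval t f - ∑ i ∈ s, algebraMap K Ω (f.coeff i) * t ^ i) := by
      refine (s.hasSum_compl_iff (f := fun i => algebraMap K Ω (f.coeff i) * t ^ i)).2 ?_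
      rw [sub_add_cancel]
      exact ConvAt.hasSum_eval hf
    have h2 := norm_le_of_hasSum (by positivity) h1 (C := d / 2) fun i => by
      rw [norm_eval_term]
      have := i.2
      rw [hmem, not_not] at this
      exact this.le
    rwa [h0, zero_sub, norm_neg] at h2
  have h3 := hP P (m + N).toNat
  rw [hcoeff, haeval, norm_mul, norm_pow, ← zpow_natCast, Int.toNat_of_nonneg (hNs m hms),
    zpow_add₀ hρ.ne', zpow_natCast, ← mul_assoc] at h3
  have h4 := le_of_mul_le_mul_right h3 (pow_pos hρ N)
  linarith

theorem IsGenericPoint.matEval_injective {a b : ℕ} (ht : IsGenericPoint K ρ t) (hρ : 0 < ρ)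
    {A D : Matrix (Fin a) (Fin b) (BaseRing K κ)} (hA : ∀ i j, ConvAt ρ (A i j))
    (hD : ∀ i j, ConvAt ρ (D i j)) (h : A.map (eval t) = D.map (eval t)) : A = D := by
  ext i j : 1
  have h1 : ‖t‖ = ρ := ht.1
  refine sub_eq_zero.1 (ht.eq_zero hρ ((hA i j).sub hρ (hD i j)) ?_)
  rw [eval_sub (h1.symm ▸ hA i j) (h1.symm ▸ hD i j), sub_eq_zero]
  exact congrFun (congrFun h i) j

/-- The hypothesis says that `x` is residually transcendental, hence generic for radius `1`. A
polynomial rescaled by `T ↦ aT` and divided by a coefficient of maximal norm is covered by it. -/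
theorem isGenericPoint_mul (a : K) {x : Ω}
    (hx : ∀ P : Polynomial K, (∀ i, ‖P.coeff i‖ ≤ 1) → (∃ i, ‖P.coeff i‖ = 1) →
      ‖Polynomial.aeval x P‖ = 1) : IsGenericPoint K ‖a‖ (algebraMap K Ω a * x) := by
  have hx1 : ‖x‖ = 1 := by
    have := hx Polynomial.X (fun i => by
      rw [Polynomial.coeff_X]
      split_ifs <;> simp) ⟨1, by simp⟩
    simpa using this
  refine ⟨by rw [norm_mul, norm_algebraMap', hx1, mul_one], fun P i => ?_⟩
  set Q : Polynomial K := P.comp (Polynomial.C a * Polynomial.X) with hQ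
  have hcoeff : ∀ j, Q.coeff j = P.coeff j * a ^ j := fun j => by
    rw [hQ, Polynomial.comp_C_mul_X_coeff]
  have haeval : Polynomial.aeval (algebraMap K Ω a * x) P = Polynomial.aeval x Q := by
    rw [hQ, Polynomial.aeval_comp]
    simp
  rw [haeval, ← norm_pow, ← norm_mul, ← hcoeff]
  by_cases hQ0 : Q = 0
  · simp [hQ0]
  · obtain ⟨j, hj, hmax⟩ := Q.support.exists_max_image (fun j => ‖Q.coeff j‖)
      (Polynomial.nonempty_support_iff.2 hQ0)
    have hj0 : Q.coeff j ≠ 0 := Polynomial.mem_support_iff.1 hj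
    have hle : ∀ i, ‖Q.coeff i‖ ≤ ‖Q.coeff j‖ := fun i => by
      by_cases hi : i ∈ Q.support
      · exact hmax i hi
      · rw [Polynomial.notMem_support_iff.1 hi, norm_zero]
        exact norm_nonneg _
    have h1 := hx (Polynomial.C (Q.coeff j)⁻¹ * Q) (fun i => by
      rw [Polynomial.coeff_C_mul, norm_mul, norm_inv, inv_mul_le_iff₀ (norm_pos_iff.2 hj0), mul_one]
      exact hle i) ⟨j, by
      rw [Polynomial.coeff_C_mul, inv_mul_cancel₀ hj0, norm_one]⟩
    rw [map_mul, Polynomial.aeval_C, norm_mul, norm_algebraMap', norm_inv,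
      inv_mul_eq_one₀ (norm_ne_zero_iff.2 hj0)] at h1
    rw [← h1]
    exact hle i

/-- If no positive power of `|t|` is a value of `K`, the nonzero terms of a polynomial at `t` have
pairwise distinct norms, so the norm of the sum is the maximum of theirs. -/
theorem isGenericPoint_of_independent {t : Ω} (ht : 0 < ‖t‖)
    (h : ∀ (N : ℕ) (a : K), 0 < N → ‖t‖ ^ N ≠ ‖a‖) : IsGenericPoint K ‖t‖ t := by
  refine ⟨rfl, fun P i => ?_⟩
  by_cases hi : P.coeff i = 0
  · simp [hi]
  have hmem : i ∈ P.support := Polynomial.mem_support_iff.2 hi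
  have hpair : Set.Pairwise (P.support : Set ℕ)
      fun j k => ‖algebraMap K Ω (P.coeff j) * t ^ j‖ ≠ ‖algebraMap K Ω (P.coeff k) * t ^ k‖ := by
    have key : ∀ j k, j < k → P.coeff k ≠ 0 →
        ‖algebraMap K Ω (P.coeff j) * t ^ j‖ ≠ ‖algebraMap K Ω (P.coeff k) * t ^ k‖ := by
      intro j k hjk hk heq
      rw [norm_mul, norm_mul, norm_algebraMap', norm_algebraMap', norm_pow, norm_pow] at heq
      refine h (k - j) (P.coeff j / P.coeff k) (by omega) ?_
      rw [norm_div, eq_div_iff (norm_ne_zero_iff.2 hk)]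
      have h1 : ‖t‖ ^ k = ‖t‖ ^ (k - j) * ‖t‖ ^ j := by rw [← pow_add, Nat.sub_add_cancel hjk.le]
      rw [h1] at heq
      have := pow_pos ht j
      refine mul_right_cancel₀ this.ne' ?_
      rw [heq]
      ring
    intro j hj k hk hne
    rcases lt_or_gt_of_ne hne with hjk | hjk
    · exact key j k hjk (Polynomial.mem_support_iff.1 hk)
    · exact (key k j hjk (Polynomial.mem_support_iff.1 hj)).symm
  rw [Polynomial.aeval_eq_sum_range' (n := P.natDegree + 1) (Nat.lt_succ_self _)]
  have hsub : ∑ j ∈ Finset.range (P.natDegree + 1), P.coeff j • t ^ j =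
      ∑ j ∈ P.support, algebraMap K Ω (P.coeff j) * t ^ j := by
    simp only [Algebra.smul_def]
    refine (Finset.sum_subset Polynomial.supp_subset_range_natDegree_succ fun j _ hj => ?_).symm
    rw [Polynomial.notMem_support_iff.1 hj, map_zero, zero_mul]
  rw [hsub, IsUltrametricDist.norm_sum_eq_sup'_of_pairwise_ne ⟨i, hmem⟩ hpair]
  refine le_trans (le_of_eq ?_)
    (Finset.le_sup' (fun j => ‖algebraMap K Ω (P.coeff j) * t ^ j‖) hmem)
  rw [norm_mul, norm_algebraMap', norm_pow]

/-- Two sources of generic points: if `K` has a value in the annulus, a residually transcendental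
element is scaled to it; otherwise the value group of `K` is discrete, and almost every radius is
independent of it. -/
theorem exists_generic (hΩ : ∀ s : ℝ, 0 ≤ s → ∃ x : Ω, ‖x‖ = s)
    (hkΩ : ∃ x : Ω, ‖x‖ ≤ 1 ∧ ∀ P : Polynomial K, (∀ i, ‖P.coeff i‖ ≤ 1) →
      (∃ i, ‖P.coeff i‖ = 1) → ‖Polynomial.aeval x P‖ = 1)
    {ε : ℝ} (h0 : 0 < ε) (h1 : ε < 1) :
    ∃ ρ ∈ annulus κ ε, ∃ t : Ω, IsGenericPoint K ρ t := by
  obtain ⟨x, -, hx⟩ := hkΩ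
  by_cases hex : ∃ a : K, a ≠ 0 ∧ ‖a‖ ∈ annulus κ ε
  · obtain ⟨a, ha, hmem⟩ := hex
    exact ⟨_, hmem, _, isGenericPoint_mul a hx⟩
  push Not at hex
  have hsub : Set.Ioo (1 - ε) 1 ⊆ annulus κ ε := by
    cases κ
    · exact subset_rfl
    · exact Set.Ioo_subset_Ioo_right (by linarith)
  -- The logarithmic value group. If it is dense, `K` has a value in `]1-ε, 1[`, which lies in the
  -- annulus for both base rings, contrary to the present case.
  let H : AddSubgroup ℝ :=
    { carrier := {y | ∃ a : K, a ≠ 0 ∧ Real.log ‖a‖ = y}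
      zero_mem' := ⟨1, one_ne_zero, by simp⟩
      add_mem' := by
        rintro _ _ ⟨a, ha, rfl⟩ ⟨b, hb, rfl⟩
        exact ⟨a * b, mul_ne_zero ha hb, by
          rw [norm_mul, Real.log_mul (norm_ne_zero_iff.2 ha) (norm_ne_zero_iff.2 hb)]⟩
      neg_mem' := by
        rintro _ ⟨a, ha, rfl⟩
        exact ⟨a⁻¹, inv_ne_zero ha, by rw [norm_inv, Real.log_inv]⟩ }
  rcases H.dense_or_cyclic with hd | ⟨g, hg⟩
  · exfalso
    have hlog : Real.log (1 - ε) < 0 := Real.log_neg (by linarith) (by linarith)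
    obtain ⟨y, ⟨a, ha, rfl⟩, hy1, hy2⟩ := hd.exists_between hlog
    have hpos : 0 < ‖a‖ := norm_pos_iff.2 ha
    refine hex a ha (hsub ⟨?_, ?_⟩)
    · exact (Real.log_lt_log_iff (by linarith) hpos).1 hy1
    · exact (Real.log_neg_iff hpos).1 hy2
  -- With `H` generated by `g`, the radii having a positive power in the value group are among the
  -- countably many numbers `exp(zg/N)`; a radius avoiding them exists.
  · have hcount : (⋃ (N : ℕ) (z : ℤ), {Real.exp (z * g / N)}).Countable :=
      Set.countable_iUnion fun N => Set.countable_iUnion fun z => Set.countable_singleton _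
    obtain ⟨ρ, hρ1, hρ2⟩ := (hcount.dense_compl ℝ).exists_between (show 1 - ε < 1 by linarith)
    have hρ0 : 0 < ρ := by linarith [hρ2.1]
    obtain ⟨t, ht⟩ := hΩ ρ hρ0.le
    refine ⟨ρ, hsub hρ2, t, ?_⟩
    rw [← ht]
    refine isGenericPoint_of_independent (by rwa [ht]) fun N a hN heq => hρ1 ?_
    rw [ht] at heq
    have ha : a ≠ 0 := by
      rintro rfl
      rw [norm_zero] at heq
      exact (pow_pos hρ0 N).ne' heq
    have hmem : Real.log ‖a‖ ∈ H := ⟨a, ha, rfl⟩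
    rw [hg, AddSubgroup.mem_closure_singleton] at hmem
    obtain ⟨z, hz⟩ := hmem
    rw [← heq, Real.log_pow, zsmul_eq_mul] at hz
    have hN' : (N : ℝ) ≠ 0 := by exact_mod_cast hN.ne'
    simp only [Set.mem_iUnion, Set.mem_singleton_iff]
    refine ⟨N, z, ?_⟩
    rw [hz, mul_div_cancel_left₀ _ hN', Real.exp_log hρ0]

end Generic

/-! ## Newton interpolation at the points `q^i` -/

section NormBounds

variable {K : Type*} [NormedField K] [IsUltrametricDist K]

theorem norm_sub_le_max' (a b : K) : ‖a - b‖ ≤ max ‖a‖ ‖b‖ := by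
  simpa only [sub_eq_add_neg, norm_neg] using IsUltrametricDist.norm_add_le_max a (-b)

/-- Each `q^j` is congruent to `1` modulo `q - 1`, so `1 + q + ⋯ + q^{n-1}` is congruent to `n`. -/
theorem norm_geom_sum_sub_natCast_le {q : K} (hq : ‖q‖ = 1) (n : ℕ) :
    ‖∑ j ∈ Finset.range n, q ^ j - n‖ ≤ ‖q - 1‖ := by
  have h1 : ∀ j : ℕ, ‖q ^ j - 1‖ ≤ ‖q - 1‖ := fun j => by
    rw [← geom_sum_mul, norm_mul]
    refine mul_le_of_le_one_left (norm_nonneg _) ?_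
    refine IsUltrametricDist.norm_sum_le_of_forall_le_of_nonneg zero_le_one fun i _ => ?_
    rw [norm_pow, hq, one_pow]
  have h2 : ∑ j ∈ Finset.range n, q ^ j - n = ∑ j ∈ Finset.range n, (q ^ j - 1) := by
    rw [Finset.sum_sub_distrib]
    simp
  rw [h2]
  exact IsUltrametricDist.norm_sum_le_of_forall_le_of_nonneg (norm_nonneg _) fun i _ => h1 i

theorem norm_pow_sub_one_le {q : K} (hq : ‖q‖ = 1) (n : ℕ) : ‖q ^ n - 1‖ ≤ ‖q - 1‖ := by
  rw [← geom_sum_mul, norm_mul]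
  refine mul_le_of_le_one_left (norm_nonneg _) ?_
  refine IsUltrametricDist.norm_sum_le_of_forall_le_of_nonneg zero_le_one fun i _ => ?_
  rw [norm_pow, hq, one_pow]

theorem norm_pow_sub_one_le_max {q : K} (hq : ‖q‖ = 1) (n : ℕ) :
    ‖q ^ n - 1‖ ≤ max ‖(n : K)‖ ‖q - 1‖ * ‖q - 1‖ := by
  rw [← geom_sum_mul, norm_mul]
  refine mul_le_mul_of_nonneg_right ?_ (norm_nonneg _)
  have h1 := norm_geom_sum_sub_natCast_le hq n
  calc ‖∑ j ∈ Finset.range n, q ^ j‖ = ‖(n : K) + (∑ j ∈ Finset.range n, q ^ j - n)‖ := by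
        rw [add_sub_cancel]
    _ ≤ max ‖(n : K)‖ ‖∑ j ∈ Finset.range n, q ^ j - n‖ := IsUltrametricDist.norm_add_le_max _ _
    _ ≤ _ := max_le_max le_rfl h1

theorem norm_pow_sub_one_eq {q : K} (hq : ‖q‖ = 1) {n : ℕ} (h : ‖q - 1‖ < ‖(n : K)‖) :
    ‖q ^ n - 1‖ = ‖(n : K)‖ * ‖q - 1‖ := by
  rw [← geom_sum_mul, norm_mul]
  congr 1
  have h1 := norm_geom_sum_sub_natCast_le hq n
  have h2 := IsUltrametricDist.norm_add_eq_max_of_norm_ne_norm (x := (n : K))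
    (y := ∑ j ∈ Finset.range n, q ^ j - n) (h1.trans_lt h).ne'
  rw [add_sub_cancel] at h2
  rw [h2, max_eq_left (h1.trans_lt h).le]

/-- Raising to the `p`-th power contracts the distance to `1` by the factor `max(|p|, |q-1|) < 1`.
-/
theorem tendsto_pow_prime_pow {p : ℕ} (hp : ‖(p : K)‖ < 1) {q : K} (hq : ‖q‖ = 1)
    (hq1 : ‖q - 1‖ < 1) : Tendsto (fun k : ℕ => q ^ p ^ k - 1) atTop (𝓝 0) := by
  set r := max ‖(p : K)‖ ‖q - 1‖ with hr
  have hr1 : r < 1 := max_lt hp hq1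
  have hr0 : 0 ≤ r := (norm_nonneg _).trans (le_max_right _ _)
  have key : ∀ k : ℕ, ‖q ^ p ^ k - 1‖ ≤ r ^ k := by
    intro k
    induction k with
    | zero => simpa using hq1.le
    | succ k ih =>
      rw [pow_succ, pow_mul]
      refine (norm_pow_sub_one_le_max (by rw [norm_pow, hq, one_pow]) p).trans ?_
      rw [pow_succ, mul_comm (r ^ k)]
      exact mul_le_mul (max_le_max le_rfl (norm_pow_sub_one_le hq _)) ih (norm_nonneg _) hr0
  exact squeeze_zero_norm key (tendsto_pow_atTop_nhds_zero_of_lt_one hr0 hr1)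

end NormBounds

/-! ### Newton polynomials with nodes `q^i - 1`, and passage between Newton series and power series.
-/

section Newton

variable {K : Type u} [NormedField K] [IsUltrametricDist K]

open Polynomial in
/-- The Newton polynomial `∏_{i<m} (u - (q^i - 1))`. -/
def newtonPoly (q : K) (m : ℕ) : Polynomial K :=
  ∏ i ∈ Finset.range m, (Polynomial.X - Polynomial.C (q ^ i - 1))

/-- The coefficients of `u^k` with respect to the Newton polynomials. -/
def newtonCoeff (q : K) : ℕ → ℕ → K
  | 0, 0 => 1
  | 0, _ + 1 => 0
  | _ + 1, 0 => 0
  | k + 1, m + 1 => newtonCoeff q k m + (q ^ (m + 1) - 1) * newtonCoeff q k (m + 1)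

theorem newtonCoeff_eq_zero (q : K) {k m : ℕ} (h : k < m) : newtonCoeff q k m = 0 := by
  induction k generalizing m with
  | zero =>
    cases m with
    | zero => omega
    | succ m => rfl
  | succ k ih =>
    cases m with
    | zero => omega
    | succ m => rw [newtonCoeff, ih (by omega), ih (by omega), mul_zero, add_zero]

theorem X_pow_eq_sum_newtonPoly (q : K) (k : ℕ) : (Polynomial.X : Polynomial K) ^ k =
    ∑ m ∈ Finset.range (k + 1), Polynomial.C (newtonCoeff q k m) * newtonPoly q m := by
  induction k with
  | zero => simp [newtonCoeff, newtonPoly]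
  | succ k ih =>
    have h1 : ∀ m, Polynomial.X * newtonPoly q m =
        newtonPoly q (m + 1) + Polynomial.C (q ^ m - 1) * newtonPoly q m := fun m => by
      rw [newtonPoly, newtonPoly, Finset.prod_range_succ]
      ring
    have hz : ∀ m, m ∈ Finset.range (k + 1) →
        Polynomial.C (newtonCoeff q k m) * (Polynomial.C (q ^ m - 1) * newtonPoly q m) =
        Polynomial.C ((q ^ m - 1) * newtonCoeff q k m) * newtonPoly q m := fun m _ => by
      rw [map_mul]
      ring
    rw [pow_succ', ih, Finset.mul_sum, Finset.sum_range_succ' _ (k + 1)]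
    simp only [newtonCoeff, map_add, add_mul, Finset.sum_add_distrib, mul_left_comm Polynomial.X,
      h1, mul_add, map_zero, zero_mul, add_zero]
    congr 1
    rw [Finset.sum_congr rfl hz, Finset.sum_range_succ' _ k, Finset.sum_range_succ _ k,
      newtonCoeff_eq_zero q (Nat.lt_succ_self k)]
    simp

variable {q : K} {s : ℝ}

/-- For `|q-1| ≤ s` all nodes lie in `|u| ≤ s`, so the triangular change of basis from powers to
Newton polynomials does not increase norms weighted by `s^k`. The inverse change is bounded in
`norm_coeff_newtonPoly_le`; together they let bounds pass both ways. -/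
theorem norm_newtonCoeff_le (hq : ‖q‖ = 1) (hs : ‖q - 1‖ ≤ s) (k m : ℕ) :
    ‖newtonCoeff q k m‖ * s ^ m ≤ s ^ k := by
  have hs0 : 0 ≤ s := (norm_nonneg _).trans hs
  induction k generalizing m with
  | zero => cases m <;> simp [newtonCoeff]
  | succ k ih =>
    cases m with
    | zero => simp [newtonCoeff]; positivity
    | succ m =>
      rw [newtonCoeff]
      refine (mul_le_mul_of_nonneg_right (IsUltrametricDist.norm_add_le_max _ _)
        (by positivity)).trans ?_
      rw [max_mul_of_nonneg _ _ (by positivity)]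
      refine max_le ?_ ?_
      · rw [pow_succ, ← mul_assoc, pow_succ]
        exact mul_le_mul_of_nonneg_right (ih m) hs0
      · rw [norm_mul, mul_assoc, pow_succ s k, mul_comm (s ^ k)]
        exact mul_le_mul ((norm_pow_sub_one_le hq _).trans hs) (ih (m + 1)) (by positivity) hs0

theorem norm_coeff_newtonPoly_le (hq : ‖q‖ = 1) (hs : ‖q - 1‖ ≤ s) (m k : ℕ) :
    ‖(newtonPoly q m).coeff k‖ * s ^ k ≤ s ^ m := by
  have hs0 : 0 ≤ s := (norm_nonneg _).trans hs
  induction m generalizing k with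
  | zero =>
    rw [newtonPoly, Finset.range_zero, Finset.prod_empty, Polynomial.coeff_one]
    split_ifs with h
    · simp [h]
    · simp
  | succ m ih =>
    have h1 : newtonPoly q (m + 1) =
        Polynomial.X * newtonPoly q m - Polynomial.C (q ^ m - 1) * newtonPoly q m := by
      rw [newtonPoly, newtonPoly, Finset.prod_range_succ]
      ring
    have h2 : ∀ a : K, ‖a‖ ≤ s → ∀ k, ‖a * (newtonPoly q m).coeff k‖ * s ^ k ≤ s ^ (m + 1) :=
      fun a ha k => by
        rw [norm_mul, mul_assoc, pow_succ, mul_comm (s ^ m)]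
        exact mul_le_mul ha (ih k) (by positivity) hs0
    have h3 := h2 _ ((norm_pow_sub_one_le hq m).trans hs) k
    rw [h1, Polynomial.coeff_sub, Polynomial.coeff_C_mul]
    refine (mul_le_mul_of_nonneg_right (norm_sub_le_max' _ _)
      (by positivity)).trans ?_
    rw [max_mul_of_nonneg _ _ (by positivity)]
    refine max_le ?_ h3
    cases k with
    | zero => simp; positivity
    | succ k =>
      rw [Polynomial.coeff_X_mul, pow_succ, ← mul_assoc, pow_succ]
      exact mul_le_mul_of_nonneg_right (ih k) hs0

theorem coeff_newtonPoly_eq_zero (q : K) {m k : ℕ} (h : m < k) : (newtonPoly q m).coeff k = 0 := by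
  refine Polynomial.coeff_eq_zero_of_natDegree_lt ?_
  rw [newtonPoly, Polynomial.natDegree_finsetProd_X_sub_C_eq_card]
  simpa using h

variable {L : Type w} [NontriviallyNormedField L] [IsUltrametricDist L] [CompleteSpace L]
  [NormedAlgebra K L]

theorem aeval_newtonPoly (q : K) (m : ℕ) (u : L) : Polynomial.aeval u (newtonPoly q m) =
    ∏ i ∈ Finset.range m, (u - algebraMap K L (q ^ i - 1)) := by
  simp [newtonPoly, map_prod]

theorem aeval_newtonPoly_node_eq_zero (q : K) {m i : ℕ} (h : i < m) :
    Polynomial.aeval (algebraMap K L (q ^ i - 1)) (newtonPoly q m) = 0 := by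
  rw [aeval_newtonPoly]
  exact Finset.prod_eq_zero (Finset.mem_range.2 h) (sub_self _)

theorem aeval_newtonPoly_node_ne_zero (hroot : ∀ m : ℕ, 0 < m → q ^ m ≠ 1) (hq : q ≠ 0) (i : ℕ) :
    Polynomial.aeval (algebraMap K L (q ^ i - 1)) (newtonPoly q i) ≠ 0 := by
  rw [aeval_newtonPoly, Finset.prod_ne_zero_iff]
  intro j hj
  have hj' : j < i := Finset.mem_range.1 hj
  rw [← map_sub, map_ne_zero]
  intro h
  have h1 : q ^ i = q ^ j := by linear_combination h
  refine hroot (i - j) (by omega) ?_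
  rw [pow_sub₀ _ hq hj'.le, h1, mul_inv_cancel₀ (pow_ne_zero _ hq)]

theorem norm_aeval_newtonPoly_le (hq : ‖q‖ = 1) (hs : ‖q - 1‖ ≤ s) {u : L} (hu : ‖u‖ ≤ s)
    (m : ℕ) : ‖Polynomial.aeval u (newtonPoly q m)‖ ≤ s ^ m := by
  rw [aeval_newtonPoly, norm_prod]
  refine (Finset.prod_le_prod (fun i _ => norm_nonneg _) fun i _ => ?_).trans
    (le_of_eq (by rw [Finset.prod_const, Finset.card_range]))
  refine (norm_sub_le_max' _ _).trans (max_le hu ?_)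
  rw [norm_algebraMap']
  exact (norm_pow_sub_one_le hq i).trans hs

/-- Newton expansion of a bounded power series. -/
theorem PB.newton {f : PowerSeries L} (hf : PB s f) (hq : ‖q‖ = 1) (hs : ‖q - 1‖ < s) :
    ∃ b : ℕ → L,
      (∀ m, HasSum (fun k => algebraMap K L (newtonCoeff q k m) * PowerSeries.coeff k f) (b m)) ∧
      ∀ u : L, ‖u‖ < s → HasSum (fun m => Polynomial.aeval u (newtonPoly q m) * b m) (ev u f) := by
  have hs0 : 0 < s := (norm_nonneg _).trans_lt hs
  have hnull : ∀ m, Tendsto (fun k => ‖algebraMap K L (newtonCoeff q k m) *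
      PowerSeries.coeff k f‖) cofinite (𝓝 0) := by
    intro m
    obtain ⟨s', h1, h2⟩ := exists_between hs
    have hs' : 0 < s' := (norm_nonneg _).trans_lt h1
    rw [Nat.cofinite_eq_atTop]
    have h3 := (hf.null hs'.le h2).mul_const (s' ^ m)⁻¹
    rw [zero_mul] at h3
    refine squeeze_zero (fun k => norm_nonneg _) (fun k => ?_) h3
    rw [← div_eq_mul_inv, le_div_iff₀ (by positivity), norm_mul, norm_algebraMap', mul_right_comm,
      mul_comm ‖PowerSeries.coeff k f‖]
    exact mul_le_mul_of_nonneg_right (norm_newtonCoeff_le hq h1.le k m) (norm_nonneg _)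
  refine ⟨fun m => ∑' k, algebraMap K L (newtonCoeff q k m) * PowerSeries.coeff k f,
    fun m => (summable_of_norm_null (hnull m)).hasSum, fun u hu => ?_⟩
  obtain ⟨s', h1, h2⟩ := exists_between (max_lt hs hu)
  have hs1 := (le_max_left _ _).trans h1.le
  have hs2 := (le_max_right _ _).trans h1.le
  have hs' : 0 < s' := (norm_nonneg _).trans_lt ((le_max_left _ _).trans_lt h1)
  refine hasSum_swap (L := L) (F := fun k m => Polynomial.aeval u (newtonPoly q m) *
    (algebraMap K L (newtonCoeff q k m) * PowerSeries.coeff k f)) ?_ (fun k => ?_) (hf.hasSum hu)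
    fun m => ((summable_of_norm_null (hnull m)).hasSum).mul_left _
  · refine tendsto_norm_uncurry (L := L) (F := fun k m => Polynomial.aeval u (newtonPoly q m) *
      (algebraMap K L (newtonCoeff q k m) * PowerSeries.coeff k f))
      (c := fun k => ‖PowerSeries.coeff k f‖ * s' ^ k) ?_ (fun k => ?_) fun k m => ?_
    · rw [Nat.cofinite_eq_atTop]
      exact hf.null hs'.le h2
    · refine tendsto_nhds_of_eventually_eq ?_
      rw [Nat.cofinite_eq_atTop]
      filter_upwards [eventually_gt_atTop k] with m hm
      simp [newtonCoeff_eq_zero q hm]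
    · rw [norm_mul, norm_mul, norm_algebraMap']
      calc ‖Polynomial.aeval u (newtonPoly q m)‖ * (‖newtonCoeff q k m‖ *
            ‖PowerSeries.coeff k f‖)
          ≤ s' ^ m * (‖newtonCoeff q k m‖ * ‖PowerSeries.coeff k f‖) :=
            mul_le_mul_of_nonneg_right (norm_aeval_newtonPoly_le hq hs1 hs2 m) (by positivity)
        _ = ‖PowerSeries.coeff k f‖ * (‖newtonCoeff q k m‖ * s' ^ m) := by ring
        _ ≤ _ := mul_le_mul_of_nonneg_left (norm_newtonCoeff_le hq hs1 k m) (norm_nonneg _)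
  · have h3 := congrArg (Polynomial.aeval u) (X_pow_eq_sum_newtonPoly q k)
    rw [map_pow, Polynomial.aeval_X, map_sum] at h3
    rw [h3, Finset.mul_sum]
    have h4 : ∀ m ∈ Finset.range (k + 1), PowerSeries.coeff k f *
        Polynomial.aeval u (Polynomial.C (newtonCoeff q k m) * newtonPoly q m) =
        Polynomial.aeval u (newtonPoly q m) *
        (algebraMap K L (newtonCoeff q k m) * PowerSeries.coeff k f) := fun m _ => by
      rw [map_mul, Polynomial.aeval_C]
      ring
    rw [Finset.sum_congr rfl h4]
    refine hasSum_sum_of_ne_finset_zero fun m hm => ?_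
    have : k < m := by simpa using hm
    simp [newtonCoeff_eq_zero q this]

/-- The Newton coefficients are determined by the values at the nodes. -/
theorem PB.newton_of_nodes {f : PowerSeries L} (hf : PB s f) (hq : ‖q‖ = 1) (hs : ‖q - 1‖ < s)
    (hroot : ∀ m : ℕ, 0 < m → q ^ m ≠ 1) {P : ℕ → L}
    (hP : ∀ i : ℕ, ev (algebraMap K L (q ^ i - 1)) f =
      ∑ m ∈ Finset.range (i + 1), Polynomial.aeval (algebraMap K L (q ^ i - 1)) (newtonPoly q m) *
        P m) :
    (∀ m, HasSum (fun k => algebraMap K L (newtonCoeff q k m) * PowerSeries.coeff k f) (P m)) ∧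
      ∀ u : L, ‖u‖ < s → HasSum (fun m => Polynomial.aeval u (newtonPoly q m) * P m) (ev u f) := by
  obtain ⟨b, hb, hsum⟩ := hf.newton hq hs
  have hq0 : q ≠ 0 := norm_pos_iff.1 (by rw [hq]; exact one_pos)
  -- At the `i`-th node all Newton polynomials of degree above `i` vanish and the `i`-th does not,
  -- as the nodes are distinct. The coefficients are thus found one after the other.
  suffices hbP : b = P by
    subst hbP
    exact ⟨hb, hsum⟩
  funext i
  induction i using Nat.strong_induction_on with
  | _ i ih =>
    have hnode : ‖algebraMap K L (q ^ i - 1)‖ < s := by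
      rw [norm_algebraMap']
      exact (norm_pow_sub_one_le hq i).trans_lt hs
    have h1 := hsum _ hnode
    have h2 : HasSum (fun m => Polynomial.aeval (algebraMap K L (q ^ i - 1)) (newtonPoly q m) * b m)
        (∑ m ∈ Finset.range (i + 1),
          Polynomial.aeval (algebraMap K L (q ^ i - 1)) (newtonPoly q m) * b m) :=
      hasSum_sum_of_ne_finset_zero fun m hm => by
        rw [aeval_newtonPoly_node_eq_zero q (by simpa using hm), zero_mul]
    have h3 := (h2.unique h1).trans (hP i)
    rw [Finset.sum_range_succ, Finset.sum_range_succ, Finset.sum_congr rfl fun m hm => by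
      rw [ih m (Finset.mem_range.1 hm)]] at h3
    exact mul_left_cancel₀ (aeval_newtonPoly_node_ne_zero hroot hq0 i) (add_left_cancel h3)

/-- A Newton series with bounded coefficients is a bounded power series. -/
theorem exists_PB_of_newton {P : ℕ → L} {B : ℝ} (hP : ∀ m, ‖P m‖ * s ^ m ≤ B) (hq : ‖q‖ = 1)
    (hs : ‖q - 1‖ < s) : ∃ f : PowerSeries L, PB s f ∧
      (∀ k, HasSum (fun m => algebraMap K L ((newtonPoly q m).coeff k) * P m)
        (PowerSeries.coeff k f)) ∧
      ∀ u : L, ‖u‖ < s → HasSum (fun m => Polynomial.aeval u (newtonPoly q m) * P m) (ev u f) := by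
  have hs0 : 0 < s := (norm_nonneg _).trans_lt hs
  have hB0 : 0 ≤ B := le_trans (by positivity) (hP 0)
  have hPnull : ∀ x, 0 ≤ x → x < s → Tendsto (fun m => ‖P m‖ * x ^ m) atTop (𝓝 0) := by
    intro x h0 hx
    have := PB.null (f := PowerSeries.mk P) (s := s) ⟨B, fun k => by
      rw [PowerSeries.coeff_mk]; exact hP k⟩ h0 hx
    simpa only [PowerSeries.coeff_mk] using this
  have hterm : ∀ x, ‖q - 1‖ ≤ x → ∀ m k,
      ‖algebraMap K L ((newtonPoly q m).coeff k) * P m‖ * x ^ k ≤ ‖P m‖ * x ^ m := by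
    intro x hx m k
    rw [norm_mul, norm_algebraMap', mul_right_comm, mul_comm ‖P m‖]
    exact mul_le_mul_of_nonneg_right (norm_coeff_newtonPoly_le hq hx m k) (norm_nonneg _)
  have hsum : ∀ k, Summable fun m => algebraMap K L ((newtonPoly q m).coeff k) * P m := by
    intro k
    obtain ⟨x, h1, h2⟩ := exists_between hs
    have hx : 0 < x := (norm_nonneg _).trans_lt h1
    refine summable_of_norm_null ?_
    rw [Nat.cofinite_eq_atTop]
    have h3 := (hPnull x hx.le h2).mul_const (x ^ k)⁻¹
    rw [zero_mul] at h3
    refine squeeze_zero (fun m => norm_nonneg _) (fun m => ?_) h3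
    rw [← div_eq_mul_inv, le_div_iff₀ (by positivity)]
    exact hterm x h1.le m k
  refine ⟨PowerSeries.mk fun k => ∑' m, algebraMap K L ((newtonPoly q m).coeff k) * P m,
    ⟨B, fun k => ?_⟩, fun k => by rw [PowerSeries.coeff_mk]; exact (hsum k).hasSum, fun u hu => ?_⟩
  · rw [PowerSeries.coeff_mk, ← le_div_iff₀ (by positivity)]
    refine norm_le_of_hasSum (by positivity) (hsum k).hasSum fun m => ?_
    rw [le_div_iff₀ (by positivity)]
    exact (hterm s hs.le m k).trans (hP m)
  · obtain ⟨x, h1, h2⟩ := exists_between (max_lt hs hu)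
    have hs1 := (le_max_left _ _).trans h1.le
    have hs2 := (le_max_right _ _).trans h1.le
    have hx : 0 < x := (norm_nonneg _).trans_lt ((le_max_left _ _).trans_lt h1)
    have hWP : Summable fun m => Polynomial.aeval u (newtonPoly q m) * P m := by
      refine summable_of_norm_null ?_
      rw [Nat.cofinite_eq_atTop]
      refine squeeze_zero (fun m => norm_nonneg _) (fun m => ?_) (hPnull x hx.le h2)
      rw [norm_mul, mul_comm]
      exact mul_le_mul_of_nonneg_left (norm_aeval_newtonPoly_le hq hs1 hs2 m) (norm_nonneg _)
    have h5 : HasSum (fun k => (∑' m, algebraMap K L ((newtonPoly q m).coeff k) * P m) * u ^ k)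
        (∑' m, Polynomial.aeval u (newtonPoly q m) * P m) := by
      refine hasSum_swap (L := L) (F := fun m k => algebraMap K L ((newtonPoly q m).coeff k) * P m *
        u ^ k) ?_ (fun m => ?_) hWP.hasSum fun k => (hsum k).hasSum.mul_right _
      · refine tendsto_norm_uncurry (L := L) (F := fun m k =>
          algebraMap K L ((newtonPoly q m).coeff k) * P m * u ^ k)
          (c := fun m => ‖P m‖ * x ^ m) ?_ (fun m => ?_) fun m k => ?_
        · rw [Nat.cofinite_eq_atTop]
          exact hPnull x hx.le h2
        · refine tendsto_nhds_of_eventually_eq ?_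
          rw [Nat.cofinite_eq_atTop]
          filter_upwards [eventually_gt_atTop m] with k hk
          simp [coeff_newtonPoly_eq_zero q hk]
        · rw [norm_mul, norm_pow]
          refine le_trans ?_ (hterm x hs1 m k)
          gcongr
      · rw [Polynomial.aeval_eq_sum_range' (n := m + 1) (by
          rw [newtonPoly, Polynomial.natDegree_finsetProd_X_sub_C_eq_card]; simp), Finset.sum_mul]
        have h4 : ∀ k ∈ Finset.range (m + 1), (newtonPoly q m).coeff k • u ^ k * P m =
            algebraMap K L ((newtonPoly q m).coeff k) * P m * u ^ k := fun k _ => by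
          rw [Algebra.smul_def]
          ring
        rw [Finset.sum_congr rfl h4]
        refine hasSum_sum_of_ne_finset_zero fun k hk => ?_
        have : m < k := by simpa using hk
        simp [coeff_newtonPoly_eq_zero q this]
    have h6 : ev u (PowerSeries.mk fun k => ∑' m, algebraMap K L ((newtonPoly q m).coeff k) * P m)
        = ∑' m, Polynomial.aeval u (newtonPoly q m) * P m :=
      ev_eq_of_hasSum (by simpa only [PowerSeries.coeff_mk] using h5)
    rw [h6]
    exact hWP.hasSum

/-- The nodes `q^i - 1` accumulate at `0`. -/
theorem frequently_node {p : ℕ} (hp0 : 0 < p) (hp : ‖(p : K)‖ < 1) (hq : ‖q‖ = 1) (hq1 : ‖q - 1‖ < 1)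
    (hroot : ∀ m : ℕ, 0 < m → q ^ m ≠ 1) {Q : L → Prop}
    (h : ∀ i : ℕ, Q (algebraMap K L (q ^ i - 1))) : ∃ᶠ z in 𝓝[≠] (0 : L), Q z := by
  have h1 : Tendsto (fun k : ℕ => algebraMap K L (q ^ p ^ k - 1)) atTop (𝓝 0) := by
    have := ((algebraMapCLM K L).continuous.tendsto 0).comp (tendsto_pow_prime_pow hp hq hq1)
    rw [map_zero] at this
    exact this
  have h2 : Tendsto (fun k : ℕ => algebraMap K L (q ^ p ^ k - 1)) atTop (𝓝[≠] 0) := by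
    refine tendsto_nhdsWithin_iff.2 ⟨h1, Eventually.of_forall fun k => ?_⟩
    rw [Set.mem_compl_singleton_iff, map_ne_zero, sub_ne_zero]
    exact hroot _ (pow_pos hp0 k)
  exact h2.frequently (Eventually.of_forall fun k => h (p ^ k)).frequently

end Newton

/-! ## Taylor solutions of `q`-difference equations -/

section NodeValues

variable {L : Type*} [Field L] {n : ℕ}

/-- The value at the node `q^i - 1` of the Newton series with coefficients `P_m`. -/
def nodeVal (q : L) (P : ℕ → Matrix (Fin n) (Fin n) L) (i : ℕ) : Matrix (Fin n) (Fin n) L :=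
  ∑ m ∈ Finset.range (i + 1), (∏ j ∈ Finset.range m, (q ^ i - q ^ j)) • P m

theorem nodeVal_zero (q : L) (P : ℕ → Matrix (Fin n) (Fin n) L) : nodeVal q P 0 = P 0 := by
  simp [nodeVal]

/-- The hypothesis is the recursion satisfied by the values of `qMat`, with `P` taken at `c` and
`P'` at `qc`. The conclusion says `Y(q^{i+1} c, c) = Y(q^i · qc, qc) A(c)` for the finite Newton
sums, so no convergence is involved. -/
theorem nodeVal_succ {q : L} {P P' : ℕ → Matrix (Fin n) (Fin n) L} {A : Matrix (Fin n) (Fin n) L}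
    (h : ∀ m, P' m * A = q ^ m • P m + (q ^ m * (q ^ (m + 1) - 1)) • P (m + 1)) (i : ℕ) :
    nodeVal q P' i * A = nodeVal q P (i + 1) := by
  have h1 : ∀ m, ∏ j ∈ Finset.range (m + 1), (q ^ (i + 1) - q ^ j) =
      (q ^ (i + 1) - 1) * q ^ m * ∏ j ∈ Finset.range m, (q ^ i - q ^ j) := by
    intro m
    rw [Finset.prod_range_succ', pow_zero, mul_comm, mul_assoc]
    congr 1
    have : ∀ j ∈ Finset.range m, q ^ (i + 1) - q ^ (j + 1) = q * (q ^ i - q ^ j) := fun j _ => by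
      ring
    rw [Finset.prod_congr rfl this, Finset.prod_mul_distrib, Finset.prod_const, Finset.card_range]
  have h2 : ∏ j ∈ Finset.range (i + 1), (q ^ i - q ^ j) = 0 :=
    Finset.prod_eq_zero (Finset.self_mem_range_succ i) (sub_self _)
  set W : ℕ → L := fun m => ∏ j ∈ Finset.range m, (q ^ i - q ^ j) with hW
  have hWs : ∀ m, W (m + 1) = W m * (q ^ i - q ^ m) := fun m => Finset.prod_range_succ _ _
  rw [nodeVal, nodeVal, Finset.sum_range_succ' _ (i + 1), Finset.sum_mul]
  simp only [h1, Finset.prod_range_zero, one_smul]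
  -- Splits `q^m (q^{m+1} - 1) W_m` as `(q^{i+1} - 1) q^m W_m - q^{m+1} W_{m+1}`. The last terms
  -- telescope against `q^m W_m P_m`, leaving `P_0` since `W_{i+1} = 0`.
  have h3 : ∀ m ∈ Finset.range (i + 1), (W m • P' m) * A =
      (q ^ m * W m) • P m + ((q ^ (i + 1) - 1) * q ^ m * W m) • P (m + 1) -
        (q ^ (m + 1) * W (m + 1)) • P (m + 1) := fun m _ => by
    rw [Matrix.smul_mul, h, hWs, smul_add, smul_smul, smul_smul, add_sub_assoc, ← sub_smul]
    congr 2 <;> ring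
  rw [Finset.sum_congr rfl h3, Finset.sum_sub_distrib, Finset.sum_add_distrib,
    Finset.sum_range_succ' (fun m => (q ^ m * W m) • P m) i,
    Finset.sum_range_succ (fun m => (q ^ (m + 1) * W (m + 1)) • P (m + 1)) i]
  have h4 : W (i + 1) = 0 := h2
  rw [h4, mul_zero, zero_smul, add_zero]
  have h5 : W 0 = 1 := Finset.prod_range_zero _
  rw [h5, pow_zero, one_mul, one_smul]
  abel

end NodeValues

/-! ### The normalized iterates `T^m H_m / [m]_q^!` and the values of the `q`-Taylor solution at the
nodes. -/

section QMat

variable {K : Type u} [NormedField K] [IsUltrametricDist K] [CompleteSpace K] [CharZero K]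
  {κ : BaseKind} {n : ℕ} {q : UnitGroup K} {A : Matrix (Fin n) (Fin n) (BaseRing K κ)}

/-- The matrices `T^m H_m / [m]_q^!`. -/
def qMat (q : UnitGroup K) (A : Matrix (Fin n) (Fin n) (BaseRing K κ)) (m : ℕ) :
    Matrix (Fin n) (Fin n) (BaseRing K κ) :=
  (qFactorial (q : K) m)⁻¹ • (qIter q A m).map fun f => monomial (m : ℤ) 1 * f

theorem qMat_zero : qMat q A 0 = 1 := by
  ext i j : 1
  simp only [qMat, qIter, qFactorial, Finset.prod_range_zero, inv_one, one_smul, Matrix.map_apply,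
    monomial_zero_mul, Nat.cast_zero]

theorem pow_ne_one_of_not_isOfFinOrder (hq : ¬ IsOfFinOrder q) {m : ℕ} (hm : 0 < m) :
    (q : K) ^ m ≠ 1 := by
  intro h
  exact hq (isOfFinOrder_iff_pow_eq_one.2 ⟨m, hm, by ext; simpa using h⟩)

theorem qFactorial_succ (q : K) (m : ℕ) :
    qFactorial q (m + 1) = qFactorial q m * ∑ j ∈ Finset.range (m + 1), q ^ j :=
  Finset.prod_range_succ _ _

theorem geom_sum_ne_zero (hq : ¬ IsOfFinOrder q) (m : ℕ) :
    ∑ j ∈ Finset.range (m + 1), (q : K) ^ j ≠ 0 := by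
  intro h
  have h1 := geom_sum_mul (q : K) (m + 1)
  rw [h, zero_mul] at h1
  exact pow_ne_one_of_not_isOfFinOrder hq (Nat.succ_pos m) (sub_eq_zero.1 h1.symm)

theorem qFactorial_ne_zero (hq : ¬ IsOfFinOrder q) (m : ℕ) : qFactorial (q : K) m ≠ 0 :=
  Finset.prod_ne_zero_iff.2 fun i _ => geom_sum_ne_zero hq i

theorem sub_one_ne_zero (hq : ¬ IsOfFinOrder q) : (q : K) - 1 ≠ 0 := by
  have := pow_ne_one_of_not_isOfFinOrder hq one_pos
  rwa [pow_one, ← sub_ne_zero] at this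

/-- The recursion for `H_{m+1}` multiplied by `(q-1) T`, which clears the denominators of `d_q` and
of `H_1`. -/
theorem qIter_sigma_mul (hq : ¬ IsOfFinOrder q) (m : ℕ) : (qIter q A m).map (sigma q) * A =
    qIter q A m + (qIter q A (m + 1)).map fun f => monomial 1 ((q : K) - 1) * f := by
  have h1 := sub_one_ne_zero hq
  have hid : ∀ f : BaseRing K κ, monomial 1 ((q : K) - 1) * (monomial (-1) ((q : K) - 1)⁻¹ * f) = f :=
    fun f => by
      rw [← mul_assoc, monomial_mul_monomial, mul_inv_cancel₀ h1, add_neg_cancel]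
      exact one_mul f
  ext i j : 1
  simp only [qIter, Matrix.map_apply, Matrix.add_apply, Matrix.mul_apply, mul_add, dq, hid,
    Finset.mul_sum]
  have h2 : ∀ l, monomial 1 ((q : K) - 1) * (sigma q (qIter q A m i l) *
      (monomial (-1) ((q : K) - 1)⁻¹ * (A - 1) l j)) =
      sigma q (qIter q A m i l) * A l j - sigma q (qIter q A m i l) * (1 : Matrix _ _ _) l j :=
    fun l => by
      rw [← mul_sub, ← Matrix.sub_apply, ← hid ((A - 1) l j)]
      simp only [mul_left_comm, hid]
  simp only [h2, Finset.sum_sub_distrib]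
  have h3 : ∑ l, sigma q (qIter q A m i l) * (1 : Matrix (Fin n) (Fin n) (BaseRing K κ)) l j =
      sigma q (qIter q A m i j) := by
    simp [Matrix.one_apply]
  rw [h3]
  ring

/-- Normalization of the preceding identity, using `σ_q(T^m) = q^m T^m` and `(q-1)(1 + ⋯ + q^m) =
q^{m+1} - 1`. -/
theorem qMat_sigma_mul (hq : ¬ IsOfFinOrder q) (m : ℕ) : (qMat q A m).map (sigma q) * A =
    (q : K) ^ m • qMat q A m + ((q : K) ^ m * ((q : K) ^ (m + 1) - 1)) • qMat q A (m + 1) := by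
  have h1 := qIter_sigma_mul (A := A) hq m
  have h0 := qFactorial_ne_zero hq m
  have hg := geom_sum_ne_zero hq m
  have h2 : (qMat q A m).map (sigma q) = ((q : K) ^ m * (qFactorial (q : K) m)⁻¹) •
      ((qIter q A m).map (sigma q)).map fun f => monomial (m : ℤ) 1 * f := by
    ext i j : 1
    simp only [qMat, Matrix.map_apply, Matrix.smul_apply, sigma_smul, map_mul, sigma_monomial,
      mul_one, zpow_natCast]
    rw [monomial_mul_eq_smul, smul_smul, mul_comm]
  have h3 : (((qIter q A m).map (sigma q)).map fun f => monomial (m : ℤ) 1 * f) * A =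
      ((qIter q A m).map (sigma q) * A).map fun f => monomial (m : ℤ) 1 * f := by
    ext i j : 1
    simp only [Matrix.map_apply, Matrix.mul_apply, Finset.mul_sum, mul_assoc]
  rw [h2, Matrix.smul_mul, h3, h1]
  ext i j : 1
  simp only [qMat, Matrix.map_apply, Matrix.smul_apply, Matrix.add_apply, mul_add, smul_add,
    smul_smul, qFactorial_succ, ← mul_assoc, monomial_mul_monomial, one_mul]
  congr 1
  rw [monomial_mul_eq_smul ((m : ℤ) + 1), smul_smul, Nat.cast_succ]
  congr 1
  have hgs := geom_sum_mul (q : K) (m + 1)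
  rw [← hgs]
  field_simp

theorem ConvAt.qMat {ρ : ℝ} (hρ : 0 < ρ) (hA : ∀ i j, ConvAt ρ (A i j)) (m : ℕ) (i j : Fin n) :
    ConvAt ρ (qMat q A m i j) := by
  have h : ∀ i j, ConvAt ρ (qIter q A m i j) := by
    induction m with
    | zero =>
      intro i j
      rw [qIter, Matrix.one_apply]
      split_ifs
      · exact convAt_one
      · exact convAt_zero
    | succ m ih =>
      intro i j
      rw [qIter, Matrix.add_apply, Matrix.mul_apply]
      refine ConvAt.add hρ (ConvAt.mul hρ (convAt_monomial _ _) (((ih i j).sigma q).sub hρ (ih i j)))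
        (ConvAt.sum hρ fun l _ => ConvAt.mul hρ ((ih i l).sigma q)
          (ConvAt.mul hρ (convAt_monomial _ _) (ConvAt.sub hρ (hA l j) ?_)))
      rw [Matrix.one_apply]
      split_ifs
      · exact convAt_one
      · exact convAt_zero
  exact ConvAt.smul _ (ConvAt.mul hρ (convAt_monomial _ _) (h i j))

variable {L : Type w} [NontriviallyNormedField L] [IsUltrametricDist L] [CompleteSpace L]
  [NormedAlgebra K L] {c : L}

theorem matEval_add_smul {F H : Matrix (Fin n) (Fin n) (BaseRing K κ)}
    (hF : ∀ i j, ConvAt ‖c‖ (F i j)) (hH : ∀ i j, ConvAt ‖c‖ (H i j)) (a b : K) :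
    matEval c (a • F + b • H) = algebraMap K L a • matEval c F + algebraMap K L b • matEval c H := by
  ext i j : 1
  simp only [matEval, Matrix.map_apply, Matrix.add_apply, Matrix.smul_apply, smul_eq_mul]
  rw [eval_add ((hF i j).smul a) ((hH i j).smul b), eval_smul, eval_smul]

theorem matEval_sigma (F : Matrix (Fin n) (Fin n) (BaseRing K κ)) :
    matEval c (F.map (sigma q)) = matEval (algebraMap K L (q : K) * c) F := by
  ext i j : 1
  exact eval_sigma q _

theorem matEval_qMat_mul (hq : ¬ IsOfFinOrder q) (hc : 0 < ‖c‖) (hA : ∀ i j, ConvAt ‖c‖ (A i j))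
    (m : ℕ) : matEval (algebraMap K L (q : K) * c) (qMat q A m) * matEval c A =
      algebraMap K L (q : K) ^ m • matEval c (qMat q A m) + (algebraMap K L (q : K) ^ m *
        (algebraMap K L (q : K) ^ (m + 1) - 1)) • matEval c (qMat q A (m + 1)) := by
  have hP := fun m => ConvAt.qMat (q := q) hc hA m
  rw [← matEval_sigma]
  have h1 := matEval_mul (A := (qMat q A m).map (sigma q)) (D := A) hc
    (fun i j => (hP m i j).sigma q) hA
  refine Eq.trans h1.symm ?_
  rw [qMat_sigma_mul hq]
  refine (matEval_add_smul (hP m) (hP (m + 1)) _ _).trans ?_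
  simp only [map_mul, map_sub, map_pow, map_one]

/-- The value of the `m`-th Newton polynomial at the `i`-th node. -/
theorem aeval_newtonPoly_node (q : K) (i m : ℕ) :
    Polynomial.aeval (algebraMap K L (q ^ i - 1)) (newtonPoly q m) =
      ∏ j ∈ Finset.range m, (algebraMap K L q ^ i - algebraMap K L q ^ j) := by
  rw [aeval_newtonPoly]
  refine Finset.prod_congr rfl fun j _ => ?_
  simp only [map_sub, map_pow, map_one]
  ring

/-- The values at the nodes of the `q`-Taylor solution of `σ_q(Y) = A Y` at `c`. -/
def qNode (q : UnitGroup K) (A : Matrix (Fin n) (Fin n) (BaseRing K κ)) (c : L) (i : ℕ) :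
    Matrix (Fin n) (Fin n) L :=
  nodeVal (algebraMap K L (q : K)) (fun m => matEval c (qMat q A m)) i

theorem qNode_zero : qNode q A c 0 = 1 := by
  rw [qNode, nodeVal_zero, qMat_zero, matEval_one]

theorem qNode_succ (hq : ¬ IsOfFinOrder q) (hc : 0 < ‖c‖) (hA : ∀ i j, ConvAt ‖c‖ (A i j)) (i : ℕ) :
    qNode q A c (i + 1) = qNode q A (algebraMap K L (q : K) * c) i * matEval c A :=
  (nodeVal_succ (matEval_qMat_mul hq hc hA) i).symm

/-- The discrete cocycle identity: `qNode q A c i` is the product of the values of `A` along `c, qc,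
…, q^{i-1} c`, by iteration of `qNode_succ`. -/
theorem qNode_add (hq : ¬ IsOfFinOrder q) (hc : 0 < ‖c‖) (hA : ∀ i j, ConvAt ‖c‖ (A i j)) (i j : ℕ) :
    qNode q A c (i + j) = qNode q A (algebraMap K L (q : K) ^ i * c) j * qNode q A c i := by
  induction i generalizing c with
  | zero => rw [zero_add, pow_zero, one_mul, qNode_zero, mul_one]
  | succ i ih =>
    have hc' := norm_algebraMap_mul (L := L) q c
    rw [add_right_comm, qNode_succ hq hc hA, ih (by rwa [hc']) (by rwa [hc']), qNode_succ hq hc hA,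
      Matrix.mul_assoc, pow_succ, mul_assoc]

theorem qNode_apply (q : UnitGroup K) (A : Matrix (Fin n) (Fin n) (BaseRing K κ)) (c : L) (i : ℕ)
    (a b : Fin n) : qNode q A c i a b = ∑ m ∈ Finset.range (i + 1),
      Polynomial.aeval (algebraMap K L ((q : K) ^ i - 1)) (newtonPoly (q : K) m) *
        eval c (qMat q A m a b) := by
  rw [qNode, nodeVal, Matrix.sum_apply]
  refine Finset.sum_congr rfl fun m _ => ?_
  rw [aeval_newtonPoly_node]
  rfl

theorem norm_unit (q : UnitGroup K) : ‖(q : K)‖ = 1 := by simp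

/-- The `q`-Taylor terms in terms of Newton polynomials. -/
theorem qTaylorTerm_apply (hc : 0 < ‖c‖) (x : L) (m : ℕ)
    (i j : Fin n) : qTaylorTerm q A c x m i j =
      Polynomial.aeval (x / c - 1) (newtonPoly (q : K) m) * eval c (qMat q A m i j) := by
  have hc0 : c ≠ 0 := norm_pos_iff.1 hc
  -- Multiplication by a monomial only shifts the summation index, so this needs no convergence of
  -- `f` at `c`.
  have h1 : ∀ f : BaseRing K κ, eval c (monomial (m : ℤ) 1 * f) = c ^ m * eval c f := by
    intro f
    have h2 : ∀ l : ℤ, algebraMap K L ((monomial (m : ℤ) 1 * f).coeff l) * c ^ l =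
        c ^ m * (algebraMap K L (f.coeff (l - m)) * c ^ (l - m)) := fun l => by
      rw [coeff_monomial_mul, one_mul, zpow_sub₀ hc0, zpow_natCast]
      field_simp
    rw [BaseRing.eval, BaseRing.eval, ← tsum_mul_left]
    exact (tsum_congr h2).trans ((Equiv.subRight (m : ℤ)).tsum_eq
      fun l => c ^ m * (algebraMap K L (f.coeff l) * c ^ l))
  rw [qTaylorTerm, Matrix.smul_apply, qMat, Matrix.smul_apply, eval_smul, Matrix.map_apply, h1,
    aeval_newtonPoly, matEval, Matrix.map_apply, smul_eq_mul, map_inv₀]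
  have h3 : ∏ l ∈ Finset.range m, (x - algebraMap K L (q : K) ^ l * c) =
      (∏ l ∈ Finset.range m, (x / c - 1 - algebraMap K L ((q : K) ^ l - 1))) * c ^ m := by
    rw [← Finset.card_range m, ← Finset.prod_const, Finset.card_range, ← Finset.prod_mul_distrib]
    refine Finset.prod_congr rfl fun l _ => ?_
    simp only [map_sub, map_pow, map_one]
    field_simp
    ring
  rw [h3]
  ring

end QMat

/-! ## Comparison of differential and `q`-difference equations -/

/-! ### Node values, Newton coefficients, and the transfer of Gauss bounds in both directions. -/

section Compare

variable {K : Type u} [NormedField K] [IsUltrametricDist K] [CompleteSpace K] [CharZero K]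
  {κ : BaseKind} {n : ℕ} {q : UnitGroup K} {A G : Matrix (Fin n) (Fin n) (BaseRing K κ)} {s : ℝ}
  {L : Type w} [NontriviallyNormedField L] [IsUltrametricDist L] [CompleteSpace L]
  [NormedAlgebra K L] {c : L}

/-- The chain rule at `v = 0`. -/
theorem PB.coeff_one_reexpand {f g : PowerSeries L} (hf : PB s f) (hg : PB s g) {u l : L}
    (hu : ‖u‖ < s) (h : ∀ v : L, ‖v‖ < s → ev v g = ev (u + l * v) f) :
    PowerSeries.coeff 1 g = l * ev u (PowerSeries.derivative L f) := by
  have hs : 0 < s := (norm_nonneg u).trans_lt hu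
  have h0 : ‖(0 : L)‖ < s := by rwa [norm_zero]
  have h1 := hg.hasDerivAt h0
  have h2 : HasDerivAt (fun v : L => u + l * v) l 0 := by
    simpa using ((hasDerivAt_id (0 : L)).const_mul l).const_add u
  have h3 : HasDerivAt (fun z => ev z f) (ev u (PowerSeries.derivative L f)) (u + l * 0) := by
    rw [mul_zero, add_zero]
    exact hf.hasDerivAt hu
  have h4 := h3.comp (0 : L) h2
  have h5 : (fun v : L => ev v g) =ᶠ[𝓝 0] (fun z => ev z f) ∘ fun v => u + l * v := by
    filter_upwards [Metric.ball_mem_nhds (0 : L) hs] with v hv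
    exact h v (by simpa using hv)
  have h6 := h1.unique (h4.congr_of_eventuallyEq h5)
  rw [ev_at_zero, PowerSeries.coeff_derivative] at h6
  simpa [mul_comm] using h6

theorem algebraMap_pow_sub_one (q : K) (i : ℕ) :
    algebraMap K L (q ^ i - 1) = algebraMap K L q ^ i - 1 := by
  rw [map_sub, map_pow, map_one]

/-- The values of the Taylor solution of the differential equation at the nodes `q^i - 1`. -/
theorem evM_solAt_node (hq : ¬ IsOfFinOrder q) (hc : 0 < ‖c‖) (hs1 : s ≤ 1)
    (hG : ∀ i j, ConvAt ‖c‖ (G i j)) (hB : SeqBound ‖c‖ s (binomMat G)) (hqs : ‖(q : K) - 1‖ < s)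
    (hA : IsTaylorMat (q : K) G A) (i : ℕ) :
    evM (algebraMap K L ((q : K) ^ i - 1)) (solAt c G) = qNode q A c i := by
  have hs : 0 < s := (norm_nonneg _).trans_lt hqs
  induction i generalizing c with
  | zero => rw [pow_zero, sub_self, map_zero, evM_zero, solAt_coeff_zero, qNode_zero]
  | succ i ih =>
    have hc' := norm_algebraMap_mul (L := L) q c
    have hAc := hA.convAt hc hG hB hqs
    -- The cocycle identity through `qc`: the base point moves from `c` to `qc`, which is why the
    -- induction is general in `c`. It matches `qNode_succ`.
    have h1 := solAt_cocycle hc hs hs1 hG hB (u := algebraMap K L ((q : K) - 1))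
      (v := algebraMap K L ((q : K) ^ i - 1)) (by rwa [norm_algebraMap'])
      (by rw [norm_algebraMap']; exact (norm_pow_sub_one_le (norm_unit q) i).trans_lt hqs)
    have h2 : 1 + algebraMap K L ((q : K) - 1) = algebraMap K L (q : K) := by
      rw [map_sub, map_one]
      ring
    have h3 : algebraMap K L ((q : K) - 1) + algebraMap K L (q : K) *
        algebraMap K L ((q : K) ^ i - 1) = algebraMap K L ((q : K) ^ (i + 1) - 1) := by
      simp only [map_sub, map_one, map_pow]
      ring
    rw [h2, h3, ih (by rwa [hc']) (by rwa [hc']) (by rwa [hc']), ← hA.matEval_eq hc hG hB hqs] at h1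
    rw [h1, qNode_succ hq hc hAc]

/-- The Taylor solution of the differential equation is the `q`-Taylor solution of the
`q`-difference equation that it satisfies. -/
theorem newton_solAt (hq : ¬ IsOfFinOrder q) (hc : 0 < ‖c‖) (hs1 : s ≤ 1)
    (hG : ∀ i j, ConvAt ‖c‖ (G i j)) (hB : SeqBound ‖c‖ s (binomMat G)) (hqs : ‖(q : K) - 1‖ < s)
    (hA : IsTaylorMat (q : K) G A) (i j : Fin n) :
    (∀ m, HasSum (fun k => algebraMap K L (newtonCoeff (q : K) k m) * eval c (binomMat G k i j))
      (eval c (qMat q A m i j))) ∧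
    ∀ u : L, ‖u‖ < s → HasSum (fun m => Polynomial.aeval u (newtonPoly (q : K) m) *
      eval c (qMat q A m i j)) (evM u (solAt c G) i j) := by
  have hs : 0 < s := (norm_nonneg _).trans_lt hqs
  have h := (PBM_solAt hc hs hG hB i j).newton_of_nodes (norm_unit q) hqs
    (fun m hm => pow_ne_one_of_not_isOfFinOrder hq hm) (P := fun m => eval c (qMat q A m i j))
    fun l => by
      have h1 := evM_solAt_node hq hc hs1 hG hB hqs hA l
      rw [← qNode_apply, ← h1]
      rfl
  simp only [coeff_solAt] at h
  exact h

theorem hasSum_qTaylorTerm {τ : ℝ} (hq : ¬ IsOfFinOrder q) (hc : 0 < ‖c‖) (hτ : τ ≤ 1)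
    (hG : ∀ i j, ConvAt ‖c‖ (G i j)) (hB : ∀ s, 0 < s → s < τ → SeqBound ‖c‖ s (binomMat G))
    (hqs : ‖(q : K) - 1‖ < τ) (hA : IsTaylorMat (q : K) G A) {x : L} (hx : ‖x - c‖ < τ * ‖c‖) :
    HasSum (qTaylorTerm q A c x) (solFun c G x) := by
  rw [matrix_hasSum]
  intro i j
  obtain ⟨s', h2, h3⟩ := exists_between (max_lt hqs (norm_div_sub_one_lt hc hx))
  have h4 := (le_max_left _ _).trans_lt h2
  simp only [qTaylorTerm_apply hc]
  exact (newton_solAt hq hc (h3.le.trans hτ) hG (hB s' ((norm_nonneg _).trans_lt h4) h3) h4 hA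
    i j).2 _ ((le_max_right _ _).trans_lt h2)

/-- An intermediate radius `s'` between `|q-1|` and `s` gives the geometric factor `(s'/s)^k`. -/
theorem nullFamily_newtonCoeff {ρ : ℝ} (hG : ∀ k i j, ConvAt ρ (binomMat G k i j))
    (hB : SeqBound ρ s (binomMat G)) (hqs : ‖(q : K) - 1‖ < s) (m : ℕ) (i j : Fin n) :
    NullFamily ρ fun k => newtonCoeff (q : K) k m • binomMat G k i j := by
  obtain ⟨s', h1, h2⟩ := exists_between hqs
  have hs' : 0 < s' := (norm_nonneg _).trans_lt h1
  have hs := hs'.trans h2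
  obtain ⟨C, hC0, hC⟩ := hB.exists_nonneg hs
  refine ⟨fun k => (hG k i j).smul _, fun k => C / s' ^ m * (s' / s) ^ k, ?_, fun k => ?_⟩
  · have := (tendsto_pow_atTop_nhds_zero_of_lt_one (by positivity) ((div_lt_one hs).2 h2)).const_mul
      (C / s' ^ m)
    rwa [mul_zero] at this
  · refine ((hC k i j).smul _).mono ?_
    have h3 := norm_newtonCoeff_le (norm_unit q) h1.le k m
    rw [← le_div_iff₀ (by positivity)] at h3
    calc ‖newtonCoeff (q : K) k m‖ * (C / s ^ k) ≤ (s' ^ k / s' ^ m) * (C / s ^ k) := by gcongr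
      _ = _ := by simp only [div_pow]; ring

theorem gaussLE_newtonCoeff {ρ C : ℝ} (hqs : ‖(q : K) - 1‖ ≤ s) (hs : 0 < s)
    (hC0 : 0 ≤ C) (hC : ∀ k i j, GaussLE ρ (C / s ^ k) (binomMat G k i j)) (m k : ℕ) (i j : Fin n) :
    GaussLE ρ (C / s ^ m) (newtonCoeff (q : K) k m • binomMat G k i j) := by
  refine ((hC k i j).smul _).mono ?_
  have h3 := norm_newtonCoeff_le (norm_unit q) hqs k m
  rw [← le_div_iff₀ (by positivity)] at h3
  calc ‖newtonCoeff (q : K) k m‖ * (C / s ^ k) ≤ (s ^ k / s ^ m) * (C / s ^ k) := by gcongr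
    _ = _ := by field_simp

theorem nullFamily_newtonPoly {ρ : ℝ} {P : ℕ → Matrix (Fin n) (Fin n) (BaseRing K κ)}
    (hP : ∀ k i j, ConvAt ρ (P k i j)) (hB : SeqBound ρ s P) (hqs : ‖(q : K) - 1‖ < s) (k : ℕ)
    (i j : Fin n) : NullFamily ρ fun m => (newtonPoly (q : K) m).coeff k • P m i j := by
  obtain ⟨s', h1, h2⟩ := exists_between hqs
  have hs' : 0 < s' := (norm_nonneg _).trans_lt h1
  have hs := hs'.trans h2
  obtain ⟨C, hC0, hC⟩ := hB.exists_nonneg hs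
  refine ⟨fun m => (hP m i j).smul _, fun m => C / s' ^ k * (s' / s) ^ m, ?_, fun m => ?_⟩
  · have := (tendsto_pow_atTop_nhds_zero_of_lt_one (by positivity) ((div_lt_one hs).2 h2)).const_mul
      (C / s' ^ k)
    rwa [mul_zero] at this
  · refine ((hC m i j).smul _).mono ?_
    have h3 := norm_coeff_newtonPoly_le (norm_unit q) h1.le m k
    rw [← le_div_iff₀ (by positivity)] at h3
    calc ‖(newtonPoly (q : K) m).coeff k‖ * (C / s ^ m) ≤ (s' ^ m / s' ^ k) * (C / s ^ m) := by gcongr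
      _ = _ := by simp only [div_pow]; ring

theorem gaussLE_newtonPoly {ρ C : ℝ} {P : ℕ → Matrix (Fin n) (Fin n) (BaseRing K κ)}
    (hqs : ‖(q : K) - 1‖ ≤ s) (hs : 0 < s) (hC0 : 0 ≤ C)
    (hC : ∀ k i j, GaussLE ρ (C / s ^ k) (P k i j)) (k m : ℕ) (i j : Fin n) :
    GaussLE ρ (C / s ^ k) ((newtonPoly (q : K) m).coeff k • P m i j) := by
  refine ((hC m i j).smul _).mono ?_
  have h3 := norm_coeff_newtonPoly_le (norm_unit q) hqs m k
  rw [← le_div_iff₀ (by positivity)] at h3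
  calc ‖(newtonPoly (q : K) m).coeff k‖ * (C / s ^ m) ≤ (s ^ m / s ^ k) * (C / s ^ m) := by gcongr
    _ = _ := by field_simp

end Compare

/-! ### Construction of the connection underlying a `q`-difference equation. -/

section Existence

variable {K : Type u} [NormedField K] [IsUltrametricDist K] [CompleteSpace K] [CharZero K]
  {κ : BaseKind} {n : ℕ} {q : UnitGroup K} {A G : Matrix (Fin n) (Fin n) (BaseRing K κ)} {s ε : ℝ}

/-- Two coefficientwise sums agree if they do at a generic point. -/
theorem isCoeffSum_of_generic {Ω : Type w} [NontriviallyNormedField Ω] [IsUltrametricDist Ω]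
    [CompleteSpace Ω] [NormedAlgebra K Ω] (hgen : ∀ {ε : ℝ}, 0 < ε → ε < 1 →
      ∃ ρ ∈ annulus κ ε, ∃ t : Ω, IsGenericPoint K ρ t)
    (h0 : 0 < ε) (h1 : ε < 1) {f : ℕ → BaseRing K κ} {g : BaseRing K κ}
    (hf : ∀ ρ ∈ annulus κ ε, NullFamily ρ f) (hg : ∀ ρ ∈ annulus κ ε, ConvAt ρ g)
    (h : ∀ t : Ω, ‖t‖ ∈ annulus κ ε → HasSum (fun k => eval t (f k)) (eval t g)) :
    IsCoeffSum f g := by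
  obtain ⟨g', hg'⟩ := exists_isCoeffSum h0 h1 hf
  obtain ⟨ρ, hρ, t, ht⟩ := hgen h0 h1
  have hρ0 := annulus_pos κ h1 hρ
  have htρ : ‖t‖ = ρ := ht.1
  have hc' := (hf ρ hρ).convAt hρ0 hg'
  have h2 := (show NullFamily ‖t‖ f from htρ ▸ hf ρ hρ).hasSum_eval (htρ ▸ hρ0) hg'
  have h3 := (h t (htρ ▸ hρ)).unique h2
  have h4 : g - g' = 0 := ht.eq_zero hρ0 ((hg ρ hρ).sub hρ0 hc') (by
    rw [eval_sub (htρ ▸ hg ρ hρ) (htρ ▸ hc'), h3, sub_self])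
  rw [sub_eq_zero.1 h4]
  exact hg'

variable (Ω : Type w) [NontriviallyNormedField Ω] [IsUltrametricDist Ω]
    [CompleteSpace Ω] [NormedAlgebra K Ω]

/-- Newton interpolation of the differential Taylor solution gives `P_m = ∑ newtonCoeff q k m ·
N_k`, first at points and then in the base ring by genericity. The bound for `N_k` passes to `P_m`
because the change of basis does not increase weighted norms. -/
theorem seqBound_qMat (hgen : ∀ {ε : ℝ}, 0 < ε → ε < 1 →
      ∃ ρ ∈ annulus κ ε, ∃ t : Ω, IsGenericPoint K ρ t) (h0 : 0 < ε) (h1 : ε < 1)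
    (hq : ¬ IsOfFinOrder q) (hs1 : s ≤ 1) (hqs : ‖(q : K) - 1‖ < s)
    (hG : ∀ ρ ∈ annulus κ ε, ∀ i j, ConvAt ρ (G i j))
    (hB : ∀ ρ ∈ annulus κ ε, SeqBound ρ s (binomMat G)) (hA : IsTaylorMat (q : K) G A)
    {ρ : ℝ} (hρ : ρ ∈ annulus κ ε) : SeqBound ρ s (qMat q A) := by
  have hs : 0 < s := (norm_nonneg _).trans_lt hqs
  have hpos := fun ρ hρ => annulus_pos κ h1 (ρ := ρ) hρ
  obtain ⟨C, hC0, hC⟩ := (hB ρ hρ).exists_nonneg hs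
  refine ⟨C, fun m i j => ?_⟩
  have hsum : IsCoeffSum (fun k => newtonCoeff (q : K) k m • binomMat G k i j) (qMat q A m i j) := by
    refine isCoeffSum_of_generic hgen h0 h1 (fun ρ hρ => nullFamily_newtonCoeff
      (ConvAt.binomMat (hpos ρ hρ) (hG ρ hρ)) (hB ρ hρ) hqs m i j) (fun ρ hρ => ConvAt.qMat (hpos ρ hρ)
      (hA.convAt (hpos ρ hρ) (hG ρ hρ) (hB ρ hρ) hqs) m i j) fun t ht => ?_
    simp only [eval_smul]
    exact (newton_solAt hq (hpos _ ht) hs1 (hG _ ht) (hB _ ht) hqs hA i j).1 m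
  exact hsum.gaussLE (hpos ρ hρ) fun k => gaussLE_newtonCoeff hqs.le hs hC0 hC m k i j

/-- A `q`-difference equation whose `q`-Taylor solutions converge comes from a differential
equation. -/
theorem exists_isTaylorMat (hgen : ∀ {ε : ℝ}, 0 < ε → ε < 1 →
      ∃ ρ ∈ annulus κ ε, ∃ t : Ω, IsGenericPoint K ρ t) (h0 : 0 < ε) (h1 : ε < 1)
    {p : ℕ} (hp0 : 0 < p) (hp : ‖(p : K)‖ < 1) (hq : ¬ IsOfFinOrder q) (hs1 : s ≤ 1)
    (hqs : ‖(q : K) - 1‖ < s) (hA : ∀ ρ ∈ annulus κ ε, ∀ i j, ConvAt ρ (A i j))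
    (hB : ∀ ρ ∈ annulus κ ε, SeqBound ρ s (qMat q A)) :
    ∃ G : Matrix (Fin n) (Fin n) (BaseRing K κ), IsTaylorMat (q : K) G A ∧
      (∀ i j, IsCoeffSum (fun m => (newtonPoly (q : K) m).coeff 1 • qMat q A m i j) (G i j)) ∧
      ∀ ρ ∈ annulus κ ε, (∀ i j, ConvAt ρ (G i j)) ∧ SeqBound ρ s (binomMat G) := by
  have hs : 0 < s := (norm_nonneg _).trans_lt hqs
  have hpos := fun ρ hρ => annulus_pos κ h1 (ρ := ρ) hρ
  have hP : ∀ ρ ∈ annulus κ ε, ∀ m i j, ConvAt ρ (qMat q A m i j) := fun ρ hρ =>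
    ConvAt.qMat (hpos ρ hρ) (hA ρ hρ)
  have hnull : ∀ k i j, ∀ ρ ∈ annulus κ ε,
      NullFamily ρ fun m => (newtonPoly (q : K) m).coeff k • qMat q A m i j := fun k i j ρ hρ =>
    nullFamily_newtonPoly (hP ρ hρ) (hB ρ hρ) hqs k i j
  choose N hN using fun k i j => exists_isCoeffSum h0 h1 (hnull k i j)
  have hNc : ∀ ρ ∈ annulus κ ε, ∀ k i j, ConvAt ρ (N k i j) := fun ρ hρ k i j =>
    (hnull k i j ρ hρ).convAt (hpos ρ hρ) (hN k i j)
  -- `N k` is the coefficient of `u^k` of the Newton series `∑ P_m ∏_{i<m} (u - (q^i - 1))`. A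
  -- Taylor solution has linear coefficient `G` by `binomMat_one`, so `N 1` is the only possible
  -- choice.
  set G : Matrix (Fin n) (Fin n) (BaseRing K κ) := Matrix.of (N 1) with hGdef
  have hG : ∀ ρ ∈ annulus κ ε, ∀ i j, ConvAt ρ (G i j) := fun ρ hρ => hNc ρ hρ 1
  have hroot : ∀ m : ℕ, 0 < m → (q : K) ^ m ≠ 1 := fun m hm => pow_ne_one_of_not_isOfFinOrder hq hm
  -- At each point the Newton series becomes a bounded power series with the prescribed values at
  -- the nodes.
  have hF : ∀ c : Ω, ‖c‖ ∈ annulus κ ε → ∃ F : Matrix (Fin n) (Fin n) (PowerSeries Ω), PBM s F ∧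
      (∀ k i j, PowerSeries.coeff k (F i j) = eval c (N k i j)) ∧
      ∀ l, evM (algebraMap K Ω ((q : K) ^ l - 1)) F = qNode q A c l := by
    intro c hc
    obtain ⟨C, hC0, hC⟩ := (hB _ hc).exists_nonneg hs
    choose F h1 h2 h3 using fun i j => exists_PB_of_newton (P := fun m => eval c (qMat q A m i j))
      (B := C) (fun m => by
        rw [← le_div_iff₀ (by positivity)]
        exact GaussLE.norm_eval_le (hP _ hc m i j) (hC m i j)) (norm_unit q) hqs
    refine ⟨Matrix.of F, h1, fun k i j => ?_, fun l => ?_⟩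
    · have h4 := (hnull k i j _ hc).hasSum_eval (hpos _ hc) (hN k i j)
      simp only [eval_smul] at h4
      exact (h2 i j k).unique h4
    · ext i j : 1
      rw [qNode_apply]
      have h4 := h3 i j (algebraMap K Ω ((q : K) ^ l - 1)) (by
        rw [norm_algebraMap']
        exact (norm_pow_sub_one_le (norm_unit q) l).trans_lt hqs)
      refine h4.unique (hasSum_sum_of_ne_finset_zero fun m hm => ?_)
      rw [aeval_newtonPoly_node_eq_zero _ (by simpa using hm), zero_mul]
  have hsol : ∀ c : Ω, ‖c‖ ∈ annulus κ ε →
      (∀ k i j, eval c (N k i j) = eval c (binomMat G k i j)) ∧ PBM s (solAt c G) ∧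
      ∀ l, evM (algebraMap K Ω ((q : K) ^ l - 1)) (solAt c G) = qNode q A c l := by
    intro c hc
    obtain ⟨F, hFb, hFk, hFn⟩ := hF c hc
    have hc0 := hpos _ hc
    have hF0 : F.map (PowerSeries.coeff 0) = 1 := by
      have := hFn 0
      rwa [pow_zero, sub_self, map_zero, evM_zero, qNode_zero] at this
    suffices hkey : F = solAt c G by
      refine ⟨fun k i j => ?_, hkey ▸ hFb, hkey ▸ hFn⟩
      rw [← hFk, hkey, coeff_solAt]
    -- The differential equation is obtained only at the nodes: the derivative of `F` at the `l`-th
    -- node is compared with the linear coefficient, namely the value of `G`, of the series based at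
    -- `q^l c`.
    have hode : ∀ l : ℕ, evM (algebraMap K Ω ((q : K) ^ l - 1)) (F.map eulerPS) =
        matEval ((1 + algebraMap K Ω ((q : K) ^ l - 1)) * c) G *
          evM (algebraMap K Ω ((q : K) ^ l - 1)) F := by
      intro l
      set u := algebraMap K Ω ((q : K) ^ l - 1) with hu
      have hus : ‖u‖ < s := by
        rw [hu, norm_algebraMap']
        exact (norm_pow_sub_one_le (norm_unit q) l).trans_lt hqs
      have hql : 1 + u = algebraMap K Ω (q : K) ^ l := by
        rw [hu, algebraMap_pow_sub_one]
        ring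
      have hqn : ‖algebraMap K Ω (q : K) ^ l‖ = 1 := by
        rw [norm_pow, norm_algebraMap', norm_unit, one_pow]
      have hcl : ‖algebraMap K Ω (q : K) ^ l * c‖ = ‖c‖ := by rw [norm_mul, hqn, one_mul]
      obtain ⟨F', hFb', hFk', hFn'⟩ := hF (algebraMap K Ω (q : K) ^ l * c) (by rwa [hcl])
      choose g hg1 _ hg3 using fun i j => (hFb i j).reexpand hus hqn.le
      -- The series recentred at the `l`-th node and the series at `q^l c` times `qNode q A c l`
      -- agree at all nodes, since `u + q^l (q^j - 1) = q^{l+j} - 1` and `qNode_add` holds. The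
      -- nodes accumulate at `0`, so the series coincide.
      have hprod : Matrix.of g = F' * (qNode q A c l).map C := by
        refine matrixPS_ext_of_frequently hg1 (hFb'.mul (PBM_C _) hs) hs
          (frequently_node hp0 hp (norm_unit q) (hqs.trans_le hs1) hroot fun j => ?_)
        have hj : ‖algebraMap K Ω ((q : K) ^ j - 1)‖ < s := by
          rw [norm_algebraMap']
          exact (norm_pow_sub_one_le (norm_unit q) j).trans_lt hqs
        rw [evM_mul hFb' (PBM_C _) hj, evM_C, hFn', ← qNode_add hq hc0 (hA _ hc), ← hFn]
        ext a b : 1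
        have h5 := hg3 a b _ hj
        refine h5.trans ?_
        rw [evM, Matrix.map_apply]
        congr 1
        rw [hu, algebraMap_pow_sub_one, algebraMap_pow_sub_one, algebraMap_pow_sub_one]
        ring
      ext a b : 1
      rw [evM, Matrix.map_apply, Matrix.map_apply, ev_euler (hFb a b) hus, hql,
        ← PB.coeff_one_reexpand (hFb a b) (hg1 a b) hus (hg3 a b), hFn]
      have h6 := congrArg (fun H => PowerSeries.coeff 1 (H a b)) hprod
      simp only [Matrix.of_apply, Matrix.mul_apply, map_sum, Matrix.map_apply,
        PowerSeries.coeff_mul_C, hFk'] at h6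
      rw [h6, Matrix.mul_apply]
      rfl
    -- Knowing the equation at the nodes suffices to identify `F` with the Taylor solution of `G`.
    have h7 := eq_solAt_mul hc0 hs hs1 (hG _ hc) hFb
      (frequently_node hp0 hp (norm_unit q) (hqs.trans_le hs1) hroot hode)
    rw [hF0] at h7
    rw [h7]
    have h8 : (1 : Matrix (Fin n) (Fin n) Ω).map (C : Ω →+* PowerSeries Ω) = 1 :=
      Matrix.map_one _ (map_zero _) (map_one _)
    rw [h8, mul_one]
  have hbin : ∀ ρ ∈ annulus κ ε, ∀ k i j, ConvAt ρ (binomMat G k i j) := fun ρ hρ =>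
    ConvAt.binomMat (hpos ρ hρ) (hG ρ hρ)
  -- The coefficients of the Newton series are thus the matrices `binomMat G k`, and they inherit
  -- the bounds of `qMat q A`.
  have hsumN : ∀ k i j, IsCoeffSum (fun m => (newtonPoly (q : K) m).coeff k • qMat q A m i j)
      (binomMat G k i j) := fun k i j =>
    isCoeffSum_of_generic hgen h0 h1 (hnull k i j) (fun ρ hρ => hbin ρ hρ k i j) fun t ht => by
      rw [← (hsol t ht).1]
      exact (hnull k i j _ ht).hasSum_eval (hpos _ ht) (hN k i j)
  have hBG : ∀ ρ ∈ annulus κ ε, SeqBound ρ s (binomMat G) := fun ρ hρ => by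
    obtain ⟨C, hC0, hC⟩ := (hB _ hρ).exists_nonneg hs
    exact ⟨C, fun k i j => (hsumN k i j).gaussLE (hpos ρ hρ) fun m =>
      gaussLE_newtonPoly hqs.le hs hC0 hC k m i j⟩
  refine ⟨G, fun i j => ?_, hN 1, fun ρ hρ => ⟨hG ρ hρ, hBG ρ hρ⟩⟩
  refine isCoeffSum_of_generic hgen h0 h1 (fun ρ hρ => (hBG ρ hρ).nullFamily (hbin ρ hρ) hqs i j)
    (fun ρ hρ => hA ρ hρ i j) fun t ht => ?_
  obtain ⟨-, hb, hnode⟩ := hsol t ht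
  -- At the first node `u = q - 1` the solution takes the value `A(t)`, which is the Taylor matrix
  -- relation.
  have h9 := hnode 1
  rw [pow_one, qNode_succ hq (hpos _ ht) (hA _ ht) 0, qNode_zero, one_mul] at h9
  have h10 := (hb i j).hasSum (u := algebraMap K Ω ((q : K) - 1)) (by rwa [norm_algebraMap'])
  have h11 : eval t (A i j) = ev (algebraMap K Ω ((q : K) - 1)) (solAt t G i j) :=
    (congrFun (congrFun h9 i) j).symm
  rw [h11]
  simp only [eval_smul]
  refine h10.congr_fun fun k => ?_
  rw [coeff_solAt, map_pow, mul_comm]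

end Existence

/-! ## Radii of convergence and bounds on Taylor coefficients -/

section Radii

variable {K : Type u} [NormedField K] [IsUltrametricDist K] [CompleteSpace K] [CharZero K]
  {κ : BaseKind} {n : ℕ} {ρ s : ℝ}

theorem ofReal_zpow {x : ℝ} (hx : 0 < x) (m : ℤ) :
    ENNReal.ofReal (x ^ m) = ENNReal.ofReal x ^ m := by
  obtain ⟨k, rfl | rfl⟩ := m.eq_nat_or_neg
  · rw [zpow_natCast, zpow_natCast, ENNReal.ofReal_pow hx.le]
  · rw [zpow_neg, ENNReal.zpow_neg, zpow_natCast, zpow_natCast, ENNReal.ofReal_inv_of_pos (by positivity),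
      ENNReal.ofReal_pow hx.le]

theorem matNorm_le_iff (hρ : 0 < ρ) {c : ℝ} (hc : 0 ≤ c) {A : Matrix (Fin n) (Fin n) (BaseRing K κ)} :
    matNorm ρ A ≤ ENNReal.ofReal c ↔ ∀ i j, GaussLE ρ c (A i j) := by
  simp only [matNorm, gaussNorm, iSup_le_iff, GaussLE]
  refine forall_congr' fun i => forall_congr' fun j => forall_congr' fun m => ?_
  rw [← ofReal_norm, ← ofReal_zpow hρ, ← ENNReal.ofReal_mul (norm_nonneg _),
    ENNReal.ofReal_le_ofReal_iff hc]

theorem ofReal_le_rpow_neg_iff {a : ℝ≥0∞} {y : ℝ} (hy : 0 < y) {m : ℕ} (hm : 0 < m) :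
    ENNReal.ofReal y ≤ a ^ (-(1 / (m : ℝ))) ↔ a ≤ ENNReal.ofReal (y⁻¹ ^ m) := by
  rw [ENNReal.rpow_neg, ENNReal.le_inv_iff_le_inv, one_div, ENNReal.rpow_inv_le_iff (by positivity),
    ← ENNReal.ofReal_inv_of_pos hy, ENNReal.rpow_natCast, ENNReal.ofReal_pow (by positivity)]

variable {N P : ℕ → Matrix (Fin n) (Fin n) (BaseRing K κ)} {f : ℕ → K}

theorem div_enorm_le_iff {a : ℝ≥0∞} {b : K} (hb : b ≠ 0) {c : ℝ} :
    a / ‖b‖ₑ ≤ ENNReal.ofReal c ↔ a ≤ ENNReal.ofReal (‖b‖ * c) := by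
  rw [ENNReal.div_le_iff (by simpa using hb) (by simp), ENNReal.ofReal_mul (norm_nonneg _),
    ofReal_norm, mul_comm]

/-- Multiplication by `T^m` scales Gauss norms at `ρ` by `ρ^m`; this converts the absolute radii in
the definition of `Ray` into the relative radii used for `SeqBound`. -/
theorem gaussLE_normalized_iff (hρ : 0 < ρ) {m : ℕ} {b : K} (hb : b ≠ 0) {c : ℝ} {g : BaseRing K κ} :
    GaussLE ρ c (b⁻¹ • (monomial (m : ℤ) 1 * g)) ↔ GaussLE ρ (‖b‖ * (c / ρ ^ m)) g := by
  have hb0 : 0 < ‖b‖ := norm_pos_iff.2 hb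
  have key : ∀ l : ℤ, ‖(b⁻¹ • (monomial (m : ℤ) 1 * g)).coeff (l + m)‖ * ρ ^ (l + m) =
      ‖b‖⁻¹ * (‖g.coeff l‖ * ρ ^ l) * ρ ^ m := fun l => by
    rw [coeff_smul, coeff_monomial_mul, one_mul, add_sub_cancel_right, norm_mul, norm_inv,
      zpow_add₀ hρ.ne', zpow_natCast]
    ring
  have key2 : ∀ y : ℝ, ‖b‖⁻¹ * y * ρ ^ m ≤ c ↔ y ≤ ‖b‖ * (c / ρ ^ m) := fun y => by
    rw [← le_div_iff₀ (by positivity), inv_mul_le_iff₀ hb0]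
  constructor
  · intro h l
    rw [← key2, ← key]
    exact h _
  · intro h l
    have := h (l - m)
    rw [← key2, ← key, sub_add_cancel] at this
    exact this

/-- Beyond some index the definition of the `liminf` gives the bound with constant `1`. The finitely
many earlier terms are absorbed in the constant, which is `1` plus the sum of their own bounds. -/
theorem seqBound_of_lt_liminf (hρ : 0 < ρ) {x : ℝ} (hx : 0 < x) (hf : ∀ m, f m ≠ 0)
    (hP : ∀ m, P m = (f m)⁻¹ • (N m).map fun g => monomial (m : ℤ) 1 * g)
    (hc : ∀ m i j, ConvAt ρ (P m i j))
    (h : ENNReal.ofReal x < liminf (fun m : ℕ => (matNorm ρ (N m) / ‖f m‖ₑ) ^ (-(1 / (m : ℝ))))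
      atTop) : SeqBound ρ (x / ρ) P := by
  obtain ⟨M, hM⟩ := eventually_atTop.1 (eventually_lt_of_lt_liminf h)
  have hbig : ∀ m, M + 1 ≤ m → ∀ i j, GaussLE ρ (1 / (x / ρ) ^ m) (P m i j) := by
    intro m hm i j
    have h1 := (hM m (by omega)).le
    rw [ofReal_le_rpow_neg_iff hx (by omega), div_enorm_le_iff (hf m),
      matNorm_le_iff hρ (by positivity)] at h1
    rw [hP, Matrix.smul_apply, Matrix.map_apply, gaussLE_normalized_iff hρ (hf m)]
    convert h1 i j using 1
    rw [div_pow, inv_pow]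
    field_simp
  choose c hc0 hcb using fun m i j => (hc m i j).exists_gaussLE
  have hnn : 0 ≤ ∑ m ∈ Finset.range (M + 1), ∑ i, ∑ j, c m i j * (x / ρ) ^ m :=
    Finset.sum_nonneg fun m _ => Finset.sum_nonneg fun i _ => Finset.sum_nonneg fun j _ =>
      mul_nonneg (hc0 m i j) (by positivity)
  refine ⟨1 + ∑ m ∈ Finset.range (M + 1), ∑ i, ∑ j, c m i j * (x / ρ) ^ m, fun m i j => ?_⟩
  by_cases hm : M + 1 ≤ m
  · refine (hbig m hm i j).mono ?_
    gcongr
    linarith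
  · refine (hcb m i j).mono ?_
    rw [le_div_iff₀ (by positivity)]
    have h1 : c m i j * (x / ρ) ^ m ≤ ∑ j, c m i j * (x / ρ) ^ m :=
      Finset.single_le_sum (f := fun j => c m i j * (x / ρ) ^ m)
        (fun j _ => mul_nonneg (hc0 m i j) (by positivity)) (Finset.mem_univ j)
    have h2 : ∑ j, c m i j * (x / ρ) ^ m ≤ ∑ i, ∑ j, c m i j * (x / ρ) ^ m :=
      Finset.single_le_sum (f := fun i => ∑ j, c m i j * (x / ρ) ^ m) (fun i _ =>
        Finset.sum_nonneg fun j _ => mul_nonneg (hc0 m i j) (by positivity)) (Finset.mem_univ i)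
    have h3 : ∑ i, ∑ j, c m i j * (x / ρ) ^ m ≤
        ∑ m ∈ Finset.range (M + 1), ∑ i, ∑ j, c m i j * (x / ρ) ^ m :=
      Finset.single_le_sum (f := fun m => ∑ i, ∑ j, c m i j * (x / ρ) ^ m) (fun m _ =>
        Finset.sum_nonneg fun i _ => Finset.sum_nonneg fun j _ =>
          mul_nonneg (hc0 m i j) (by positivity)) (Finset.mem_range.2 (by omega))
    linarith

/-- The constant `B` disappears after taking `m`-th roots: for `y < sρ` the quantity `B (y/(sρ))^m`
is eventually below `1`. -/
theorem le_liminf_of_seqBound (hρ : 0 < ρ) (hs : 0 < s) (hf : ∀ m, f m ≠ 0)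
    (hP : ∀ m, P m = (f m)⁻¹ • (N m).map fun g => monomial (m : ℤ) 1 * g) (hB : SeqBound ρ s P) :
    ENNReal.ofReal (s * ρ) ≤
      liminf (fun m : ℕ => (matNorm ρ (N m) / ‖f m‖ₑ) ^ (-(1 / (m : ℝ)))) atTop := by
  obtain ⟨B, hB0, hB⟩ := hB.exists_nonneg hs
  have hsρ : 0 < s * ρ := by positivity
  refine le_of_forall_lt_imp_le_of_dense fun a ha => ?_
  have ha' : a ≠ ⊤ := (ha.trans ENNReal.ofReal_lt_top).ne
  obtain ⟨y, hay, hy⟩ := exists_between ha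
  have hy' : y ≠ ⊤ := (hy.trans ENNReal.ofReal_lt_top).ne
  have hy0 : 0 < y.toReal := ENNReal.toReal_pos (bot_le.trans_lt hay).ne' hy'
  have hys : y.toReal < s * ρ := (ENNReal.lt_ofReal_iff_toReal_lt hy').1 hy
  refine hay.le.trans ?_
  rw [← ENNReal.ofReal_toReal hy']
  refine le_liminf_of_le (by isBoundedDefault) ?_
  have h1 : Tendsto (fun m : ℕ => B * (y.toReal / (s * ρ)) ^ m) atTop (𝓝 0) := by
    have := (tendsto_pow_atTop_nhds_zero_of_lt_one (by positivity)
      ((div_lt_one hsρ).2 hys)).const_mul B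
    rwa [mul_zero] at this
  filter_upwards [h1.eventually_lt_const one_pos, eventually_gt_atTop 0] with m hm hm0
  rw [ofReal_le_rpow_neg_iff hy0 hm0, div_enorm_le_iff (hf m), matNorm_le_iff hρ (by positivity)]
  intro i j
  have h2 := hB m i j
  rw [hP, Matrix.smul_apply, Matrix.map_apply, gaussLE_normalized_iff hρ (hf m)] at h2
  refine h2.mono (mul_le_mul_of_nonneg_left ?_ (norm_nonneg _))
  rw [div_pow, mul_pow, mul_div_assoc', div_lt_one (by positivity)] at hm
  rw [inv_pow, div_div, div_le_iff₀ (by positivity), inv_mul_eq_div, le_div_iff₀ (by positivity)]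
  exact hm.le

end Radii

/-! ### The radius condition in terms of relative radii on annuli. -/

section RadiusCondition

variable {K : Type u} [NormedField K] [IsUltrametricDist K] [CompleteSpace K] {κ : BaseKind} {r : ℝ}
  {q : UnitGroup K} {ray : ℝ → ℝ≥0∞}

/-- Uniform relative radii `τ < r`, with annuli depending on `τ`, are enough for both base rings:
over `H^†_K` evaluate at `ρ = 1`, over the Robba ring let `ρ → 1` and then `τ → r`. -/
theorem radiusCondition_of_le (hq : q ∈ disk K r)
    (h : ∀ τ, 0 < τ → τ < r → ‖(q : K) - 1‖ < τ → ∃ ε : ℝ, 0 < ε ∧ ε < 1 ∧ ∀ ρ ∈ annulus κ ε,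
      ENNReal.ofReal (τ * ρ) ≤ ray ρ) : RadiusCondition κ r q ray := by
  have hq' : ‖(q : K) - 1‖ < r := hq
  cases κ with
  | hdagger =>
    refine ⟨hq', le_of_forall_lt_imp_le_of_dense fun a ha => ?_⟩
    have ha' : a ≠ ⊤ := (ha.trans ENNReal.ofReal_lt_top).ne
    obtain ⟨τ, h1, h2⟩ := exists_between (max_lt hq' ((ENNReal.lt_ofReal_iff_toReal_lt ha').1 ha))
    have h3 := (le_max_left _ _).trans_lt h1
    obtain ⟨ε, he0, he1, he⟩ := h τ ((norm_nonneg _).trans_lt h3) h2 h3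
    have h4 := he 1 (by simp only [annulus, Set.mem_Ioo]; constructor <;> linarith)
    rw [mul_one] at h4
    refine le_trans ?_ h4
    rw [← ENNReal.ofReal_toReal ha']
    exact ENNReal.ofReal_le_ofReal ((le_max_right _ _).trans h1.le)
  | robba =>
    have key : ∀ x, ‖(q : K) - 1‖ ≤ x → x < r → ∀ᶠ ρ in 𝓝[<] (1 : ℝ), ENNReal.ofReal x < ray ρ := by
      intro x h0 hx
      obtain ⟨τ, h1, h2⟩ := exists_between hx
      have hτ : 0 < τ := ((norm_nonneg _).trans h0).trans_lt h1
      obtain ⟨ε, he0, he1, he⟩ := h τ hτ h2 (h0.trans_lt h1)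
      -- For `ρ > x/τ` one has `τρ > x`, so the loss from relative to absolute radius disappears
      -- close to `1`.
      have hm : max (1 - ε) (x / τ) < 1 := max_lt (by linarith) ((div_lt_one hτ).2 h1)
      filter_upwards [Ioo_mem_nhdsLT hm] with ρ hρ
      have h3 : x / τ < ρ := (le_max_right _ _).trans_lt hρ.1
      refine lt_of_lt_of_le ?_ (he ρ ⟨(le_max_left _ _).trans_lt hρ.1, hρ.2⟩)
      rw [div_lt_iff₀ hτ, mul_comm] at h3
      exact (ENNReal.ofReal_lt_ofReal_iff (((norm_nonneg _).trans h0).trans_lt h3)).2 h3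
    refine ⟨hq'.le, le_of_forall_lt_imp_le_of_dense fun a ha => ?_, key _ le_rfl hq'⟩
    have ha' : a ≠ ⊤ := (ha.trans ENNReal.ofReal_lt_top).ne
    have h1 := max_lt hq' ((ENNReal.lt_ofReal_iff_toReal_lt ha').1 ha)
    refine le_liminf_of_le (by isBoundedDefault) ?_
    filter_upwards [key _ (le_max_left _ _) h1] with ρ hρ
    refine le_trans ?_ hρ.le
    rw [← ENNReal.ofReal_toReal ha', ENNReal.toReal_ofReal ENNReal.toReal_nonneg]
    exact ENNReal.ofReal_le_ofReal (le_max_right _ _)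

theorem RadiusCondition.lt_ray_robba (h : RadiusCondition BaseKind.robba r q ray) {τ : ℝ} (hτ0 : 0 < τ)
    (hτ : τ < r) : ∃ ε : ℝ, 0 < ε ∧ ε < 1 ∧ ∀ ρ ∈ annulus BaseKind.robba ε,
      ENNReal.ofReal τ < ray ρ := by
  have h1 : ENNReal.ofReal τ < liminf ray (𝓝[<] (1 : ℝ)) :=
    ((ENNReal.ofReal_lt_ofReal_iff (hτ0.trans hτ)).2 hτ).trans_le h.2.1
  have h2 := eventually_lt_of_lt_liminf h1
  obtain ⟨l, hl, hl2⟩ := (mem_nhdsLT_iff_exists_Ioo_subset' (show (0 : ℝ) < 1 by norm_num)).1 h2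
  have hl1 : l < 1 := hl
  refine ⟨min (1 - l) (1 / 2), lt_min (by linarith) (by norm_num), min_lt_of_right_lt (by norm_num),
    fun ρ hρ => hl2 ⟨?_, hρ.2⟩⟩
  have := hρ.1
  have := min_le_left (1 - l) (1 / 2)
  linarith

theorem RadiusCondition.lt_ray_hdagger (h : RadiusCondition BaseKind.hdagger r q ray) {τ : ℝ}
    (hτ0 : 0 < τ) (hτ : τ < r) : ENNReal.ofReal τ < ray 1 :=
  ((ENNReal.ofReal_lt_ofReal_iff (hτ0.trans hτ)).2 hτ).trans_le h.2

end RadiusCondition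

/-! ### Lower bounds for `|m!|` and for the products of the `|q^i - 1|`. -/

section TrivialBounds

variable {K : Type u} [NormedField K] [IsUltrametricDist K]

/-- By Bézout, `|m| < 1` and `|p| < 1` would give `|1| < 1`. -/
theorem norm_natCast_eq_one_of_coprime {p : ℕ} (hp : ‖(p : K)‖ < 1) {m : ℕ} (h : m.Coprime p) :
    ‖(m : K)‖ = 1 := by
  refine le_antisymm (IsUltrametricDist.norm_natCast_le_one K m) ?_
  have h1 : (m : ℤ) * m.gcdA p + p * m.gcdB p = 1 := by
    rw [← Nat.gcd_eq_gcd_ab, h]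
    rfl
  have h2 : (m : K) * (m.gcdA p : K) + (p : K) * (m.gcdB p : K) = 1 := by
    simpa using congrArg (Int.cast : ℤ → K) h1
  have h3 : ‖(p : K) * (m.gcdB p : K)‖ < 1 := by
    rw [norm_mul]
    exact (mul_le_of_le_one_right (norm_nonneg _)
      (IsUltrametricDist.norm_intCast_le_one K _)).trans_lt hp
  by_contra hlt
  push Not at hlt
  have h4 : ‖(m : K) * (m.gcdA p : K)‖ < 1 := by
    rw [norm_mul]
    exact (mul_le_of_le_one_right (norm_nonneg _)
      (IsUltrametricDist.norm_intCast_le_one K _)).trans_lt hlt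
  have h5 := IsUltrametricDist.norm_add_le_max ((m : K) * (m.gcdA p : K)) ((p : K) * (m.gcdB p : K))
  rw [h2, norm_one] at h5
  exact absurd h5 (not_le.2 (max_lt h4 h3))

theorem norm_natCast_eq_pow {p : ℕ} (hpp : p.Prime) (hp : ‖(p : K)‖ < 1) {m : ℕ} (hm : m ≠ 0) :
    ‖(m : K)‖ = ‖(p : K)‖ ^ padicValNat p m := by
  have := Fact.mk hpp
  obtain ⟨k, m', hm', rfl⟩ := Nat.exists_eq_pow_mul_and_not_dvd hm p hpp.ne_one
  have h1 : ‖(m' : K)‖ = 1 :=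
    norm_natCast_eq_one_of_coprime hp ((Nat.Prime.coprime_iff_not_dvd hpp).2 hm').symm
  rw [padicValNat.mul (pow_ne_zero _ hpp.ne_zero) (by rintro rfl; simp at hm'),
    padicValNat.prime_pow, padicValNat.eq_zero_of_not_dvd hm', add_zero]
  push_cast
  rw [norm_mul, h1, mul_one, norm_pow]

theorem norm_factorial_ge {p : ℕ} (hpp : p.Prime) (hp : ‖(p : K)‖ < 1) (m : ℕ) :
    ‖(p : K)‖ ^ m ≤ ‖(m.factorial : K)‖ := by
  have := Fact.mk hpp
  rw [norm_natCast_eq_pow hpp hp m.factorial_ne_zero]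
  exact pow_le_pow_of_le_one (norm_nonneg _) hp.le (padicValNat_factorial_le p m)

/-- For `|q-1| < |p|` the sum `1 + ⋯ + q^{p-1}` has the norm of `p`. With `m = p^k m'`, iterate this
`k` times and finish with the factor `m'`, of norm `1`. -/
theorem norm_pow_sub_one_eq_of_lt {p : ℕ} (hpp : p.Prime) (hp : ‖(p : K)‖ < 1) {q : K}
    (hq : ‖q‖ = 1) (hqp : ‖q - 1‖ < ‖(p : K)‖) {m : ℕ} (hm : m ≠ 0) :
    ‖q ^ m - 1‖ = ‖(m : K)‖ * ‖q - 1‖ := by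
  obtain ⟨k, m', hm', rfl⟩ := Nat.exists_eq_pow_mul_and_not_dvd hm p hpp.ne_one
  have h1 : ‖(m' : K)‖ = 1 :=
    norm_natCast_eq_one_of_coprime hp ((Nat.Prime.coprime_iff_not_dvd hpp).2 hm').symm
  have hk : ∀ k : ℕ, ‖q ^ p ^ k - 1‖ = ‖(p : K)‖ ^ k * ‖q - 1‖ := by
    intro k
    induction k with
    | zero => simp
    | succ k ih =>
      rw [pow_succ, pow_mul, norm_pow_sub_one_eq (by rw [norm_pow, hq, one_pow])
        ((norm_pow_sub_one_le hq _).trans_lt hqp), ih]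
      ring
  rw [pow_mul, norm_pow_sub_one_eq (by rw [norm_pow, hq, one_pow])
    (((norm_pow_sub_one_le hq _).trans_lt hqp).trans (h1 ▸ hp)), hk]
  push_cast
  rw [norm_mul, norm_pow]
  ring

/-- Choose `Q = q^{p^k}` with `|Q - 1| < |p|`. There the product is `|m!| |Q-1|^m`, and each `|q^i -
1|` is at least `|Q^i - 1|` because `Q^i` is a power of `q^i`. Hence `c = |p| |Q - 1|` works. -/
theorem exists_prod_norm_pow_sub_one_ge [CharZero K] {p : ℕ} (hpp : p.Prime) (hp : ‖(p : K)‖ < 1) {q : K}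
    (hq : ‖q‖ = 1) (hq1 : ‖q - 1‖ < 1) (hroot : ∀ m : ℕ, 0 < m → q ^ m ≠ 1) :
    ∃ c : ℝ, 0 < c ∧ ∀ m : ℕ, c ^ m ≤ ∏ i ∈ Finset.range m, ‖q ^ (i + 1) - 1‖ := by
  have hp0 : 0 < ‖(p : K)‖ := norm_pos_iff.2 (Nat.cast_ne_zero.2 hpp.ne_zero)
  obtain ⟨k, hk⟩ := ((tendsto_pow_prime_pow hp hq hq1).norm.eventually_lt_const
    (by rwa [norm_zero])).exists
  set Q := q ^ p ^ k with hQ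
  have hQ1 : ‖Q‖ = 1 := by rw [hQ, norm_pow, hq, one_pow]
  have hQ0 : 0 < ‖Q - 1‖ := norm_pos_iff.2 (sub_ne_zero.2 (hroot _ (pow_pos hpp.pos k)))
  refine ⟨‖(p : K)‖ * ‖Q - 1‖, by positivity, fun m => ?_⟩
  calc (‖(p : K)‖ * ‖Q - 1‖) ^ m ≤ ‖(m.factorial : K)‖ * ‖Q - 1‖ ^ m := by
        rw [mul_pow]
        exact mul_le_mul_of_nonneg_right (norm_factorial_ge hpp hp m) (by positivity)
    _ = ∏ i ∈ Finset.range m, ‖Q ^ (i + 1) - 1‖ := by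
        rw [← Finset.prod_range_add_one_eq_factorial]
        push_cast
        rw [norm_prod, ← Finset.card_range m, ← Finset.prod_const, Finset.card_range,
          ← Finset.prod_mul_distrib]
        refine Finset.prod_congr rfl fun i _ => ?_
        rw [norm_pow_sub_one_eq_of_lt hpp hp hQ1 hk (Nat.succ_ne_zero i)]
        push_cast
        rfl
    _ ≤ _ := by
        refine Finset.prod_le_prod (fun i _ => norm_nonneg _) fun i _ => ?_
        rw [hQ, ← pow_mul, mul_comm, pow_mul]
        exact norm_pow_sub_one_le (by rw [norm_pow, hq, one_pow]) _

end TrivialBounds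

/-! ### Extending bounds from the circle `|T| = 1` to neighbouring circles. -/

section Hadamard

variable {K : Type u} [NormedField K] [IsUltrametricDist K] [CompleteSpace K] [CharZero K]
  {κ : BaseKind} {n : ℕ} {ρ₀ ρ₁ ρ : ℝ}

/-- The three circles inequality. -/
theorem gaussLE_of_three_circles {f : BaseRing K κ} (hρ₀ : 0 < ρ₀) (hρ : 0 < ρ) {M : ℕ}
    (h0 : ρ₀ ≤ ρ ^ (M + 1)) (h1 : ρ ^ (M + 1) ≤ ρ₁) {c D e : ℝ} (hc : GaussLE 1 c f)
    (hD₀ : GaussLE ρ₀ D f) (hD₁ : GaussLE ρ₁ D f) (he : 0 ≤ e) (hle : c ^ M * D ≤ e ^ (M + 1)) :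
    GaussLE ρ e f := by
  intro m
  have hc0 := hc.nonneg
  have hcm := hc m
  rw [one_zpow, mul_one] at hcm
  -- The radius `ρ^(M+1)` lies between `ρ₀` and `ρ₁`, so its `m`-th power is dominated at `ρ₁` for
  -- `m ≥ 0` and at `ρ₀` for `m ≤ 0`.
  have hDm : ‖f.coeff m‖ * (ρ ^ (M + 1)) ^ m ≤ D := by
    rcases le_total 0 m with hm | hm
    · refine le_trans (mul_le_mul_of_nonneg_left ?_ (norm_nonneg _)) (hD₁ m)
      exact zpow_le_zpow_left₀ hm (by positivity) h1
    · refine le_trans (mul_le_mul_of_nonneg_left ?_ (norm_nonneg _)) (hD₀ m)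
      obtain ⟨k, hk⟩ := Int.eq_ofNat_of_zero_le (neg_nonneg.2 hm)
      obtain rfl : m = -(k : ℤ) := by omega
      rw [zpow_neg, zpow_neg, zpow_natCast, zpow_natCast]
      gcongr
  -- Log-convexity in the form `(|a| ρ^m)^(M+1) = |a|^M · (|a| (ρ^(M+1))^m)`: the first factor is
  -- controlled at `1`, the second one by `D`.
  refine le_of_pow_le_pow_left₀ (Nat.succ_ne_zero M) he (le_trans (le_of_eq_of_le ?_
    (mul_le_mul (pow_le_pow_left₀ (norm_nonneg _) hcm M) hDm (by positivity) (by positivity))) hle)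
  rw [mul_pow, pow_succ, ← zpow_natCast (ρ ^ m), ← zpow_mul, ← zpow_natCast ρ, ← zpow_mul,
    mul_comm m]
  ring

/-- Interpolation between the sharp bound at `1` and the crude exponential bounds `D^m` on two other
circles costs an arbitrarily small part of the radius, here from `τ'` to `τ`. The annulus does not
depend on `m`. -/
theorem exists_seqBound_near_one {P : ℕ → Matrix (Fin n) (Fin n) (BaseRing K κ)} {τ τ' D : ℝ}
    (hτ : 0 < τ) (hττ' : τ < τ') (h1 : SeqBound 1 τ' P) (hρ₀ : 0 < ρ₀) (hρ₀1 : ρ₀ < 1) (hρ₁ : 1 < ρ₁)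
    (hD : 0 ≤ D) (hD₀ : ∀ m i j, GaussLE ρ₀ (D ^ m) (P m i j))
    (hD₁ : ∀ m i j, GaussLE ρ₁ (D ^ m) (P m i j)) :
    ∃ ε : ℝ, 0 < ε ∧ ε < 1 ∧ ∀ ρ ∈ annulus BaseKind.hdagger ε, SeqBound ρ τ P := by
  have hτ' := hτ.trans hττ'
  obtain ⟨c, hc0, hc⟩ := h1.exists_nonneg hτ'
  have hlim : Tendsto (fun M : ℕ => D * τ * (τ / τ') ^ M) atTop (𝓝 0) := by
    have := (tendsto_pow_atTop_nhds_zero_of_lt_one (by positivity)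
      ((div_lt_one hτ').2 hττ')).const_mul (D * τ)
    rwa [mul_zero] at this
  -- The weight `M` is chosen with `D τ (τ/τ')^M < 1`; this is what makes the interpolated bound at
  -- most a constant times `τ^{-m}`.
  obtain ⟨M, hM⟩ := (hlim.eventually_lt_const one_pos).exists
  have hcont : Tendsto (fun x : ℝ => x ^ (M + 1)) (𝓝 1) (𝓝 1) := by
    simpa using (continuous_pow (M + 1)).tendsto (1 : ℝ)
  obtain ⟨ε, hε, he⟩ := Metric.eventually_nhds_iff.1
    ((hcont.eventually_const_lt hρ₀1).and (hcont.eventually_lt_const hρ₁))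
  refine ⟨min ε (1 / 2), lt_min hε (by norm_num), min_lt_of_right_lt (by norm_num), fun ρ hρ => ?_⟩
  have hρ0 := annulus_pos _ (min_lt_of_right_lt (by norm_num)) hρ
  have hρε : dist ρ 1 < ε := by
    have h2 := hρ.1
    have h3 := hρ.2
    have h4 := min_le_left ε (1 / 2)
    rw [Real.dist_eq, abs_lt]
    constructor <;> linarith
  have h5 := he hρε
  refine ⟨max 1 c, fun m i j => ?_⟩
  refine gaussLE_of_three_circles hρ₀ hρ0 h5.1.le h5.2.le (hc m i j) (hD₀ m i j) (hD₁ m i j)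
    (by positivity) ?_
  have h6 : (D * τ * (τ / τ') ^ M) ^ m ≤ 1 := pow_le_one₀ (by positivity) hM.le
  have h7 : c ^ M ≤ (max 1 c) ^ (M + 1) := by
    calc c ^ M ≤ (max 1 c) ^ M := pow_le_pow_left₀ hc0 (le_max_right _ _) M
      _ ≤ _ := pow_le_pow_right₀ (le_max_left _ _) (Nat.le_succ M)
  calc (c / τ' ^ m) ^ M * D ^ m = c ^ M * (D * τ * (τ / τ') ^ M) ^ m / (τ ^ m) ^ (M + 1) := by
        rw [div_pow, div_pow, mul_pow, mul_pow, div_pow]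
        field_simp
        ring
    _ ≤ (max 1 c) ^ (M + 1) * 1 / (τ ^ m) ^ (M + 1) := by gcongr
    _ = _ := by rw [mul_one, div_pow]

/-- Bounds for a sequence given by a recursion with denominators `b_m`. -/
theorem gaussLE_of_recursion {P : ℕ → Matrix (Fin n) (Fin n) (BaseRing K κ)} {b : ℕ → ℝ} {E d : ℝ}
    (hρ : 0 < ρ) (hE : 0 ≤ E) (hd : 0 < d) (hb : ∀ m, d ^ m ≤ ∏ i ∈ Finset.range m, b i) (h0 : P 0 = 1)
    (hb0 : ∀ m, 0 ≤ b m)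
    (hstep : ∀ m c, (∀ i j, GaussLE ρ c (P m i j)) → 0 ≤ c →
      ∀ i j, GaussLE ρ (E * c / b m) (P (m + 1) i j)) (m : ℕ) (i j : Fin n) :
    GaussLE ρ ((E / d) ^ m) (P m i j) := by
  have h1 : ∀ m i j, GaussLE ρ (E ^ m / ∏ i ∈ Finset.range m, b i) (P m i j) := by
    intro m
    induction m with
    | zero =>
      intro i j
      rw [h0, pow_zero, Finset.prod_range_zero, div_one, Matrix.one_apply]
      split_ifs
      · exact gaussLE_one hρ
      · exact gaussLE_zero zero_le_one
    | succ m ih =>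
      intro i j
      convert hstep m _ ih (div_nonneg (pow_nonneg hE m) (Finset.prod_nonneg fun i _ => hb0 i)) i j
        using 1
      rw [Finset.prod_range_succ, pow_succ, mul_div_assoc', div_div, mul_comm E]
  refine (h1 m i j).mono ?_
  rw [div_pow]
  gcongr
  exact hb m

end Hadamard

/-! ### From the radius condition to `Rad`, and back. -/

section RadiiBounds

variable {K : Type u} [NormedField K] [IsUltrametricDist K] [CompleteSpace K] [CharZero K]
  {κ : BaseKind} {n : ℕ} {r ρ s τ : ℝ} {q : UnitGroup K} {A G : Matrix (Fin n) (Fin n) (BaseRing K κ)}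

theorem le_dRay (hρ : 0 < ρ) (hs : 0 < s) (hs1 : s ≤ 1) (hB : SeqBound ρ s (binomMat G)) :
    ENNReal.ofReal (s * ρ) ≤ dRay G ρ :=
  le_min (le_liminf_of_seqBound (f := fun m => (m.factorial : K)) hρ hs
    (fun m => Nat.cast_ne_zero.2 m.factorial_ne_zero) (binomMat_eq_dIter G) hB)
    (ENNReal.ofReal_le_ofReal (mul_le_of_le_one_left hρ.le hs1))

theorem le_qRay (hq : ¬ IsOfFinOrder q) (hρ : 0 < ρ) (hs : 0 < s) (hs1 : s ≤ 1)
    (hB : SeqBound ρ s (qMat q A)) : ENNReal.ofReal (s * ρ) ≤ qRay q A ρ :=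
  le_min (le_liminf_of_seqBound (f := fun m => qFactorial (q : K) m) hρ hs
    (qFactorial_ne_zero hq) (fun _ => rfl) hB)
    (ENNReal.ofReal_le_ofReal (mul_le_of_le_one_left hρ.le hs1))

theorem seqBound_of_lt_dRay (hρ : 0 < ρ) (hs : 0 < s) (hG : ∀ i j, ConvAt ρ (G i j))
    (h : ENNReal.ofReal s < dRay G ρ) : SeqBound ρ (s / ρ) (binomMat G) :=
  seqBound_of_lt_liminf (f := fun m => (m.factorial : K)) hρ hs
    (fun m => Nat.cast_ne_zero.2 m.factorial_ne_zero) (binomMat_eq_dIter G)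
    (ConvAt.binomMat hρ hG) (h.trans_le (min_le_left _ _))

theorem seqBound_of_lt_qRay (hq : ¬ IsOfFinOrder q) (hρ : 0 < ρ) (hs : 0 < s)
    (hA : ∀ i j, ConvAt ρ (A i j)) (h : ENNReal.ofReal s < qRay q A ρ) :
    SeqBound ρ (s / ρ) (qMat q A) :=
  seqBound_of_lt_liminf (f := fun m => qFactorial (q : K) m) hρ hs
    (qFactorial_ne_zero hq) (fun _ => rfl) (ConvAt.qMat hρ hA) (h.trans_le (min_le_left _ _))

theorem exists_gaussLE_mat (hA : ∀ i j, ConvAt ρ (A i j)) :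
    ∃ E : ℝ, 1 ≤ E ∧ ∀ i j, GaussLE ρ E (A i j) := by
  choose c h0 hc using fun i j => (hA i j).exists_gaussLE
  refine ⟨1 + ∑ i, ∑ j, c i j, by
    have := Finset.sum_nonneg fun i (_ : i ∈ Finset.univ) =>
      Finset.sum_nonneg fun j (_ : j ∈ Finset.univ) => h0 i j
    linarith, fun i j => (hc i j).mono ?_⟩
  have h1 := Finset.single_le_sum (f := fun j => c i j) (fun j _ => h0 i j) (Finset.mem_univ j)
  have h2 := Finset.single_le_sum (f := fun i => ∑ j, c i j)
    (fun i _ => Finset.sum_nonneg fun j _ => h0 i j) (Finset.mem_univ i)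
  exact (h1.trans h2).trans (by linarith)

theorem gaussLE_mul_mat {F H : Matrix (Fin n) (Fin n) (BaseRing K κ)} {c E : ℝ} (hρ : 0 < ρ)
    (hc : 0 ≤ c) (hE : 0 ≤ E) (hF : ∀ i j, GaussLE ρ c (F i j)) (hH : ∀ i j, GaussLE ρ E (H i j))
    (i j : Fin n) : GaussLE ρ (E * c) ((F * H) i j) := by
  rw [Matrix.mul_apply]
  refine GaussLE.sum hρ (by positivity) fun l _ => ?_
  rw [mul_comm E]
  exact (hF i l).mul hρ (hH l j)

/-- Each step of the recursion multiplies the bound by at most a bound `E` for `G`, divided by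
`|m+1|`; the denominators accumulate to `|m!| ≥ |p|^m`. -/
theorem exists_gaussLE_binomMat {p : ℕ} (hpp : p.Prime) (hp : ‖(p : K)‖ < 1) (hρ : 0 < ρ)
    (hG : ∀ i j, ConvAt ρ (G i j)) : ∃ D : ℝ, 0 ≤ D ∧ ∀ m i j, GaussLE ρ (D ^ m) (binomMat G m i j) := by
  obtain ⟨E, hE1, hE⟩ := exists_gaussLE_mat hG
  have hp0 : 0 < ‖(p : K)‖ := norm_pos_iff.2 (Nat.cast_ne_zero.2 hpp.ne_zero)
  refine ⟨E / ‖(p : K)‖, by positivity, gaussLE_of_recursion (b := fun m => ‖((m + 1 : ℕ) : K)‖) hρ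
    (by positivity) hp0 (fun m => ?_) rfl (fun m => norm_nonneg _) fun m c hc hc0 i j => ?_⟩
  · rw [← norm_prod, ← Nat.cast_prod, Finset.prod_range_add_one_eq_factorial]
    exact norm_factorial_ge hpp hp m
  · have h1 : c ≤ E * c := le_mul_of_one_le_left hc0 hE1
    have h2 : ∀ k : ℕ, ∀ f : BaseRing K κ, GaussLE ρ c f → GaussLE ρ c (k • f) := fun k f hf => by
      rw [← Nat.cast_smul_eq_nsmul K]
      exact (hf.smul _).mono (mul_le_of_le_one_left hc0 (IsUltrametricDist.norm_natCast_le_one K k))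
    rw [binomMat, div_eq_inv_mul, ← norm_inv, ← Nat.cast_succ]
    refine GaussLE.smul _ (GaussLE.sub hρ (GaussLE.add hρ (((hc i j).theta hρ).mono h1)
      (gaussLE_mul_mat hρ hc0 (by positivity) hc hE i j)) ((h2 m _ (hc i j)).mono h1))

/-- The same argument with denominators `|q^{m+1} - 1|`, whose products are bounded below by
`exists_prod_norm_pow_sub_one_ge`. -/
theorem exists_gaussLE_qMat {p : ℕ} (hpp : p.Prime) (hp : ‖(p : K)‖ < 1) (hq : ¬ IsOfFinOrder q)
    (hq1 : ‖(q : K) - 1‖ < 1) (hρ : 0 < ρ) (hA : ∀ i j, ConvAt ρ (A i j)) :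
    ∃ D : ℝ, 0 ≤ D ∧ ∀ m i j, GaussLE ρ (D ^ m) (qMat q A m i j) := by
  obtain ⟨E, hE1, hE⟩ := exists_gaussLE_mat hA
  obtain ⟨d, hd, hprod⟩ := exists_prod_norm_pow_sub_one_ge hpp hp (norm_unit q) hq1
    fun m hm => pow_ne_one_of_not_isOfFinOrder hq hm
  refine ⟨E / d, by positivity, gaussLE_of_recursion (b := fun m => ‖(q : K) ^ (m + 1) - 1‖) hρ
    (by positivity) hd hprod qMat_zero (fun m => norm_nonneg _) fun m c hc hc0 i j => ?_⟩
  have h0 : (q : K) ^ m ≠ 0 := pow_ne_zero _ (coe_ne_zero q)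
  have h1 : (q : K) ^ (m + 1) - 1 ≠ 0 :=
    sub_ne_zero.2 (pow_ne_one_of_not_isOfFinOrder hq (Nat.succ_pos m))
  have h2 : qMat q A (m + 1) i j = ((q : K) ^ m * ((q : K) ^ (m + 1) - 1))⁻¹ •
      (((qMat q A m).map (sigma q) * A) i j - (q : K) ^ m • qMat q A m i j) := by
    rw [qMat_sigma_mul hq, Matrix.add_apply, Matrix.smul_apply, Matrix.smul_apply,
      add_sub_cancel_left, smul_smul, inv_mul_cancel₀ (mul_ne_zero h0 h1), one_smul]
  have h3 : ‖(q : K) ^ m‖ = 1 := by rw [norm_pow, norm_unit, one_pow]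
  rw [h2]
  have h4 := GaussLE.smul ((q : K) ^ m * ((q : K) ^ (m + 1) - 1))⁻¹
    (GaussLE.sub hρ (gaussLE_mul_mat (F := (qMat q A m).map (sigma q)) hρ hc0 (by positivity)
      (fun i j => (hc i j).sigma q) hE i j)
    (((hc i j).smul ((q : K) ^ m)).mono (show _ ≤ E * c by
      rw [h3]
      gcongr)))
  rwa [norm_inv, norm_mul, h3, one_mul, ← div_eq_inv_mul] at h4

/-- The matrices `G` whose Taylor solutions converge on the disks of relative radius `τ < r`. -/
def Rad (r : ℝ) (G : Matrix (Fin n) (Fin n) (BaseRing K κ)) : Prop :=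
  ∀ τ : ℝ, 0 < τ → τ < r → ∃ ε : ℝ, 0 < ε ∧ ε < 1 ∧ ∀ ρ ∈ annulus κ ε,
    (∀ i j, ConvAt ρ (G i j)) ∧ SeqBound ρ τ (binomMat G)

theorem exists_convAt_mat (A : Matrix (Fin n) (Fin n) (BaseRing K κ)) :
    ∃ ε : ℝ, 0 < ε ∧ ε < 1 ∧ ∀ ρ ∈ annulus κ ε, ∀ i j, ConvAt ρ (A i j) := by
  obtain ⟨ε, h0, h1, h⟩ := exists_convAt_finite fun p : Fin n × Fin n => A p.1 p.2
  exact ⟨ε, h0, h1, fun ρ hρ i j => h ρ hρ (i, j)⟩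

theorem one_mem_annulus {ε : ℝ} (h : 0 < ε) : (1 : ℝ) ∈ annulus BaseKind.hdagger ε :=
  ⟨by linarith, by linarith⟩

/-- From the radius condition to bounds on an annulus, for a sequence of matrices. -/
theorem exists_seqBound_of_radiusCondition {P : Matrix (Fin n) (Fin n) (BaseRing K κ) → ℕ →
      Matrix (Fin n) (Fin n) (BaseRing K κ)} {ray : ℝ → ℝ≥0∞}
    (h1 : ∀ ρ s : ℝ, 0 < ρ → 0 < s → (∀ i j, ConvAt ρ (A i j)) → ENNReal.ofReal s < ray ρ →
      SeqBound ρ (s / ρ) (P A))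
    (h2 : ∀ ρ : ℝ, 0 < ρ → (∀ i j, ConvAt ρ (A i j)) →
      ∃ D : ℝ, 0 ≤ D ∧ ∀ m i j, GaussLE ρ (D ^ m) (P A m i j))
    (h : RadiusCondition κ r q ray) (hτ0 : 0 < τ) (hτ : τ < r) :
    ∃ ε : ℝ, 0 < ε ∧ ε < 1 ∧ ∀ ρ ∈ annulus κ ε, (∀ i j, ConvAt ρ (A i j)) ∧ SeqBound ρ τ (P A) := by
  obtain ⟨ε₀, he0, he1, hA⟩ := exists_convAt_mat A
  cases κ with
  | robba =>
    obtain ⟨ε, h0', h1', hε⟩ := h.lt_ray_robba hτ0 hτ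
    refine ⟨min ε₀ ε, lt_min he0 h0', min_lt_of_left_lt he1, fun ρ hρ => ?_⟩
    have hA' := hA ρ (annulus_mono _ (min_le_left _ _) hρ)
    have hρ0 := annulus_pos _ (min_lt_of_left_lt he1) hρ
    -- Since `ρ < 1`, the relative radius `τ/ρ` is at least `τ`.
    refine ⟨hA', (h1 ρ τ hρ0 hτ0 hA' (hε ρ (annulus_mono _ (min_le_right _ _) hρ))).mono hτ0 ?_⟩
    rw [le_div_iff₀ hρ0]
    exact mul_le_of_le_one_right hτ0.le hρ.2.le
  | hdagger =>
    -- Only `ρ = 1` is controlled by the hypothesis. The margin between `τ` and `τ'` pays for the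
    -- interpolation with the circles `1 ± ε₀/2`, which lie in the annulus of convergence.
    obtain ⟨τ', hτ1, hτ2⟩ := exists_between hτ
    have h3 := h1 1 τ' one_pos (hτ0.trans hτ1) (hA 1 (one_mem_annulus he0))
      (h.lt_ray_hdagger (hτ0.trans hτ1) hτ2)
    rw [div_one] at h3
    have hm₀ : 1 - ε₀ / 2 ∈ annulus BaseKind.hdagger ε₀ := ⟨by linarith, by linarith⟩
    have hm₁ : 1 + ε₀ / 2 ∈ annulus BaseKind.hdagger ε₀ := ⟨by linarith, by linarith⟩
    obtain ⟨D₀, hD₀, hb₀⟩ := h2 _ (by linarith) (hA _ hm₀)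
    obtain ⟨D₁, -, hb₁⟩ := h2 _ (by linarith) (hA _ hm₁)
    have hmax : 0 ≤ max D₀ |D₁| := hD₀.trans (le_max_left _ _)
    obtain ⟨ε, h0', h1', hε⟩ := exists_seqBound_near_one (D := max D₀ |D₁|) hτ0 hτ1 h3
      (ρ₀ := 1 - ε₀ / 2) (ρ₁ := 1 + ε₀ / 2) (by linarith) (by linarith) (by linarith) hmax
      (fun m i j => (hb₀ m i j).mono (pow_le_pow_left₀ hD₀ (le_max_left _ _) m))
      (fun m i j => (hb₁ m i j).mono ((le_abs_self _).trans (by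
        rw [abs_pow]
        exact pow_le_pow_left₀ (abs_nonneg _) (le_max_right _ _) m)))
    exact ⟨min ε₀ ε, lt_min he0 h0', min_lt_of_left_lt he1, fun ρ hρ =>
      ⟨hA ρ (annulus_mono _ (min_le_left _ _) hρ), hε ρ (annulus_mono _ (min_le_right _ _) hρ)⟩⟩

theorem Rad.of_radiusCondition {p : ℕ} (hpp : p.Prime) (hp : ‖(p : K)‖ < 1)
    (h : RadiusCondition κ r q (dRay G)) : Rad r G := fun _ hτ0 hτ =>
  exists_seqBound_of_radiusCondition (P := binomMat)
    (fun _ _ hρ hs hG hlt => seqBound_of_lt_dRay hρ hs hG hlt)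
    (fun _ hρ hG => exists_gaussLE_binomMat hpp hp hρ hG) h hτ0 hτ

/-- A `q`-difference equation satisfying the radius condition comes from a differential equation. -/
theorem exists_rad_of_radiusCondition (Ω : Type w) [NontriviallyNormedField Ω] [IsUltrametricDist Ω]
    [CompleteSpace Ω] [NormedAlgebra K Ω] (hgen : ∀ {ε : ℝ}, 0 < ε → ε < 1 →
      ∃ ρ ∈ annulus κ ε, ∃ t : Ω, IsGenericPoint K ρ t)
    {p : ℕ} (hpp : p.Prime) (hp : ‖(p : K)‖ < 1) (hr1 : r ≤ 1) (hq : ¬ IsOfFinOrder q)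
    (hqr : ‖(q : K) - 1‖ < r) (h : RadiusCondition κ r q (qRay q A)) :
    ∃ G : Matrix (Fin n) (Fin n) (BaseRing K κ), Rad r G ∧ IsTaylorMat (q : K) G A := by
  have key : ∀ τ, ‖(q : K) - 1‖ < τ → τ < r → ∃ G : Matrix (Fin n) (Fin n) (BaseRing K κ),
      IsTaylorMat (q : K) G A ∧
      (∀ i j, IsCoeffSum (fun m => (newtonPoly (q : K) m).coeff 1 • qMat q A m i j) (G i j)) ∧
      ∃ ε : ℝ, 0 < ε ∧ ε < 1 ∧ ∀ ρ ∈ annulus κ ε,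
        (∀ i j, ConvAt ρ (G i j)) ∧ SeqBound ρ τ (binomMat G) := by
    intro τ h1 h2
    obtain ⟨ε, he0, he1, hε⟩ := exists_seqBound_of_radiusCondition (P := qMat q)
      (fun _ _ hρ hs hA hlt => seqBound_of_lt_qRay hq hρ hs hA hlt)
      (fun _ hρ hA => exists_gaussLE_qMat hpp hp hq (hqr.trans_le hr1) hρ hA) h
      ((norm_nonneg _).trans_lt h1) h2
    obtain ⟨G, hG1, hG2, hG3⟩ := exists_isTaylorMat Ω hgen he0 he1 hpp.pos hp hq (h2.le.trans hr1) h1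
      (fun ρ hρ => (hε ρ hρ).1) (fun ρ hρ => (hε ρ hρ).2)
    exact ⟨G, hG1, hG2, ε, he0, he1, hG3⟩
  obtain ⟨τ₀, h1, h2⟩ := exists_between hqr
  obtain ⟨G, hT, hG, -⟩ := key τ₀ h1 h2
  refine ⟨G, fun τ hτ0 hτ => ?_, hT⟩
  -- The construction for `τ` requires `|q-1| < τ`, hence the maximum with `τ₀`. It returns the same
  -- `G`, as both are the coefficientwise sum of one explicit series.
  obtain ⟨G', -, hG', ε, he0, he1, hε⟩ := key (max τ τ₀) (h1.trans_le (le_max_right _ _)) (max_lt hτ h2)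
  have hGG' : G = G' := by
    ext i j : 1
    exact (hG i j).unique (hG' i j)
  subst hGG'
  exact ⟨ε, he0, he1, fun ρ hρ => ⟨(hε ρ hρ).1, (hε ρ hρ).2.mono hτ0 (le_max_left _ _)⟩⟩

theorem Rad.radiusCondition_dRay (hr1 : r ≤ 1) (hG : Rad r G) (hq : q ∈ disk K r) :
    RadiusCondition κ r q (dRay G) :=
  radiusCondition_of_le hq fun τ h0 h1 _ => by
    obtain ⟨ε, he0, he1, hε⟩ := hG τ h0 h1
    exact ⟨ε, he0, he1, fun ρ hρ => le_dRay (annulus_pos κ he1 hρ) h0 (h1.le.trans hr1) (hε ρ hρ).2⟩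

theorem Rad.radiusCondition_qRay (Ω : Type w) [NontriviallyNormedField Ω] [IsUltrametricDist Ω]
    [CompleteSpace Ω] [NormedAlgebra K Ω] (hgen : ∀ {ε : ℝ}, 0 < ε → ε < 1 →
      ∃ ρ ∈ annulus κ ε, ∃ t : Ω, IsGenericPoint K ρ t)
    (hr1 : r ≤ 1) (hG : Rad r G) (hq : q ∈ disk K r) (hq' : ¬ IsOfFinOrder q)
    (hA : IsTaylorMat (q : K) G A) : RadiusCondition κ r q (qRay q A) :=
  radiusCondition_of_le hq fun τ h0 h1 hτ => by
    obtain ⟨ε, he0, he1, hε⟩ := hG τ h0 h1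
    exact ⟨ε, he0, he1, fun ρ hρ => le_qRay hq' (annulus_pos κ he1 hρ) h0 (h1.le.trans hr1)
      (seqBound_qMat Ω hgen he0 he1 hq' (h1.le.trans hr1) hτ (fun ρ hρ => (hε ρ hρ).1)
        (fun ρ hρ => (hε ρ hρ).2) hA hρ)⟩

end RadiiBounds

/-! ## Intertwining matrices -/

section Intertwine

variable {K : Type u} [NormedField K] [IsUltrametricDist K] [CompleteSpace K] [CharZero K]
  {κ : BaseKind} {n m : ℕ} {r s ρ τ ε : ℝ}
  {G : Matrix (Fin n) (Fin n) (BaseRing K κ)} {G' : Matrix (Fin m) (Fin m) (BaseRing K κ)}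
  {F : Matrix (Fin n) (Fin m) (BaseRing K κ)}
  {L : Type w} [NontriviallyNormedField L] [IsUltrametricDist L] [CompleteSpace L]
  [NormedAlgebra K L] {x : L}

/-- For `|q-1| < τ < r` the series `∑ (q-1)^k N_k` has geometrically decreasing Gauss norms on the
annulus belonging to `τ`. -/
theorem Rad.exists_isTaylorMat (hG : Rad r G) {q : K} (hq : ‖q - 1‖ < r) :
    ∃ A, IsTaylorMat q G A := by
  obtain ⟨τ, h1, h2⟩ := exists_between hq
  obtain ⟨ε, he0, he1, hε⟩ := hG τ ((norm_nonneg _).trans_lt h1) h2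
  choose A hA using fun i j => exists_isCoeffSum he0 he1 fun ρ hρ =>
    (hε ρ hρ).2.nullFamily (ConvAt.binomMat (annulus_pos κ he1 hρ) (hε ρ hρ).1) h1 i j
  exact ⟨Matrix.of A, hA⟩

theorem isTaylorMat_one (G : Matrix (Fin n) (Fin n) (BaseRing K κ)) : IsTaylorMat (1 : K) G 1 := by
  intro i j l
  rw [sub_self]
  convert hasSum_single (f := fun k => ((0 : K) ^ k • binomMat G k i j).coeff l) 0 fun k hk => ?_
    using 1
  · rw [pow_zero, one_smul]
    rfl
  · simp only [zero_pow hk, coeff_smul, zero_mul]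

theorem map_C_evalPS {a b : ℕ} (F : Matrix (Fin a) (Fin b) (BaseRing K κ)) (x : L) :
    (F.map C).map (evalPS x) = (F.map (eval x)).map C := by
  ext i j k
  simp only [Matrix.map_apply, coeff_evalPS, PowerSeries.coeff_C]
  split_ifs
  · rfl
  · exact eval_zero

theorem solAt_intertwine (hx : 0 < ‖x‖) (hG : ∀ i j, ConvAt ‖x‖ (G i j))
    (hG' : ∀ i j, ConvAt ‖x‖ (G' i j)) (hF : ∀ i j, ConvAt ‖x‖ (F i j))
    (h : G * F = F.map theta + F * G') :
    solAt x G * (F.map (eval x)).map C = (F.map tay).map (evalPS x) * solAt x G' := by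
  have h1 := congrArg (fun Z => Z.map (evalPS x)) (genSol_intertwine h)
  have hC : ∀ i j k, ConvAt ‖x‖ (PowerSeries.coeff k ((F.map (C : BaseRing K κ → _)) i j)) :=
    fun i j k => by
      rw [Matrix.map_apply, PowerSeries.coeff_C]
      split_ifs
      · exact hF i j
      · exact convAt_zero
  rwa [map_evalPS_mul hx (convAt_coeff_genSol hx hG) hC,
    map_evalPS_mul hx (A := F.map tay) (fun i j k => convAt_coeff_tay hx (hF i j) k)
      (convAt_coeff_genSol hx hG'), map_C_evalPS] at h1

theorem map_eval_sigma {a b : ℕ} (q : UnitGroup K) (F : Matrix (Fin a) (Fin b) (BaseRing K κ)) (x : L) :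
    (F.map (sigma q)).map (eval x) = F.map (eval (algebraMap K L (q : K) * x)) := by
  ext i j : 1
  exact eval_sigma q _

/-- Iteration of the relation for one step along `x, qx, q²x, …`. -/
theorem qNode_intertwine {q : UnitGroup K} (hq : ¬ IsOfFinOrder q) (hx : 0 < ‖x‖)
    {A : Matrix (Fin n) (Fin n) (BaseRing K κ)} {A' : Matrix (Fin m) (Fin m) (BaseRing K κ)}
    (hA : ∀ i j, ConvAt ‖x‖ (A i j)) (hA' : ∀ i j, ConvAt ‖x‖ (A' i j))
    (hF : ∀ i j, ConvAt ‖x‖ (F i j)) (h : A * F = F.map (sigma q) * A') (i : ℕ) :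
    qNode q A x i * F.map (eval x) =
      F.map (eval (algebraMap K L (q : K) ^ i * x)) * qNode q A' x i := by
  induction i generalizing x with
  | zero => rw [pow_zero, one_mul, qNode_zero, qNode_zero, Matrix.one_mul, Matrix.mul_one]
  | succ i ih =>
    have hx' := norm_algebraMap_mul (L := L) q x
    have h1 := congrArg (fun Z => Z.map (eval x)) h
    rw [matEval_mul hx hA hF, matEval_mul (A := F.map (sigma q)) hx (fun i j => (hF i j).sigma q) hA',
      map_eval_sigma] at h1
    rw [qNode_succ hq hx hA, qNode_succ hq hx hA', Matrix.mul_assoc, matEval, h1, ← Matrix.mul_assoc,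
      ih (by rwa [hx']) (by rwa [hx']) (by rwa [hx']) (by rwa [hx']), Matrix.mul_assoc, pow_succ,
      mul_assoc]
    rfl

/-- The relation for a single `σ_q` gives equality of both sides at all nodes `q^i - 1`, and the
identity principle then gives equality of the series. This is where `q` must not be a root of unity.
-/
theorem solAt_intertwine_of_sigma {p : ℕ} (hp0 : 0 < p) (hp : ‖(p : K)‖ < 1) {q : UnitGroup K}
    (hq : ¬ IsOfFinOrder q) (hqs : ‖(q : K) - 1‖ < s) (hs1 : s ≤ 1) (hx : 0 < ‖x‖)
    {A : Matrix (Fin n) (Fin n) (BaseRing K κ)} {A' : Matrix (Fin m) (Fin m) (BaseRing K κ)}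
    (hG : ∀ i j, ConvAt ‖x‖ (G i j)) (hG' : ∀ i j, ConvAt ‖x‖ (G' i j))
    (hF : ∀ i j, ConvAt ‖x‖ (F i j)) (hB : SeqBound ‖x‖ s (binomMat G))
    (hB' : SeqBound ‖x‖ s (binomMat G')) (hA : IsTaylorMat (q : K) G A)
    (hA' : IsTaylorMat (q : K) G' A') (h : A * F = F.map (sigma q) * A') :
    solAt x G * (F.map (eval x)).map C = (F.map tay).map (evalPS x) * solAt x G' := by
  have hs : 0 < s := (norm_nonneg _).trans_lt hqs
  have hb := PBM_solAt hx hs hG hB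
  have hb' := PBM_solAt hx hs hG' hB'
  have ht := PBM_tay hx hF hs.le hs1
  refine matrixPS_ext_of_frequently (hb.mul (PBM_C _) hs) (ht.mul hb' hs) hs
    (frequently_node hp0 hp (norm_unit q) (hqs.trans_le hs1)
      (fun m hm => pow_ne_one_of_not_isOfFinOrder hq hm) fun i => ?_)
  have hi : ‖algebraMap K L ((q : K) ^ i - 1)‖ < s := by
    rw [norm_algebraMap']
    exact (norm_pow_sub_one_le (norm_unit q) i).trans_lt hqs
  rw [evM_mul hb (PBM_C _) hi, evM_mul ht hb' hi, evM_C, evM_tay hx hF (hi.trans_le hs1),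
    evM_solAt_node hq hx hs1 hG hB hqs hA, evM_solAt_node hq hx hs1 hG' hB' hqs hA',
    qNode_intertwine hq hx (hA.convAt hx hG hB hqs) (hA'.convAt hx hG' hB' hqs) hF h,
    algebraMap_pow_sub_one, add_sub_cancel]

/-- If `F` intertwines the Taylor solutions at a generic point, it intertwines the Taylor operators
for all `q`. -/
theorem sigma_intertwine (ht : IsGenericPoint K ρ x) (hρ : 0 < ρ) {q : UnitGroup K}
    (hqs : ‖(q : K) - 1‖ < s) (hs1 : s ≤ 1)
    {A : Matrix (Fin n) (Fin n) (BaseRing K κ)} {A' : Matrix (Fin m) (Fin m) (BaseRing K κ)}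
    (hG : ∀ i j, ConvAt ρ (G i j)) (hG' : ∀ i j, ConvAt ρ (G' i j))
    (hF : ∀ i j, ConvAt ρ (F i j)) (hB : SeqBound ρ s (binomMat G))
    (hB' : SeqBound ρ s (binomMat G')) (hA : IsTaylorMat (q : K) G A)
    (hA' : IsTaylorMat (q : K) G' A')
    (h : solAt x G * (F.map (eval x)).map C = (F.map tay).map (evalPS x) * solAt x G') :
    A * F = F.map (sigma q) * A' := by
  have hxρ : ‖x‖ = ρ := ht.1
  subst hxρ
  have hs : 0 < s := (norm_nonneg _).trans_lt hqs
  have hAc := hA.convAt hρ hG hB hqs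
  have hAc' := hA'.convAt hρ hG' hB' hqs
  have hu : ‖algebraMap K L ((q : K) - 1)‖ < s := by rwa [norm_algebraMap']
  have hb := PBM_solAt hρ hs hG hB
  have hb' := PBM_solAt hρ hs hG' hB'
  have htay := PBM_tay hρ hF hs.le hs1
  have h1 := congrArg (evM (algebraMap K L ((q : K) - 1))) h
  rw [evM_mul hb (PBM_C _) hu, evM_mul htay hb' hu, evM_C, evM_tay hρ hF (hu.trans_le hs1),
    ← hA.matEval_eq hρ hG hB hqs, ← hA'.matEval_eq hρ hG' hB' hqs, map_sub, map_one,
    add_sub_cancel, ← map_eval_sigma] at h1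
  refine ht.matEval_injective hρ (fun i j => ?_) (fun i j => ?_) ?_
  · rw [Matrix.mul_apply]
    exact ConvAt.sum hρ fun l _ => (hAc i l).mul hρ (hF l j)
  · rw [Matrix.mul_apply]
    exact ConvAt.sum hρ fun l _ => ((hF i l).sigma q).mul hρ (hAc' l j)
  · rw [matEval_mul hρ hAc hF, matEval_mul (A := F.map (sigma q)) hρ (fun i j => (hF i j).sigma q) hAc']
    exact h1

/-- The Taylor matrices are determined by their values at a generic point. -/
theorem isTaylorMat_of_generic (ht : IsGenericPoint K ρ x) (hρ : 0 < ρ) (hG : Rad r G) {q : K}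
    (hqr : ‖q - 1‖ < r) (hqs : ‖q - 1‖ < s) {A : Matrix (Fin n) (Fin n) (BaseRing K κ)}
    (hA : ∀ i j, ConvAt ρ (A i j)) (hGc : ∀ i j, ConvAt ρ (G i j)) (hB : SeqBound ρ s (binomMat G))
    (h : matEval x A = evM (algebraMap K L (q - 1)) (solAt x G)) : IsTaylorMat q G A := by
  have hxρ : ‖x‖ = ρ := ht.1
  subst hxρ
  -- The true Taylor matrix exists by the radius hypothesis; it equals `A` because both have the
  -- same value at the generic point.
  obtain ⟨A', hA'⟩ := hG.exists_isTaylorMat hqr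
  rw [← hA'.matEval_eq hρ hGc hB hqs] at h
  rwa [ht.matEval_injective hρ hA (hA'.convAt hρ hGc hB hqs) h]

/-- The cocycle relation for the Taylor operators. -/
theorem IsTaylorMat.mul (ht : IsGenericPoint K ρ x) (hρ : 0 < ρ) (hG : Rad r G) {q q' : UnitGroup K}
    (hqs : ‖(q : K) - 1‖ < s) (hqs' : ‖(q' : K) - 1‖ < s) (hsr : s ≤ r) (hs1 : s ≤ 1)
    {A A' : Matrix (Fin n) (Fin n) (BaseRing K κ)} (hGc : ∀ i j, ConvAt ρ (G i j))
    (hB : SeqBound ρ s (binomMat G)) (hA : IsTaylorMat (q : K) G A) (hA' : IsTaylorMat (q' : K) G A') :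
    IsTaylorMat ((q * q' : UnitGroup K) : K) G (A'.map (sigma q) * A) := by
  have hxρ : ‖x‖ = ρ := ht.1
  have hs : 0 < s := (norm_nonneg _).trans_lt hqs
  have hqq : ‖((q * q' : UnitGroup K) : K) - 1‖ < s := by
    have : ((q * q' : UnitGroup K) : K) - 1 = (q : K) * ((q' : K) - 1) + ((q : K) - 1) := by
      rw [Metric.unitSphere.coe_mul]
      ring
    rw [this]
    refine (IsUltrametricDist.norm_add_le_max _ _).trans_lt (max_lt ?_ hqs)
    rwa [norm_mul, norm_unit, one_mul]
  have hAc := hA.convAt hρ hGc hB hqs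
  have hAc' := hA'.convAt hρ hGc hB hqs'
  refine isTaylorMat_of_generic ht hρ hG (hqq.trans_le hsr) hqq (fun i j => ?_) hGc hB ?_
  · rw [Matrix.mul_apply]
    exact ConvAt.sum hρ fun l _ => ((hAc' i l).sigma q).mul hρ (hAc l j)
  · subst hxρ
    have hqx := norm_algebraMap_mul (L := L) q x
    -- The relative coordinate `q - 1` followed by `q' - 1` at the point `qx` is the relative
    -- coordinate `qq' - 1` at `x`.
    have h1 := solAt_cocycle hρ hs hs1 hGc hB (u := algebraMap K L ((q : K) - 1))
      (v := algebraMap K L ((q' : K) - 1)) (by rwa [norm_algebraMap']) (by rwa [norm_algebraMap'])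
    have h2 : 1 + algebraMap K L ((q : K) - 1) = algebraMap K L (q : K) := by
      rw [map_sub, map_one, add_sub_cancel]
    have h3 : algebraMap K L ((q : K) - 1) + algebraMap K L (q : K) * algebraMap K L ((q' : K) - 1) =
        algebraMap K L (((q * q' : UnitGroup K) : K) - 1) := by
      rw [Metric.unitSphere.coe_mul]
      simp only [map_sub, map_one, map_mul]
      ring
    rw [h2, h3] at h1
    rw [h1, ← hA.matEval_eq hρ hGc hB hqs,
      ← hA'.matEval_eq (by rwa [hqx]) (by rwa [hqx]) (by rwa [hqx]) hqs', ← matEval_sigma]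
    exact matEval_mul hρ (fun i j => (hAc' i j).sigma q) hAc

/-- Invariance of the radius under changes of basis. -/
theorem Rad.of_intertwine (hG' : Rad r G') (hr1 : r ≤ 1) {F' : Matrix (Fin m) (Fin n) (BaseRing K κ)}
    (hF : F * F' = 1) (h : G * F = F.map theta + F * G') : Rad r G := by
  intro τ hτ0 hτ
  obtain ⟨ε₁, h10, h11, h1⟩ := hG' τ hτ0 hτ
  obtain ⟨ε₂, h20, h21, h2⟩ := exists_convAt_mat G
  obtain ⟨ε₃, h30, h31, h3⟩ := exists_convAt_finite fun p : Fin n × Fin m => F p.1 p.2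
  obtain ⟨ε₄, h40, h41, h4⟩ := exists_convAt_finite fun p : Fin m × Fin n => F' p.1 p.2
  refine ⟨min (min ε₁ ε₂) (min ε₃ ε₄), lt_min (lt_min h10 h20) (lt_min h30 h40),
    min_lt_of_left_lt (min_lt_of_left_lt h11), fun ρ hρ => ?_⟩
  have hρ1 := annulus_mono κ ((min_le_left _ _).trans (min_le_left _ _)) hρ
  have hρ2 := annulus_mono κ ((min_le_left _ _).trans (min_le_right _ _)) hρ
  have hρ3 := annulus_mono κ ((min_le_right _ _).trans (min_le_left _ _)) hρ
  have hρ4 := annulus_mono κ ((min_le_right _ _).trans (min_le_right _ _)) hρ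
  have hρ0 := annulus_pos κ h11 hρ1
  refine ⟨h2 ρ hρ2, ?_⟩
  obtain ⟨c, hc0, hc⟩ := (h1 ρ hρ1).2.exists_nonneg hτ0
  choose a ha0 ha using fun i j => (h3 ρ hρ3 (i, j)).exists_gaussLE
  choose b hb0 hb using fun i j => (h4 ρ hρ4 (i, j)).exists_gaussLE
  refine ⟨∑ i, ∑ j, ∑ k, ∑ l, a i j * c * b k l, fun k i l => ?_⟩
  -- With `F` invertible, the solution for `G` is `F((1+X)T) · N' · F⁻¹`. The outer factors have
  -- bounded coefficients, so the growth of the coefficients of `N'` is kept.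
  have hgen : genSol G = (F.map tay * genSol G') * F'.map C := by
    rw [← genSol_intertwine h, Matrix.mul_assoc, ← Matrix.map_mul, hF,
      Matrix.map_one _ (map_zero _) (map_one _), mul_one]
  rw [← coeff_genSol, hgen, Matrix.mul_apply, map_sum]
  have hnn : ∀ i j k l, 0 ≤ a i j * c * b k l := fun i j k l =>
    mul_nonneg (mul_nonneg (ha0 i j) hc0) (hb0 k l)
  have hle : ∀ i j k l, a i j * c * b k l ≤ ∑ i, ∑ j, ∑ k, ∑ l, a i j * c * b k l := by
    intro i j k l
    refine le_trans (Finset.single_le_sum (f := fun l => a i j * c * b k l) (fun l _ => hnn i j k l)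
      (Finset.mem_univ l)) ?_
    refine le_trans (Finset.single_le_sum (f := fun k => ∑ l, a i j * c * b k l) (fun k _ =>
      Finset.sum_nonneg fun l _ => hnn i j k l) (Finset.mem_univ k)) ?_
    refine le_trans (Finset.single_le_sum (f := fun j => ∑ k, ∑ l, a i j * c * b k l) (fun j _ =>
      Finset.sum_nonneg fun k _ => Finset.sum_nonneg fun l _ => hnn i j k l) (Finset.mem_univ j)) ?_
    exact Finset.single_le_sum (f := fun i => ∑ j, ∑ k, ∑ l, a i j * c * b k l) (fun i _ =>
      Finset.sum_nonneg fun j _ => Finset.sum_nonneg fun k _ => Finset.sum_nonneg fun l _ =>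
        hnn i j k l) (Finset.mem_univ i)
  have hnn' : 0 ≤ (∑ i, ∑ j, ∑ k, ∑ l, a i j * c * b k l) / τ ^ k :=
    div_nonneg (Finset.sum_nonneg fun i _ => Finset.sum_nonneg fun j _ =>
      Finset.sum_nonneg fun k _ => Finset.sum_nonneg fun l _ => hnn i j k l) (by positivity)
  refine GaussLE.sum hρ0 hnn' fun d _ => ?_
  rw [Matrix.map_apply, PowerSeries.coeff_mul_C, Matrix.mul_apply, map_sum, Finset.sum_mul]
  refine GaussLE.sum hρ0 hnn' fun j _ => ?_
  rw [PowerSeries.coeff_mul, Finset.sum_mul]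
  refine GaussLE.sum hρ0 hnn' fun z hz => ?_
  rw [coeff_genSol, Matrix.map_apply, tay, PowerSeries.coeff_mk]
  refine ((((ha i j).binomTheta hρ0 z.1).mul hρ0 (hc z.2 j d)).mul hρ0 (hb d l)).mono ?_
  have hz2 : z.2 ≤ k := by
    have := Finset.HasAntidiagonal.mem_antidiagonal.1 hz
    omega
  -- Here `τ ≤ 1` is needed: the factor `F((1+X)T)` is bounded only on the relative unit disk.
  have hpow : τ ^ k ≤ τ ^ z.2 := pow_le_pow_of_le_one hτ0.le (hτ.le.trans hr1) hz2
  calc a i j * (c / τ ^ z.2) * b d l = a i j * c * b d l / τ ^ z.2 := by ring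
    _ ≤ a i j * c * b d l / τ ^ k := div_le_div_of_nonneg_left (hnn _ _ _ _) (by positivity) hpow
    _ ≤ _ := by
      gcongr
      exact hle i j d l

end Intertwine

/-! ## Connections and semilinear operators on free modules -/

section Operators

variable {K : Type u} [NormedField K] [IsUltrametricDist K] [CompleteSpace K]
  {κ : BaseKind} {n m : ℕ}
  {M N : Type v} [AddCommGroup M] [Module (BaseRing K κ) M] [AddCommGroup N] [Module (BaseRing K κ) N]
  {e : Module.Basis (Fin n) (BaseRing K κ) M} {e' : Module.Basis (Fin m) (BaseRing K κ) N}
  {q : UnitGroup K}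

/-- The matrix of a map between free modules: `φ(e_i) = ∑_j F_{ij} e'_j`. -/
def linMat (e : Module.Basis (Fin n) (BaseRing K κ) M) (e' : Module.Basis (Fin m) (BaseRing K κ) N)
    (φ : M → N) : Matrix (Fin n) (Fin m) (BaseRing K κ) :=
  Matrix.of fun i j => e'.repr (φ (e i)) j

theorem sum_linMat (φ : M → N) (i : Fin n) : ∑ j, linMat e e' φ i j • e' j = φ (e i) :=
  e'.sum_repr (φ (e i))

variable (K κ) in
/-- `δ` is a connection over `T d/dT`. -/
def IsConn (δ : M →+ M) : Prop :=
  ∀ (f : BaseRing K κ) (x : M), δ (f • x) = theta f • x + f • δ x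

variable (κ) in
/-- `φ` is semilinear over `σ_q`. -/
def IsSemilin (q : UnitGroup K) (φ : M →+ M) : Prop :=
  ∀ (f : BaseRing K κ) (x : M), φ (f • x) = sigma q f • φ x

theorem repr_sum_smul {l : ℕ} (a : Fin l → BaseRing K κ) (x : Fin l → N) (k : Fin m) :
    e'.repr (∑ j, a j • x j) k = ∑ j, a j * e'.repr (x j) k := by
  simp only [map_sum, map_smul, Finsupp.coe_finsetSum, Finset.sum_apply, Finsupp.smul_apply,
    smul_eq_mul]

theorem repr_lin_comp (f : M →ₗ[BaseRing K κ] N) (φ : M → M) (i : Fin n) (k : Fin m) :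
    e'.repr (f (φ (e i))) k = (linMat e e φ * linMat e e' f) i k := by
  rw [← sum_linMat (e := e) (e' := e) φ i, map_sum]
  simp only [map_smul]
  exact (repr_sum_smul (e' := e') _ _ _).trans (Matrix.mul_apply).symm

/-- With the row convention `f(e_i) = ∑_j F_{ij} e'_j`, composition reverses the order of matrices
and twists the inner one by `σ_q`. -/
theorem repr_semilin_comp {φ : N →+ N} (hφ : IsSemilin κ q φ) (f : M → N) (i : Fin n)
    (k : Fin m) : e'.repr (φ (f (e i))) k =
      ((linMat e e' f).map (sigma q) * linMat e' e' φ) i k := by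
  rw [← sum_linMat (e := e) (e' := e') f i, map_sum]
  simp only [hφ _ _]
  rw [repr_sum_smul]
  rfl

theorem repr_conn_comp {δ : N →+ N} (hδ : IsConn K κ δ) (f : M → N) (i : Fin n)
    (k : Fin m) : e'.repr (δ (f (e i))) k =
      ((linMat e e' f).map theta + linMat e e' f * linMat e' e' δ) i k := by
  rw [← sum_linMat (e := e) (e' := e') f i, map_sum]
  simp only [hδ _ _]
  rw [Finset.sum_add_distrib, map_add, Finsupp.add_apply, repr_sum_smul, repr_sum_smul,
    Matrix.add_apply, Matrix.mul_apply]
  congr 1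
  simp [Finsupp.single_apply]

theorem linMat_conn {δ : M →+ M} {δ' : N →+ N} (hδ' : IsConn K κ δ')
    (f : M →ₗ[BaseRing K κ] N) (h : ∀ x, f (δ x) = δ' (f x)) :
    linMat e e δ * linMat e e' f = (linMat e e' f).map theta + linMat e e' f * linMat e' e' δ' := by
  ext i k : 1
  rw [← repr_lin_comp, ← repr_conn_comp hδ', h]

theorem linMat_semilin {φ : M →+ M} {φ' : N →+ N} (hφ' : IsSemilin κ q φ')
    (f : M →ₗ[BaseRing K κ] N) (h : ∀ x, f (φ x) = φ' (f x)) :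
    linMat e e φ * linMat e e' f = (linMat e e' f).map (sigma q) * linMat e' e' φ' := by
  ext i k : 1
  rw [← repr_lin_comp, ← repr_semilin_comp hφ', h]

theorem semilin_comm {φ : M →+ M} {φ' : N →+ N} (hφ : IsSemilin κ q φ)
    (hφ' : IsSemilin κ q φ') (f : M →ₗ[BaseRing K κ] N)
    (h : linMat e e φ * linMat e e' f = (linMat e e' f).map (sigma q) * linMat e' e' φ') (x : M) :
    f (φ x) = φ' (f x) := by
  have h1 : ∀ i, f (φ (e i)) = φ' (f (e i)) := fun i => by
    refine e'.repr.injective (Finsupp.ext fun k => ?_)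
    rw [repr_lin_comp, repr_semilin_comp hφ', h]
  rw [← e.sum_repr x]
  simp only [map_sum, map_smul, hφ _ _, hφ' _ _, h1]

theorem linMat_id : linMat e e (id : M → M) = 1 := by
  ext i j : 1
  simp [linMat, Matrix.one_apply, Finsupp.single_apply]

theorem semilin_ext {φ φ' : M →+ M} (hφ : IsSemilin κ q φ) (hφ' : IsSemilin κ q φ')
    (h : linMat e e φ = linMat e e φ') : φ = φ' := by
  ext x
  refine semilin_comm (e := e) (e' := e) hφ hφ' LinearMap.id ?_ x
  have h1 : linMat e e (LinearMap.id : M →ₗ[BaseRing K κ] M) = 1 := linMat_id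
  rw [h1, h, mul_one, Matrix.map_one _ (map_zero _) (map_one _), one_mul]

/-- The transition matrices between two bases are inverse to each other. -/
theorem linMat_id_mul (e : Module.Basis (Fin n) (BaseRing K κ) M)
    (e' : Module.Basis (Fin m) (BaseRing K κ) M) :
    linMat e e' (LinearMap.id : M →ₗ[BaseRing K κ] M) *
      linMat e' e (LinearMap.id : M →ₗ[BaseRing K κ] M) = 1 := by
  ext i k : 1
  rw [Matrix.mul_apply, ← linMat_id (e := e)]
  have h2 : e.repr (∑ j, linMat e e' (LinearMap.id : M →ₗ[BaseRing K κ] M) i j • e' j) k =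
      e.repr (e i) k := by
    rw [sum_linMat]
    rfl
  simp only [map_sum, map_smul, Finsupp.coe_finsetSum, Finset.sum_apply, Finsupp.smul_apply,
    smul_eq_mul] at h2
  exact h2

/-- The semilinear operator with a given matrix. -/
def mkSemilin (q : UnitGroup K) (e : Module.Basis (Fin n) (BaseRing K κ) M)
    (A : Matrix (Fin n) (Fin n) (BaseRing K κ)) : M →+ M where
  toFun x := ∑ i, sigma q (e.repr x i) • ∑ j, A i j • e j
  map_zero' := by simp
  map_add' x y := by
    simp only [map_add, Finsupp.add_apply, add_smul, Finset.sum_add_distrib]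

theorem mkSemilin_isSemilin (A : Matrix (Fin n) (Fin n) (BaseRing K κ)) :
    IsSemilin κ q (mkSemilin q e A) := by
  intro f x
  change ∑ i, sigma q (e.repr (f • x) i) • _ = sigma q f • ∑ i, sigma q (e.repr x i) • _
  simp only [map_smul, Finsupp.smul_apply, smul_eq_mul, map_mul, mul_smul, Finset.smul_sum]

theorem linMat_mkSemilin (A : Matrix (Fin n) (Fin n) (BaseRing K κ)) :
    linMat e e (mkSemilin q e A) = A := by
  ext i k : 1
  have h1 : mkSemilin q e A (e i) = ∑ j, A i j • e j := by
    change ∑ l, sigma q (e.repr (e i) l) • ∑ j, A l j • e j = _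
    rw [Finset.sum_eq_single i]
    · simp
    · intro l _ hl
      simp [hl.symm]
    · simp
  rw [linMat, Matrix.of_apply, h1, repr_sum_smul]
  simp [Finsupp.single_apply]

/-- The connection with a given matrix. -/
def mkConn (e : Module.Basis (Fin n) (BaseRing K κ) M)
    (G : Matrix (Fin n) (Fin n) (BaseRing K κ)) : M →+ M where
  toFun x := ∑ i, (theta (e.repr x i) • e i + e.repr x i • ∑ j, G i j • e j)
  map_zero' := by simp [theta_zero]
  map_add' x y := by
    rw [← Finset.sum_add_distrib]
    refine Finset.sum_congr rfl fun i _ => ?_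
    simp only [map_add, Finsupp.add_apply, theta_add, add_smul]
    abel

theorem mkConn_isConn (G : Matrix (Fin n) (Fin n) (BaseRing K κ)) : IsConn K κ (mkConn e G) := by
  intro f x
  change ∑ i, (theta (e.repr (f • x) i) • e i + e.repr (f • x) i • ∑ j, G i j • e j) =
    theta f • x + f • ∑ i, (theta (e.repr x i) • e i + e.repr x i • ∑ j, G i j • e j)
  conv_rhs => rw [← e.sum_repr x]
  rw [Finset.smul_sum, Finset.smul_sum, ← Finset.sum_add_distrib]
  refine Finset.sum_congr rfl fun i _ => ?_
  simp only [map_smul, Finsupp.smul_apply, smul_eq_mul, theta_mul, add_smul, smul_add, mul_smul,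
    e.sum_repr]
  abel

theorem linMat_mkConn (G : Matrix (Fin n) (Fin n) (BaseRing K κ)) :
    linMat e e (mkConn e G) = G := by
  ext i k : 1
  have h1 : mkConn e G (e i) = ∑ j, G i j • e j := by
    change ∑ l, (theta (e.repr (e i) l) • e l + e.repr (e i) l • ∑ j, G l j • e j) = _
    rw [Finset.sum_eq_single i]
    · simp [theta_one]
    · intro l _ hl
      simp [hl.symm, theta_zero]
    · simp
  rw [linMat, Matrix.of_apply, h1, repr_sum_smul]
  simp [Finsupp.single_apply]

end Operators

/-! ### The disks around `1` are groups. -/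

section DiskGroup

variable {K : Type u} [NormedField K] [IsUltrametricDist K]

/-- By the ultrametric inequality `D⁻(1,τ)` is stable under `qq' - 1 = q(q' - 1) + (q - 1)` and
under inversion. Hence the group generated by a disk is the disk itself. -/
theorem mem_disk_of_mem_closure {τ : ℝ} (hτ : 0 < τ) {q : UnitGroup K}
    (hq : q ∈ Subgroup.closure (disk K τ)) : q ∈ disk K τ := by
  induction hq using Subgroup.closure_induction with
  | mem x hx => exact hx
  | one => simpa [disk] using hτ
  | mul x y _ _ hx hy =>
    have h1 : ((x * y : UnitGroup K) : K) - 1 = (x : K) * ((y : K) - 1) + ((x : K) - 1) := by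
      rw [Metric.unitSphere.coe_mul]
      ring
    have hx1 : ‖(x : K)‖ = 1 := by simp
    change ‖((x * y : UnitGroup K) : K) - 1‖ < τ
    rw [h1]
    refine (IsUltrametricDist.norm_add_le_max _ _).trans_lt (max_lt ?_ hx)
    rw [norm_mul, hx1, one_mul]
    exact hy
  | inv x _ hx =>
    have hx1 : ‖(x : K)‖ = 1 := by simp
    have hx0 : (x : K) ≠ 0 := norm_pos_iff.1 (by rw [hx1]; exact one_pos)
    have h1 : ((x⁻¹ : UnitGroup K) : K) - 1 = -((x : K)⁻¹ * ((x : K) - 1)) := by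
      rw [Metric.unitSphere.coe_inv]
      field_simp
      ring
    change ‖((x⁻¹ : UnitGroup K) : K) - 1‖ < τ
    rw [h1, norm_neg, norm_mul, norm_inv, hx1, inv_one, one_mul]
    exact hx

end DiskGroup

/-! ### Taylor operators of a connection: functoriality, independence of the basis, group law. -/

section TaylorOperators

variable {K : Type u} [NormedField K] [IsUltrametricDist K] [CompleteSpace K] [CharZero K]
  {κ : BaseKind} {n m : ℕ} {r : ℝ}
  {M N : Type v} [AddCommGroup M] [Module (BaseRing K κ) M] [AddCommGroup N] [Module (BaseRing K κ) N]
  {e : Module.Basis (Fin n) (BaseRing K κ) M} {e' : Module.Basis (Fin m) (BaseRing K κ) N}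
  {q : UnitGroup K}

/-- The extension `Ω` has generic points in all annuli. -/
def HasGenericPoints (K : Type u) [NormedField K] (κ : BaseKind) (Ω : Type w)
    [NontriviallyNormedField Ω] [NormedAlgebra K Ω] : Prop :=
  ∀ {ε : ℝ}, 0 < ε → ε < 1 → ∃ ρ ∈ annulus κ ε, ∃ t : Ω, IsGenericPoint K ρ t

variable {Ω : Type w} [NontriviallyNormedField Ω] [IsUltrametricDist Ω]
    [CompleteSpace Ω] [NormedAlgebra K Ω]

theorem Rad.change {δ : M →+ M} (hδ : IsConn K κ δ) (hG : Rad r (linMat e e δ)) (hr1 : r ≤ 1)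
    (e₂ : Module.Basis (Fin m) (BaseRing K κ) M) : Rad r (linMat e₂ e₂ δ) :=
  hG.of_intertwine hr1 (linMat_id_mul e₂ e) (linMat_conn hδ LinearMap.id fun _ => rfl)

/-- A single generic point on a common annulus at which two connections and a matrix all converge
with the required bounds; comparisons in the base ring are then made at this point. -/
theorem exists_generic_of_rad (hgen : HasGenericPoints K κ Ω)
    {G : Matrix (Fin n) (Fin n) (BaseRing K κ)}
    {G' : Matrix (Fin m) (Fin m) (BaseRing K κ)} (hG : Rad r G) (hG' : Rad r G')
    (F : Matrix (Fin n) (Fin m) (BaseRing K κ)) {τ : ℝ} (hτ0 : 0 < τ) (hτ : τ < r) :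
    ∃ (ρ : ℝ) (t : Ω), 0 < ρ ∧ IsGenericPoint K ρ t ∧ (∀ i j, ConvAt ρ (G i j)) ∧
      (∀ i j, ConvAt ρ (G' i j)) ∧ (∀ i j, ConvAt ρ (F i j)) ∧ SeqBound ρ τ (binomMat G) ∧
      SeqBound ρ τ (binomMat G') := by
  obtain ⟨ε₁, h10, h11, h1⟩ := hG τ hτ0 hτ
  obtain ⟨ε₂, h20, h21, h2⟩ := hG' τ hτ0 hτ
  obtain ⟨ε₃, h30, h31, h3⟩ := exists_convAt_finite fun p : Fin n × Fin m => F p.1 p.2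
  obtain ⟨ρ, hρ, t, ht⟩ := hgen (lt_min h10 (lt_min h20 h30)) (min_lt_of_left_lt h11)
  have hρ1 := annulus_mono κ (min_le_left _ _) hρ
  have hρ2 := annulus_mono κ ((min_le_right _ _).trans (min_le_left _ _)) hρ
  have hρ3 := annulus_mono κ ((min_le_right _ _).trans (min_le_right _ _)) hρ
  exact ⟨ρ, t, annulus_pos κ h11 hρ1, ht, (h1 ρ hρ1).1, (h2 ρ hρ2).1, fun i j => h3 ρ hρ3 (i, j),
    (h1 ρ hρ1).2, (h2 ρ hρ2).2⟩

/-- A horizontal matrix intertwines the formal Taylor solutions, hence, evaluating at `u = q - 1`,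
the Taylor operators. -/
theorem sigma_intertwine_of_conn (hgen : HasGenericPoints K κ Ω)
    {G : Matrix (Fin n) (Fin n) (BaseRing K κ)}
    {G' : Matrix (Fin m) (Fin m) (BaseRing K κ)} (hG : Rad r G) (hG' : Rad r G') (hr1 : r ≤ 1)
    {F : Matrix (Fin n) (Fin m) (BaseRing K κ)} (h : G * F = F.map theta + F * G')
    (hq : ‖(q : K) - 1‖ < r) {A : Matrix (Fin n) (Fin n) (BaseRing K κ)}
    {A' : Matrix (Fin m) (Fin m) (BaseRing K κ)} (hA : IsTaylorMat (q : K) G A)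
    (hA' : IsTaylorMat (q : K) G' A') : A * F = F.map (sigma q) * A' := by
  obtain ⟨τ, h1, h2⟩ := exists_between hq
  obtain ⟨ρ, t, hρ, ht, hc1, hc2, hc3, hB1, hB2⟩ :=
    exists_generic_of_rad hgen hG hG' F ((norm_nonneg _).trans_lt h1) h2
  refine sigma_intertwine ht hρ h1 (h2.le.trans hr1) hc1 hc2 hc3 hB1 hB2 hA hA' ?_
  obtain rfl := ht.1
  exact solAt_intertwine hρ hc1 hc2 hc3 h

/-- A matrix which intertwines one Taylor operator, for `q₀` not a root of unity, intertwines all of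
them. -/
theorem sigma_intertwine_of_sigma (hgen : HasGenericPoints K κ Ω)
    {p : ℕ} (hp0 : 0 < p) (hp : ‖(p : K)‖ < 1)
    {G : Matrix (Fin n) (Fin n) (BaseRing K κ)}
    {G' : Matrix (Fin m) (Fin m) (BaseRing K κ)} (hG : Rad r G) (hG' : Rad r G') (hr1 : r ≤ 1)
    {F : Matrix (Fin n) (Fin m) (BaseRing K κ)} {q₀ : UnitGroup K} (hq₀ : ¬ IsOfFinOrder q₀)
    (hqr₀ : ‖(q₀ : K) - 1‖ < r) {A₀ : Matrix (Fin n) (Fin n) (BaseRing K κ)}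
    {A₀' : Matrix (Fin m) (Fin m) (BaseRing K κ)} (hA₀ : IsTaylorMat (q₀ : K) G A₀)
    (hA₀' : IsTaylorMat (q₀ : K) G' A₀') (h : A₀ * F = F.map (sigma q₀) * A₀')
    (hq : ‖(q : K) - 1‖ < r) {A : Matrix (Fin n) (Fin n) (BaseRing K κ)}
    {A' : Matrix (Fin m) (Fin m) (BaseRing K κ)} (hA : IsTaylorMat (q : K) G A)
    (hA' : IsTaylorMat (q : K) G' A') : A * F = F.map (sigma q) * A' := by
  obtain ⟨τ, h1, h2⟩ := exists_between (max_lt hq hqr₀)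
  have h3 := (le_max_left _ _).trans_lt h1
  have h4 := (le_max_right _ _).trans_lt h1
  obtain ⟨ρ, t, hρ, ht, hc1, hc2, hc3, hB1, hB2⟩ :=
    exists_generic_of_rad hgen hG hG' F ((norm_nonneg _).trans_lt h3) h2
  refine sigma_intertwine ht hρ h3 (h2.le.trans hr1) hc1 hc2 hc3 hB1 hB2 hA hA' ?_
  obtain rfl := ht.1
  exact solAt_intertwine_of_sigma hp0 hp hq₀ h4 (h2.le.trans hr1) hρ hc1 hc2 hc3 hB1 hB2 hA₀ hA₀' h

/-- The Taylor operators do not depend on the basis. -/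
theorem IsTaylorMat.change (hgen : HasGenericPoints K κ Ω)
    {δ : M →+ M} (hδ : IsConn K κ δ) (hG : Rad r (linMat e e δ))
    (hr1 : r ≤ 1) {φ : M →+ M} (hφ : IsSemilin κ q φ) (hq : ‖(q : K) - 1‖ < r)
    (h : IsTaylorMat (q : K) (linMat e e δ) (linMat e e φ))
    (e₂ : Module.Basis (Fin m) (BaseRing K κ) M) :
    IsTaylorMat (q : K) (linMat e₂ e₂ δ) (linMat e₂ e₂ φ) := by
  have hG₂ := hG.change hδ hr1 e₂
  obtain ⟨A, hA⟩ := hG₂.exists_isTaylorMat hq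
  -- The transition matrix is horizontal, so it intertwines the Taylor matrix `A` in the new basis
  -- with the given one. By definition it also intertwines the matrix of `φ`; cancelling it
  -- identifies the two.
  have h1 := sigma_intertwine_of_conn hgen hG₂ hG hr1
    (linMat_conn (e := e₂) (e' := e) (δ := δ) hδ LinearMap.id fun _ => rfl) hq hA h
  have h2 := linMat_semilin (e := e₂) (e' := e) (φ := φ) hφ LinearMap.id fun _ => rfl
  rw [← h2] at h1
  have h3 := congrArg (· * linMat e e₂ (LinearMap.id : M →ₗ[BaseRing K κ] M)) h1
  simp only [Matrix.mul_assoc, linMat_id_mul, mul_one] at h3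
  rwa [← h3]

/-- A connection with large radius gives an action of the disk `D⁻(1,r)`. -/
theorem exists_action (hgen : HasGenericPoints K κ Ω)
    (hr0 : 0 < r) (hr1 : r ≤ 1) {δ : M →+ M} (hG : Rad r (linMat e e δ)) :
    ∃ σ : Subgroup.closure (disk K r) →* AddMonoid.End M,
      ∀ q : Subgroup.closure (disk K r),
      IsSemilin κ (q : UnitGroup K) (σ q) ∧
      IsTaylorMat ((q : UnitGroup K) : K) (linMat e e δ) (linMat e e (σ q)) := by
  have hd : ∀ q : Subgroup.closure (disk K r), ‖((q : UnitGroup K) : K) - 1‖ < r := fun q =>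
    mem_disk_of_mem_closure hr0 q.2
  choose A hA using fun q : Subgroup.closure (disk K r) => hG.exists_isTaylorMat (hd q)
  have hone : A 1 = 1 := by
    refine (hA 1).unique ?_
    convert isTaylorMat_one (linMat e e δ)
    simp
  -- The group law is the cocycle identity together with uniqueness of the Taylor matrix.
  have hmul : ∀ q q', A (q * q') = (A q').map (sigma (q : UnitGroup K)) * A q := fun q q' => by
    obtain ⟨τ, h1, h2⟩ := exists_between (max_lt (hd q) (hd q'))
    have h3 := (le_max_left _ _).trans_lt h1
    have h4 := (le_max_right _ _).trans_lt h1
    obtain ⟨ρ, t, hρ, ht, hc1, -, -, hB1, -⟩ :=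
      exists_generic_of_rad hgen hG hG 1 ((norm_nonneg _).trans_lt h3) h2
    exact (hA (q * q')).unique (IsTaylorMat.mul ht hρ hG h3 h4 h2.le (h2.le.trans hr1) hc1 hB1
      (hA q) (hA q'))
  refine ⟨{ toFun := fun q => mkSemilin (q : UnitGroup K) e (A q), map_one' := ?_, map_mul' := ?_ },
    fun q => ⟨mkSemilin_isSemilin _, ?_⟩⟩
  · refine semilin_ext (e := e) (q := 1) (mkSemilin_isSemilin _) (fun f x => ?_) ?_
    · rw [sigma_one]
      rfl
    · rw [linMat_mkSemilin, hone]
      exact linMat_id.symm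
  · intro q q'
    have hcomp : IsSemilin κ ((q * q' : Subgroup.closure (disk K r)) : UnitGroup K)
        ((mkSemilin (q : UnitGroup K) e (A q)).comp (mkSemilin (q' : UnitGroup K) e (A q'))) := by
      intro f x
      rw [AddMonoidHom.comp_apply, mkSemilin_isSemilin, mkSemilin_isSemilin, sigma_sigma]
      rfl
    refine semilin_ext (e := e) (mkSemilin_isSemilin _) hcomp ?_
    rw [linMat_mkSemilin, hmul]
    ext i k : 1
    change _ = e.repr (mkSemilin (q : UnitGroup K) e (A q)
      (mkSemilin (q' : UnitGroup K) e (A q') (e i))) k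
    rw [repr_semilin_comp (mkSemilin_isSemilin _) (mkSemilin (q' : UnitGroup K) e (A q')),
      linMat_mkSemilin, linMat_mkSemilin]
  · change IsTaylorMat _ _ (linMat e e (mkSemilin (q : UnitGroup K) e (A q)))
    rw [linMat_mkSemilin]
    exact hA q

end TaylorOperators

/-! ## The modules which come from connections of large radius -/

section Analyticity

variable {K : Type u} [NontriviallyNormedField K] [IsUltrametricDist K] [CompleteSpace K] [CharZero K]
  {κ : BaseKind} {n : ℕ} {G : Matrix (Fin n) (Fin n) (BaseRing K κ)} {ρ τ ε : ℝ}

/-- The Taylor matrices depend analytically on `q`. -/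
theorem exists_analytic_expansion (he0 : 0 < ε) (he1 : ε < 1)
    (hG : ∀ ρ ∈ annulus κ ε, ∀ i j, ConvAt ρ (G i j))
    (hB : ∀ ρ ∈ annulus κ ε, SeqBound ρ τ (binomMat G)) {q : K} (hq : ‖q - 1‖ < τ) (i j : Fin n) :
    ∃ a : ℕ → ℤ → K,
      (∀ ρ ∈ annulus κ ε, ∀ s : ℝ, 0 ≤ s → s < τ →
        Tendsto (fun p : ℕ × ℤ => ‖a p.1 p.2‖ * s ^ p.1 * ρ ^ p.2) cofinite (𝓝 0)) ∧
      ∀ (q' : K) (A : Matrix (Fin n) (Fin n) (BaseRing K κ)), IsTaylorMat q' G A →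
        ‖q' - q‖ < τ → ∀ m : ℤ, HasSum (fun k => a k m * (q' - q) ^ k) ((A i j).coeff m) := by
  have hτ : 0 < τ := (norm_nonneg _).trans_lt hq
  -- For each exponent `m`, the coefficient of `T^m` in the Taylor matrix is a power series in `q -
  -- 1`.
  let f : ℤ → PowerSeries K := fun m => mk fun k => (binomMat G k i j).coeff m
  have hf : ∀ m, PB τ (f m) := fun m => by
    obtain ⟨ρ, hρ⟩ := exists_mem_annulus κ he0
    obtain ⟨B, hB⟩ := hB ρ hρ
    have hρm := zpow_pos (annulus_pos κ he1 hρ) m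
    refine ⟨B / ρ ^ m, fun k => ?_⟩
    rw [PowerSeries.coeff_mk, le_div_iff₀ hρm, mul_right_comm, ← le_div_iff₀ (pow_pos hτ k)]
    exact hB k i j m
  -- Recentring at `q` loses no radius, as every point of an ultrametric disk is a centre.
  choose g hg hgs hge using fun m => (hf m).reexpand hq (l := 1) (by simp)
  refine ⟨fun k m => PowerSeries.coeff k (g m), fun ρ hρ s hs0 hs => ?_, fun q' A hA hqq m => ?_⟩
  · have hρ0 := annulus_pos κ he1 hρ
    obtain ⟨B, hB0, hBd⟩ := (hB ρ hρ).exists_nonneg hτ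
    have hterm : ∀ k l : ℕ, GaussLE ρ (B / τ ^ k * (‖q - 1‖ / τ) ^ (l - k))
        (((l.choose k : K) * (q - 1) ^ (l - k)) • binomMat G l i j) := fun k l => by
      rcases lt_or_ge l k with hlk | hlk
      · rw [Nat.choose_eq_zero_of_lt hlk, Nat.cast_zero, zero_mul, zero_smul]
        exact gaussLE_zero (by positivity)
      · refine ((hBd l i j).smul _).mono ?_
        rw [norm_mul, norm_pow, div_pow]
        have h1 : ‖(l.choose k : K)‖ ≤ 1 := IsUltrametricDist.norm_natCast_le_one K _
        have h2 : τ ^ l = τ ^ k * τ ^ (l - k) := by rw [← pow_add, Nat.add_sub_cancel' hlk]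
        rw [h2]
        calc ‖(l.choose k : K)‖ * ‖q - 1‖ ^ (l - k) * (B / (τ ^ k * τ ^ (l - k)))
            ≤ 1 * ‖q - 1‖ ^ (l - k) * (B / (τ ^ k * τ ^ (l - k))) := by gcongr
          _ = _ := by field_simp
    have hsum : ∀ k m, HasSum (fun l => ((((l.choose k : K) * (q - 1) ^ (l - k)) •
        binomMat G l i j).coeff m)) (PowerSeries.coeff k (g m)) := fun k m => by
      refine (hgs m k).congr_fun fun l => ?_
      simp only [f, PowerSeries.coeff_mk, one_pow, mul_one, coeff_smul]
      ring
    have hnull : ∀ k, NullFamily ρ fun l => ((l.choose k : K) * (q - 1) ^ (l - k)) •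
        binomMat G l i j := fun k => by
      refine ⟨fun l => (ConvAt.binomMat hρ0 (hG ρ hρ) l i j).smul _, _, ?_, hterm k⟩
      have := ((tendsto_pow_atTop_nhds_zero_of_lt_one (div_nonneg (norm_nonneg _) hτ.le)
        ((div_lt_one hτ).2 hq)).comp (tendsto_sub_atTop_nat k)).const_mul (B / τ ^ k)
      rwa [mul_zero] at this
    have hbd : ∀ k m, ‖PowerSeries.coeff k (g m)‖ * ρ ^ m ≤ B / τ ^ k := fun k m => by
      have hρm := zpow_pos hρ0 m
      rw [← le_div_iff₀ hρm]
      refine norm_le_of_hasSum (by positivity) (hsum k m) fun l => ?_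
      rw [le_div_iff₀ hρm]
      refine (hterm k l m).trans (mul_le_of_le_one_right (by positivity) (pow_le_one₀ (by positivity)
        ((div_le_one hτ).2 hq.le)))
    have h0 : ∀ p : ℕ × ℤ, 0 ≤ ‖PowerSeries.coeff p.1 (g p.2)‖ * s ^ p.1 * ρ ^ p.2 := fun p => by
      have := zpow_pos hρ0 p.2
      positivity
    -- The criterion for null double families is applied to the weighted norms themselves, regarded
    -- as real numbers.
    refine (tendsto_norm_uncurry (L := ℝ)
      (F := fun k m => ‖PowerSeries.coeff k (g m)‖ * s ^ k * ρ ^ m)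
      (c := fun k => B * (s / τ) ^ k) ?_ (fun k => ?_) fun k m => ?_).congr fun p =>
        Real.norm_of_nonneg (h0 p)
    · rw [Nat.cofinite_eq_atTop]
      have := (tendsto_pow_atTop_nhds_zero_of_lt_one (by positivity)
        ((div_lt_one hτ).2 hs)).const_mul B
      rwa [mul_zero] at this
    · have h1 := ((hnull k).null_of_hasSum hρ0 (hsum k)).const_mul (s ^ k)
      rw [mul_zero] at h1
      refine h1.congr fun m => ?_
      rw [Real.norm_of_nonneg (h0 (k, m))]
      ring
    · rw [Real.norm_of_nonneg (h0 (k, m))]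
      calc ‖PowerSeries.coeff k (g m)‖ * s ^ k * ρ ^ m
          = s ^ k * (‖PowerSeries.coeff k (g m)‖ * ρ ^ m) := by ring
        _ ≤ s ^ k * (B / τ ^ k) := mul_le_mul_of_nonneg_left (hbd k m) (by positivity)
        _ = B * (s / τ) ^ k := by rw [div_pow]; ring
  · have h1 := (hg m).hasSum hqq
    rw [hge m _ hqq, one_mul, add_comm, sub_add_sub_cancel] at h1
    convert h1
    refine (ev_eq_of_hasSum ((hA i j m).congr_fun fun k => ?_)).symm
    simp only [f, PowerSeries.coeff_mk, coeff_smul]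
    ring

/-- The derivative of the Taylor matrices at `q = 1`. -/
theorem IsTaylorMat.gaussLE_sub (hρ : 0 < ρ) (hτ : 0 < τ) {B : ℝ} (hB0 : 0 ≤ B)
    (hB : ∀ k i j, GaussLE ρ (B / τ ^ k) (binomMat G k i j)) {q : K} (hq : ‖q - 1‖ ≤ τ)
    (hq1 : q ≠ 1) {A : Matrix (Fin n) (Fin n) (BaseRing K κ)} (hA : IsTaylorMat q G A) (i j : Fin n) :
    GaussLE ρ (‖q - 1‖ * (B / τ ^ 2)) (((A - 1).map (fun f => monomial 0 (q - 1)⁻¹ * f) - G :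
      Matrix (Fin n) (Fin n) (BaseRing K κ)) i j) := by
  have hq0 : q - 1 ≠ 0 := sub_ne_zero.2 hq1
  have h1 : IsCoeffSum (fun k => ((q - 1)⁻¹ * (q - 1) ^ (k + 2)) • binomMat G (k + 2) i j)
      (((A - 1).map (fun f => monomial 0 (q - 1)⁻¹ * f) - G :
      Matrix (Fin n) (Fin n) (BaseRing K κ)) i j) := fun m => by
    -- The terms `k = 0` and `k = 1` contribute `1` and `(q-1) G`. After removing them and dividing
    -- by `q - 1`, every remaining term still contains a factor `q - 1`.
    have h2 := ((hasSum_nat_add_iff' 2).2 (hA i j m)).mul_left (q - 1)⁻¹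
    rw [Finset.sum_range_succ, Finset.sum_range_one] at h2
    simp only [pow_zero, one_smul, pow_one, binomMat_one] at h2
    have h3 : (((A - 1).map (fun f => monomial 0 (q - 1)⁻¹ * f) - G :
        Matrix (Fin n) (Fin n) (BaseRing K κ)) i j).coeff m = (q - 1)⁻¹ * ((A i j).coeff m -
          ((binomMat G 0 i j).coeff m + ((q - 1) • G i j).coeff m)) := by
      rw [Matrix.sub_apply, Matrix.map_apply, Matrix.sub_apply, monomial_zero_mul, coeff_sub,
        coeff_smul, coeff_sub, coeff_smul]
      simp only [binomMat]
      field_simp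
      ring
    rw [h3]
    exact h2.congr_fun fun k => by rw [coeff_smul, coeff_smul, mul_assoc]
  refine h1.gaussLE hρ fun k => ((hB (k + 2) i j).smul _).mono ?_
  have h3 : (‖q - 1‖ / τ) ^ k ≤ 1 := pow_le_one₀ (by positivity) ((div_le_one hτ).2 hq)
  rw [pow_succ', pow_succ', inv_mul_cancel_left₀ hq0, norm_mul, norm_pow]
  calc ‖q - 1‖ * ‖q - 1‖ ^ k * (B / τ ^ (k + 2))
      = ‖q - 1‖ * (B / τ ^ 2) * (‖q - 1‖ / τ) ^ k := by rw [div_pow, pow_add]; field_simp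
    _ ≤ ‖q - 1‖ * (B / τ ^ 2) * 1 := by gcongr
    _ = _ := mul_one _

end Analyticity

/-! ### Modules over the disk given by Taylor matrices are analytically constant. -/

section DiskModules

variable {K : Type u} [NontriviallyNormedField K] [IsUltrametricDist K] [CompleteSpace K] [CharZero K]
  {κ : BaseKind} {n : ℕ} {r : ℝ} {S : Set (UnitGroup K)}

/-- The group `⟨S⟩` acts in the basis `e` by the Taylor matrices of the connection with matrix `G`. -/
def SigmaModule.IsTaylor (M : SigmaModule.{u, v} K κ S)
    (e : Module.Basis (Fin n) (BaseRing K κ) M.carrier) (G : Matrix (Fin n) (Fin n) (BaseRing K κ)) :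
    Prop :=
  ∀ q : Subgroup.closure S, IsTaylorMat ((q : UnitGroup K) : K) G (M.mat e q)

variable {M : SigmaModule.{u, v} K κ (disk K r)} {e : Module.Basis (Fin n) (BaseRing K κ) M.carrier}
  {G : Matrix (Fin n) (Fin n) (BaseRing K κ)}

theorem SigmaModule.IsTaylor.isDefinedOn (hM : M.IsTaylor e G) {τ ε : ℝ} (hτ0 : 0 < τ) (he1 : ε < 1)
    (hε : ∀ ρ ∈ annulus κ ε, (∀ i j, ConvAt ρ (G i j)) ∧ SeqBound ρ τ (binomMat G))
    {V : Set (UnitGroup K)} (hV : V ⊆ disk K τ) : M.IsDefinedOn e (annulus κ ε) V :=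
  fun q hq i j ρ hρ => (hM q).convAt (annulus_pos κ he1 hρ) (hε ρ hρ).1 (hε ρ hρ).2
    (mem_disk_of_mem_closure hτ0 (Subgroup.closure_mono hV hq)) i j

theorem SigmaModule.IsTaylor.isAnalyticOn (hM : M.IsTaylor e G) {τ ε : ℝ} (hτ0 : 0 < τ)
    (he0 : 0 < ε) (he1 : ε < 1)
    (hε : ∀ ρ ∈ annulus κ ε, (∀ i j, ConvAt ρ (G i j)) ∧ SeqBound ρ τ (binomMat G)) :
    M.IsAnalyticOn e (annulus κ ε) (disk K τ) := by
  refine fun q hq => ⟨τ, hτ0, fun i j => ?_⟩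
  obtain ⟨a, ha, hs⟩ := exists_analytic_expansion he0 he1 (fun ρ hρ => (hε ρ hρ).1)
    (fun ρ hρ => (hε ρ hρ).2) hq i j
  exact ⟨a, ha, fun q' hq' => hs _ _ (hM q') hq'⟩

theorem SigmaModule.mat_one (M : SigmaModule.{u, v} K κ S)
    (e : Module.Basis (Fin n) (BaseRing K κ) M.carrier) : M.mat e 1 = 1 := by
  ext i j : 1
  simp [SigmaModule.mat, Matrix.one_apply, Finsupp.single_apply]

variable {L : Type w} [NontriviallyNormedField L] [IsUltrametricDist L] [CompleteSpace L]
  [NormedAlgebra K L] {c : L} {τ : ℝ}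

theorem SigmaModule.IsTaylor.isTrivializedBy (hM : M.IsTaylor e G) (hτ1 : τ ≤ 1) (hc : 0 < ‖c‖)
    (hG : ∀ i j, ConvAt ‖c‖ (G i j)) (hB : ∀ s, 0 < s → s < τ → SeqBound ‖c‖ s (binomMat G)) :
    M.IsTrivializedBy e (disk K τ) c (τ * ‖c‖) :=
  ⟨solFun c G, fun x => solFun x G c, solFun_isAnalytic hc hG hB, solFun_inv_isAnalytic hc hτ1 hG hB,
    fun _ hx => solFun_inv_mul hc hτ1 hG hB hx, fun q hq _ hx => solFun_q hc hτ1 hG hB hx hq (hM q)⟩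

/-- A module over the disk `D⁻(1,r)` given by the Taylor matrices of a connection of radius `r` is
analytically constant. -/
theorem SigmaModule.IsTaylor.isAnalyticallyConstant (hM : M.IsTaylor e G) (hr0 : 0 < r) (hr1 : r ≤ 1)
    (hG : Rad r G) : M.IsAnalyticallyConstant := by
  refine ⟨fun τ h0 h1 => ?_, ?_⟩
  · obtain ⟨ε, he0, he1, hε⟩ := hG τ h0 h1
    refine ⟨ε, he0, he1, n, e, hM.isDefinedOn h0 he1 hε subset_rfl, hM.isAnalyticOn h0 he0 he1 hε, ?_⟩
    intro L _ _ _ _ c hc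
    exact hM.isTrivializedBy (h1.le.trans hr1) (annulus_pos κ he1 hc) (hε _ hc).1
      fun s hs hsτ => (hε _ hc).2.mono hs hsτ.le
  -- The circle `|c| = 1` lies in every annulus of `H^†_K`, so the bounds for all `s < r` hold there
  -- at once, in one basis. The choice `r/2` serves only to have convergence of `G`.
  · rintro rfl
    refine ⟨n, e, ?_⟩
    intro L _ _ _ _ c hc
    have h1 : ∀ ε : ℝ, 0 < ε → ‖c‖ ∈ annulus BaseKind.hdagger ε := fun ε hε => hc ▸ one_mem_annulus hε
    obtain ⟨ε, he0, he1, hε⟩ := hG (r / 2) (half_pos hr0) (half_lt_self hr0)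
    have h2 := hM.isTrivializedBy hr1 (hc ▸ one_pos) (hε _ (h1 ε he0)).1 fun s hs hsr => by
      obtain ⟨ε, he0, -, hε⟩ := hG s hs hsr
      exact (hε _ (h1 ε he0)).2
    rwa [hc, mul_one] at h2

variable {M : SigmaDeltaModule.{u, v} K κ (disk K r)}
  {e : Module.Basis (Fin n) (BaseRing K κ) M.carrier}

/-- The limit defining the connection comes from `IsTaylorMat.gaussLE_sub`, whose error bound is a
constant times `|q - 1|`. -/
theorem SigmaDeltaModule.isAnalyticOn (hM : M.toSigmaModule.IsTaylor e (M.dmat e)) {ε : ℝ}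
    (hτ0 : 0 < τ) (he0 : 0 < ε) (he1 : ε < 1)
    (hε : ∀ ρ ∈ annulus κ ε, (∀ i j, ConvAt ρ (M.dmat e i j)) ∧ SeqBound ρ τ (binomMat (M.dmat e))) :
    M.IsAnalyticOn e (annulus κ ε) (disk K τ) := by
  refine ⟨SigmaModule.IsTaylor.isAnalyticOn hM hτ0 he0 he1 hε, fun i j ρ hρ => (hε ρ hρ).1 i j,
    fun ρ hρ => ?_⟩
  have hρ0 := annulus_pos κ he1 hρ
  obtain ⟨B, hB0, hB⟩ := (hε ρ hρ).2.exists_nonneg hτ0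
  have hcont : Continuous fun q : Subgroup.closure (disk K r) => ‖((q : UnitGroup K) : K) - 1‖ := by
    fun_prop
  have hlim : Tendsto (fun q : Subgroup.closure (disk K r) => ‖((q : UnitGroup K) : K) - 1‖)
      (𝓝[≠] 1) (𝓝 0) := by
    have h1 := hcont.tendsto 1
    rw [show ‖(((1 : Subgroup.closure (disk K r)) : UnitGroup K) : K) - 1‖ = 0 by simp] at h1
    exact h1.mono_left nhdsWithin_le_nhds
  have hlim2 := (ENNReal.continuous_ofReal.tendsto _).comp (hlim.mul_const (B / τ ^ 2))
  rw [zero_mul, ENNReal.ofReal_zero] at hlim2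
  refine tendsto_of_tendsto_of_tendsto_of_le_of_le' tendsto_const_nhds hlim2
    (Eventually.of_forall fun _ => zero_le) ?_
  filter_upwards [hlim.eventually_lt_const hτ0, self_mem_nhdsWithin] with q hq hq1
  have hq1' : ((q : UnitGroup K) : K) ≠ 1 := fun h => hq1 (Subtype.ext (Subtype.ext h))
  refine (matNorm_le_iff hρ0 (by positivity)).2 fun i j => ?_
  rw [M.toSigmaModule.mat_one]
  exact IsTaylorMat.gaussLE_sub hρ0 hτ0 hB0 hB hq.le hq1' (hM q) i j

theorem SigmaDeltaModule.isTrivializedBy (hM : M.toSigmaModule.IsTaylor e (M.dmat e)) (hτ1 : τ ≤ 1)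
    (hc : 0 < ‖c‖) (hG : ∀ i j, ConvAt ‖c‖ (M.dmat e i j))
    (hB : ∀ s, 0 < s → s < τ → SeqBound ‖c‖ s (binomMat (M.dmat e))) :
    M.IsTrivializedBy e (disk K τ) c (τ * ‖c‖) :=
  ⟨solFun c (M.dmat e), fun x => solFun x (M.dmat e) c, solFun_isAnalytic hc hG hB,
    solFun_inv_isAnalytic hc hτ1 hG hB, fun _ hx => solFun_inv_mul hc hτ1 hG hB hx,
    fun q hq _ hx => solFun_q hc hτ1 hG hB hx hq (hM q),
    fun _ hx i j => solFun_hasDerivAt hc hτ1 hG hB hx i j⟩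

theorem SigmaDeltaModule.isAnalyticallyConstant (hM : M.toSigmaModule.IsTaylor e (M.dmat e))
    (hr0 : 0 < r) (hr1 : r ≤ 1) (hG : Rad r (M.dmat e)) : M.IsAnalyticallyConstant := by
  refine ⟨fun τ h0 h1 => ?_, ?_⟩
  · obtain ⟨ε, he0, he1, hε⟩ := hG τ h0 h1
    refine ⟨ε, he0, he1, n, e, SigmaModule.IsTaylor.isDefinedOn hM h0 he1 hε subset_rfl,
      SigmaDeltaModule.isAnalyticOn hM h0 he0 he1 hε, ?_⟩
    intro L _ _ _ _ c hc
    exact SigmaDeltaModule.isTrivializedBy hM (h1.le.trans hr1) (annulus_pos κ he1 hc) (hε _ hc).1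
      fun s hs hsτ => (hε _ hc).2.mono hs hsτ.le
  · rintro rfl
    refine ⟨n, e, ?_⟩
    intro L _ _ _ _ c hc
    have h1 : ∀ ε : ℝ, 0 < ε → ‖c‖ ∈ annulus BaseKind.hdagger ε := fun ε hε => hc ▸ one_mem_annulus hε
    obtain ⟨ε, he0, he1, hε⟩ := hG (r / 2) (half_pos hr0) (half_lt_self hr0)
    have h2 := SigmaDeltaModule.isTrivializedBy hM hr1 (hc ▸ one_pos) (hε _ (h1 ε he0)).1
      fun s hs hsr => by
        obtain ⟨ε, he0, -, hε⟩ := hG s hs hsr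
        exact (hε _ (h1 ε he0)).2
    rwa [hc, mul_one] at h2

end DiskModules

/-! ### Modules over the disk given by Taylor matrices lie in the categories of radius `r`. -/

section CommonSolutions

variable {K : Type u} [NontriviallyNormedField K] [IsUltrametricDist K] [CompleteSpace K] [CharZero K]
  {κ : BaseKind} {n : ℕ} {r : ℝ}
  {Ω : Type w} [NontriviallyNormedField Ω] [IsUltrametricDist Ω]
  [CompleteSpace Ω] [NormedAlgebra K Ω]

theorem SigmaModule.IsTaylor.hasSum_qTaylorTerm_and {M : SigmaModule.{u, v} K κ (disk K r)}
    {e : Module.Basis (Fin n) (BaseRing K κ) M.carrier} {G : Matrix (Fin n) (Fin n) (BaseRing K κ)}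
    (hM : M.IsTaylor e G) {t : Ω} {τ : ℝ} (ht : 0 < ‖t‖) (hτ1 : τ ≤ 1)
    (hG : ∀ i j, ConvAt ‖t‖ (G i j)) (hB : ∀ s, 0 < s → s < τ → SeqBound ‖t‖ s (binomMat G))
    {q : Subgroup.closure (disk K r)} (hq : (q : UnitGroup K) ∈ disk K r ∩ disk K τ) :
    ‖((q : UnitGroup K) : K) - 1‖ * ‖t‖ < τ * ‖t‖ ∧
      (¬ IsOfFinOrder (q : UnitGroup K) → ∀ x : Ω, ‖x - t‖ < τ * ‖t‖ →
        HasSum (qTaylorTerm (q : UnitGroup K) (M.mat e q) t x) (solFun t G x)) ∧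
      ∀ x : Ω, ‖x - t‖ < τ * ‖t‖ →
        solFun t G (algebraMap K Ω ((q : UnitGroup K) : K) * x) =
          matEval x (M.mat e q) * solFun t G x :=
  ⟨mul_lt_mul_of_pos_right hq.2 ht,
    fun hq' _ hx => hasSum_qTaylorTerm hq' ht hτ1 hG hB hq.2 (hM q) hx,
    fun _ hx => solFun_q ht hτ1 hG hB hx hq.2 (hM q)⟩

theorem SigmaModule.IsTaylor.sigmaProp (hgen : HasGenericPoints K κ Ω)
    {M : SigmaModule.{u, v} K κ (disk K r)}
    {e : Module.Basis (Fin n) (BaseRing K κ) M.carrier} {G : Matrix (Fin n) (Fin n) (BaseRing K κ)}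
    (hM : M.IsTaylor e G) (hr1 : r ≤ 1) (hG : Rad r G) : QDiff.sigmaProp Ω r (disk K r) M := by
  refine ⟨fun q hq hq' => ⟨n, e, hG.radiusCondition_qRay Ω hgen hr1 hq hq' (hM q)⟩,
    fun τ h0 h1 => ?_⟩
  obtain ⟨ε, he0, he1, hε⟩ := hG τ h0 h1
  refine ⟨ε, he0, he1, n, e, hM.isDefinedOn h0 he1 hε Set.inter_subset_right, fun ρ hρ t ht => ?_⟩
  obtain rfl := ht.1
  have ht0 := annulus_pos κ he1 hρ
  have hB : ∀ s, 0 < s → s < τ → SeqBound ‖t‖ s (binomMat G) :=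
    fun s hs hsτ => (hε _ hρ).2.mono hs hsτ.le
  -- The Taylor solution of relative radius `τ` is the common solution. All `q` with `|q - 1| < τ`
  -- preserve its disk, which explains the radius `R = τ |t|`.
  exact ⟨τ * ‖t‖, by positivity, mul_le_of_le_one_left ht0.le (h1.le.trans hr1), solFun t G,
    solFun_isAnalytic ht0 (hε _ hρ).1 hB, solFun_self ht0,
    fun q hq => hM.hasSum_qTaylorTerm_and ht0 (h1.le.trans hr1) (hε _ hρ).1 hB hq⟩

theorem SigmaModule.IsTaylor.sigmaDeltaProp {M : SigmaDeltaModule.{u, v} K κ (disk K r)}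
    {e : Module.Basis (Fin n) (BaseRing K κ) M.carrier}
    (hM : M.toSigmaModule.IsTaylor e (M.dmat e)) (hr1 : r ≤ 1) (hG : Rad r (M.dmat e)) :
    QDiff.sigmaDeltaProp Ω r (disk K r) M := by
  refine ⟨fun q hq => ⟨n, e, hG.radiusCondition_dRay hr1 hq⟩, fun τ h0 h1 => ?_⟩
  obtain ⟨ε, he0, he1, hε⟩ := hG τ h0 h1
  refine ⟨ε, he0, he1, n, e, hM.isDefinedOn h0 he1 hε Set.inter_subset_right,
    fun i j ρ hρ => (hε ρ hρ).1 i j, fun ρ hρ t ht => ?_⟩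
  obtain rfl := ht.1
  have ht0 := annulus_pos κ he1 hρ
  have hB : ∀ s, 0 < s → s < τ → SeqBound ‖t‖ s (binomMat (M.dmat e)) :=
    fun s hs hsτ => (hε _ hρ).2.mono hs hsτ.le
  exact ⟨τ * ‖t‖, by positivity, mul_le_of_le_one_left ht0.le (h1.le.trans hr1), solFun t (M.dmat e),
    solFun_isAnalytic ht0 (hε _ hρ).1 hB, solFun_self ht0,
    fun x hx => hasSum_dTaylorTerm ht0 (hε _ hρ).1 hB hx,
    fun q hq => hM.hasSum_qTaylorTerm_and ht0 (h1.le.trans hr1) (hε _ hρ).1 hB hq⟩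

end CommonSolutions

/-! ## Deformation and confluence -/

section Deformation

variable {K : Type u} [NontriviallyNormedField K] [IsUltrametricDist K] [CompleteSpace K] [CharZero K]
  {κ : BaseKind} {n : ℕ} {r : ℝ} {S : Set (UnitGroup K)}
  {Ω : Type w} [NontriviallyNormedField Ω] [IsUltrametricDist Ω]
  [CompleteSpace Ω] [NormedAlgebra K Ω]

theorem solFun_algebraMap_mul {t : Ω} (ht : 0 < ‖t‖) (G : Matrix (Fin n) (Fin n) (BaseRing K κ))
    (q : K) : solFun t G (algebraMap K Ω q * t) = evM (algebraMap K Ω (q - 1)) (solAt t G) := by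
  rw [solFun, mul_div_cancel_right₀ _ (norm_pos_iff.1 ht), map_sub, map_one]

theorem norm_algebraMap_mul_sub (q : K) (t : Ω) : ‖algebraMap K Ω q * t - t‖ = ‖q - 1‖ * ‖t‖ := by
  rw [show algebraMap K Ω q * t - t = algebraMap K Ω (q - 1) * t by rw [map_sub, map_one]; ring,
    norm_mul, norm_algebraMap']

/-- The compatibility of the Taylor solutions, in one basis, of a module over `S` identifies its
operators with the Taylor operators of a connection. -/
theorem SigmaModule.isTaylorMat_of_solutions (hgen : HasGenericPoints K κ Ω) (hr1 : r ≤ 1)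
    (M : SigmaModule.{u, v} K κ S) {δ : M.carrier →+ M.carrier} (hδ : IsConn K κ δ)
    {e : Module.Basis (Fin n) (BaseRing K κ) M.carrier} (hG : Rad r (linMat e e δ)) {m : ℕ}
    {e' : Module.Basis (Fin m) (BaseRing K κ) M.carrier} {q : Subgroup.closure S} {τ ε : ℝ}
    (hτ : τ < r) (he0 : 0 < ε) (he1 : ε < 1) (hq : ‖((q : UnitGroup K) : K) - 1‖ < τ)
    (hconv : MatConvergesOn (annulus κ ε) (M.mat e' q))
    (hsol : ∀ ρ ∈ annulus κ ε, (∀ i j, ConvAt ρ (linMat e' e' δ i j)) →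
      SeqBound ρ τ (binomMat (linMat e' e' δ)) → ∀ t : Ω, IsGenericPoint K ρ t →
        matEval t (M.mat e' q) =
          solFun t (linMat e' e' δ) (algebraMap K Ω ((q : UnitGroup K) : K) * t)) :
    IsTaylorMat ((q : UnitGroup K) : K) (linMat e e δ) (M.mat e q) := by
  have hτ0 : 0 < τ := (norm_nonneg _).trans_lt hq
  have hG' := hG.change hδ hr1 e'
  obtain ⟨ε₁, h10, h11, h1⟩ := hG' τ hτ0 hτ
  obtain ⟨ρ, hρ, t, ht⟩ := hgen (lt_min he0 h10) (min_lt_of_left_lt he1)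
  have hρ1 := annulus_mono κ (min_le_left _ _) hρ
  have hρ2 := h1 ρ (annulus_mono κ (min_le_right _ _) hρ)
  have hρ0 := annulus_pos κ he1 hρ1
  have h2 := hsol ρ hρ1 hρ2.1 hρ2.2 t ht
  rw [solFun_algebraMap_mul (ht.1.symm ▸ hρ0)] at h2
  have h3 : IsTaylorMat ((q : UnitGroup K) : K) (linMat e' e' δ) (linMat e' e' (M.σ q)) :=
    isTaylorMat_of_generic ht hρ0 hG' (hq.trans hτ) hq (fun i j => hconv i j ρ hρ1) hρ2.1 hρ2.2 h2
  exact h3.change hgen hδ hG' hr1 (φ := M.σ q) (M.semilinear q) (hq.trans hτ) e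

/-- A `(σ,δ)`-module in the category of radius `r` is given by its connection. -/
theorem SigmaDeltaModule.exists_taylor (hgen : HasGenericPoints K κ Ω) {p : ℕ} (hpp : p.Prime)
    (hp : ‖(p : K)‖ < 1) (hr1 : r ≤ 1) (hS : S ⊆ disk K r) (hne : S.Nonempty)
    (M : SigmaDeltaModule.{u, v} K κ S) (hM : sigmaDeltaProp Ω r S M) :
    ∃ (n : ℕ) (e : Module.Basis (Fin n) (BaseRing K κ) M.carrier), Rad r (M.dmat e) ∧
      ∀ q : Subgroup.closure S, (q : UnitGroup K) ∈ S →
        IsTaylorMat ((q : UnitGroup K) : K) (M.dmat e) (M.mat e q) := by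
  obtain ⟨q₀, hq₀⟩ := hne
  obtain ⟨n, e, he⟩ := hM.1 ⟨q₀, Subgroup.subset_closure hq₀⟩ hq₀
  have hG : Rad r (linMat e e M.δ) := Rad.of_radiusCondition hpp hp he
  refine ⟨n, e, hG, fun q hq => ?_⟩
  obtain ⟨τ, h1, h2⟩ := exists_between (show ‖((q : UnitGroup K) : K) - 1‖ < r from hS hq)
  obtain ⟨ε, he0, he1, m, e', hd, -, hY⟩ := hM.2 τ ((norm_nonneg _).trans_lt h1) h2
  refine M.toSigmaModule.isTaylorMat_of_solutions hgen hr1 M.leibniz hG h2 he0 he1 h1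
    (hd q (Subgroup.subset_closure ⟨hq, h1⟩)) fun ρ hρ hc hB t ht => ?_
  obtain ⟨R, hR0, hR, Y, -, hYt, hYG, hYq⟩ := hY ρ hρ t ht
  obtain rfl := ht.1
  have ht0 := annulus_pos κ he1 hρ
  have h3 := norm_algebraMap_mul_sub ((q : UnitGroup K) : K) t
  obtain ⟨h4, -, h5⟩ := hYq q ⟨hq, h1⟩
  -- At the centre `x = t` the functional equation reads `Y(qt) = A(q,t)`, because `Y(t) = 1`.
  -- Uniqueness of sums identifies `Y(qt)` with the Taylor solution of the connection; this argument
  -- does not see whether `q` is a root of unity.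
  have h6 := h5 t (by rwa [sub_self, norm_zero])
  rw [hYt, mul_one] at h6
  rw [← h6]
  exact (hYG _ (by rwa [h3])).unique (hasSum_dTaylorTerm ht0 hc (fun s hs hsτ => hB.mono hs hsτ.le)
    (by rw [h3]; exact mul_lt_mul_of_pos_right h1 ht0))

/-- A `σ`-module in the category of radius `r` comes from a connection. -/
theorem SigmaModule.exists_taylor (hgen : HasGenericPoints K κ Ω) {p : ℕ} (hpp : p.Prime)
    (hp : ‖(p : K)‖ < 1) (hr1 : r ≤ 1) (hS : S ⊆ disk K r) {q₀ : UnitGroup K} (hq₀ : q₀ ∈ S)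
    (hq₀' : ¬ IsOfFinOrder q₀) (M : SigmaModule.{u, v} K κ S) (hM : sigmaProp Ω r S M) :
    ∃ (n : ℕ) (e : Module.Basis (Fin n) (BaseRing K κ) M.carrier) (δ : M.carrier →+ M.carrier),
      IsConn K κ δ ∧ Rad r (linMat e e δ) ∧ ∀ q : Subgroup.closure S, (q : UnitGroup K) ∈ S →
        IsTaylorMat ((q : UnitGroup K) : K) (linMat e e δ) (M.mat e q) := by
  set Q₀ : Subgroup.closure S := ⟨q₀, Subgroup.subset_closure hq₀⟩ with hQ₀
  obtain ⟨n, e, he⟩ := hM.1 Q₀ hq₀ hq₀'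
  obtain ⟨G, hG, hGA⟩ := exists_rad_of_radiusCondition Ω hgen hpp hp hr1 hq₀' (hS hq₀) he
  -- The connection is defined from `q₀` alone, in the basis in which `q₀` satisfies the radius
  -- condition; the other elements of `S` are compared with it afterwards.
  refine ⟨n, e, mkConn e G, mkConn_isConn G, by rwa [linMat_mkConn], fun q hq => ?_⟩
  rw [← linMat_mkConn (e := e) G] at hG hGA
  obtain ⟨τ, h1, h2⟩ := exists_between (max_lt (show ‖((q : UnitGroup K) : K) - 1‖ < r from hS hq)
    (show ‖(q₀ : K) - 1‖ < r from hS hq₀))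
  have hq1 := (le_max_left _ _).trans_lt h1
  have hq2 := (le_max_right _ _).trans_lt h1
  obtain ⟨ε, he0, he1, m, e', hd, hY⟩ := hM.2 τ ((norm_nonneg _).trans_lt hq1) h2
  refine M.isTaylorMat_of_solutions hgen hr1 (mkConn_isConn G) hG h2 he0 he1 hq1
    (hd q (Subgroup.subset_closure ⟨hq, hq1⟩)) fun ρ hρ hc hB t ht => ?_
  obtain ⟨R, hR0, hR, Y, -, hYt, hYq⟩ := hY ρ hρ t ht
  obtain rfl := ht.1
  have ht0 := annulus_pos κ he1 hρ
  have h3 := norm_algebraMap_mul_sub ((q : UnitGroup K) : K) t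
  obtain ⟨h4, -, h5⟩ := hYq q ⟨hq, hq1⟩
  have h6 := h5 t (by rwa [sub_self, norm_zero])
  rw [hYt, mul_one] at h6
  rw [← h6]
  -- In the basis of the second condition, the common solution is the `q₀`-Taylor solution and
  -- therefore the Taylor solution of the connection. This transfers the information from `q₀` to
  -- `q`.
  have hA : IsTaylorMat (q₀ : K) (linMat e' e' (mkConn e G)) (M.mat e' Q₀) :=
    hGA.change hgen (mkConn_isConn G) hG hr1 (φ := M.σ Q₀) (M.semilinear Q₀) (hS hq₀) e'
  exact ((hYq Q₀ ⟨hq₀, hq2⟩).2.1 hq₀' _ (by rwa [h3])).unique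
    (hasSum_qTaylorTerm hq₀' ht0 (h2.le.trans hr1) hc (fun s hs hsτ => hB.mono hs hsτ.le) hq2 hA
      (by rw [h3]; exact mul_lt_mul_of_pos_right hq1 ht0))

/-- The extension of the action of `⟨S⟩` to the whole disk. -/
theorem SigmaModule.exists_extension (hgen : HasGenericPoints K κ Ω) (hr0 : 0 < r) (hr1 : r ≤ 1)
    (hS : S ⊆ disk K r) (M : SigmaModule.{u, v} K κ S) {δ : M.carrier →+ M.carrier}
    (hδ : IsConn K κ δ) {e : Module.Basis (Fin n) (BaseRing K κ) M.carrier}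
    (hG : Rad r (linMat e e δ)) (hM : ∀ q : Subgroup.closure S, (q : UnitGroup K) ∈ S →
        IsTaylorMat ((q : UnitGroup K) : K) (linMat e e δ) (M.mat e q)) :
    ∃ M' : SigmaDeltaModule.{u, v} K κ (disk K r), ∃ f : M'.carrier ≃ₗ[BaseRing K κ] M.carrier,
      (∃ e' : Module.Basis (Fin n) (BaseRing K κ) M'.carrier, Rad r (M'.dmat e') ∧
        M'.toSigmaModule.IsTaylor e' (M'.dmat e')) ∧
      (∀ x, f (M'.δ x) = δ (f x)) ∧
      ∀ (q : Subgroup.closure S) (x : M'.carrier),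
        f (M'.σ (Subgroup.inclusion (Subgroup.closure_mono hS) q) x) = M.σ q (f x) := by
  obtain ⟨σ, hσ⟩ := exists_action hgen hr0 hr1 hG
  have hres : σ.comp (Subgroup.inclusion (Subgroup.closure_mono hS)) = M.σ := by
    -- Two homomorphisms on `⟨S⟩` agree if they agree on `S`, where both operators are the Taylor
    -- operator of the connection.
    refine MonoidHom.eq_of_eqOn_dense Subgroup.closure_closure_coe_preimage fun q hq => ?_
    have h1 := hσ (Subgroup.inclusion (Subgroup.closure_mono hS) q)
    exact semilin_ext (e := e) h1.1 (M.semilinear q) (h1.2.unique (hM q hq))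
  refine ⟨{ carrier := M.carrier, σ := σ, semilinear := fun q => (hσ q).1, δ := δ, leibniz := hδ },
    LinearEquiv.refl _ _, ⟨e, hG, fun q => (hσ q).2⟩, fun _ => rfl, fun q x => ?_⟩
  exact DFunLike.congr_fun (DFunLike.congr_fun hres q) x

end Deformation

/-! ### Full faithfulness and essential surjectivity of restriction. -/

section Equivalence

variable {K : Type u} [NontriviallyNormedField K] [IsUltrametricDist K] [CompleteSpace K] [CharZero K]
  {κ : BaseKind} {r : ℝ} {S : Set (UnitGroup K)}
  {Ω : Type w} [NontriviallyNormedField Ω] [IsUltrametricDist Ω]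
  [CompleteSpace Ω] [NormedAlgebra K Ω]

theorem mem_disk_of_closure (hr0 : 0 < r) (q : Subgroup.closure (disk K r)) :
    (q : UnitGroup K) ∈ disk K r := mem_disk_of_mem_closure hr0 q.2

/-- A linear map which commutes with the operators `σ_q`, `q ∈ S`, commutes with those for all
`q ∈ D⁻(1,r)`. -/
theorem SigmaModule.comm_of_comm (hgen : HasGenericPoints K κ Ω) {p : ℕ} (hpp : p.Prime)
    (hp : ‖(p : K)‖ < 1) (hr0 : 0 < r) (hr1 : r ≤ 1) {q₀ : Subgroup.closure (disk K r)}
    (hq₀ : ¬ IsOfFinOrder (q₀ : UnitGroup K)) {M N : SigmaModule.{u, v} K κ (disk K r)}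
    (hM : sigmaProp Ω r (disk K r) M) (hN : sigmaProp Ω r (disk K r) N)
    (f : M.carrier →ₗ[BaseRing K κ] N.carrier) (hf : ∀ x, f (M.σ q₀ x) = N.σ q₀ (f x))
    (q : Subgroup.closure (disk K r)) (x : M.carrier) : f (M.σ q x) = N.σ q (f x) := by
  obtain ⟨n, e, δ, -, hG, hT⟩ := M.exists_taylor hgen hpp hp hr1 subset_rfl
    (mem_disk_of_closure hr0 q₀) hq₀ hM
  obtain ⟨m, e', δ', -, hG', hT'⟩ := N.exists_taylor hgen hpp hp hr1 subset_rfl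
    (mem_disk_of_closure hr0 q₀) hq₀ hN
  have h0 := mem_disk_of_closure hr0 q₀
  have h1 := mem_disk_of_closure hr0 q
  refine semilin_comm (e := e) (e' := e') (φ := M.σ q) (φ' := N.σ q) (M.semilinear q)
    (N.semilinear q) f ?_ x
  exact sigma_intertwine_of_sigma hgen hpp.pos hp hG hG' hr1 hq₀ h0 (hT q₀ h0) (hT' q₀ h0)
    (linMat_semilin (φ := M.σ q₀) (φ' := N.σ q₀) (N.semilinear q₀) f hf) h1 (hT q h1) (hT' q h1)

/-- A horizontal linear map commutes with the operators `σ_q` for all `q ∈ D⁻(1,r)`. -/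
theorem SigmaDeltaModule.comm_of_comm_δ (hgen : HasGenericPoints K κ Ω) {p : ℕ} (hpp : p.Prime)
    (hp : ‖(p : K)‖ < 1) (hr0 : 0 < r) (hr1 : r ≤ 1) {M N : SigmaDeltaModule.{u, v} K κ (disk K r)}
    (hM : sigmaDeltaProp Ω r (disk K r) M) (hN : sigmaDeltaProp Ω r (disk K r) N)
    (f : M.carrier →ₗ[BaseRing K κ] N.carrier) (hf : ∀ x, f (M.δ x) = N.δ (f x))
    (q : Subgroup.closure (disk K r)) (x : M.carrier) : f (M.σ q x) = N.σ q (f x) := by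
  have h1 := mem_disk_of_closure hr0 q
  obtain ⟨n, e, hG, hT⟩ := M.exists_taylor hgen hpp hp hr1 subset_rfl ⟨q, h1⟩ hM
  obtain ⟨m, e', hG', hT'⟩ := N.exists_taylor hgen hpp hp hr1 subset_rfl ⟨q, h1⟩ hN
  refine semilin_comm (e := e) (e' := e') (φ := M.σ q) (φ' := N.σ q) (M.semilinear q)
    (N.semilinear q) f ?_ x
  exact sigma_intertwine_of_conn hgen hG hG' hr1 (linMat_conn (δ := M.δ) (δ' := N.δ) N.leibniz f hf)
    h1 (hT q h1) (hT' q h1)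

/-- A linear isomorphism which commutes with the actions is an isomorphism of `σ`-modules. -/
def SigmaModule.isoOfEquiv {M N : SigmaModule.{u, v} K κ S}
    (f : M.carrier ≃ₗ[BaseRing K κ] N.carrier)
    (h : ∀ (q : Subgroup.closure S) (x : M.carrier), f (M.σ q x) = N.σ q (f x)) : M ≅ N where
  hom := ⟨f.toLinearMap, h⟩
  inv := ⟨f.symm.toLinearMap, fun q x => f.injective (by simp [h])⟩
  hom_inv_id := SigmaModule.Hom.ext (LinearMap.ext fun x => f.symm_apply_apply x)
  inv_hom_id := SigmaModule.Hom.ext (LinearMap.ext fun x => f.apply_symm_apply x)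

/-- A linear isomorphism which commutes with the actions and the connections is an isomorphism of
`(σ,δ)`-modules. -/
def SigmaDeltaModule.isoOfEquiv {M N : SigmaDeltaModule.{u, v} K κ S}
    (f : M.carrier ≃ₗ[BaseRing K κ] N.carrier)
    (h : ∀ (q : Subgroup.closure S) (x : M.carrier), f (M.σ q x) = N.σ q (f x))
    (hδ : ∀ x : M.carrier, f (M.δ x) = N.δ (f x)) : M ≅ N where
  hom := ⟨⟨f.toLinearMap, h⟩, hδ⟩
  inv := ⟨⟨f.symm.toLinearMap, fun q x => f.injective (by simp [h])⟩,
    fun x => f.injective (by simp [hδ])⟩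
  hom_inv_id := SigmaDeltaModule.Hom.ext (LinearMap.ext fun x => f.symm_apply_apply x)
  inv_hom_id := SigmaDeltaModule.Hom.ext (LinearMap.ext fun x => f.apply_symm_apply x)

theorem sigmaRes_exists_preimage (hgen : HasGenericPoints K κ Ω) {p : ℕ} (hpp : p.Prime)
    (hp : ‖(p : K)‖ < 1) (hr0 : 0 < r) (hr1 : r ≤ 1) (hS : S ⊆ disk K r) {q₀ : UnitGroup K}
    (hq₀ : q₀ ∈ S) (hq₀' : ¬ IsOfFinOrder q₀) (M : SigmaCat.{u, v, w} K κ Ω r S) :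
    ∃ M' : SigmaCat.{u, v, w} K κ Ω r (disk K r),
      M'.obj.IsAnalyticallyConstant ∧ Nonempty ((sigmaRes K κ Ω r hS).obj M' ≅ M) := by
  obtain ⟨n, e, δ, hδ, hG, hT⟩ := M.obj.exists_taylor hgen hpp hp hr1 hS hq₀ hq₀' M.property
  obtain ⟨M', f, ⟨e', hG', hT'⟩, -, hf⟩ := M.obj.exists_extension hgen hr0 hr1 hS hδ hG hT
  exact ⟨⟨M'.toSigmaModule, hT'.sigmaProp hgen hr1 hG'⟩, hT'.isAnalyticallyConstant hr0 hr1 hG',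
    ⟨ObjectProperty.isoMk _ (SigmaModule.isoOfEquiv f hf)⟩⟩

theorem sigmaDeltaRes_exists_preimage (hgen : HasGenericPoints K κ Ω) {p : ℕ} (hpp : p.Prime)
    (hp : ‖(p : K)‖ < 1) (hr0 : 0 < r) (hr1 : r ≤ 1) (hS : S ⊆ disk K r) (hne : S.Nonempty)
    (M : SigmaDeltaCat.{u, v, w} K κ Ω r S) :
    ∃ M' : SigmaDeltaCat.{u, v, w} K κ Ω r (disk K r),
      M'.obj.IsAnalyticallyConstant ∧ Nonempty ((sigmaDeltaRes K κ Ω r hS).obj M' ≅ M) := by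
  obtain ⟨n, e, hG, hT⟩ := M.obj.exists_taylor hgen hpp hp hr1 hS hne M.property
  obtain ⟨M', f, ⟨e', hG', hT'⟩, hfδ, hf⟩ :=
    M.obj.toSigmaModule.exists_extension hgen hr0 hr1 hS M.obj.leibniz hG hT
  exact ⟨⟨M', hT'.sigmaDeltaProp hr1 hG'⟩, SigmaDeltaModule.isAnalyticallyConstant hT' hr0 hr1 hG',
    ⟨ObjectProperty.isoMk _ (SigmaDeltaModule.isoOfEquiv f hf hfδ)⟩⟩

/-- Restriction does not change the underlying linear maps, so it is faithful. It is full because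
commutation with `σ_{q₀}` alone forces commutation with every `σ_q` of the disk. -/
theorem sigmaRes_isEquivalence (hgen : HasGenericPoints K κ Ω) {p : ℕ} (hpp : p.Prime)
    (hp : ‖(p : K)‖ < 1) (hr0 : 0 < r) (hr1 : r ≤ 1) (hS : S ⊆ disk K r) {q₀ : UnitGroup K}
    (hq₀ : q₀ ∈ S) (hq₀' : ¬ IsOfFinOrder q₀) :
    (sigmaRes.{u, v, w} K κ Ω r hS).IsEquivalence where
  faithful := ⟨fun {M N f g} h => ObjectProperty.hom_ext _ (SigmaModule.Hom.ext
    (congrArg (fun k => k.hom.toLin) h))⟩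
  full := ⟨fun {M N} f => ⟨ObjectProperty.homMk ⟨f.hom.toLin,
    SigmaModule.comm_of_comm hgen hpp hp hr0 hr1
      (q₀ := Subgroup.inclusion (Subgroup.closure_mono hS) ⟨q₀, Subgroup.subset_closure hq₀⟩) hq₀'
      M.property N.property f.hom.toLin (f.hom.comm ⟨q₀, Subgroup.subset_closure hq₀⟩)⟩, rfl⟩⟩
  essSurj := ⟨fun M => by
    obtain ⟨M', -, h⟩ := sigmaRes_exists_preimage hgen hpp hp hr0 hr1 hS hq₀ hq₀' M
    exact ⟨M', h⟩⟩

/-- Here fullness comes from the connection: a horizontal map already commutes with all Taylor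
operators. Hence no element of infinite order is needed, and a point of `S` serves only to invoke
the radius condition. -/
theorem sigmaDeltaRes_isEquivalence (hgen : HasGenericPoints K κ Ω) {p : ℕ} (hpp : p.Prime)
    (hp : ‖(p : K)‖ < 1) (hr0 : 0 < r) (hr1 : r ≤ 1) (hS : S ⊆ disk K r) (hne : S.Nonempty) :
    (sigmaDeltaRes.{u, v, w} K κ Ω r hS).IsEquivalence where
  faithful := ⟨fun {M N f g} h => ObjectProperty.hom_ext _ (SigmaDeltaModule.Hom.ext
    (congrArg (fun k => k.hom.toLin) h))⟩
  full := ⟨fun {M N} f => ⟨ObjectProperty.homMk ⟨⟨f.hom.toLin,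
    SigmaDeltaModule.comm_of_comm_δ hgen hpp hp hr0 hr1 M.property N.property f.hom.toLin
      f.hom.comm_δ⟩, f.hom.comm_δ⟩, rfl⟩⟩
  essSurj := ⟨fun M => by
    obtain ⟨M', -, h⟩ := sigmaDeltaRes_exists_preimage hgen hpp hp hr0 hr1 hS hne M
    exact ⟨M', h⟩⟩

end Equivalence

end QDiff

end

theorem mainTheorem4 {p : ℕ} (hp : p.Prime)
    {K : Type u} [NontriviallyNormedField K] [IsUltrametricDist K] [CompleteSpace K] [CharZero K]
    (hpK : ‖(p : K)‖ < 1)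
    {Ω : Type w} [NontriviallyNormedField Ω] [IsUltrametricDist Ω] [CompleteSpace Ω]
    [NormedAlgebra K Ω]
    (hΩ : ∀ s : ℝ, 0 ≤ s → ∃ x : Ω, ‖x‖ = s)
    (hkΩ : ∃ x : Ω, ‖x‖ ≤ 1 ∧ ∀ P : Polynomial K, (∀ i, ‖P.coeff i‖ ≤ 1) →
      (∃ i, ‖P.coeff i‖ = 1) → ‖Polynomial.aeval x P‖ = 1)
    (κ : QDiff.BaseKind) {r : ℝ} (hr0 : 0 < r) (hr1 : r ≤ 1)
    {S : Set (QDiff.UnitGroup K)} (hS : S ⊆ QDiff.disk K r) :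
    ((∃ q ∈ S, ¬ IsOfFinOrder q) →
      (QDiff.sigmaRes.{u, v, w} K κ Ω r hS).IsEquivalence ∧
      ∀ M : QDiff.SigmaCat.{u, v, w} K κ Ω r S,
        ∃ M' : QDiff.SigmaCat.{u, v, w} K κ Ω r (QDiff.disk K r),
          M'.obj.IsAnalyticallyConstant ∧ Nonempty ((QDiff.sigmaRes K κ Ω r hS).obj M' ≅ M)) ∧
    (S.Nonempty →
      (QDiff.sigmaDeltaRes.{u, v, w} K κ Ω r hS).IsEquivalence ∧
      ∀ M : QDiff.SigmaDeltaCat.{u, v, w} K κ Ω r S,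
        ∃ M' : QDiff.SigmaDeltaCat.{u, v, w} K κ Ω r (QDiff.disk K r),
          M'.obj.IsAnalyticallyConstant ∧
            Nonempty ((QDiff.sigmaDeltaRes K κ Ω r hS).obj M' ≅ M)) := by
  -- The hypotheses on the values and on the residue field of `Ω` enter only through the existence
  -- of generic points in all annuli.
  have hgen : QDiff.HasGenericPoints K κ Ω := QDiff.exists_generic hΩ hkΩ
  refine ⟨?_, fun hne => ⟨QDiff.sigmaDeltaRes_isEquivalence hgen hp hpK hr0 hr1 hS hne,
    QDiff.sigmaDeltaRes_exists_preimage hgen hp hpK hr0 hr1 hS hne⟩⟩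
  rintro ⟨q, hq, hq'⟩
  exact ⟨QDiff.sigmaRes_isEquivalence hgen hp hpK hr0 hr1 hS hq hq',
    QDiff.sigmaRes_exists_preimage hgen hp hpK hr0 hr1 hS hq hq'⟩
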